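/- Let $\mathbb F_q$ be a finite field of characteristic $p>4n$, let $V$ be a $2n$-dimensional symplectic space over $\mathbb F_q$ with form $B$, and let $\psi$ be a nontrivial additive character of $\mathbb F_q$. \textbf{Orbits.} For a symplectic space $U$ and an $\mathfrak{sl}_2$-triple $\gamma=(X,H,Y)$ in $\mathfrak{sp}(U)$ (possibly zero), let $k_a$ be the multiplicity of the $a$-dimensional irreducible $\mathfrak{sl}_2$-module in $U$. For $a$ even, the lowest weight vectors of weight $-(a-1)$ form a $k_a$-dimensional space with the nondegenerate quadratic form $q_a(v)=B(v,X^{a-1}v)$. Rational nilpotent orbits $\mathcal O_\Gamma$ are labelled by $\Gamma=(\lambda,(q_a))$, where $\lambda=(a^{k_a})$ is a partition of $\dim U$ in which odd parts have even multiplicity and $q_a$, for each even part $a$, is an equivalence class of nondegenerate quadratic forms of dimension $k_a$; $\gamma$ is of type $\Gamma$ if it gives these data. For a $k$-dimensional form $q$ put $\operatorname{disc} q=(-1)^{k(k-1)/2}\det q\in\mathbb F_q^\times/(\mathbb F_q^\times)^2$. \textbf{Fourier coefficients.} For $\gamma$ of type $\Gamma$ let $G_{\ge i}\subset \mathrm{Sp}(U)$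 ($i=1,2$) be the group of rational points of the connected unipotent group whose Lie algebra is the sum of the $\mathrm{ad}(H)$-weight spaces of weight at least $i$, and let $M_X$ be the centralizer of $\gamma$ in $\mathrm{Sp}(U)$. Let $\omega_\psi$ be a Weil representation of $M_X\ltimes G_{\ge1}$, i.e. a complex representation extending the irreducible representation of $G_{\ge 1}$ on which $G_{\ge2}$ acts by $u\mapsto\psi(\operatorname{tr}(Y\log u))$. For a complex representation $\pi$ of $\mathrm{Sp}(U)$ put $$\mathcal F(\pi,\mathcal O_\Gamma,\psi)=\operatorname{Hom}_{G_{\ge1}}(\omega_\psi,\pi),$$ a representation of $M_X$ by $m\cdot f=\pi(m)\,f\,\omega_\psi(m)^{-1}$. If $\lambda=(2n_1,1^{2(n-n_1)})$ and $U=V$, then $V=V_0\oplus V_0^\perp$, where $V_0$, of dimension $2(n-n_1)$, is the subspace killed by $X,H,Y$, and $\mathcal F(\pi,\mathcal O_\Gamma,\psi)$ is regarded as a representation of $\mathrm{Sp}(V_0)\cong\mathrm{Sp}_{2(n-n_1)}(\mathbb F_q)$, embedded in $M_X$ by letting it act trivially on $V_0^\perp$. \textbf{Statement.} Let $\pi$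 be an irreducible representation of $\mathrm{Sp}(V)=\mathrm{Sp}_{2n}(\mathbb F_q)$, and let $\Gamma=((2n_1,d_2,\dots,d_s),(q_a))$ with $n_1\ge1$, $2n_1\ge d_2\ge\dots\ge d_s\geq 1$ and $2n_1+d_2+\dots+d_s=2n$. Let $q_1^{\circ}$ be the one-dimensional form with $\operatorname{disc}q_1^\circ=\operatorname{disc}q_{2n_1}$, and let $(q'_a)$ be nondegenerate forms for the even parts of $(d_2,\dots,d_s)$ with $q'_a=q_a$ for $a<2n_1$ and, if $d_2=2n_1$, $$\operatorname{disc} q'_{2n_1}=(-1)^{\#\{i\ge2\,:\,d_i=2n_1\}}\in\mathbb F_q^\times/(\mathbb F_q^\times)^2 .$$ Then $$\dim\mathcal F(\pi,\mathcal O_\Gamma,\psi)=\dim\mathcal F\bigl(\mathcal F(\pi,\mathcal O_{(2n_1,1^{2(n-n_1)}),(q_1^\circ)},\psi),\ \mathcal O_{(d_2,\dots,d_s),(q'_a)},\ \psi\bigr),$$ for all choices of triples of the given types and of Weil representations attached to them. -/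

import Mathlib

open Module

namespace SpFourier

noncomputable section

/-! ### Symplectic groups and `sl₂`-triples -/

section Triples

variable {K : Type*} [Field K] {V : Type*} [AddCommGroup V] [Module K V]

/-- The isometry group of a bilinear form `B`; it is the symplectic group `Sp(V, B)` when `B` is
alternating and nondegenerate. -/
def Sp (B : LinearMap.BilinForm K V) : Subgroup (V ≃ₗ[K] V) where
  carrier := {g | ∀ v w, B (g v) (g w) = B v w}
  one_mem' := fun _ _ => rfl
  mul_mem' := fun {g h} hg hh v w => by
    rw [LinearEquiv.mul_apply, LinearEquiv.mul_apply, hg, hh]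
  inv_mem' := fun {g} hg v w => by
    have h := hg (g⁻¹ v) (g⁻¹ w)
    rw [← LinearEquiv.mul_apply, ← LinearEquiv.mul_apply, mul_inv_cancel] at h
    exact h.symm

/-- The endomorphism underlying an element of `Sp B`. -/
def Sp.toEnd {B : LinearMap.BilinForm K V} (g : Sp B) : Module.End K V :=
  ((g : V ≃ₗ[K] V) : V →ₗ[K] V)

/-- An `sl₂`-triple in the Lie algebra `sp(V, B)`. The zero triple is allowed: a triple is the
same as a homomorphism of Lie algebras `sl₂ → sp(V, B)`. -/
structure Triple (B : LinearMap.BilinForm K V) where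
  X : Module.End K V
  H : Module.End K V
  Y : Module.End K V
  X_mem : X ∈ skewAdjointLieSubalgebra B
  H_mem : H ∈ skewAdjointLieSubalgebra B
  Y_mem : Y ∈ skewAdjointLieSubalgebra B
  lie_H_X : ⁅H, X⁆ = (2 : K) • X
  lie_H_Y : ⁅H, Y⁆ = -((2 : K) • Y)
  lie_X_Y : ⁅X, Y⁆ = H

namespace Triple

variable {B : LinearMap.BilinForm K V} (γ : Triple B)

/-- The `H`-weight space of `V` of integral weight `j`. The weights of a triple on `V` satisfy
`|j| < dim V`; the bound is written down because in characteristic `p` the eigenvalue of `H` only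
determines the weight modulo `p`. -/
def weightSpace (j : ℤ) : Submodule K V :=
  if |j| < (finrank K V : ℤ) then End.eigenspace γ.H (j : K) else ⊥

/-- The filtration of `V` by the sums of the weight spaces of weight at least `i`. -/
def fil (i : ℤ) : Submodule K V := ⨆ j : ℤ, ⨆ _ : i ≤ j, γ.weightSpace j

/-- `T` lies in the part of degree at least `k` of `End V`, for the grading given by `H`. -/
def Raises (k : ℕ) (T : Module.End K V) : Prop :=
  ∀ i : ℤ, ∀ v ∈ γ.fil i, T v ∈ γ.fil (i + k)

theorem fil_anti {i j : ℤ} (h : i ≤ j) : γ.fil j ≤ γ.fil i := by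
  refine iSup_le fun l => iSup_le fun hl => ?_
  exact le_iSup_of_le l (le_iSup_of_le (h.trans hl) le_rfl)

theorem apply_mem_fil {k : ℕ} {g : Sp B} (hg : γ.Raises k (Sp.toEnd g - 1)) {i : ℤ} {v : V}
    (hv : v ∈ γ.fil i) : (g : V ≃ₗ[K] V) v ∈ γ.fil i := by
  have h1 := γ.fil_anti (show i ≤ i + k by omega) (hg i v hv)
  have h2 : (g : V ≃ₗ[K] V) v = (Sp.toEnd g - 1) v + v := by
    simp [Sp.toEnd]
  rw [h2]
  exact add_mem h1 hv

section Groups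

variable [FiniteDimensional K V]

theorem inv_apply_mem_fil {k : ℕ} {g : Sp B} (hg : γ.Raises k (Sp.toEnd g - 1)) {i : ℤ} {v : V}
    (hv : v ∈ γ.fil i) : (g : V ≃ₗ[K] V)⁻¹ v ∈ γ.fil i := by
  have hle : (γ.fil i).map ((g : V ≃ₗ[K] V) : V →ₗ[K] V) ≤ γ.fil i := by
    rintro _ ⟨w, hw, rfl⟩
    exact γ.apply_mem_fil hg hw
  have heq : (γ.fil i).map ((g : V ≃ₗ[K] V) : V →ₗ[K] V) = γ.fil i :=
    Submodule.eq_of_le_of_finrank_eq hle (LinearEquiv.finrank_map_eq (g : V ≃ₗ[K] V) _)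
  rw [← heq] at hv
  obtain ⟨w, hw, rfl⟩ := hv
  have : (g : V ≃ₗ[K] V)⁻¹ (((g : V ≃ₗ[K] V) : V →ₗ[K] V) w) = w :=
    (g : V ≃ₗ[K] V).symm_apply_apply w
  rw [this]
  exact hw

/-- The subgroup `G_{≥ k}` of `Sp(V, B)`. For `k ≥ 1` it consists of the rational points of the
connected unipotent group whose Lie algebra is the sum of the `H`-weight spaces of `sp(V, B)` of
weight at least `k`. -/
def unip (k : ℕ) : Subgroup (Sp B) where
  carrier := {g | γ.Raises k (Sp.toEnd g - 1)}
  one_mem' := fun i v _ => by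
    have : (Sp.toEnd (1 : Sp B) - 1) v = 0 := by simp [Sp.toEnd]
    rw [this]
    exact zero_mem _
  mul_mem' := fun {g h} hg hh i v hv => by
    have h2 : (Sp.toEnd (g * h) - 1) v
        = (Sp.toEnd g - 1) ((h : V ≃ₗ[K] V) v) + (Sp.toEnd h - 1) v := by
      simp [Sp.toEnd]
    rw [h2]
    exact add_mem (hg i _ (γ.apply_mem_fil hh hv)) (hh i v hv)
  inv_mem' := fun {g} hg i v hv => by
    have h2 : (Sp.toEnd g⁻¹ - 1) v = -((Sp.toEnd g - 1) ((g : V ≃ₗ[K] V)⁻¹ v)) := by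
      simp [Sp.toEnd]
    rw [h2]
    exact neg_mem (hg i _ (γ.inv_apply_mem_fil hg hv))

end Groups

/-- The reductive centralizer `M_X`: the elements of `Sp(V, B)` whose adjoint action fixes `X`,
`H` and `Y`. -/
def centralizer : Subgroup (Sp B) where
  carrier := {g | Commute (Sp.toEnd g) γ.X ∧ Commute (Sp.toEnd g) γ.H ∧ Commute (Sp.toEnd g) γ.Y}
  one_mem' := ⟨Commute.one_left _, Commute.one_left _, Commute.one_left _⟩
  mul_mem' := fun {g h} hg hh =>
    ⟨hg.1.mul_left hh.1, hg.2.1.mul_left hh.2.1, hg.2.2.mul_left hh.2.2⟩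
  inv_mem' := fun {g} hg => by
    have key : ∀ T : Module.End K V, Commute (Sp.toEnd g) T → Commute (Sp.toEnd g⁻¹) T := by
      intro T hT
      have h1 : Sp.toEnd g⁻¹ * Sp.toEnd g = 1 := by
        ext v
        exact (g : V ≃ₗ[K] V).symm_apply_apply v
      have h2 : Sp.toEnd g * Sp.toEnd g⁻¹ = 1 := by
        ext v
        exact (g : V ≃ₗ[K] V).apply_symm_apply v
      exact Commute.units_inv_left (u := ⟨Sp.toEnd g, Sp.toEnd g⁻¹, h2, h1⟩) hT
    exact ⟨key _ hg.1, key _ hg.2.1, key _ hg.2.2⟩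

theorem centralizer_apply_mem_fil {m : Sp B} (hm : m ∈ γ.centralizer) {i : ℤ} {v : V}
    (hv : v ∈ γ.fil i) : (m : V ≃ₗ[K] V) v ∈ γ.fil i := by
  have hle : γ.fil i ≤ (γ.fil i).comap ((m : V ≃ₗ[K] V) : V →ₗ[K] V) := by
    conv_lhs => rw [fil]
    refine iSup_le fun j => iSup_le fun hj => ?_
    intro w hw
    refine (le_iSup_of_le j (le_iSup_of_le hj le_rfl) : γ.weightSpace j ≤ γ.fil i) ?_
    unfold weightSpace at hw ⊢
    split_ifs at hw ⊢ with hb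
    · rw [End.mem_eigenspace_iff] at hw ⊢
      have h := LinearMap.congr_fun hm.2.1 w
      simp only [Module.End.mul_apply] at h
      change γ.H (Sp.toEnd m w) = _ • Sp.toEnd m w
      rw [← h, hw, map_smul]
    · rw [Submodule.mem_bot] at hw ⊢
      rw [hw, map_zero]
  exact hle hv

theorem conj_mem_unip [FiniteDimensional K V] {k : ℕ} {m u : Sp B} (hm : m ∈ γ.centralizer)
    (hu : u ∈ γ.unip k) : m * u * m⁻¹ ∈ γ.unip k := by
  intro i v hv
  have h2 : (Sp.toEnd (m * u * m⁻¹) - 1) v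
      = (m : V ≃ₗ[K] V) ((Sp.toEnd u - 1) (((m⁻¹ : Sp B) : V ≃ₗ[K] V) v)) := by
    simp [Sp.toEnd]
  rw [h2]
  exact γ.centralizer_apply_mem_fil hm
    (hu i _ (γ.centralizer_apply_mem_fil (inv_mem hm) hv))

/-! ### Rational nilpotent orbits -/

/-- The lowest weight vectors generating the `a`-dimensional irreducible `sl₂`-submodules. -/
def lowest (a : ℕ) : Submodule K V :=
  LinearMap.ker γ.Y ⊓ γ.weightSpace (-((a : ℤ) - 1))

/-- The quadratic form `v ↦ B(v, X^{a-1} v)` on the multiplicity space of the `a`-dimensional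
irreducible `sl₂`-module in `V` (of interest for even `a`, where `B(v, X^{a-1} w)` is symmetric). -/
def multForm (a : ℕ) : QuadraticForm K (γ.lowest a) :=
  LinearMap.BilinMap.toQuadraticMap
    (LinearMap.BilinForm.restrict (LinearMap.BilinForm.compRight B (γ.X ^ (a - 1))) (γ.lowest a))

end Triple

/-- A datum `Γ = (λ, (q_a))`: a partition `λ` in which odd parts have even multiplicity, and for
each even part `a` of multiplicity `k` a nondegenerate quadratic form of dimension `k`, which only
matters up to equivalence (the value of `form` at an odd `a` plays no role). -/
structure OrbitDatum (K : Type*) [Field K] where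
  parts : Multiset ℕ
  parts_pos : ∀ a ∈ parts, 0 < a
  even_count : ∀ a, Odd a → Even (parts.count a)
  form : (a : ℕ) → QuadraticForm K (Fin (parts.count a) → K)
  form_nondegenerate : ∀ a ∈ parts, Even a → (form a).polarBilin.Nondegenerate

/-- `γ` is an `sl₂`-triple whose nilpotent element `X` lies in the rational orbit `O_Γ`: the
multiplicities of the irreducible `sl₂`-modules in `V` are those of the partition, and the
quadratic forms on the multiplicity spaces of the even-dimensional ones are those of `Γ`. -/
def Triple.HasType {B : LinearMap.BilinForm K V} (γ : Triple B) (Γ : OrbitDatum K) : Prop :=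
  (∀ a, 0 < a → finrank K (γ.lowest a) = Γ.parts.count a) ∧
    ∀ a ∈ Γ.parts, Even a → (γ.multForm a).Equivalent (Γ.form a)

/-- The Gram matrix of a quadratic form in the standard basis, so that the form `∑ aᵢ xᵢ²` has the
diagonal matrix `(aᵢ)` (in characteristic different from two). -/
def gram {k : ℕ} (Q : QuadraticForm K (Fin k → K)) : Matrix (Fin k) (Fin k) K :=
  fun i j => 2⁻¹ * QuadraticMap.polar Q (Pi.single i 1) (Pi.single j 1)

/-- The normalized discriminant `(-1)^{k(k-1)/2} det Q` of a `k`-dimensional quadratic form, a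
representative of a square class. -/
def disc {k : ℕ} (Q : QuadraticForm K (Fin k → K)) : K :=
  (-1) ^ (k * (k - 1) / 2) * (gram Q).det

/-- Two elements have the same class modulo nonzero squares. -/
def SameSquareClass (x y : K) : Prop := ∃ c : K, c ≠ 0 ∧ y = c ^ 2 * x

end Triples

/-! ### The part of `V` fixed by a triple -/

section Fixed

variable {K : Type*} [Field K] {V : Type*} [AddCommGroup V] [Module K V]
variable {B : LinearMap.BilinForm K V}

/-- The subspace of `V` on which the triple acts by zero. -/
def Triple.fixed (γ : Triple B) : Submodule K V :=
  LinearMap.ker γ.X ⊓ LinearMap.ker γ.H ⊓ LinearMap.ker γ.Y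

theorem skew {T : Module.End K V} (hT : T ∈ skewAdjointLieSubalgebra B) (v w : V) :
    B (T v) w = -B v (T w) := by
  have h := (LinearMap.mem_skewAdjointSubmodule (B := B) T).1 hT v w
  simpa using h

theorem Triple.HX (γ : Triple B) (v : V) : γ.H (γ.X v) = γ.X (γ.H v) + (2 : K) • γ.X v := by
  have h := LinearMap.congr_fun γ.lie_H_X v
  rw [Ring.lie_def] at h
  simp only [LinearMap.sub_apply, Module.End.mul_apply, LinearMap.smul_apply] at h
  rw [← h]; abel

theorem Triple.YX (γ : Triple B) (v : V) : γ.Y (γ.X v) = γ.X (γ.Y v) - γ.H v := by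
  have h := LinearMap.congr_fun γ.lie_X_Y v
  rw [Ring.lie_def] at h
  simp only [LinearMap.sub_apply, Module.End.mul_apply] at h
  rw [← h]; abel

theorem Triple.H_pow (γ : Triple B) {c : K} {u : V} (hH : γ.H u = c • u) (k : ℕ) :
    γ.H ((γ.X ^ k) u) = (c + 2 * (k : K)) • (γ.X ^ k) u := by
  induction k with
  | zero => simp [hH]
  | succ k ih =>
    rw [pow_succ', Module.End.mul_apply, γ.HX, ih, map_smul, ← add_smul]
    congr 1
    push_cast
    ring

theorem Triple.Y_pow (γ : Triple B) {c : K} {u : V} (hH : γ.H u = c • u) (hY : γ.Y u = 0)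
    (k : ℕ) : γ.Y ((γ.X ^ (k + 1)) u) = (-(((k : K) + 1) * (c + k))) • (γ.X ^ k) u := by
  induction k with
  | zero => simp [γ.YX, hY, hH]
  | succ k ih =>
    rw [pow_succ', Module.End.mul_apply, γ.YX, ih, γ.H_pow hH, map_smul,
      ← Module.End.mul_apply, ← pow_succ', ← sub_smul]
    congr 1
    push_cast
    ring

theorem Triple.X_pow_ne (γ : Triple B) {c : K} {u : V} (hH : γ.H u = c • u) (hY : γ.Y u = 0)
    (hu : u ≠ 0) (m : ℕ) (hm : ∀ k < m, ((k : K) + 1) * (c + k) ≠ 0) : (γ.X ^ m) u ≠ 0 := by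
  induction m with
  | zero => simpa using hu
  | succ m ih =>
    intro h
    have h1 := γ.Y_pow hH hY m
    rw [h, map_zero, eq_comm, smul_eq_zero, neg_eq_zero] at h1
    exact h1.elim (hm m (Nat.lt_succ_self m)) (ih fun k hk => hm k (hk.trans (Nat.lt_succ_self m)))

theorem natCast_ne {K : Type*} [Field K] {m : ℕ} (h0 : m ≠ 0) (h : m < ringChar K) :
    (m : K) ≠ 0 := by
  intro h'
  exact absurd (Nat.le_of_dvd (Nat.pos_of_ne_zero h0) ((ringChar.spec K m).1 h')) (not_le.2 h)

theorem intCast_ne {K : Type*} [Field K] {m : ℤ} (h0 : m ≠ 0) (h : |m| < (ringChar K : ℤ)) :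
    (m : K) ≠ 0 := by
  intro h'
  have h1 : ((m.natAbs : ℕ) : K) = 0 := by
    rcases Int.natAbs_eq m with h2 | h2
    · rw [h2] at h'
      simpa using h'
    · rw [h2] at h'
      simpa using h'
  rw [Int.abs_eq_natAbs] at h
  exact natCast_ne (by omega) (by omega) h1

variable [FiniteDimensional K V]

/-- A lowest weight vector of weight zero is fixed, in large characteristic. -/
theorem Triple.mem_fixed (γ : Triple B) (hp : finrank K V + 2 < ringChar K) {v : V}
    (hH : γ.H v = 0) (hY : γ.Y v = 0) : v ∈ γ.fixed := by
  refine ⟨⟨?_, hH⟩, hY⟩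
  by_contra hX
  have hX' : γ.X v ≠ 0 := hX
  have hH' : γ.H (γ.X v) = (2 : K) • γ.X v := by rw [γ.HX, hH, map_zero, zero_add]
  have hY' : γ.Y (γ.X v) = 0 := by rw [γ.YX, hY, hH, map_zero, sub_zero]
  have hinj : Function.Injective fun k : Fin (finrank K V + 1) => (2 : K) + 2 * ((k : ℕ) : K) := by
    intro k l hkl
    by_contra hne
    have h2 : ((2 * ((k : ℕ) : ℤ) - 2 * ((l : ℕ) : ℤ) : ℤ) : K) = 0 := by
      push_cast
      have : (2 : K) + 2 * ((k : ℕ) : K) = 2 + 2 * ((l : ℕ) : K) := hkl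
      linear_combination this
    rw [← mul_sub, Int.cast_mul, mul_eq_zero] at h2
    have hk := k.2
    have hl := l.2
    have hne' : (k : ℕ) ≠ l := fun h => hne (Fin.ext h)
    rcases h2 with h2 | h2
    · exact intCast_ne (K := K) (m := 2) (by norm_num) (by norm_num; omega) h2
    · exact intCast_ne (K := K) (by omega) (by rw [abs_lt]; omega) h2
  have hli := End.eigenvectors_linearIndependent' γ.H _ hinj
    (fun k : Fin (finrank K V + 1) => (γ.X ^ (k : ℕ)) (γ.X v)) (fun k => by
      refine ⟨End.mem_eigenspace_iff.2 (γ.H_pow hH' k), ?_⟩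
      refine γ.X_pow_ne hH' hY' hX' k fun j hj => ?_
      have hk := k.2
      refine mul_ne_zero ?_ ?_
      · exact_mod_cast natCast_ne (K := K) (m := j + 1) (by omega) (by omega)
      · exact_mod_cast natCast_ne (K := K) (m := 2 + j) (by omega) (by omega))
  have := hli.fintype_card_le_finrank
  simp at this

/-- For a triple with partition `(2n₁, 1^{2(n-n₁)})` the space `V` is the orthogonal direct sum of
the fixed space, of dimension `2(n-n₁)`, and its orthogonal complement. -/
theorem Triple.isCompl_fixed (γ : Triple B) (hB : B.IsAlt) (hnd : B.Nondegenerate) {n n₁ s : ℕ}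
    (hn₁ : 0 < n₁) (hsum : 2 * n₁ + s = 2 * n) (hdim : finrank K V = 2 * n) (hp : 4 * n < ringChar K)
    {Γ : OrbitDatum K} (hΓ : Γ.parts = (2 * n₁) ::ₘ Multiset.replicate (2 * (n - n₁)) 1)
    (hγ : γ.HasType Γ) : IsCompl γ.fixed (B.orthogonal γ.fixed) := by
  rw [LinearMap.BilinForm.isCompl_orthogonal_iff_disjoint hB.isRefl, Submodule.disjoint_def]
  intro v hv hv'
  by_contra hv0
  have hle1 : γ.lowest 1 ≤ γ.fixed := by
    rintro w ⟨hwY, hwH⟩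
    refine γ.mem_fixed (by omega) ?_ hwY
    rw [weightSpace, if_pos (by simp; omega)] at hwH
    simpa using End.mem_eigenspace_iff.1 hwH
  have hc1 : finrank K (γ.lowest 1) = 2 * (n - n₁) := by
    rw [hγ.1 1 one_pos, hΓ, Multiset.count_cons_of_ne (by omega), Multiset.count_replicate_self]
  have hc2 : finrank K (γ.lowest (2 * n₁)) = 1 := by
    rw [hγ.1 _ (by omega), hΓ, Multiset.count_cons_self, Multiset.count_replicate,
      if_neg (by omega)]
  have hfin : finrank K (B.orthogonal γ.fixed) ≤ 2 * n₁ := by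
    have h1 := LinearMap.BilinForm.finrank_orthogonal hnd γ.fixed
    have h2 := Submodule.finrank_mono hle1
    omega
  obtain ⟨v₀, hv₀, hv₀0⟩ : ∃ v₀ ∈ γ.lowest (2 * n₁), v₀ ≠ 0 := by
    apply Submodule.exists_mem_ne_zero_of_ne_bot
    intro h
    rw [h] at hc2
    simp at hc2
  obtain ⟨hY, hH⟩ := hv₀
  rw [SetLike.mem_coe, weightSpace, if_pos (by rw [abs_lt]; omega)] at hH
  have hH := End.mem_eigenspace_iff.1 hH
  set c : K := ((-(((2 * n₁ : ℕ) : ℤ) - 1) : ℤ) : K) with hc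
  have horth : ∀ k : ℕ, (γ.X ^ k) v₀ ∈ B.orthogonal γ.fixed := by
    intro k w hw
    change B w ((γ.X ^ k) v₀) = 0
    cases k with
    | zero =>
      have h1 : B (γ.H w) v₀ = 0 := by rw [show γ.H w = 0 from hw.1.2]; simp
      rw [skew γ.H_mem, hH, map_smul, smul_eq_mul, neg_eq_zero, mul_eq_zero] at h1
      refine h1.resolve_left ?_
      exact intCast_ne (by omega) (by rw [abs_lt]; omega)
    | succ k =>
      have h1 : B (γ.X w) ((γ.X ^ k) v₀) = 0 := by rw [show γ.X w = 0 from hw.1.1]; simp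
      rw [skew γ.X_mem, neg_eq_zero] at h1
      rw [pow_succ', Module.End.mul_apply]
      exact h1
  -- the weights of `v` and of the vectors `X^k v₀`
  let μ : Option (Fin (2 * n₁)) → ℤ := fun o =>
    o.elim 0 fun k => -(((2 * n₁ : ℕ) : ℤ) - 1) + 2 * ((k : ℕ) : ℤ)
  let x : Option (Fin (2 * n₁)) → B.orthogonal γ.fixed := fun o =>
    o.elim ⟨v, hv'⟩ fun k => ⟨(γ.X ^ (k : ℕ)) v₀, horth k⟩
  have hinj : Function.Injective fun o => ((μ o : ℤ) : K) := by
    have aux : ∀ o o', o ≠ o' → μ o - μ o' ≠ 0 ∧ |μ o - μ o'| < (ringChar K : ℤ) := by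
      rintro (_ | k) (_ | l) hne
      · exact absurd rfl hne
      · have := l.2
        simp only [μ, Option.elim]
        rw [abs_lt]
        omega
      · have := k.2
        simp only [μ, Option.elim]
        rw [abs_lt]
        omega
      · have := k.2
        have := l.2
        have : (k : ℕ) ≠ l := fun h => hne (congrArg some (Fin.ext h))
        simp only [μ, Option.elim]
        rw [abs_lt]
        omega
    intro o o' h
    by_contra hne
    obtain ⟨h1, h2⟩ := aux o o' hne
    refine intCast_ne (K := K) h1 h2 ?_
    rw [Int.cast_sub, sub_eq_zero]
    exact h
  have hli := End.eigenvectors_linearIndependent' γ.H _ hinj (fun o => (x o : V)) (by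
    rintro (_ | k)
    · exact ⟨End.mem_eigenspace_iff.2 (by simpa [μ, x] using hv.1.2), hv0⟩
    · refine ⟨End.mem_eigenspace_iff.2 ?_, ?_⟩
      · have := γ.H_pow hH k
        simp only [μ, x, Option.elim]
        rw [this, hc]
        congr 1
        push_cast
        ring
      · refine γ.X_pow_ne hH hY hv₀0 k fun j hj => ?_
        have hk := k.2
        refine mul_ne_zero ?_ ?_
        · exact_mod_cast natCast_ne (K := K) (m := j + 1) (by omega) (by omega)
        · rw [hc]
          have := intCast_ne (K := K) (m := -(((2 * n₁ : ℕ) : ℤ) - 1) + j) (by omega)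
            (by rw [abs_lt]; omega)
          exact_mod_cast this)
  have hli' : LinearIndependent K x := LinearIndependent.of_comp (Submodule.subtype _) hli
  have := hli'.fintype_card_le_finrank
  simp at this
  omega

/-- Extension of an isometry of a subspace `U` with `V = U ⊕ U^⊥` by the identity on `U^⊥`. -/
def extend (hB : B.IsRefl) (U : Submodule K V) (h : IsCompl U (B.orthogonal U)) :
    Sp (B.restrict U) →* Sp B where
  toFun g := ⟨((U.prodEquivOfIsCompl _ h).symm.trans
      ((g : U ≃ₗ[K] U).prodCongr (LinearEquiv.refl K (B.orthogonal U)))).trans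
      (U.prodEquivOfIsCompl _ h), by
    intro v w
    obtain ⟨⟨a, b⟩, rfl⟩ := (U.prodEquivOfIsCompl _ h).surjective v
    obtain ⟨⟨c, d⟩, rfl⟩ := (U.prodEquivOfIsCompl _ h).surjective w
    have hg : B (((g : U ≃ₗ[K] U) a : U) : V) (((g : U ≃ₗ[K] U) c : U) : V) = B a c := g.2 a c
    have h1 : ∀ (y : U) (z : B.orthogonal U), B (y : V) z = 0 := fun y z => z.2 y y.2
    have h2 : ∀ (y : U) (z : B.orthogonal U), B (z : V) y = 0 := fun y z => hB _ _ (h1 y z)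
    simp [Submodule.coe_prodEquivOfIsCompl', hg, h1, h2]⟩
  map_one' := by
    ext v
    obtain ⟨⟨a, b⟩, rfl⟩ := (U.prodEquivOfIsCompl _ h).surjective v
    simp
  map_mul' g g' := by
    ext v
    obtain ⟨⟨a, b⟩, rfl⟩ := (U.prodEquivOfIsCompl _ h).surjective v
    simp

theorem commute_extend (hB : B.IsRefl) {U : Submodule K V} (h : IsCompl U (B.orthogonal U))
    {T : Module.End K V} (hT : T ∈ skewAdjointLieSubalgebra B) (hU : ∀ u ∈ U, T u = 0)
    (g : Sp (B.restrict U)) : Commute (Sp.toEnd (extend hB U h g)) T := by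
  refine LinearMap.ext fun v => ?_
  obtain ⟨⟨a, b⟩, rfl⟩ := (U.prodEquivOfIsCompl _ h).surjective v
  have hTb : T b ∈ B.orthogonal U := by
    intro u hu
    have h1 : B (T u) b = 0 := by rw [hU u hu]; simp
    rw [skew hT, neg_eq_zero] at h1
    exact h1
  have e1 : ∀ (y : U) (z : B.orthogonal U), Sp.toEnd (extend hB U h g) ((y : V) + z)
      = (((g : U ≃ₗ[K] U) y : U) : V) + z := by
    intro y z
    have : (U.prodEquivOfIsCompl _ h).symm ((y : V) + z) = (y, z) := by
      rw [LinearEquiv.symm_apply_eq, Submodule.coe_prodEquivOfIsCompl']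
    change (U.prodEquivOfIsCompl _ h) (((g : U ≃ₗ[K] U).prodCongr
      (LinearEquiv.refl K (B.orthogonal U))) ((U.prodEquivOfIsCompl _ h).symm ((y : V) + z))) = _
    rw [this, Submodule.coe_prodEquivOfIsCompl']
    rfl
  have e2 := e1 0 ⟨T b, hTb⟩
  simp only [map_zero, ZeroMemClass.coe_zero, zero_add] at e2
  change Sp.toEnd (extend hB U h g) (T ((a : V) + b))
    = T (Sp.toEnd (extend hB U h g) ((a : V) + b))
  have e3 : ∀ y : U, T ((y : V) + b) = T b := fun y => by rw [map_add, hU y y.2, zero_add]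
  rw [e1, e3, e3, e2]

/-- The embedding `Sp(V_0) → M_X`, with `V_0` the fixed space of the triple, extending an isometry
of `V_0` by the identity on the orthogonal complement of `V_0`. -/
def Triple.embed (γ : Triple B) (hB : B.IsRefl) (h : IsCompl γ.fixed (B.orthogonal γ.fixed)) :
    Sp (B.restrict γ.fixed) →* γ.centralizer :=
  (extend hB γ.fixed h).codRestrict γ.centralizer fun g =>
    ⟨commute_extend hB h γ.X_mem (fun _ hu => hu.1.1) g,
      commute_extend hB h γ.H_mem (fun _ hu => hu.1.2) g,
      commute_extend hB h γ.Y_mem (fun _ hu => hu.2) g⟩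

end Fixed

/-! ### Fourier coefficients -/

section Coefficients

variable {K : Type*} [Field K] {V : Type*} [AddCommGroup V] [Module K V] [FiniteDimensional K V]
variable {B : LinearMap.BilinForm K V}

/-- The logarithm of a unipotent element of `Sp(V, B)` (in large characteristic). -/
def unipLog (u : Sp B) : Module.End K V :=
  ∑ k ∈ Finset.Icc 1 (finrank K V), ((-1 : K) ^ (k + 1) * (k : K)⁻¹) • (Sp.toEnd u - 1) ^ k

/-- The character `u ↦ ψ(κ(Y, log u))` of `G_{≥ 2}`, with `κ` the trace form. -/
def Triple.psi (γ : Triple B) (ψ : AddChar K ℂ) (u : Sp B) : ℂ :=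
  ψ (LinearMap.trace K V (γ.Y * unipLog u))

/-- The group `M_X · G_{≥ 1}`, which is the internal semidirect product `M_X ⋉ G_{≥ 1}`. -/
def Triple.jacobi (γ : Triple B) : Subgroup (Sp B) := γ.centralizer ⊔ γ.unip 1

/-- `ω` is a Weil representation of `M_X ⋉ G_{≥ 1}` attached to `ψ`: it extends the irreducible
representation of `G_{≥ 1}` on which `G_{≥ 2}` acts through the character `ψ(κ(Y, log u))`. -/
structure IsWeil (γ : Triple B) (ψ : AddChar K ℂ) {E : Type*} [AddCommGroup E] [Module ℂ E]
    (ω : Representation ℂ γ.jacobi E) : Prop where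
  irreducible : Representation.IsIrreducible
    (ω.comp (Subgroup.inclusion (le_sup_right : γ.unip 1 ≤ γ.jacobi)))
  central : ∀ u : γ.jacobi, (u : Sp B) ∈ γ.unip 2 →
    ω u = γ.psi ψ (u : Sp B) • LinearMap.id

variable {W : Type*} [AddCommGroup W] [Module ℂ W] {E : Type*} [AddCommGroup E] [Module ℂ E]

/-- The space `Hom_{G_{≥ 1}}(ω, π)` of the Fourier coefficient `F(π, O_Γ, ψ)`, for `γ` of type `Γ`
and `ω` a Weil representation attached to `ψ`. -/
def coeff (γ : Triple B) (ω : Representation ℂ γ.jacobi E) (π : Representation ℂ (Sp B) W) :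
    Submodule ℂ (E →ₗ[ℂ] W) where
  carrier := {f | ∀ u : γ.jacobi, (u : Sp B) ∈ γ.unip 1 → π (u : Sp B) ∘ₗ f = f ∘ₗ ω u}
  zero_mem' := fun u _ => by simp
  add_mem' := fun {f g} hf hg u hu => by
    rw [LinearMap.comp_add, LinearMap.add_comp, hf u hu, hg u hu]
  smul_mem' := fun c f hf u hu => by
    rw [LinearMap.comp_smul, LinearMap.smul_comp, hf u hu]

/-- An element of `M_X` as an element of `M_X ⋉ G_{≥ 1}`. -/
abbrev Triple.inl (γ : Triple B) : γ.centralizer →* γ.jacobi :=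
  Subgroup.inclusion (le_sup_left : γ.centralizer ≤ γ.jacobi)

theorem coeff_stable (γ : Triple B) (ω : Representation ℂ γ.jacobi E)
    (π : Representation ℂ (Sp B) W) (m : γ.centralizer) {f : E →ₗ[ℂ] W} (hf : f ∈ coeff γ ω π) :
    π (m : Sp B) ∘ₗ f ∘ₗ ω (γ.inl m)⁻¹ ∈ coeff γ ω π := by
  intro u hu
  have hv : (((γ.inl m)⁻¹ * u * γ.inl m : γ.jacobi) : Sp B) ∈ γ.unip 1 := by
    have := γ.conj_mem_unip (inv_mem m.2) hu
    rw [inv_inv] at this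
    exact this
  have h := hf _ hv
  have e1 : (u : Sp B) * m = m * (((γ.inl m)⁻¹ * u * γ.inl m : γ.jacobi) : Sp B) := by
    change (u : Sp B) * m = m * ((m : Sp B)⁻¹ * u * m)
    group
  have e2 : ((γ.inl m)⁻¹ * u * γ.inl m) * (γ.inl m)⁻¹ = (γ.inl m)⁻¹ * u := by
    group
  calc π (u : Sp B) ∘ₗ π (m : Sp B) ∘ₗ f ∘ₗ ω (γ.inl m)⁻¹
      = (π ((u : Sp B) * m)) ∘ₗ f ∘ₗ ω (γ.inl m)⁻¹ := by rw [map_mul]; rfl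
    _ = π (m : Sp B) ∘ₗ (π (((γ.inl m)⁻¹ * u * γ.inl m : γ.jacobi) : Sp B) ∘ₗ f) ∘ₗ
          ω (γ.inl m)⁻¹ := by rw [e1, map_mul]; rfl
    _ = π (m : Sp B) ∘ₗ f ∘ₗ ω (((γ.inl m)⁻¹ * u * γ.inl m) * (γ.inl m)⁻¹) := by
          rw [h, map_mul ω _ (γ.inl m)⁻¹]; rfl
    _ = (π (m : Sp B) ∘ₗ f ∘ₗ ω (γ.inl m)⁻¹) ∘ₗ ω u := by rw [e2, map_mul]; rfl

/-- The Fourier coefficient as a representation of `M_X`: `m` acts by `f ↦ π(m) f ω(m)⁻¹`. -/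
def coeffRep (γ : Triple B) (ω : Representation ℂ γ.jacobi E) (π : Representation ℂ (Sp B) W) :
    Representation ℂ γ.centralizer (coeff γ ω π) where
  toFun m :=
    { toFun := fun f => ⟨π (m : Sp B) ∘ₗ f.1 ∘ₗ ω (γ.inl m)⁻¹, coeff_stable γ ω π m f.2⟩
      map_add' := fun f g => by ext; simp
      map_smul' := fun c f => by ext; simp }
  map_one' := by ext; simp
  map_mul' := fun m m' => by ext; simp

/-- The Fourier coefficient as a representation of `Sp(V_0)`, with `V_0` the fixed space of `γ`. -/
def coeffSp (γ : Triple B) (ω : Representation ℂ γ.jacobi E) (π : Representation ℂ (Sp B) W)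
    (hB : B.IsRefl) (h : IsCompl γ.fixed (B.orthogonal γ.fixed)) :
    Representation ℂ (Sp (B.restrict γ.fixed)) (coeff γ ω π) :=
  (coeffRep γ ω π).comp (γ.embed hB h)

end Coefficients

end

end SpFourier

open SpFourier

/-! The proof shows that both sides, multiplied by the dimension of the Weil representation of `γ'`,
equal the dimension of one and the same space of eigenvectors in `π`.

Let `γ₂` be the sum of `γ₁` and `γ'` on `V₀ ⊕ V₀^⊥`. Over a finite field a nondegenerate quadratic
form is determined by dimension and determinant, and the two discriminant conditions say exactly
that `q_{2n₁}` is the sum of `q₁°` and `q'_{2n₁}` (`equivalent_prod_of_disc`). Hence `γ₂` has the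
same strings and multiplicity forms as `γ`, and some `g` in `Sp(V)` carries `H` and `Y` of `γ` to
those of `γ₂` (`Triple.exists_conj`). Only `H` and `Y` enter `G_{≥ 1}` and its character, so `γ` may
be replaced by `γ₂`.

All characters are written as `psiLin`, that is `ψ(tr(Y(g - 1)))`. This agrees with `ψ(tr(Y log g))`
on `G_{≥ 2}`, because the higher terms of the logarithm raise weights too much to have a trace
against `Y`, and it is still a character on groups that are not contained in `G_{≥ 1}`.

Choose a Lagrangian `L0` of `V₀` between the steps one and zero of the filtration of `γ'`. It
defines a group `S`, the product of a polarization of the Heisenberg group of `γ₁` and of the group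
`G_{≥ 2}` of `γ'`. The polarization fixes a single line in the Weil representation of `γ₁` up to its
character, and evaluation on this line identifies the first coefficient with eigenvectors in `π`.
The group `G_{≥ 2}` of `γ'` acts trivially on the line: it consists of commutators of elements
stabilizing `L0`, and these act on the line by scalars. So the iterated coefficient times `dim ω'`
is the dimension of the `S`-eigenspace of `π` (`Stage.finrank_iterated_mul`).

For the other side, `S` is exchanged against `(S ∩ G_{≥ 1}) G_{≥ 2}`, formed with `γ₂`. Averaging
over one group and then over the other is a nonzero scalar in both directions, since the elements of
either group that do not preserve the other character are killed (`finrank_eig_exchange`,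
`Compatible.finrank_eig_S`). The `G_{≥ 2}`-eigenspace of `π` is a multiple of the Heisenberg
representation `ω`, and in `ω` the `(S ∩ G_{≥ 1})`-eigenspace is an irreducible representation of
`G_{≥ 1}` of `γ'` with the central character of `ω'`, hence has dimension `dim ω'`. So the
coefficient of `γ₂` times `dim ω'` is the dimension of the `S`-eigenspace too
(`Adapted.finrank_intertwining_mul`). Cancelling `dim ω'` finishes the proof. -/

namespace SpFourier
noncomputable section
-- Eigenspaces of subgroups, averaging, and exchange of subgroups
section RepTheory

/-- `χ` restricts to a linear character of the subgroup `Q`. -/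
structure IsCharOn {G : Type*} [Group G] (Q : Subgroup G) (χ : G → ℂ) : Prop where
  one : χ 1 = 1
  mul : ∀ g ∈ Q, ∀ h ∈ Q, χ (g * h) = χ g * χ h

namespace IsCharOn

variable {G : Type*} [Group G] {Q : Subgroup G} {χ : G → ℂ} (h : IsCharOn Q χ)
include h

theorem mul_inv {g : G} (hg : g ∈ Q) : χ g * χ g⁻¹ = 1 := by
  rw [← h.mul g hg _ (inv_mem hg), mul_inv_cancel, h.one]

theorem ne_zero {g : G} (hg : g ∈ Q) : χ g ≠ 0 := left_ne_zero_of_mul_eq_one (h.mul_inv hg)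

end IsCharOn

variable {G : Type*} [Group G] {W : Type*} [AddCommGroup W] [Module ℂ W]

/-- The subspace of `W` on which the subgroup `Q` acts through `χ`. -/
def eig (π : Representation ℂ G W) (Q : Subgroup G) (χ : G → ℂ) : Submodule ℂ W where
  carrier := {w | ∀ g ∈ Q, π g w = χ g • w}
  zero_mem' := fun g _ => by simp
  add_mem' := fun {v w} hv hw g hg => by rw [map_add, hv g hg, hw g hg, smul_add]
  smul_mem' := fun c v hv g hg => by rw [map_smul, hv g hg, smul_comm]

theorem mem_eig {π : Representation ℂ G W} {Q : Subgroup G} {χ : G → ℂ} {w : W} :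
    w ∈ eig π Q χ ↔ ∀ g ∈ Q, π g w = χ g • w := Iff.rfl

/-- The unnormalized projector to `eig π Q χ`. -/
def avg [Finite G] (π : Representation ℂ G W) (Q : Subgroup G) (χ : G → ℂ) : W →ₗ[ℂ] W :=
  letI := Fintype.ofFinite Q
  ∑ g : Q, χ (g : G)⁻¹ • π g

section Avg

variable [Finite G] (π : Representation ℂ G W) {Q : Subgroup G} {χ : G → ℂ}

theorem avg_apply [Fintype Q] (w : W) : avg π Q χ w = ∑ g : Q, χ (g : G)⁻¹ • π g w := by
  simp only [avg, LinearMap.sum_apply, LinearMap.smul_apply]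
  exact Finset.sum_congr (by ext; simp) fun _ _ => rfl

theorem avg_comp (hχ : IsCharOn Q χ) {g : G} (hg : g ∈ Q) (w : W) :
    avg π Q χ (π g w) = χ g • avg π Q χ w := by
  have := Fintype.ofFinite Q
  rw [avg_apply, avg_apply, Finset.smul_sum]
  refine Fintype.sum_equiv (Equiv.mulRight ⟨g, hg⟩) _ _ fun x => ?_
  simp only [Equiv.coe_mulRight, Subgroup.coe_mul, map_mul, mul_inv_rev, Module.End.mul_apply,
    smul_smul]
  rw [hχ.mul _ (inv_mem hg) _ (inv_mem x.2), ← mul_assoc, hχ.mul_inv hg, one_mul]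

theorem avg_mem (hχ : IsCharOn Q χ) (w : W) : avg π Q χ w ∈ eig π Q χ := by
  intro g hg
  have := Fintype.ofFinite Q
  rw [avg_apply, map_sum, Finset.smul_sum]
  refine Fintype.sum_equiv (Equiv.mulLeft ⟨g, hg⟩) _ _ fun x => ?_
  simp only [Equiv.coe_mulLeft, Subgroup.coe_mul, map_mul, mul_inv_rev, Module.End.mul_apply,
    smul_smul, map_smul]
  rw [hχ.mul _ (inv_mem x.2) _ (inv_mem hg), mul_left_comm, hχ.mul_inv hg, mul_one]

theorem avg_eq_card (hχ : IsCharOn Q χ) {w : W} (hw : w ∈ eig π Q χ) :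
    avg π Q χ w = (Nat.card Q : ℂ) • w := by
  have := Fintype.ofFinite Q
  rw [avg_apply, Finset.sum_congr rfl (g := fun _ => w)]
  · simp [Nat.card_eq_fintype_card, Nat.cast_smul_eq_nsmul]
  · intro x _
    rw [hw _ x.2, smul_smul, mul_comm, hχ.mul_inv x.2, one_smul]

theorem card_ne_zero (Q : Subgroup G) : (Nat.card Q : ℂ) ≠ 0 := by
  exact_mod_cast Nat.card_pos.ne'

/-- The dimension of an eigenspace in terms of traces. -/
theorem card_mul_finrank_eig [FiniteDimensional ℂ W] [Fintype Q] (hχ : IsCharOn Q χ) :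
    (Nat.card Q : ℂ) * finrank ℂ (eig π Q χ) = ∑ g : Q, χ (g : G)⁻¹ * LinearMap.trace ℂ W (π g) := by
  have h : LinearMap.IsProj (eig π Q χ) ((Nat.card Q : ℂ)⁻¹ • avg π Q χ) :=
    ⟨fun w => Submodule.smul_mem _ _ (avg_mem π hχ w), fun w hw => by
      rw [LinearMap.smul_apply, avg_eq_card π hχ hw, smul_smul, inv_mul_cancel₀ (card_ne_zero Q),
        one_smul]⟩
  have h2 := h.trace
  rw [map_smul, smul_eq_mul] at h2
  rw [← h2, ← mul_assoc, mul_inv_cancel₀ (card_ne_zero Q), one_mul]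
  have : avg π Q χ = ∑ g : Q, χ (g : G)⁻¹ • π g := by
    ext w; simp [avg_apply]
  rw [this, map_sum]
  simp

/-- Conjugation by `u` shows that the projector annihilates `π u w`. -/
theorem avg_eq_zero (hχ : IsCharOn Q χ) {w : W} {u s : G} (hs : s ∈ Q) (h1 : u * s * u⁻¹ ∈ Q)
    (h2 : χ (u * s * u⁻¹) ≠ χ s) (hw : w ∈ eig π Q χ) : avg π Q χ (π u w) = 0 := by
  have e1 := avg_comp π hχ h1 (π u w)
  have e2 : π (u * s * u⁻¹) (π u w) = χ s • π u w := by
    rw [← Module.End.mul_apply, ← map_mul, inv_mul_cancel_right, map_mul, Module.End.mul_apply,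
      hw s hs, map_smul]
  rw [e2, map_smul, ← sub_eq_zero, ← sub_smul, smul_eq_zero, sub_eq_zero] at e1
  exact e1.resolve_left (Ne.symm h2)

/-- Expand the inner average over `Q`: an element of `N` contributes `|R| w`, every other element is
annihilated by the outer average. The resulting nonzero scalar is what makes the two averaging maps
in an exchange of subgroups injective. -/
theorem avg_avg {R N : Subgroup G} {θ : G → ℂ} (hχ : IsCharOn Q χ) (hθ : IsCharOn R θ)
    (hNQ : N ≤ Q) {w : W} (hwR : w ∈ eig π R θ) (hN : ∀ g ∈ N, π g w = χ g • w)
    (h0 : ∀ g ∈ Q, g ∉ N → avg π R θ (π g w) = 0) :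
    avg π R θ (avg π Q χ w) = ((Nat.card N : ℂ) * Nat.card R) • w := by
  classical
  have := Fintype.ofFinite G
  rw [avg_apply π (Q := Q), map_sum]
  have h1 : ∀ g : Q, avg π R θ (χ (g : G)⁻¹ • π g w) =
      if (g : G) ∈ N then (Nat.card R : ℂ) • w else 0 := by
    intro g
    split_ifs with hg
    · rw [hN g hg, smul_smul, mul_comm, hχ.mul_inv g.2, one_smul, avg_eq_card π hθ hwR]
    · rw [map_smul, h0 g g.2 hg, smul_zero]
  rw [Finset.sum_congr rfl fun g _ => h1 g, ← Finset.sum_filter, Finset.sum_const]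
  have h2 : (Finset.univ.filter fun g : Q => (g : G) ∈ N).card = Nat.card N := by
    rw [Nat.card_eq_fintype_card, ← Finset.card_univ (α := N)]
    refine Finset.card_bij (fun g hg => ⟨g, (Finset.mem_filter.1 hg).2⟩) (by simp) ?_ ?_
    · intro a _ b _ h
      exact Subtype.ext (congrArg (fun z : N => (z : G)) h)
    · intro b _
      exact ⟨⟨b, hNQ b.2⟩, by simp, rfl⟩
  rw [h2, ← Nat.cast_smul_eq_nsmul ℂ, smul_smul]

/-- Exchange of subgroups. -/
theorem finrank_eig_exchange [FiniteDimensional ℂ W] {S C Z : Subgroup G} {θ : G → ℂ}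
    (hχ : IsCharOn S χ) (hθ : IsCharOn Z θ) (hCS : C ≤ S)
    (hC : ∀ c ∈ C, ∀ z ∈ Z, c * z * c⁻¹ ∈ Z ∧ θ (c * z * c⁻¹) = θ z)
    (hag : ∀ z ∈ Z, z ∈ S → θ z = χ z)
    (h1 : ∀ u ∈ Z, u ∉ S → ∃ s ∈ S, u * s * u⁻¹ ∈ S ∧ χ (u * s * u⁻¹) ≠ χ s)
    (h2 : ∀ q ∈ S, q ∉ C → ∃ z ∈ Z, q * z * q⁻¹ ∈ Z ∧ θ (q * z * q⁻¹) ≠ θ z) :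
    finrank ℂ (eig π S χ) = finrank ℂ (eig π C χ ⊓ eig π Z θ : Submodule ℂ W) := by
  have hCχ : IsCharOn C χ := ⟨hχ.one, fun g hg h hh => hχ.mul g (hCS hg) h (hCS hh)⟩
  -- If `g ∘ f` multiplies each vector of `A` by a nonzero scalar, then `f` embeds `A` into `B`.
  -- This is applied once in each direction, with the averages over `S` and `Z` in both orders.
  have hc : ∀ {A B : Submodule ℂ W} (f g : W →ₗ[ℂ] W), (∀ w ∈ A, f w ∈ B) →
      (∀ w ∈ A, ∃ c : ℂ, c ≠ 0 ∧ g (f w) = c • w) → finrank ℂ A ≤ finrank ℂ B := by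
    intro A B f g hf hg
    refine LinearMap.finrank_le_finrank_of_injective (f := f.restrict hf) ?_
    rw [← LinearMap.ker_eq_bot, LinearMap.ker_eq_bot']
    intro w hw
    obtain ⟨c, hc, h⟩ := hg w w.2
    have : f w = 0 := congrArg Subtype.val hw
    rw [this, map_zero, eq_comm, smul_eq_zero] at h
    exact Subtype.ext (h.resolve_left hc)
  apply le_antisymm
  · refine hc (avg π Z θ) (avg π S χ) (fun w hw => ⟨?_, avg_mem π hθ w⟩) fun w hw => ?_
    -- Conjugation by `c` permutes `Z` and preserves `θ`, so the average over `Z` commutes with `c`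
    -- and keeps the `C`-eigenvector property.
    · intro c hc'
      have := Fintype.ofFinite Z
      rw [avg_apply, map_sum, Finset.smul_sum]
      refine Fintype.sum_equiv (Equiv.ofBijective (fun z : Z => (⟨c * z * c⁻¹, (hC c hc' z z.2).1⟩ : Z))
        (Finite.injective_iff_bijective.1 fun a b hab => ?_)) _ _ fun z => ?_
      · have := congrArg Subtype.val hab
        exact Subtype.ext (by simpa using this)
      · simp only [Equiv.ofBijective_apply, map_smul, smul_smul]
        have e : (c * z * c⁻¹)⁻¹ = c * (z : G)⁻¹ * c⁻¹ := by group
        rw [e, (hC c hc' _ (inv_mem z.2)).2]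
        have e2 : π c (π z w) = π (c * z * c⁻¹) (π c w) := by
          rw [← Module.End.mul_apply, ← Module.End.mul_apply, ← map_mul, ← map_mul,
            inv_mul_cancel_right]
        rw [e2, hw c (hCS hc'), map_smul, smul_smul, mul_comm]
    -- Elements of `Z` outside `S` move `χ` and hence contribute nothing; in the reverse direction
    -- below the same holds for the elements of `S` outside `C`.
    · refine ⟨_, ?_, avg_avg π (N := S ⊓ Z) hθ hχ inf_le_right hw (fun g hg => ?_) fun g hg hg' => ?_⟩
      · exact mul_ne_zero (card_ne_zero _) (card_ne_zero _)
      · rw [hw g hg.1, hag g hg.2 hg.1]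
      · obtain ⟨s, hs, h3, h4⟩ := h1 g hg fun h => hg' ⟨h, hg⟩
        exact avg_eq_zero π hχ hs h3 h4 hw
  · refine hc (avg π S χ) (avg π Z θ) (fun w hw => avg_mem π hχ w) fun w hw => ?_
    refine ⟨_, ?_, avg_avg π (N := C) hχ hθ hCS hw.2 (fun g hg => hw.1 g hg) fun g hg hg' => ?_⟩
    · exact mul_ne_zero (card_ne_zero _) (card_ne_zero _)
    · obtain ⟨s, hs, h3, h4⟩ := h2 g hg hg'
      exact avg_eq_zero π hθ hs h3 h4 hw.2

/-- An irreducible representation of a finite group is finite-dimensional. -/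
theorem finiteDimensional_of_isIrreducible (h : π.IsIrreducible) : FiniteDimensional ℂ W := by
  have := Fintype.ofFinite G
  obtain ⟨w, hw⟩ : ∃ w : W, w ≠ 0 := by
    by_contra! h0
    exact bot_ne_top (α := Subrepresentation π) (SetLike.ext fun w => by
      rw [h0 w]; exact ⟨fun _ => zero_mem (⊤ : Submodule ℂ W), fun _ => zero_mem (⊥ : Submodule ℂ W)⟩)
  let U : Subrepresentation π := ⟨Submodule.span ℂ (Set.range fun g => π g w), by
    intro g v hv
    induction hv using Submodule.span_induction with
    | mem x hx =>
      obtain ⟨k, rfl⟩ := hx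
      refine Submodule.subset_span ⟨g * k, ?_⟩
      simp
    | zero => simp
    | add x y _ _ hx hy => rw [map_add]; exact add_mem hx hy
    | smul c x _ hx => rw [map_smul]; exact Submodule.smul_mem _ _ hx⟩
  have hU : U = ⊤ := (eq_bot_or_eq_top U).resolve_left fun h0 => hw (by
    have : w ∈ U.toSubmodule := Submodule.subset_span ⟨1, by simp⟩
    rw [h0] at this
    exact (Submodule.mem_bot ℂ).1 this)
  have h2 : U.toSubmodule = ⊤ := by rw [hU]; rfl
  exact ⟨h2 ▸ Submodule.fg_span (Set.finite_range _)⟩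

omit [Finite G] in
/-- An irreducible representation has no proper nonzero invariant subspace. -/
theorem eq_top_of_isIrreducible (h : π.IsIrreducible) (M : Submodule ℂ W)
    (hM : ∀ g, ∀ w ∈ M, π g w ∈ M) (h0 : M ≠ ⊥) : M = ⊤ := by
  rcases eq_bot_or_eq_top (⟨M, hM⟩ : Subrepresentation π) with h1 | h1
  · exact absurd (congrArg Subrepresentation.toSubmodule h1) h0
  · exact congrArg Subrepresentation.toSubmodule h1

theorem finrank_pos_of_isIrreducible (hi : π.IsIrreducible) :
    0 < finrank ℂ W := by
  have := finiteDimensional_of_isIrreducible π hi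
  by_contra h0
  have h1 : finrank ℂ W = 0 := by omega
  have h2 := finrank_zero_iff.1 h1
  exact bot_ne_top (α := Subrepresentation π) (SetLike.ext fun w => by
    rw [Subsingleton.elim w 0]
    exact ⟨fun _ => zero_mem (⊤ : Submodule ℂ W), fun _ => zero_mem (⊥ : Submodule ℂ W)⟩)

end Avg

/-! ### Groups with a Heisenberg central character -/

/-- `θ` is a character of `Z` for which the commutator pairing of the ambient group is
nondegenerate. -/
structure IsHeis (Z : Subgroup G) (θ : G → ℂ) : Prop where
  isChar : IsCharOn Z θ
  nondeg : ∀ x, x ∉ Z → ∃ y, x * y * x⁻¹ * y⁻¹ ∈ Z ∧ θ (x * y * x⁻¹ * y⁻¹) ≠ 1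

section Heis

variable [Finite G] {Z : Subgroup G} {θ : G → ℂ} (hZ : IsHeis Z θ)
include hZ

omit [Finite G] in
-- Write `x = [x, y] · y x y⁻¹` with `θ([x, y]) ≠ 1`: the trace at `x` equals itself times `θ([x,
-- y])`. So the character lives on `Z`, and every multiplicity below is a count of elements.
theorem IsHeis.trace_eq_zero {π : Representation ℂ G W} (hπ : ∀ z ∈ Z, π z = θ z • LinearMap.id)
    {x : G} (hx : x ∉ Z) : LinearMap.trace ℂ W (π x) = 0 := by
  obtain ⟨y, h1, h2⟩ := hZ.nondeg x hx
  have e : x = (x * y * x⁻¹ * y⁻¹) * (y * x * y⁻¹) := by group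
  have e2 : LinearMap.trace ℂ W (π x) = θ (x * y * x⁻¹ * y⁻¹) * LinearMap.trace ℂ W (π x) := by
    conv_lhs => rw [e]
    rw [map_mul, hπ _ h1, smul_mul_assoc, map_smul, smul_eq_mul]
    congr 1
    change LinearMap.trace ℂ W (1 * _) = _
    rw [one_mul, map_mul, LinearMap.trace_mul_comm, ← map_mul, ← mul_assoc, inv_mul_cancel, one_mul]
  have e3 : (1 - θ (x * y * x⁻¹ * y⁻¹)) * LinearMap.trace ℂ W (π x) = 0 := by
    rw [sub_mul, one_mul, ← e2, sub_self]
  exact (mul_eq_zero.1 e3).resolve_left (sub_ne_zero.2 (Ne.symm h2))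

/-- In the trace formula for the dimension of an eigenspace only `C ∩ Z` contributes, and each of
its elements contributes `dim W`. -/
theorem IsHeis.finrank_eig_mul_card [FiniteDimensional ℂ W] {π : Representation ℂ G W}
    (hπ : ∀ z ∈ Z, π z = θ z • LinearMap.id) {C : Subgroup G} {χ : G → ℂ} (hχ : IsCharOn C χ)
    (hag : ∀ z ∈ Z, z ∈ C → θ z = χ z) :
    finrank ℂ (eig π C χ) * Nat.card C = finrank ℂ W * Nat.card (C ⊓ Z : Subgroup G) := by
  classical
  have := Fintype.ofFinite G
  have h := card_mul_finrank_eig π hχ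
  have h1 : ∀ g : C, χ (g : G)⁻¹ * LinearMap.trace ℂ W (π g) =
      if (g : G) ∈ Z then (finrank ℂ W : ℂ) else 0 := by
    intro g
    split_ifs with hg
    · rw [hπ _ hg, map_smul, smul_eq_mul, hag _ hg g.2, ← mul_assoc, mul_comm (χ _),
        hχ.mul_inv g.2, one_mul, LinearMap.trace_id]
    · rw [hZ.trace_eq_zero hπ hg, mul_zero]
  rw [Finset.sum_congr rfl fun g _ => h1 g, ← Finset.sum_filter, Finset.sum_const] at h
  have h2 : (Finset.univ.filter fun g : C => (g : G) ∈ Z).card = Nat.card (C ⊓ Z : Subgroup G) := by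
    rw [Nat.card_eq_fintype_card, ← Finset.card_univ]
    refine Finset.card_bij (fun g hg => ⟨g, g.2, (Finset.mem_filter.1 hg).2⟩) (by simp) ?_ ?_
    · intro a _ b _ h
      exact Subtype.ext (congrArg (fun z : (C ⊓ Z : Subgroup G) => (z : G)) h)
    · intro b _
      exact ⟨⟨b, b.2.1⟩, by simpa using b.2.2, rfl⟩
  rw [h2, nsmul_eq_mul] at h
  have h' : finrank ℂ (eig π C χ) * (Nat.card C : ℂ) = finrank ℂ W * Nat.card (C ⊓ Z : Subgroup G) := by
    rw [mul_comm, h, mul_comm]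
  exact_mod_cast h'

variable {E : Type*} [AddCommGroup E] [Module ℂ E]

theorem IsHeis.finrank_intertwining_mul [FiniteDimensional ℂ W] [FiniteDimensional ℂ E]
    {ω : Representation ℂ G E} (hω : ∀ z ∈ Z, ω z = θ z • LinearMap.id)
    (π : Representation ℂ G W) :
    finrank ℂ (Representation.IntertwiningMap ω π) * Nat.card G =
      finrank ℂ E * Nat.card Z * finrank ℂ (eig π Z θ) := by
  classical
  have := Fintype.ofFinite G
  have hG : (Nat.card G : ℂ) ≠ 0 := by exact_mod_cast Nat.card_pos.ne'
  have : Invertible (Nat.card G : ℂ) := invertibleOfNonzero hG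
  have h := Representation.card_inv_mul_sum_char_mul_char_eq_finrank ω π
  rw [inv_mul_eq_iff_eq_mul₀ hG] at h
  have h1 : ∑ g : G, π.character g * ω.character g⁻¹ =
      ∑ g : Z, finrank ℂ E * (θ (g : G)⁻¹ * LinearMap.trace ℂ W (π g)) := by
    rw [← Finset.sum_subtype (Finset.univ.filter fun g => g ∈ Z) (by simp)
      (fun g => finrank ℂ E * (θ g⁻¹ * LinearMap.trace ℂ W (π g))), Finset.sum_filter]
    refine Finset.sum_congr rfl fun g _ => ?_
    split_ifs with hg
    · have : ω.character g⁻¹ = θ g⁻¹ * finrank ℂ E := by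
        rw [Representation.character, hω _ (inv_mem hg), map_smul, LinearMap.trace_id, smul_eq_mul]
      rw [this, Representation.character]
      ring
    · have : ω.character g⁻¹ = 0 := hZ.trace_eq_zero hω fun h => hg (by simpa using inv_mem h)
      rw [this, mul_zero]
  rw [h1, ← Finset.mul_sum, ← card_mul_finrank_eig π hZ.isChar] at h
  have h' : (finrank ℂ (Representation.IntertwiningMap ω π) : ℂ) * Nat.card G =
      finrank ℂ E * Nat.card Z * finrank ℂ (eig π Z θ) := by
    rw [mul_comm, ← h, mul_assoc]
  exact_mod_cast h'

/-- Schur's lemma makes the self-intertwiners one-dimensional, and all of `E` is the `Z`-eigenspace.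
So `dim E` depends only on the index of `Z`, not on the representation; this is how Weil
representations are compared without a uniqueness theorem. -/
theorem IsHeis.finrank_sq_mul_card [FiniteDimensional ℂ E]
    {ω : Representation ℂ G E} (hω : ∀ z ∈ Z, ω z = θ z • LinearMap.id) (hi : ω.IsIrreducible) :
    finrank ℂ E * finrank ℂ E * Nat.card Z = Nat.card G := by
  have h := hZ.finrank_intertwining_mul hω ω
  have h1 : eig ω Z θ = ⊤ := by
    rw [eq_top_iff]
    intro w _ z hz
    rw [hω z hz]; rfl
  rw [h1, finrank_top, Representation.IsIrreducible.finrank_intertwiningMap_self, one_mul] at h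
  rw [h]; ring

theorem IsHeis.finrank_intertwining_mul_finrank [FiniteDimensional ℂ W]
    {ω : Representation ℂ G E} (hω : ∀ z ∈ Z, ω z = θ z • LinearMap.id) (hi : ω.IsIrreducible)
    (π : Representation ℂ G W) :
    finrank ℂ (Representation.IntertwiningMap ω π) * finrank ℂ E = finrank ℂ (eig π Z θ) := by
  have := finiteDimensional_of_isIrreducible ω hi
  have h1 := hZ.finrank_sq_mul_card hω hi
  have h2 := hZ.finrank_intertwining_mul hω π
  have h3 := finrank_pos_of_isIrreducible ω hi
  have h4 : 0 < Nat.card Z := Nat.card_pos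
  rw [← h1] at h2
  have h5 : 0 < finrank ℂ E * Nat.card Z := Nat.mul_pos h3 h4
  refine Nat.eq_of_mul_eq_mul_left h5 ?_
  rw [← h2]; ring

/-- The part of `eig π Z θ` on which a further subgroup acts through a character. -/
theorem IsHeis.finrank_eig_inf_mul_card [FiniteDimensional ℂ W] (π : Representation ℂ G W)
    (hn : ∀ g, ∀ z ∈ Z, g * z * g⁻¹ ∈ Z ∧ θ (g * z * g⁻¹) = θ z)
    {C : Subgroup G} {χ : G → ℂ} (hχ : IsCharOn C χ) (hag : ∀ z ∈ Z, z ∈ C → θ z = χ z) :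
    finrank ℂ (eig π C χ ⊓ eig π Z θ : Submodule ℂ W) * Nat.card C =
      finrank ℂ (eig π Z θ) * Nat.card (C ⊓ Z : Subgroup G) := by
  -- Since `θ` is invariant under conjugation, its eigenspace is a representation of the whole group
  -- on which `Z` acts by `θ`, and the count for such representations applies to it.
  let U : Subrepresentation π := ⟨eig π Z θ, fun g w hw z hz => by
    obtain ⟨h1, h2⟩ := hn g⁻¹ z hz
    rw [inv_inv] at h1 h2
    rw [← Module.End.mul_apply, ← map_mul, show z * g = g * (g⁻¹ * z * g) by group, map_mul,
      Module.End.mul_apply, hw _ h1, map_smul, h2]⟩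
  have h := hZ.finrank_eig_mul_card (π := U.toRepresentation) (fun z hz => by
    ext w; exact w.2 z hz) hχ hag
  rw [← h]
  congr 1
  have h3 : eig U.toRepresentation C χ = (eig π C χ).comap U.toSubmodule.subtype := by
    ext w
    simp only [Submodule.mem_comap, mem_eig]
    refine forall₂_congr fun g _ => ?_
    rw [Subtype.ext_iff]; rfl
  rw [h3, inf_comm]
  have h4 := (Submodule.equivMapOfInjective U.toSubmodule.subtype (Submodule.subtype_injective _)
    ((eig π C χ).comap U.toSubmodule.subtype)).finrank_eq
  rw [h4, Submodule.map_comap_subtype]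

omit hZ in
/-- An irreducibility criterion for an eigenspace of a subgroup. -/
theorem IsHeis.eig_eq_of_stable {ω : Representation ℂ G E}
    (hω : ∀ z ∈ Z, ω z = θ z • LinearMap.id) (hi : ω.IsIrreducible)
    {C : Subgroup G} {χ : G → ℂ} (hχ : IsCharOn C χ) (N : Set G)
    (hN : ∀ x, (∃ c ∈ C, x * c * x⁻¹ * c⁻¹ ∈ Z ∧ θ (x * c * x⁻¹ * c⁻¹) ≠ 1) ∨
      ∃ z ∈ Z, ∃ c ∈ C, ∃ y ∈ N, x = z * c * y)
    (D : Submodule ℂ E) (hD : D ≤ eig ω C χ) (hND : ∀ y ∈ N, ∀ w ∈ D, ω y w ∈ D) (h0 : D ≠ ⊥) :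
    D = eig ω C χ := by
  refine le_antisymm hD fun w hw => ?_
  -- `M` collects the vectors all of whose translates average into `D`. It is invariant and contains
  -- `D`, so by irreducibility it is everything; at `x = 1` this puts all of `eig ω C χ` inside `D`.
  let M : Submodule ℂ E := ⨅ x : G, D.comap (avg ω C χ ∘ₗ ω x)
  have hM : M = ⊤ := by
    refine eq_top_of_isIrreducible ω hi M (fun g v hv => ?_) ?_
    · simp only [M, Submodule.mem_iInf, Submodule.mem_comap] at hv ⊢
      intro x
      have := hv (x * g)
      rwa [map_mul] at this
    · intro hM
      apply h0
      rw [eq_bot_iff, ← hM]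
      intro d hd
      simp only [M, Submodule.mem_iInf, Submodule.mem_comap, LinearMap.comp_apply]
      intro x
      -- Either the commutator with some `c` forces the average of `ω x d` to vanish, or `x = z c y`
      -- and the average is a multiple of `ω y d`, which stays in `D`.
      rcases hN x with ⟨c, hc, h1, h2⟩ | ⟨z, hz, c, hc, y, hy, rfl⟩
      · have e1 : avg ω C χ (ω (x * c * x⁻¹ * c⁻¹ * c) (ω x d)) = avg ω C χ (ω (x * c) d) := by
          refine congrArg _ ?_
          rw [← Module.End.mul_apply, ← map_mul, inv_mul_cancel_right, inv_mul_cancel_right]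
        rw [map_mul ω x c, Module.End.mul_apply, hD hd c hc, map_mul ω _ c, hω _ h1, smul_mul_assoc,
          LinearMap.smul_apply, map_smul, map_smul, map_smul] at e1
        change θ _ • avg ω C χ (ω c (ω x d)) = _ at e1
        rw [avg_comp ω hχ hc, smul_smul, ← sub_eq_zero, ← sub_smul, smul_eq_zero] at e1
        have e2 : θ (x * c * x⁻¹ * c⁻¹) * χ c - χ c ≠ 0 := by
          rw [sub_ne_zero]
          intro h
          exact h2 (mul_right_cancel₀ (hχ.ne_zero hc) (by rw [h, one_mul]))
        rw [e1.resolve_left e2]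
        exact zero_mem _
      · have hyd := hND y hy d hd
        rw [map_mul, map_mul, hω z hz, smul_mul_assoc, smul_mul_assoc, LinearMap.smul_apply, map_smul]
        refine Submodule.smul_mem _ _ ?_
        change avg ω C χ (ω c (ω y d)) ∈ D
        rw [avg_comp ω hχ hc, avg_eq_card ω hχ (hD hyd)]
        exact Submodule.smul_mem _ _ (Submodule.smul_mem _ _ hyd)
  have h1 : w ∈ M := hM ▸ Submodule.mem_top
  simp only [M, Submodule.mem_iInf, Submodule.mem_comap, LinearMap.comp_apply] at h1
  have h2 := h1 1
  rw [map_one, Module.End.one_apply, avg_eq_card ω hχ hw] at h2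
  exact (Submodule.smul_mem_iff _ (card_ne_zero C)).1 h2

end Heis

end RepTheory
end
end SpFourier

namespace SpFourier
noncomputable section

/-! ### Isometries and Siegel transvections -/

section Siegel

variable {K : Type*} [Field K] {V : Type*} [AddCommGroup V] [Module K V]
variable {B : LinearMap.BilinForm K V}

theorem Sp.toEnd_mul (g h : Sp B) : Sp.toEnd (g * h) = Sp.toEnd g * Sp.toEnd h := rfl

theorem Sp.toEnd_one : Sp.toEnd (1 : Sp B) = 1 := rfl

theorem Sp.toEnd_inv_mul (g : Sp B) : Sp.toEnd g⁻¹ * Sp.toEnd g = 1 := by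
  rw [← Sp.toEnd_mul, inv_mul_cancel, Sp.toEnd_one]

theorem Sp.toEnd_mul_inv (g : Sp B) : Sp.toEnd g * Sp.toEnd g⁻¹ = 1 := by
  rw [← Sp.toEnd_mul, mul_inv_cancel, Sp.toEnd_one]

theorem Sp.inv_apply_apply (g : Sp B) (v : V) : Sp.toEnd g⁻¹ (Sp.toEnd g v) = v :=
  LinearMap.congr_fun (Sp.toEnd_inv_mul g) v

theorem Sp.apply_inv_apply (g : Sp B) (v : V) : Sp.toEnd g (Sp.toEnd g⁻¹ v) = v :=
  LinearMap.congr_fun (Sp.toEnd_mul_inv g) v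

theorem Sp.toEnd_injective : Function.Injective (Sp.toEnd : Sp B → Module.End K V) := by
  intro g h hgh
  exact Subtype.ext (LinearEquiv.ext fun v => LinearMap.congr_fun hgh v)

theorem Sp.form_apply (g : Sp B) (v w : V) : B (Sp.toEnd g v) (Sp.toEnd g w) = B v w := g.2 v w

theorem Sp.form_apply_left (g : Sp B) (v w : V) : B (Sp.toEnd g v) w = B v (Sp.toEnd g⁻¹ w) := by
  rw [← Sp.form_apply g v, Sp.apply_inv_apply]

theorem Sp.form_sub_left (g : Sp B) (v w : V) :
    B ((Sp.toEnd g - 1) v) w = B v ((Sp.toEnd g⁻¹ - 1) w) := by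
  simp only [LinearMap.sub_apply, Module.End.one_apply, map_sub, Sp.form_apply_left]

theorem Sp.sub_one_mul (g h : Sp B) :
    Sp.toEnd (g * h) - 1 = (Sp.toEnd g - 1) + (Sp.toEnd h - 1)
      + (Sp.toEnd g - 1) * (Sp.toEnd h - 1) := by
  rw [Sp.toEnd_mul]; noncomm_ring

theorem Sp.conj_sub_one (g h : Sp B) :
    Sp.toEnd (g * h * g⁻¹) - 1 = Sp.toEnd g * (Sp.toEnd h - 1) * Sp.toEnd g⁻¹ := by
  rw [Sp.toEnd_mul, Sp.toEnd_mul, mul_sub, sub_mul, mul_one, Sp.toEnd_mul_inv]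

theorem form_swap (hB : B.IsAlt) (v w : V) : B v w = -B w v := (hB.neg_eq w v).symm

/-- The element `e · v` of `sp(V) = Sym² V`. -/
def symm2 (B : LinearMap.BilinForm K V) (e v : V) : Module.End K V :=
  (B e).smulRight v + (B v).smulRight e

theorem symm2_apply (e v w : V) : symm2 B e v w = B e w • v + B v w • e := rfl

theorem symm2_mul_self (hB : B.IsAlt) {e v : V} (h : B e v = 0) :
    symm2 B e v * symm2 B e v = 0 := by
  ext w
  have h' : B v e = 0 := by rw [form_swap hB, h, neg_zero]
  simp [symm2_apply, h, h', hB.self_eq_zero]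

theorem conj_symm2 (g : Sp B) (e v : V) :
    Sp.toEnd g * symm2 B e v * Sp.toEnd g⁻¹ = symm2 B (Sp.toEnd g e) (Sp.toEnd g v) := by
  ext w
  simp [symm2_apply, Sp.form_apply_left]

/-- The Siegel transvection `1 + e · v`, for orthogonal `e` and `v`. -/
def siegel (hB : B.IsAlt) (e v : V) (h : B e v = 0) : Sp B :=
  ⟨LinearEquiv.ofLinearMap (1 + symm2 B e v) (1 - symm2 B e v)
    (by
      change (1 + symm2 B e v) * (1 - symm2 B e v) = 1
      simp [mul_sub, add_mul, symm2_mul_self hB h])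
    (by
      change (1 - symm2 B e v) * (1 + symm2 B e v) = 1
      simp [mul_add, sub_mul, symm2_mul_self hB h]), by
    intro x y
    have h' : B v e = 0 := by rw [form_swap hB, h, neg_zero]
    change B (x + symm2 B e v x) (y + symm2 B e v y) = B x y
    simp only [symm2_apply, map_add, LinearMap.add_apply, map_smul, LinearMap.smul_apply,
      smul_eq_mul, hB.self_eq_zero, h, h', form_swap hB x e, form_swap hB x v]
    ring⟩

theorem siegel_sub_one (hB : B.IsAlt) (e v : V) (h : B e v = 0) :
    Sp.toEnd (siegel hB e v h) - 1 = symm2 B e v := by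
  change (1 + symm2 B e v) - 1 = _
  abel

theorem conj_siegel_sub_one (hB : B.IsAlt) (e v : V) (h : B e v = 0) (g : Sp B) :
    Sp.toEnd (g * siegel hB e v h * g⁻¹) - 1 = symm2 B (Sp.toEnd g e) (Sp.toEnd g v) := by
  rw [Sp.conj_sub_one, siegel_sub_one, conj_symm2]

/-- The function `g ↦ ψ(tr(Y (g - 1)))`. -/
def psiLin (ψ : AddChar K ℂ) (Y : Module.End K V) (g : Sp B) : ℂ :=
  ψ (LinearMap.trace K V (Y * (Sp.toEnd g - 1)))

variable [FiniteDimensional K V]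

theorem trace_mul_symm2 (hB : B.IsAlt) {Y : Module.End K V} (hY : Y ∈ skewAdjointLieSubalgebra B)
    (e v : V) : LinearMap.trace K V (Y * symm2 B e v) = 2 * B v (Y e) := by
  have h : Y * symm2 B e v = (B e).smulRight (Y v) + (B v).smulRight (Y e) := by
    ext w; simp [symm2_apply]
  rw [h, map_add, LinearMap.trace_smulRight, LinearMap.trace_smulRight]
  have h2 := skew hY e v
  rw [form_swap hB] at h2
  linear_combination h2

theorem psiLin_siegel (hB : B.IsAlt) {Y : Module.End K V} (hY : Y ∈ skewAdjointLieSubalgebra B)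
    (ψ : AddChar K ℂ) (e v : V) (h : B e v = 0) :
    psiLin ψ Y (siegel hB e v h) = ψ (2 * B v (Y e)) := by
  rw [psiLin, siegel_sub_one, trace_mul_symm2 hB hY]

/-- Conjugation carries `e · v` to `ge · gv`, and the trace against `Y` becomes one value of `B`.
Siegel transvections thus serve as the test elements in all nondegeneracy arguments. -/
theorem psiLin_conj_siegel (hB : B.IsAlt) {Y : Module.End K V}
    (hY : Y ∈ skewAdjointLieSubalgebra B) (ψ : AddChar K ℂ) (e v : V) (h : B e v = 0) (g : Sp B) :
    psiLin ψ Y (g * siegel hB e v h * g⁻¹) =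
      ψ (2 * B v (Sp.toEnd g⁻¹ (Y (Sp.toEnd g e)))) := by
  rw [psiLin, conj_siegel_sub_one, trace_mul_symm2 hB hY, Sp.form_apply_left]

omit [FiniteDimensional K V] in
/-- If the pairing of products vanishes, `psiLin` is a character. -/
theorem isCharOn_psiLin (ψ : AddChar K ℂ) (Y : Module.End K V) (Q : Subgroup (Sp B))
    (h : ∀ g ∈ Q, ∀ k ∈ Q,
      LinearMap.trace K V (Y * ((Sp.toEnd g - 1) * (Sp.toEnd k - 1))) = 0) :
    IsCharOn Q (psiLin ψ Y) := by
  constructor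
  · simp [psiLin, Sp.toEnd_one]
  · intro g hg k hk
    rw [psiLin, psiLin, psiLin, Sp.sub_one_mul, mul_add, mul_add, map_add (LinearMap.trace K V),
      map_add (LinearMap.trace K V), h g hg k hk, add_zero, AddChar.map_add_eq_mul]

end Siegel

/-! ### The weight grading -/

section Grading

variable {K : Type*} [Field K] {V : Type*} [AddCommGroup V] [Module K V]
variable {B : LinearMap.BilinForm K V}

theorem intCast_inj_of_lt {K : Type*} [Field K] {i j : ℤ} (h : |i - j| < ringChar K) (h2 : (i : K) = j) : i = j := by
  by_contra hne
  exact intCast_ne (K := K) (sub_ne_zero.2 hne) h (by push_cast; rw [h2, sub_self])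

/-- `γ` is completely reducible: `V` is the sum of its weight spaces, for a nondegenerate
alternating form in large characteristic. -/
structure Triple.Full (γ : Triple B) : Prop where
  alt : B.IsAlt
  nondeg : B.Nondegenerate
  char : 2 * finrank K V < ringChar K
  top : ⨆ j, γ.weightSpace j = ⊤

namespace Triple

variable (γ : Triple B)

/-- `T` raises the filtration by at least `k`. -/
def RaisesZ (k : ℤ) (T : Module.End K V) : Prop := ∀ i : ℤ, ∀ v ∈ γ.fil i, T v ∈ γ.fil (i + k)

variable {γ}

theorem RaisesZ.mono {k l : ℤ} {T : Module.End K V} (h : γ.RaisesZ k T) (hl : l ≤ k) :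
    γ.RaisesZ l T := fun i v hv => γ.fil_anti (by omega) (h i v hv)

theorem RaisesZ.add {k : ℤ} {S T : Module.End K V} (hS : γ.RaisesZ k S) (hT : γ.RaisesZ k T) :
    γ.RaisesZ k (S + T) := fun i v hv => add_mem (hS i v hv) (hT i v hv)

theorem RaisesZ.neg {k : ℤ} {S : Module.End K V} (hS : γ.RaisesZ k S) :
    γ.RaisesZ k (-S) := fun i v hv => neg_mem (hS i v hv)

theorem RaisesZ.sub {k : ℤ} {S T : Module.End K V} (hS : γ.RaisesZ k S) (hT : γ.RaisesZ k T) :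
    γ.RaisesZ k (S - T) := fun i v hv => sub_mem (hS i v hv) (hT i v hv)

theorem RaisesZ.smul {k : ℤ} {S : Module.End K V} (hS : γ.RaisesZ k S) (c : K) :
    γ.RaisesZ k (c • S) := fun i v hv => Submodule.smul_mem _ _ (hS i v hv)

theorem RaisesZ.mul {k l : ℤ} {S T : Module.End K V} (hS : γ.RaisesZ k S) (hT : γ.RaisesZ l T) :
    γ.RaisesZ (k + l) (S * T) := fun i v hv => by
  have := hS _ _ (hT i v hv)
  rwa [show i + l + k = i + (k + l) by ring] at this

theorem raisesZ_one : γ.RaisesZ 0 1 := fun i v hv => by simpa using hv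

theorem weightSpace_le_fil {i j : ℤ} (h : i ≤ j) : γ.weightSpace j ≤ γ.fil i :=
  le_iSup_of_le j (le_iSup_of_le h le_rfl)

theorem weightSpace_eq_bot {j : ℤ} (h : (finrank K V : ℤ) ≤ |j|) : γ.weightSpace j = ⊥ :=
  if_neg (not_lt.2 h)

theorem fil_eq_bot {i : ℤ} (h : (finrank K V : ℤ) ≤ i) : γ.fil i = ⊥ := by
  rw [eq_bot_iff]
  refine iSup_le fun j => iSup_le fun hj => ?_
  rw [weightSpace_eq_bot]
  exact (h.trans hj).trans (le_abs_self j)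

theorem H_apply_of_mem {j : ℤ} {v : V} (h : v ∈ γ.weightSpace j) : γ.H v = (j : K) • v := by
  unfold weightSpace at h
  split_ifs at h
  · exact End.mem_eigenspace_iff.1 h
  · rw [(Submodule.mem_bot K).1 h]; simp

variable (γ) in
/-- The projection to the weight space of weight `j`. -/
def proj (j : ℤ) : Module.End K V :=
  if |j| < (finrank K V : ℤ) then
    Polynomial.aeval γ.H (Lagrange.basis (Finset.Ioo (-(finrank K V : ℤ)) (finrank K V))
      (fun i : ℤ => (i : K)) j)
  else 0

theorem raisesZ_of_weightSpace {T : Module.End K V} {k : ℤ}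
    (h : ∀ j, ∀ v ∈ γ.weightSpace j, T v ∈ γ.fil (j + k)) : γ.RaisesZ k T := by
  intro i
  change γ.fil i ≤ (γ.fil (i + k)).comap T
  refine iSup_le fun j => iSup_le fun hj v hv => ?_
  exact γ.fil_anti (by omega) (h j v hv)

namespace Full

variable (hγ : γ.Full)
include hγ

/-- The Lagrange polynomial at `H` takes the value one at the eigenvalue `j` and zero at the others.
The eigenvalues are distinct in `K` because weights lie strictly between `-dim V` and `dim V` while
`2 dim V < p`. -/
theorem proj_apply_of_mem {i j : ℤ} {v : V} (h : v ∈ γ.weightSpace i) :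
    γ.proj j v = if i = j then v else 0 := by
  have hc := hγ.char
  by_cases hv : v = 0
  · simp [hv]
  by_cases hi : |i| < (finrank K V : ℤ)
  · have hev : End.HasEigenvector γ.H (i : K) v :=
      ⟨End.mem_eigenspace_iff.2 (H_apply_of_mem h), hv⟩
    unfold proj
    by_cases hj : |j| < (finrank K V : ℤ)
    · rw [if_pos hj, End.aeval_apply_of_hasEigenvector hev]
      rw [abs_lt] at hi hj
      split_ifs with hij
      · subst hij
        rw [Lagrange.eval_basis_self (v := fun i : ℤ => (i : K)), one_smul]
        · intro a ha b hb hab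
          simp only [Finset.coe_Ioo, Set.mem_Ioo] at ha hb
          exact intCast_inj_of_lt (by rw [abs_lt]; omega) hab
        · simp only [Finset.mem_Ioo]; exact hi
      · rw [Lagrange.eval_basis_of_ne (v := fun i : ℤ => (i : K)) (Ne.symm hij), zero_smul]
        simp only [Finset.mem_Ioo]; exact hi
    · rw [if_neg hj, if_neg]
      · rfl
      · rintro rfl; exact hj hi
  · rw [weightSpace_eq_bot (not_lt.1 hi)] at h
    exact absurd ((Submodule.mem_bot K).1 h) hv

theorem induction {P : V → Prop} (h : ∀ j, ∀ v ∈ γ.weightSpace j, P v) (h0 : P 0)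
    (ha : ∀ v w, P v → P w → P (v + w)) (v : V) : P v :=
  Submodule.iSup_induction γ.weightSpace (motive := P) (hγ.top ▸ Submodule.mem_top) h h0 ha

theorem ext {M : Type*} [AddCommGroup M] [Module K M] {S T : V →ₗ[K] M}
    (h : ∀ j, ∀ v ∈ γ.weightSpace j, S v = T v) : S = T :=
  LinearMap.ext fun v => hγ.induction h (by simp) (fun v w hv hw => by simp [hv, hw]) v

theorem proj_mem (j : ℤ) (v : V) : γ.proj j v ∈ γ.weightSpace j := by
  refine hγ.induction (P := fun v => γ.proj j v ∈ γ.weightSpace j) (fun i v hv => ?_) ?_ ?_ v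
  · rw [hγ.proj_apply_of_mem hv]
    split_ifs with h
    · exact h ▸ hv
    · exact zero_mem _
  · simp
  · intro v w hv hw; rw [map_add]; exact add_mem hv hw

theorem proj_proj (i j : ℤ) (v : V) : γ.proj i (γ.proj j v) = if j = i then γ.proj j v else 0 :=
  hγ.proj_apply_of_mem (hγ.proj_mem j v)

theorem sum_proj (v : V) :
    ∑ j ∈ Finset.Ioo (-(finrank K V : ℤ)) (finrank K V), γ.proj j v = v := by
  refine hγ.induction (P := fun v => ∑ j ∈ Finset.Ioo (-(finrank K V : ℤ)) (finrank K V),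
    γ.proj j v = v) (fun i v hv => ?_) (by simp) ?_ v
  · by_cases hi : |i| < (finrank K V : ℤ)
    · rw [Finset.sum_congr rfl fun j _ => hγ.proj_apply_of_mem hv, Finset.sum_ite_eq, if_pos]
      rw [Finset.mem_Ioo]; exact abs_lt.1 hi
    · rw [weightSpace_eq_bot (not_lt.1 hi)] at hv
      rw [(Submodule.mem_bot K).1 hv]; simp
  · intro v w hv hw
    simp only [map_add, Finset.sum_add_distrib, hv, hw]

theorem mem_fil_iff {i : ℤ} {v : V} : v ∈ γ.fil i ↔ ∀ j < i, γ.proj j v = 0 := by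
  constructor
  · intro hv j hj
    have : γ.fil i ≤ LinearMap.ker (γ.proj j) := by
      refine iSup_le fun l => iSup_le fun hl w hw => ?_
      rw [LinearMap.mem_ker, hγ.proj_apply_of_mem hw, if_neg (by omega)]
    exact this hv
  · intro h
    rw [← hγ.sum_proj v]
    refine sum_mem fun j _ => ?_
    by_cases hj : j < i
    · rw [h j hj]; exact zero_mem _
    · exact weightSpace_le_fil (not_lt.1 hj) (hγ.proj_mem j v)

theorem fil_eq_top {i : ℤ} (h : i ≤ -(finrank K V : ℤ) + 1) : γ.fil i = ⊤ := by
  rw [eq_top_iff]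
  intro v _
  rw [hγ.mem_fil_iff]
  intro j hj
  have := hγ.proj_mem j v
  rwa [weightSpace_eq_bot (le_trans (by omega) (neg_le_abs j)), Submodule.mem_bot] at this

/-- The part of weight `i` of an element of `fil i` is its class modulo `fil (i + 1)`. -/
theorem sub_proj_mem {i : ℤ} {v : V} (h : v ∈ γ.fil i) : v - γ.proj i v ∈ γ.fil (i + 1) := by
  rw [hγ.mem_fil_iff] at h ⊢
  intro j hj
  rw [map_sub, hγ.proj_proj]
  split_ifs with h1
  · rw [h1, sub_self]
  · rw [h j (by omega), sub_zero]

/-- For `j ≠ c` the projection to weight `j` is multiplied by both `c` and `j`, which differ in `K`.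
The bound `dim V + 1` covers a weight shifted by two, so `X` and `Y` map weight spaces to weight
spaces even past the extreme weights, where the target is zero. -/
theorem mem_weightSpace_of_eq {c : ℤ} (hc : |c| ≤ finrank K V + 1) {v : V}
    (h : γ.H v = (c : K) • v) : v ∈ γ.weightSpace c := by
  have hchar := hγ.char
  have key : ∀ j, j ≠ c → γ.proj j v = 0 := by
    intro j hj
    by_cases hj2 : |j| < (finrank K V : ℤ)
    · have h1 : ∀ w, γ.proj j (γ.H w) = (j : K) • γ.proj j w := by
        intro w
        have : γ.proj j ∘ₗ γ.H = (j : K) • γ.proj j := hγ.ext fun i u hu => by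
          simp only [LinearMap.comp_apply, LinearMap.smul_apply, H_apply_of_mem hu, map_smul,
            hγ.proj_apply_of_mem hu]
          split_ifs with hij
          · rw [hij]
          · simp
        exact LinearMap.congr_fun this w
      have h2 := h1 v
      rw [h, map_smul, ← sub_eq_zero, ← sub_smul, smul_eq_zero] at h2
      refine h2.resolve_left fun h3 => hj ?_
      rw [sub_eq_zero] at h3
      rw [abs_lt] at hj2
      rw [abs_le] at hc
      exact (intCast_inj_of_lt (by rw [abs_lt]; omega) h3).symm
    · rw [proj, if_neg hj2]; rfl
  rw [← hγ.sum_proj v]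
  refine sum_mem fun j _ => ?_
  by_cases hj : j = c
  · exact hj ▸ hγ.proj_mem j v
  · rw [key j hj]; exact zero_mem _

theorem X_mem {j : ℤ} {v : V} (hv : v ∈ γ.weightSpace j) : γ.X v ∈ γ.weightSpace (j + 2) := by
  by_cases hj : |j| < (finrank K V : ℤ)
  · refine hγ.mem_weightSpace_of_eq ?_ ?_
    · rw [abs_lt] at hj; rw [abs_le]; omega
    · rw [γ.HX, H_apply_of_mem hv, map_smul, ← add_smul]; push_cast; rfl
  · rw [weightSpace_eq_bot (not_lt.1 hj)] at hv
    rw [(Submodule.mem_bot K).1 hv, map_zero]; exact zero_mem _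

theorem Y_mem {j : ℤ} {v : V} (hv : v ∈ γ.weightSpace j) : γ.Y v ∈ γ.weightSpace (j - 2) := by
  by_cases hj : |j| < (finrank K V : ℤ)
  · refine hγ.mem_weightSpace_of_eq ?_ ?_
    · rw [abs_lt] at hj; rw [abs_le]; omega
    · have h := LinearMap.congr_fun γ.lie_H_Y v
      rw [Ring.lie_def] at h
      simp only [LinearMap.sub_apply, Module.End.mul_apply, LinearMap.smul_apply,
        LinearMap.neg_apply, H_apply_of_mem hv, map_smul] at h
      rw [sub_eq_iff_eq_add] at h
      rw [h, ← neg_smul, ← add_smul]; push_cast; congr 1; ring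
  · rw [weightSpace_eq_bot (not_lt.1 hj)] at hv
    rw [(Submodule.mem_bot K).1 hv, map_zero]; exact zero_mem _

theorem raisesZ_Y : γ.RaisesZ (-2) γ.Y := raisesZ_of_weightSpace fun _ _ hv =>
  weightSpace_le_fil le_rfl (hγ.Y_mem hv)

theorem form_eq_zero {i j : ℤ} (hij : i + j ≠ 0) {v w : V} (hv : v ∈ γ.weightSpace i)
    (hw : w ∈ γ.weightSpace j) : B v w = 0 := by
  have hchar := hγ.char
  by_cases hi : |i| < (finrank K V : ℤ)
  · by_cases hj : |j| < (finrank K V : ℤ)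
    · have h := skew γ.H_mem v w
      rw [H_apply_of_mem hv, H_apply_of_mem hw, map_smul, LinearMap.smul_apply, map_smul,
        smul_eq_mul, smul_eq_mul] at h
      have h2 : ((i + j : ℤ) : K) * B v w = 0 := by push_cast; linear_combination h
      refine (mul_eq_zero.1 h2).resolve_left (intCast_ne hij ?_)
      rw [abs_lt] at *; omega
    · rw [weightSpace_eq_bot (not_lt.1 hj)] at hw
      rw [(Submodule.mem_bot K).1 hw, map_zero]
  · rw [weightSpace_eq_bot (not_lt.1 hi)] at hv
    rw [(Submodule.mem_bot K).1 hv, map_zero, LinearMap.zero_apply]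

theorem form_fil_weightSpace {i j : ℤ} (hij : 0 < i + j) {v w : V} (hv : v ∈ γ.fil i)
    (hw : w ∈ γ.weightSpace j) : B v w = 0 := by
  have : γ.fil i ≤ LinearMap.ker (B.flip w) := by
    refine iSup_le fun l => iSup_le fun hl u hu => ?_
    exact hγ.form_eq_zero (by omega) hu hw
  exact this hv

theorem form_fil_fil {i j : ℤ} (hij : 0 < i + j) {v w : V} (hv : v ∈ γ.fil i)
    (hw : w ∈ γ.fil j) : B v w = 0 := by
  have : γ.fil j ≤ LinearMap.ker (B v) := by
    refine iSup_le fun l => iSup_le fun hl u hu => ?_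
    exact hγ.form_fil_weightSpace (by omega) hv hu
  exact this hw

theorem form_proj (j : ℤ) (v w : V) : B (γ.proj j v) w = B v (γ.proj (-j) w) := by
  have h : B ∘ₗ γ.proj j = B.compl₂ (γ.proj (-j)) := hγ.ext fun i u hu => hγ.ext fun l u' hu' => by
    simp only [LinearMap.comp_apply, LinearMap.compl₂_apply, hγ.proj_apply_of_mem hu,
      hγ.proj_apply_of_mem hu']
    split_ifs with h1 h2 h2
    · rfl
    · rw [map_zero]; exact hγ.form_eq_zero (by omega) hu hu'
    · rw [map_zero, LinearMap.zero_apply]; exact (hγ.form_eq_zero (by omega) hu hu').symm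
    · simp
  exact LinearMap.congr_fun (LinearMap.congr_fun h v) w

/-- `fil` is orthogonally self-dual. -/
theorem mem_fil_of_form {i : ℤ} {v : V} (h : ∀ w ∈ γ.fil (1 - i), B v w = 0) : v ∈ γ.fil i := by
  rw [hγ.mem_fil_iff]
  intro j hj
  refine hγ.nondeg.1 _ fun w => ?_
  rw [hγ.form_proj]
  exact h _ (weightSpace_le_fil (by omega) (hγ.proj_mem _ w))

/-- A map raising weights is nilpotent, since fewer than `2 dim V` weights occur. -/
theorem trace_eq_zero [FiniteDimensional K V] {T : Module.End K V} {k : ℤ} (hk : 0 < k)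
    (hT : γ.RaisesZ k T) : LinearMap.trace K V T = 0 := by
  have h1 := hT.mono (show 1 ≤ k by omega)
  have h2 : ∀ m : ℕ, γ.RaisesZ m (T ^ m) := by
    intro m
    induction m with
    | zero => simpa using raisesZ_one
    | succ m ih =>
      rw [pow_succ]
      exact_mod_cast ih.mul h1
  have h3 : T ^ (2 * finrank K V) = 0 := by
    ext v
    have := h2 (2 * finrank K V) (-(finrank K V : ℤ)) v (by
      rw [hγ.fil_eq_top (by omega)]; exact Submodule.mem_top)
    rwa [fil_eq_bot (by push_cast; omega), Submodule.mem_bot] at this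
  exact (LinearMap.isNilpotent_trace_of_isNilpotent ⟨_, h3⟩).eq_zero

/-- In the terms of order at least two of the logarithm `u - 1` occurs at least twice and raises by
at least four, while `Y` lowers by two; their traces vanish. -/
theorem psi_eq_psiLin [FiniteDimensional K V] (ψ : AddChar K ℂ) {u : Sp B} (hu : u ∈ γ.unip 2) :
    γ.psi ψ u = psiLin ψ γ.Y u := by
  have hu' : γ.RaisesZ 2 (Sp.toEnd u - 1) := hu
  unfold psi psiLin
  congr 1
  by_cases hV : finrank K V = 0
  · have := finrank_zero_iff.1 hV
    rw [Subsingleton.elim (unipLog u) (Sp.toEnd u - 1)]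
  rw [unipLog, Finset.mul_sum, map_sum, Finset.sum_eq_single 1]
  · simp
  · intro k hk hk1
    rw [Finset.mem_Icc] at hk
    obtain ⟨m, rfl⟩ : ∃ m, k = m + 2 := ⟨k - 2, by omega⟩
    rw [mul_smul_comm, map_smul]
    have h2 : ∀ m : ℕ, γ.RaisesZ 0 ((Sp.toEnd u - 1) ^ m) := by
      intro m
      induction m with
      | zero => simpa using raisesZ_one
      | succ m ih =>
        rw [pow_succ]
        exact (ih.mul hu').mono (by omega)
    rw [hγ.trace_eq_zero (k := 2) (by omega), smul_zero]
    rw [pow_succ, pow_succ]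
    exact (hγ.raisesZ_Y.mul (((h2 m).mul hu').mul hu')).mono (by omega)
  · intro h
    exact absurd (Finset.mem_Icc.2 ⟨le_rfl, by omega⟩) h

end Full

variable (γ) in
/-- The part of degree one of an endomorphism. -/
def gr1 (T : Module.End K V) : Module.End K V :=
  ∑ j ∈ Finset.Ioo (-(finrank K V : ℤ)) (finrank K V), γ.proj (j + 1) * T * γ.proj j

namespace Full

variable (hγ : γ.Full)
include hγ

theorem gr1_apply {T : Module.End K V} {j : ℤ} {v : V} (hv : v ∈ γ.weightSpace j) :
    γ.gr1 T v = γ.proj (j + 1) (T v) := by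
  by_cases hj : |j| < (finrank K V : ℤ)
  · rw [gr1, LinearMap.sum_apply, Finset.sum_eq_single j]
    · simp [hγ.proj_apply_of_mem hv]
    · intro i _ hi
      simp [hγ.proj_apply_of_mem hv, Ne.symm hi]
    · intro h
      exact absurd (Finset.mem_Ioo.2 (abs_lt.1 hj)) h
  · rw [weightSpace_eq_bot (not_lt.1 hj)] at hv
    rw [(Submodule.mem_bot K).1 hv]; simp

theorem gr1_mem {T : Module.End K V} {j : ℤ} {v : V} (hv : v ∈ γ.weightSpace j) :
    γ.gr1 T v ∈ γ.weightSpace (j + 1) := by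
  rw [hγ.gr1_apply hv]; exact hγ.proj_mem _ _

theorem raisesZ_gr1 (T : Module.End K V) : γ.RaisesZ 1 (γ.gr1 T) :=
  raisesZ_of_weightSpace fun _ _ hv => weightSpace_le_fil le_rfl (hγ.gr1_mem hv)

theorem raisesZ_sub_gr1 {T : Module.End K V} (hT : γ.RaisesZ 1 T) : γ.RaisesZ 2 (T - γ.gr1 T) :=
  raisesZ_of_weightSpace fun j v hv => by
    rw [LinearMap.sub_apply, hγ.gr1_apply hv]
    have := hγ.sub_proj_mem (hT j v (weightSpace_le_fil le_rfl hv))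
    rwa [add_assoc] at this

theorem raisesZ_two_iff {T : Module.End K V} (hT : γ.RaisesZ 1 T) :
    γ.RaisesZ 2 T ↔ γ.gr1 T = 0 := by
  constructor
  · intro h
    refine hγ.ext fun j v hv => ?_
    rw [hγ.gr1_apply hv]
    exact hγ.mem_fil_iff.1 (h j v (weightSpace_le_fil le_rfl hv)) _ (by omega)
  · intro h
    have := hγ.raisesZ_sub_gr1 hT
    rwa [h, sub_zero] at this

/-- An endomorphism of degree one commuting with `Y` vanishes. -/
theorem eq_zero_of_commute {ξ : Module.End K V}
    (h1 : ∀ j, ∀ v ∈ γ.weightSpace j, ξ v ∈ γ.weightSpace (j + 1)) (h2 : ⁅γ.Y, ξ⁆ = 0) :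
    ξ = 0 := by
  have hchar := hγ.char
  -- The `sl₂` theory of a lowest weight vector `ξ` of weight one in `End V`: a nonzero one would
  -- have weight at most zero. Here `f m = ad(X)^m ξ` has weight `1 + 2m`, and `ad(Y)` sends `f (m +
  -- 1)` to `-(m + 1)² f m`.
  let f : ℕ → Module.End K V := fun m => (fun T => ⁅γ.X, T⁆)^[m] ξ
  have fs : ∀ m, f (m + 1) = ⁅γ.X, f m⁆ := fun m => Function.iterate_succ_apply' _ _ _
  have hw : ∀ m : ℕ, ∀ j, ∀ v ∈ γ.weightSpace j, f m v ∈ γ.weightSpace (j + 1 + 2 * m) := by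
    intro m
    induction m with
    | zero => simpa [f] using h1
    | succ m ih =>
      intro j v hv
      rw [fs, Ring.lie_def, LinearMap.sub_apply, Module.End.mul_apply, Module.End.mul_apply]
      refine sub_mem ?_ ?_
      · have := hγ.X_mem (ih j v hv)
        convert this using 2; push_cast; ring
      · have := ih _ _ (hγ.X_mem hv)
        convert this using 2; push_cast; ring
  have hH : ∀ m : ℕ, ⁅γ.H, f m⁆ = (1 + 2 * (m : K)) • f m := by
    intro m
    refine hγ.ext fun j v hv => ?_
    rw [Ring.lie_def, LinearMap.sub_apply, Module.End.mul_apply, Module.End.mul_apply,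
      H_apply_of_mem (hw m j v hv), H_apply_of_mem hv, map_smul, LinearMap.smul_apply, ← sub_smul]
    push_cast; congr 1; ring
  have hY : ∀ m : ℕ, ⁅γ.Y, f (m + 1)⁆ = (-(((m : K) + 1) * (m + 1))) • f m := by
    have e : ∀ T : Module.End K V, ⁅γ.Y, ⁅γ.X, T⁆⁆ = ⁅γ.X, ⁅γ.Y, T⁆⁆ - ⁅γ.H, T⁆ := by
      intro T
      rw [← γ.lie_X_Y]
      simp only [Ring.lie_def]
      noncomm_ring
    intro m
    induction m with
    | zero =>
      rw [fs, e, hH, show f 0 = ξ from rfl, h2, Ring.lie_def, mul_zero, zero_mul]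
      simp
    | succ m ih =>
      rw [fs (m + 1), e, ih, Ring.lie_def, mul_smul_comm, smul_mul_assoc, ← smul_sub,
        ← Ring.lie_def, ← fs, hH, ← sub_smul]
      congr 1; push_cast; ring
  have hz : ∀ m : ℕ, m ≤ finrank K V → f m = 0 → ξ = 0 := by
    intro m
    induction m with
    | zero => intro _ h; exact h
    | succ m ih =>
      intro hm h
      refine ih (by omega) ?_
      have := hY m
      rw [h, Ring.lie_def, mul_zero, zero_mul, sub_zero, eq_comm, smul_eq_zero, neg_eq_zero, mul_self_eq_zero] at this
      refine this.resolve_left ?_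
      exact_mod_cast natCast_ne (K := K) (m := m + 1) (by omega) (by omega)
  -- `f (dim V)` raises past the top weight and is zero. The coefficients `(m + 1)²` with `m < dim
  -- V` are invertible, so vanishing descends to `ξ`.
  refine hz (finrank K V) le_rfl (hγ.ext fun j v hv => ?_)
  rw [LinearMap.zero_apply]
  by_cases hj : |j| < (finrank K V : ℤ)
  · have := hw (finrank K V) j v hv
    rw [abs_lt] at hj
    rwa [weightSpace_eq_bot (le_trans (by omega) (le_abs_self _)), Submodule.mem_bot] at this
  · rw [weightSpace_eq_bot (not_lt.1 hj)] at hv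
    rw [(Submodule.mem_bot K).1 hv, map_zero]

end Full

end Triple

end Grading

end
end SpFourier

namespace SpFourier
noncomputable section

/-! ### Nondegeneracy of the commutator pairing on `G_{≥ 1}` -/

section Nondegeneracy

variable {K : Type*} [Field K] {V : Type*} [AddCommGroup V] [Module K V]
variable {B : LinearMap.BilinForm K V} {γ : Triple B}

namespace Triple.Full

variable (hγ : γ.Full)
include hγ

theorem raisesZ_symm2 {i j k : ℤ} (h : k ≤ i + j) {e v : V} (he : e ∈ γ.fil i)
    (hv : v ∈ γ.fil j) : γ.RaisesZ k (symm2 B e v) := by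
  intro l w hw
  rw [symm2_apply]
  refine add_mem ?_ ?_
  · by_cases hl : 0 < i + l
    · rw [hγ.form_fil_fil hl he hw, zero_smul]; exact zero_mem _
    · exact Submodule.smul_mem _ _ (γ.fil_anti (by omega) hv)
  · by_cases hl : 0 < j + l
    · rw [hγ.form_fil_fil hl hv hw, zero_smul]; exact zero_mem _
    · exact Submodule.smul_mem _ _ (γ.fil_anti (by omega) he)

variable [FiniteDimensional K V]

omit hγ in
theorem raisesZ_of_mem {k : ℕ} {g : Sp B} (hg : g ∈ γ.unip k) :
    γ.RaisesZ k (Sp.toEnd g - 1) := hg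

omit hγ in
theorem raisesZ_toEnd {k : ℕ} {g : Sp B} (hg : g ∈ γ.unip k) : γ.RaisesZ 0 (Sp.toEnd g) := by
  have h : Sp.toEnd g = (Sp.toEnd g - 1) + 1 := by abel
  rw [h]
  exact ((raisesZ_of_mem hg).mono (by omega)).add raisesZ_one

theorem siegel_mem_unip {i j : ℤ} {k : ℕ} (h : (k : ℤ) ≤ i + j) {e v : V} (he : e ∈ γ.fil i)
    (hv : v ∈ γ.fil j) (hev : B e v = 0) : siegel hγ.alt e v hev ∈ γ.unip k := by
  change γ.RaisesZ k _
  rw [siegel_sub_one]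
  exact hγ.raisesZ_symm2 h he hv

omit hγ in
theorem unip_anti {k l : ℕ} (h : k ≤ l) : γ.unip l ≤ γ.unip k := fun _ hg =>
  (raisesZ_of_mem hg).mono (by omega)

omit hγ in
-- The commutator minus one is `[g - 1, u - 1] g⁻¹ u⁻¹`, and degrees add.
theorem commutator_mem {k l m : ℕ} (h : m ≤ k + l) {g u : Sp B} (hg : g ∈ γ.unip k)
    (hu : u ∈ γ.unip l) : g * u * g⁻¹ * u⁻¹ ∈ γ.unip m := by
  change γ.RaisesZ m _
  have e : Sp.toEnd (g * u * g⁻¹ * u⁻¹) - 1 =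
      ((Sp.toEnd g - 1) * (Sp.toEnd u - 1) - (Sp.toEnd u - 1) * (Sp.toEnd g - 1)) *
        (Sp.toEnd g⁻¹ * Sp.toEnd u⁻¹) := by
    have h1 : Sp.toEnd u * Sp.toEnd g * (Sp.toEnd g⁻¹ * Sp.toEnd u⁻¹) = 1 := by
      rw [← Sp.toEnd_mul, ← Sp.toEnd_mul, ← Sp.toEnd_mul, ← Sp.toEnd_one]
      congr 1; group
    have h2 : (Sp.toEnd g - 1) * (Sp.toEnd u - 1) - (Sp.toEnd u - 1) * (Sp.toEnd g - 1) =
        Sp.toEnd g * Sp.toEnd u - Sp.toEnd u * Sp.toEnd g := by noncomm_ring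
    rw [h2, sub_mul, h1, Sp.toEnd_mul, Sp.toEnd_mul, Sp.toEnd_mul]
    simp only [mul_assoc]
  rw [e]
  have h1 := (raisesZ_of_mem hg).mul (raisesZ_of_mem hu)
  have h2 := (raisesZ_of_mem hu).mul (raisesZ_of_mem hg)
  have h3 := (raisesZ_toEnd (inv_mem hg)).mul (raisesZ_toEnd (inv_mem hu))
  exact (((h1.sub (h2.mono (by omega))).mul h3)).mono (by omega)

/-- The defect of multiplicativity is the trace of `Y(g - 1)(k - 1)`, which has degree at least `4 -
2`. -/
theorem isCharOn_psiLin_unip (ψ : AddChar K ℂ) : IsCharOn (γ.unip 2) (psiLin ψ γ.Y) :=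
  isCharOn_psiLin ψ γ.Y _ fun _ hg _ hk => hγ.trace_eq_zero (k := 2) (by norm_num)
    ((hγ.raisesZ_Y.mul ((raisesZ_of_mem hg).mul (raisesZ_of_mem hk))).mono (by norm_num))

/-- `psiLin` on commutators of elements of `G_{≥ 1}`. -/
theorem psiLin_commutator_siegel (ψ : AddChar K ℂ) {x : Sp B} (hx : x ∈ γ.unip 1) {e v : V}
    (hev : B e v = 0) (hs : siegel hγ.alt e v hev ∈ γ.unip 1) :
    psiLin ψ γ.Y (x * siegel hγ.alt e v hev * x⁻¹ * (siegel hγ.alt e v hev)⁻¹) =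
      ψ (2 * (B v (Sp.toEnd x⁻¹ (γ.Y (Sp.toEnd x e))) - B v (γ.Y e))) := by
  set s := siegel hγ.alt e v hev
  have hc : γ.RaisesZ 2 (Sp.toEnd (x * s * x⁻¹ * s⁻¹) - 1) := commutator_mem (m := 2) le_rfl hx hs
  -- With `z` the commutator, `x s x⁻¹ - s = (z - 1) + (z - 1)(s - 1)`. The last term has degree at
  -- least three and is invisible to the trace against `Y`.
  have e1 : Sp.toEnd (x * s * x⁻¹) - Sp.toEnd s = (Sp.toEnd (x * s * x⁻¹ * s⁻¹) - 1) +
      (Sp.toEnd (x * s * x⁻¹ * s⁻¹) - 1) * (Sp.toEnd s - 1) := by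
    have : Sp.toEnd (x * s * x⁻¹) = Sp.toEnd (x * s * x⁻¹ * s⁻¹) * Sp.toEnd s := by
      rw [← Sp.toEnd_mul]; congr 1; group
    rw [this]; noncomm_ring
  have e2 : LinearMap.trace K V (γ.Y * (Sp.toEnd (x * s * x⁻¹) - Sp.toEnd s)) =
      LinearMap.trace K V (γ.Y * (Sp.toEnd (x * s * x⁻¹ * s⁻¹) - 1)) := by
    rw [e1, mul_add, map_add, hγ.trace_eq_zero (k := 1) (by norm_num)
      ((hγ.raisesZ_Y.mul (hc.mul (raisesZ_of_mem hs))).mono (by norm_num)), add_zero]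
  rw [psiLin, ← e2]
  have e3 : Sp.toEnd (x * s * x⁻¹) - Sp.toEnd s =
      (Sp.toEnd (x * s * x⁻¹) - 1) - (Sp.toEnd s - 1) := by abel
  rw [e3, mul_sub, map_sub, conj_siegel_sub_one, siegel_sub_one, trace_mul_symm2 hγ.alt γ.Y_mem,
    trace_mul_symm2 hγ.alt γ.Y_mem, Sp.form_apply_left]
  congr 1; ring

theorem raisesZ_inv_add_gr1 {x : Sp B} (hx : x ∈ γ.unip 1) :
    γ.RaisesZ 2 (Sp.toEnd x⁻¹ - 1 + γ.gr1 (Sp.toEnd x - 1)) := by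
  have h1 := hγ.raisesZ_sub_gr1 (raisesZ_of_mem hx)
  have e : Sp.toEnd x⁻¹ - 1 + γ.gr1 (Sp.toEnd x - 1) =
      -((Sp.toEnd x - 1) - γ.gr1 (Sp.toEnd x - 1)) - (Sp.toEnd x⁻¹ - 1) * (Sp.toEnd x - 1) := by
    have := Sp.toEnd_inv_mul x
    rw [sub_mul, mul_sub, this]; noncomm_ring
  rw [e]
  exact h1.neg.sub (((raisesZ_of_mem (inv_mem hx)).mul (raisesZ_of_mem hx)).mono (by norm_num))

/-- First order expansion: if `x ≡ 1 + ξ` modulo degree two, then `x⁻¹ Y x ≡ Y + [Y, ξ]` modulo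
degree zero. Thus the commutator pairing only sees `[Y, ξ]`. -/
theorem raisesZ_conj_Y {x : Sp B} (hx : x ∈ γ.unip 1) :
    γ.RaisesZ 0 (Sp.toEnd x⁻¹ * γ.Y * Sp.toEnd x - γ.Y - ⁅γ.Y, γ.gr1 (Sp.toEnd x - 1)⁆) := by
  have h1 := hγ.raisesZ_sub_gr1 (raisesZ_of_mem hx)
  have h2 := hγ.raisesZ_inv_add_gr1 hx
  have hY := hγ.raisesZ_Y
  set ξ := γ.gr1 (Sp.toEnd x - 1)
  have e : Sp.toEnd x⁻¹ * γ.Y * Sp.toEnd x - γ.Y - ⁅γ.Y, ξ⁆ =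
      γ.Y * (Sp.toEnd x - 1 - ξ) + (Sp.toEnd x⁻¹ - 1 + ξ) * γ.Y +
        (Sp.toEnd x⁻¹ - 1) * γ.Y * (Sp.toEnd x - 1) := by
    rw [Ring.lie_def]; noncomm_ring
  rw [e]
  exact (((hY.mul h1).mono (by norm_num)).add ((h2.mul hY).mono (by norm_num))).add
    ((((raisesZ_of_mem (inv_mem hx)).mul hY).mul (raisesZ_of_mem hx)).mono (by norm_num))

omit hγ [FiniteDimensional K V] in
theorem exists_scalar {ψ : AddChar K ℂ} (hψ : ψ ≠ 1) {b : K} (hb : b ≠ 0) :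
    ∃ t : K, ψ (t * b) ≠ 1 := by
  obtain ⟨a, ha⟩ := AddChar.ne_one_iff.1 hψ
  exact ⟨a / b, by rwa [div_mul_cancel₀ _ hb]⟩

/-- The commutator pairing of `G_{≥ 1}` against Siegel transvections of weight one. -/
theorem exists_commutator_ne_one {ψ : AddChar K ℂ} (hψ : ψ ≠ 1) {x : Sp B}
    (hx : x ∈ γ.unip 1) {i : ℤ} {e v : V} (he : e ∈ γ.fil i) (hv : v ∈ γ.fil (1 - i))
    (hev : B e v = 0) (hb : B v (⁅γ.Y, γ.gr1 (Sp.toEnd x - 1)⁆ e) ≠ 0) :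
    ∃ (t : K) (h : B e (t • v) = 0), siegel hγ.alt e (t • v) h ∈ γ.unip 1 ∧
      x * siegel hγ.alt e (t • v) h * x⁻¹ * (siegel hγ.alt e (t • v) h)⁻¹ ∈ γ.unip 2 ∧
      psiLin ψ γ.Y (x * siegel hγ.alt e (t • v) h * x⁻¹ * (siegel hγ.alt e (t • v) h)⁻¹) ≠ 1 := by
  have h2 : (2 : K) ≠ 0 := by
    have hc := hγ.char
    have : finrank K V ≠ 0 := by
      intro h0
      have := finrank_zero_iff.1 h0
      exact hb (by rw [Subsingleton.elim v 0]; simp)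
    exact_mod_cast natCast_ne (K := K) (m := 2) (by norm_num) (by omega)
  obtain ⟨t, ht⟩ := exists_scalar hψ (mul_ne_zero h2 hb)
  have hev : B e (t • v) = 0 := by rw [map_smul, hev, smul_zero]
  have hs : siegel hγ.alt e (t • v) hev ∈ γ.unip 1 :=
    hγ.siegel_mem_unip (i := i) (j := 1 - i) (by push_cast; omega) he
      (Submodule.smul_mem _ _ hv) hev
  refine ⟨t, hev, hs, commutator_mem (by norm_num) hx hs, ?_⟩
  rw [hγ.psiLin_commutator_siegel ψ hx hev hs]
  -- The remainder sends `e` into `fil i`, which is orthogonal to `v` in `fil (1 - i)`; only the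
  -- term `[Y, ξ]` survives.
  have h3 := hγ.raisesZ_conj_Y hx i e he
  have h4 : B v ((Sp.toEnd x⁻¹ * γ.Y * Sp.toEnd x - γ.Y - ⁅γ.Y, γ.gr1 (Sp.toEnd x - 1)⁆) e) = 0 :=
    hγ.form_fil_fil (by omega) hv h3
  simp only [LinearMap.sub_apply, Module.End.mul_apply, map_sub] at h4
  convert ht using 2
  simp only [map_smul, LinearMap.smul_apply, smul_eq_mul]
  linear_combination 2 * t * h4

/-- Outside `G_{≥ 2}` the degree one part `ξ` is nonzero, and then so is `[Y, ξ]`, because `ad(Y)`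
is injective in degree one. A weight vector `e` of weight `j` not killed by it and a dual vector of
weight `1 - j` give the transvection. -/
theorem exists_nondeg {ψ : AddChar K ℂ} (hψ : ψ ≠ 1) {x : Sp B} (hx : x ∈ γ.unip 1)
    (hx2 : x ∉ γ.unip 2) : ∃ y ∈ γ.unip 1, x * y * x⁻¹ * y⁻¹ ∈ γ.unip 2 ∧
      psiLin ψ γ.Y (x * y * x⁻¹ * y⁻¹) ≠ 1 := by
  set ξ := γ.gr1 (Sp.toEnd x - 1) with hξ
  have h1 : ξ ≠ 0 := fun h => hx2 ((hγ.raisesZ_two_iff (raisesZ_of_mem hx)).2 h)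
  have h2 : ⁅γ.Y, ξ⁆ ≠ 0 := fun h => h1 (hγ.eq_zero_of_commute (fun j v hv => hγ.gr1_mem hv) h)
  obtain ⟨j, e, he, hne⟩ : ∃ j, ∃ e ∈ γ.weightSpace j, ⁅γ.Y, ξ⁆ e ≠ 0 := by
    by_contra! h
    exact h2 (hγ.ext fun j v hv => by simpa using h j v hv)
  have hmem : ⁅γ.Y, ξ⁆ e ∈ γ.weightSpace (j - 1) := by
    rw [Ring.lie_def, LinearMap.sub_apply, Module.End.mul_apply, Module.End.mul_apply]
    refine sub_mem ?_ ?_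
    · have := hγ.Y_mem (hγ.gr1_mem (T := Sp.toEnd x - 1) he)
      rwa [show j + 1 - 2 = j - 1 by ring] at this
    · have := hγ.gr1_mem (T := Sp.toEnd x - 1) (hγ.Y_mem he)
      rwa [show j - 2 + 1 = j - 1 by ring] at this
  obtain ⟨v, hv⟩ : ∃ v, B v (⁅γ.Y, ξ⁆ e) ≠ 0 := by
    by_contra! h
    exact hne (hγ.nondeg.2 _ h)
  have hv' : B (γ.proj (1 - j) v) (⁅γ.Y, ξ⁆ e) ≠ 0 := by
    rwa [hγ.form_proj, hγ.proj_apply_of_mem hmem, if_pos (by ring)]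
  obtain ⟨t, h, h3, h4, h5⟩ := hγ.exists_commutator_ne_one hψ hx
    (Triple.weightSpace_le_fil le_rfl he) (Triple.weightSpace_le_fil le_rfl (hγ.proj_mem _ v))
    (hγ.form_eq_zero (by omega) he (hγ.proj_mem _ v)) hv'
  exact ⟨_, h3, h4, h5⟩

/-- `ψ(κ(Y, log u))` is a nondegenerate central character of `G_{≥ 1}` modulo its kernel. -/
theorem isHeis {ψ : AddChar K ℂ} (hψ : ψ ≠ 1) :
    IsHeis ((γ.unip 2).subgroupOf (γ.unip 1)) (fun u : γ.unip 1 => psiLin ψ γ.Y (u : Sp B)) where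
  isChar := ⟨(hγ.isCharOn_psiLin_unip ψ).one, fun g hg h hh =>
    (hγ.isCharOn_psiLin_unip ψ).mul g hg h hh⟩
  nondeg x hx := by
    obtain ⟨y, hy, h1, h2⟩ := hγ.exists_nondeg hψ x.2 hx
    exact ⟨⟨y, hy⟩, h1, h2⟩

/-- Commutators of `G_{≥ 1}` with `G_{≥ 2}` lie in `G_{≥ 3}`, where the character is trivial by
degree. -/
theorem conj_unip_two (ψ : AddChar K ℂ) {g z : Sp B} (hg : g ∈ γ.unip 1) (hz : z ∈ γ.unip 2) :
    g * z * g⁻¹ ∈ γ.unip 2 ∧ psiLin ψ γ.Y (g * z * g⁻¹) = psiLin ψ γ.Y z := by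
  have h1 : g * z * g⁻¹ * z⁻¹ ∈ γ.unip 3 := commutator_mem (by norm_num) hg hz
  have h2 := unip_anti (show 2 ≤ 3 by norm_num) h1
  have e : g * z * g⁻¹ = (g * z * g⁻¹ * z⁻¹) * z := by group
  refine ⟨by rw [e]; exact mul_mem h2 hz, ?_⟩
  rw [e, (hγ.isCharOn_psiLin_unip ψ).mul _ h2 _ hz]
  have : psiLin ψ γ.Y (g * z * g⁻¹ * z⁻¹) = 1 := by
    rw [psiLin, hγ.trace_eq_zero (k := 1) (by norm_num)
      ((hγ.raisesZ_Y.mul (raisesZ_of_mem h1)).mono (by norm_num)), AddChar.map_zero_eq_one]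
  rw [this, one_mul]

end Triple.Full

end Nondegeneracy

end
end SpFourier

namespace SpFourier
noncomputable section

/-! ### Frames: a string next to a filtered space, and the group `S` -/

section FrameSection

variable {K : Type*} [Field K] {V : Type*} [AddCommGroup V] [Module K V]

/-- The subgroup of `Sp(V, B)` of the elements `g` for which `g - 1` maps `F i` to `F' i`. -/
def flagGroup [FiniteDimensional K V] (B : LinearMap.BilinForm K V) {ι : Type*}
    (F F' : ι → Submodule K V) (h : ∀ i, F' i ≤ F i) : Subgroup (Sp B) where
  carrier := {g | ∀ i, ∀ v ∈ F i, (Sp.toEnd g - 1) v ∈ F' i}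
  one_mem' := fun i v _ => by simp [Sp.toEnd_one]
  mul_mem' := fun {g k} hg hk i v hv => by
    rw [Sp.sub_one_mul]
    exact add_mem (add_mem (hg i v hv) (hk i v hv)) (hg i _ (h i (hk i v hv)))
  inv_mem' := fun {g} hg i v hv => by
    have hle : (F i).map (Sp.toEnd g) ≤ F i := by
      rintro _ ⟨w, hw, rfl⟩
      have : Sp.toEnd g w = (Sp.toEnd g - 1) w + w := by simp
      rw [this]
      exact add_mem (h i (hg i w hw)) hw
    have heq : (F i).map (Sp.toEnd g) = F i :=
      Submodule.eq_of_le_of_finrank_eq hle (LinearEquiv.finrank_map_eq (g : V ≃ₗ[K] V) _)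
    rw [← heq] at hv
    obtain ⟨w, hw, rfl⟩ := hv
    have e : (Sp.toEnd g⁻¹ - 1) (Sp.toEnd g w) = -((Sp.toEnd g - 1) w) := by
      simp [Sp.inv_apply_apply]
    rw [e]
    exact neg_mem (hg i w hw)

/-- An orthogonal decomposition of `V` into a space `V0` with a self-dual filtration `F0`,
containing a Lagrangian subspace `L0`, and the span of a string of vectors `x 0, …, x N`, where
`x k` is thought of as having weight `2 k - N`. The endomorphism `Y` lowers weights by two. -/
structure Frame (B : LinearMap.BilinForm K V) (Y : Module.End K V) (N : ℕ) where
  V0 : Submodule K V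
  pr0 : Module.End K V
  x : ℕ → V
  lam : ℕ → K
  F0 : ℤ → Submodule K V
  L0 : Submodule K V
  alt : B.IsAlt
  skewY : Y ∈ skewAdjointLieSubalgebra B
  odd : Odd N
  pr0_mem : ∀ v, pr0 v ∈ V0
  pr0_of_mem : ∀ v ∈ V0, pr0 v = v
  pr0_x : ∀ k, pr0 (x k) = 0
  sub_pr0_mem : ∀ v, v - pr0 v ∈ Submodule.span K (x '' {k | k ≤ N})
  orth : ∀ v ∈ V0, ∀ k, B v (x k) = 0
  form_x_zero : ∀ j k, j + k ≠ N → B (x j) (x k) = 0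
  form_x_ne : ∀ j k, j + k = N → B (x j) (x k) ≠ 0
  Y_x_zero : Y (x 0) = 0
  Y_x_succ : ∀ k < N, Y (x (k + 1)) = lam k • x k
  lam_ne : ∀ k < N, lam k ≠ 0
  F0_le : ∀ b, F0 b ≤ V0
  F0_anti : ∀ b b', b ≤ b' → F0 b' ≤ F0 b
  F0_top : ∀ b : ℤ, b ≤ -N → F0 b = V0
  F0_bot : ∀ b : ℤ, N < b → F0 b = ⊥
  F0_orth : ∀ b b', 1 ≤ b + b' → ∀ v ∈ F0 b, ∀ w ∈ F0 b', B v w = 0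
  F0_mem : ∀ b, ∀ v ∈ V0, (∀ w ∈ F0 b, B w v = 0) → v ∈ F0 (1 - b)
  Y_F0 : ∀ b, ∀ v ∈ F0 b, Y v ∈ F0 (b - 2)
  L0_le : L0 ≤ F0 0
  le_L0 : F0 1 ≤ L0
  L0_orth : ∀ v ∈ L0, ∀ w ∈ L0, B v w = 0
  L0_mem : ∀ v ∈ V0, (∀ w ∈ L0, B w v = 0) → v ∈ L0

namespace Frame

variable {B : LinearMap.BilinForm K V} {Y : Module.End K V} {N : ℕ} (f : Frame B Y N)

/-- The sum of a subspace `A` of `V0` and the span of the `x k` of weight at least `c`. -/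
def P (A : Submodule K V) (c : ℤ) : Submodule K V where
  carrier := {v | f.pr0 v ∈ A ∧ ∀ k ≤ N, -c < 2 * (k : ℤ) - N → B v (f.x k) = 0}
  zero_mem' := ⟨by simp, by simp⟩
  add_mem' := fun {v w} hv hw => ⟨by rw [map_add]; exact add_mem hv.1 hw.1, fun k hk h => by
    rw [map_add, LinearMap.add_apply, hv.2 k hk h, hw.2 k hk h, add_zero]⟩
  smul_mem' := fun r v hv => ⟨by rw [map_smul]; exact Submodule.smul_mem _ _ hv.1, fun k hk h => by
    rw [map_smul, LinearMap.smul_apply, hv.2 k hk h, smul_zero]⟩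

variable {f}

theorem mem_P {A : Submodule K V} {c : ℤ} {v : V} :
    v ∈ f.P A c ↔ f.pr0 v ∈ A ∧ ∀ k ≤ N, -c < 2 * (k : ℤ) - N → B v (f.x k) = 0 := Iff.rfl

theorem P_mono {A A' : Submodule K V} {c c' : ℤ} (hA : A ≤ A') (hc : c' ≤ c) :
    f.P A c ≤ f.P A' c' := fun _ hv => ⟨hA hv.1, fun k hk h => hv.2 k hk (by omega)⟩

/-- All weights of the string are odd, so an even bound may be raised by one. This half-step recurs
in the arguments about `S`. -/
theorem P_parity {A : Submodule K V} {c : ℤ} (hc : Even c) : f.P A c ≤ f.P A (c + 1) :=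
  fun v hv => ⟨hv.1, fun k hk h => hv.2 k hk (by
    obtain ⟨a, ha⟩ := f.odd
    obtain ⟨b, hb⟩ := hc
    omega)⟩

theorem mem_P_of_mem {A : Submodule K V} (hA : A ≤ f.V0) {v : V} (hv : v ∈ A) (c : ℤ) :
    v ∈ f.P A c :=
  ⟨by rwa [f.pr0_of_mem v (hA hv)], fun k _ _ => f.orth v (hA hv) k⟩

theorem x_mem_P (A : Submodule K V) {c : ℤ} {k : ℕ} (hk : c ≤ 2 * (k : ℤ) - N) :
    f.x k ∈ f.P A c :=
  ⟨by rw [f.pr0_x]; exact zero_mem _, fun j _ h => f.form_x_zero k j (by omega)⟩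

/-- The coefficient of `x k` is detected by pairing with `x (N - k)`, so the orthogonality
conditions defining `P A c` leave only string vectors of weight at least `c`. Inclusions from `P A
c` can then be checked on `A` and on these vectors. -/
theorem P_le {A M : Submodule K V} {c : ℤ} (hA : A ≤ M)
    (hx : ∀ k ≤ N, c ≤ 2 * (k : ℤ) - N → f.x k ∈ M) : f.P A c ≤ M := by
  intro v hv
  have h1 : v - f.pr0 v ∈ Submodule.span K (f.x '' {k | k ≤ N}) := f.sub_pr0_mem v
  have h2 : ∀ k ≤ N, -c < 2 * (k : ℤ) - N → B (v - f.pr0 v) (f.x k) = 0 := fun k hk h => by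
    rw [map_sub, LinearMap.sub_apply, hv.2 k hk h, f.orth _ (f.pr0_mem v), sub_zero]
  have h3 : v - f.pr0 v ∈ M := by
    have hfin : (f.x '' {k | k ≤ N}) = f.x '' ((Finset.range (N + 1) : Finset ℕ) : Set ℕ) := by
      congr 1; ext k; simp
    rw [hfin, Submodule.mem_span_image_finset_iff_exists_fun] at h1
    obtain ⟨a, ha⟩ := h1
    rw [← ha] at h2 ⊢
    refine sum_mem fun k _ => ?_
    have hk : (k : ℕ) < N + 1 := Finset.mem_range.1 k.2
    by_cases hc : c ≤ 2 * ((k : ℕ) : ℤ) - N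
    · exact Submodule.smul_mem _ _ (hx k (by omega) hc)
    · have h4 := h2 (N - k) (by omega) (by omega)
      rw [map_sum, LinearMap.sum_apply, Finset.sum_eq_single k] at h4
      · rw [map_smul, LinearMap.smul_apply, smul_eq_mul, mul_eq_zero] at h4
        rw [h4.resolve_right (f.form_x_ne k (N - k) (by omega)), zero_smul]
        exact zero_mem _
      · intro j _ hjk
        have : (j : ℕ) ≠ k := fun h => hjk (Subtype.ext h)
        rw [map_smul, LinearMap.smul_apply, f.form_x_zero j (N - k) (by omega), smul_zero]
      · intro h; exact absurd (Finset.mem_univ k) h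
  have : v = f.pr0 v + (v - f.pr0 v) := by abel
  rw [this]
  exact add_mem (hA hv.1) h3

theorem mem_bot_P_orth {c : ℤ} {v w : V} (hv : v ∈ f.P ⊥ c) (hw : w ∈ f.V0) : B v w = 0 := by
  have h : f.P ⊥ c ≤ LinearMap.ker (B.flip w) := P_le (by simp) fun k _ _ => by
    change B (f.x k) w = 0
    rw [form_swap f.alt, f.orth w hw, neg_zero]
  exact h hv

/-- The pairing of two of the subspaces `P A c`. -/
theorem form_P {A A' : Submodule K V} {c c' : ℤ} (hc : 0 < c + c')
    (hA : A ≤ f.V0) (hA' : A' ≤ f.V0) (h : ∀ a ∈ A, ∀ a' ∈ A', B a a' = 0) {v w : V}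
    (hv : v ∈ f.P A c) (hw : w ∈ f.P A' c') : B v w = 0 := by
  have h2 : f.P A' c' ≤ LinearMap.ker (B v) := by
    refine P_le (fun a' ha' => ?_) fun k hk hk' => hv.2 k hk (by omega)
    have h3 : f.P A c ≤ LinearMap.ker (B.flip a') := P_le (fun a ha => h a ha a' ha')
      fun k _ _ => by
        change B (f.x k) a' = 0
        rw [form_swap f.alt, f.orth a' (hA' ha'), neg_zero]
    exact h3 hv
  exact h2 hw

theorem form_bot_P {A : Submodule K V} (hA : A ≤ f.V0) {c c' : ℤ} (hc : 0 < c + c')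
    {v w : V} (hv : v ∈ f.P ⊥ c) (hw : w ∈ f.P A c') : B v w = 0 :=
  form_P hc bot_le hA (fun a ha a' _ => by rw [(Submodule.mem_bot K).1 ha]; simp) hv hw

theorem P_V0_eq_top {c : ℤ} (hc : c ≤ -N) : f.P f.V0 c = ⊤ := by
  rw [eq_top_iff]
  intro v _
  exact ⟨f.pr0_mem v, fun k hk h => by omega⟩

theorem P_bot_eq_bot {c : ℤ} (hc : N < c) : f.P ⊥ c = ⊥ := by
  rw [eq_bot_iff]
  exact P_le le_rfl fun k hk h => by omega

theorem Y_mem_P {A A' : Submodule K V} (hA' : A' ≤ f.V0)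
    (h : ∀ a ∈ A, Y a ∈ A') {c : ℤ} {v : V}
    (hv : v ∈ f.P A c) : Y v ∈ f.P A' (c - 2) := by
  have : f.P A c ≤ (f.P A' (c - 2)).comap Y := by
    refine P_le (fun a ha => mem_P_of_mem hA' (h a ha) _) fun k hk hk' => ?_
    rw [Submodule.mem_comap]
    cases k with
    | zero => rw [f.Y_x_zero]; exact zero_mem _
    | succ k =>
      rw [f.Y_x_succ k (by omega)]
      exact Submodule.smul_mem _ _ (x_mem_P _ (by push_cast at hk'; omega))
  exact this hv

theorem Y_mem_P_F0 {b c : ℤ} {v : V} (hv : v ∈ f.P (f.F0 b) c) :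
    Y v ∈ f.P (f.F0 (b - 2)) (c - 2) :=
  Y_mem_P (f.F0_le _) (f.Y_F0 b) hv

theorem Y_mem_P_bot {c : ℤ} {v : V} (hv : v ∈ f.P ⊥ c) : Y v ∈ f.P ⊥ (c - 2) :=
  Y_mem_P bot_le (fun a ha => by rw [(Submodule.mem_bot K).1 ha]; simp) hv

theorem F0_nondeg {v : V} (hv : v ∈ f.V0) (h : ∀ w ∈ f.V0, B w v = 0) : v = 0 := by
  have := f.F0_mem (-N) v hv (fun w hw => h w (f.F0_le _ hw))
  rwa [f.F0_bot _ (by omega), Submodule.mem_bot] at this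

theorem form_pr0 {v w : V} (hw : w ∈ f.V0) : B w (f.pr0 v) = B w v := by
  have h : Submodule.span K (f.x '' {k | k ≤ N}) ≤ LinearMap.ker (B w) := by
    rw [Submodule.span_le]
    rintro _ ⟨k, _, rfl⟩
    exact f.orth w hw k
  have := h (f.sub_pr0_mem v)
  rw [LinearMap.mem_ker, map_sub, sub_eq_zero] at this
  exact this.symm

variable [FiniteDimensional K V]

variable (f)

/-- The subgroup generated by the groups of the iterated coefficient. -/
def S : Subgroup (Sp B) :=
  (flagGroup B (fun c : {c : ℤ // 1 ≤ c} => f.P ⊥ c) (fun c => f.P ⊥ (c + 2))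
      fun _ => P_mono le_rfl (by omega)) ⊓
    (flagGroup B (fun b : ℤ => f.P (f.F0 b) 1) (fun b => f.P (f.F0 (b + 2)) 1)
      fun _ => P_mono (f.F0_anti _ _ (by omega)) le_rfl) ⊓
    (flagGroup B (fun _ : Unit => f.P f.L0 (-1)) (fun _ => f.P f.L0 1)
      fun _ => P_mono le_rfl (by omega)) ⊓
    (flagGroup B (fun c : {c : ℤ // c ≤ -1} => f.P f.V0 c) (fun c => f.P f.V0 (c + 2))
      fun _ => P_mono le_rfl (by omega))

variable {f}

/-- `T` maps the subspaces defining `S` to each other. -/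
structure SMap (f : Frame B Y N) (T : Module.End K V) : Prop where
  bot : ∀ c : ℤ, 1 ≤ c → ∀ v ∈ f.P ⊥ c, T v ∈ f.P ⊥ (c + 2)
  mid : ∀ b : ℤ, ∀ v ∈ f.P (f.F0 b) 1, T v ∈ f.P (f.F0 (b + 2)) 1
  lag : ∀ v ∈ f.P f.L0 (-1), T v ∈ f.P f.L0 1
  top : ∀ c : ℤ, c ≤ -1 → ∀ v ∈ f.P f.V0 c, T v ∈ f.P f.V0 (c + 2)

/-- Meaning of the four flags: string vectors of positive weight move up by two inside the string;
`V0` moves up by two in its own filtration, modulo the positive string; the vector of weight `-1`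
acquires a `V0`-component only in `L0`; and vectors of weight at most `-1` move up by two modulo
`V0`. -/
theorem mem_S {g : Sp B} : g ∈ f.S ↔ f.SMap (Sp.toEnd g - 1) :=
  ⟨fun h => ⟨fun c hc => h.1.1.1 ⟨c, hc⟩, h.1.1.2, h.1.2 (), fun c hc => h.2 ⟨c, hc⟩⟩,
    fun h => ⟨⟨⟨fun c => h.bot c c.2, h.mid⟩, fun _ => h.lag⟩, fun c => h.top c c.2⟩⟩

omit [FiniteDimensional K V] in
/-- It suffices to check `SMap` on generators. -/
theorem SMap.of_generators {T : Module.End K V}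
    (h1 : ∀ k ≤ N, 1 ≤ 2 * (k : ℤ) - N → T (f.x k) ∈ f.P ⊥ (2 * k - N + 2))
    (h2 : ∀ b, ∀ v ∈ f.F0 b, T v ∈ f.P (f.F0 (b + 2)) 1)
    (h3 : ∀ k ≤ N, 2 * (k : ℤ) - N = -1 → T (f.x k) ∈ f.P f.L0 1)
    (h4 : ∀ k ≤ N, 2 * (k : ℤ) - N ≤ -1 → T (f.x k) ∈ f.P f.V0 (2 * k - N + 2)) : f.SMap T := by
  obtain ⟨a, ha⟩ := f.odd
  have hV : ∀ v ∈ f.V0, T v ∈ f.P f.V0 1 := fun v hv => by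
    rw [← f.F0_top _ le_rfl] at hv
    exact P_mono (f.F0_le _) le_rfl (h2 _ v hv)
  have hL : ∀ v ∈ f.L0, T v ∈ f.P f.L0 1 := fun v hv =>
    P_mono ((f.F0_anti _ _ (by omega)).trans f.le_L0) le_rfl (h2 0 v (f.L0_le hv))
  refine ⟨fun c hc => ?_, fun b => ?_, ?_, fun c hc => ?_⟩
  · exact P_le (M := (f.P ⊥ (c + 2)).comap T) (by simp) fun k hk hk' =>
      P_mono le_rfl (by omega) (h1 k hk (by omega))
  · exact P_le (M := (f.P (f.F0 (b + 2)) 1).comap T) (h2 b) fun k hk hk' =>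
      P_mono bot_le (by omega) (h1 k hk (by omega))
  · refine P_le (M := (f.P f.L0 1).comap T) hL fun k hk hk' => ?_
    by_cases h : 1 ≤ 2 * (k : ℤ) - N
    · exact P_mono bot_le (by omega) (h1 k hk h)
    · exact h3 k hk (by omega)
  · refine P_le (M := (f.P f.V0 (c + 2)).comap T)
      (fun v hv => P_mono le_rfl (by omega) (hV v hv)) fun k hk hk' => ?_
    by_cases h : 1 ≤ 2 * (k : ℤ) - N
    · exact P_mono bot_le (by omega) (h1 k hk h)
    · exact P_mono le_rfl (by omega) (h4 k hk (by omega))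

omit [FiniteDimensional K V] in
theorem V0_mem_P {v : V} (hv : v ∈ f.V0) (c : ℤ) : v ∈ f.P f.V0 c := mem_P_of_mem le_rfl hv c

/-- For `e` of weight at least three the whole of `V0` is allowed in `v`, because the first string
vector pairing with `e` has weight at most `-3`, where `S` puts no condition on the `V0`-component.
-/
theorem siegel_mem_S {m : ℤ} (hm : 3 ≤ m) {e v : V} (he : e ∈ f.P ⊥ m) (hv : v ∈ f.P f.V0 (2 - m))
    (hev : B e v = 0) : siegel f.alt e v hev ∈ f.S := by
  rw [mem_S, siegel_sub_one]
  have h0 : ∀ {A : Submodule K V} {c : ℤ} {y : V}, A ≤ f.V0 → 0 < m + c → y ∈ f.P A c → B e y = 0 :=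
    fun hA hc hy => form_bot_P hA hc he hy
  refine ⟨fun c hc y hy => ?_, fun b y hy => ?_, fun y hy => ?_, fun c hc y hy => ?_⟩
  · rw [symm2_apply, h0 bot_le (by omega) hy, zero_smul, zero_add]
    by_cases h : 0 < c + (2 - m)
    · rw [form_swap f.alt, form_bot_P le_rfl h hy hv, neg_zero, zero_smul]; exact zero_mem _
    · exact Submodule.smul_mem _ _ (P_mono le_rfl (by omega) he)
  · rw [symm2_apply, h0 (f.F0_le b) (by omega) hy, zero_smul, zero_add]
    exact Submodule.smul_mem _ _ (P_mono bot_le (by omega) he)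
  · rw [symm2_apply, h0 (f.L0_le.trans (f.F0_le 0)) (by omega) hy, zero_smul, zero_add]
    exact Submodule.smul_mem _ _ (P_mono bot_le (by omega) he)
  · rw [symm2_apply]
    refine add_mem ?_ (Submodule.smul_mem _ _ (P_mono bot_le (by omega) he))
    by_cases h : 0 < m + c
    · rw [h0 le_rfl h hy, zero_smul]; exact zero_mem _
    · exact Submodule.smul_mem _ _ (P_mono le_rfl (by omega) hv)

/-- At weight one `e` pairs with the vector of weight `-1`, so the `V0`-component must lie in the
Lagrangian. -/
theorem siegel_mem_S_of_lag {e v : V} (he : e ∈ f.P ⊥ 1) (hv : v ∈ f.L0)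
    (hev : B e v = 0) : siegel f.alt e v hev ∈ f.S := by
  rw [mem_S, siegel_sub_one]
  have hv0 := f.F0_le 0 (f.L0_le hv)
  have h0 : ∀ {A : Submodule K V} {c : ℤ} {y : V}, A ≤ f.V0 → 0 < 1 + c → y ∈ f.P A c → B e y = 0 :=
    fun hA hc hy => form_bot_P hA hc he hy
  refine ⟨fun c hc y hy => ?_, fun b y hy => ?_, fun y hy => ?_, fun c hc y hy => ?_⟩
  · rw [symm2_apply, h0 bot_le (by omega) hy, zero_smul, zero_add, form_swap f.alt,
      mem_bot_P_orth hy hv0, neg_zero, zero_smul]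
    exact zero_mem _
  · rw [symm2_apply, h0 (f.F0_le b) (by omega) hy, zero_smul, zero_add]
    exact Submodule.smul_mem _ _ (P_mono bot_le (by omega) he)
  · rw [symm2_apply]
    refine add_mem (Submodule.smul_mem _ _ (mem_P_of_mem (f.L0_le.trans (f.F0_le 0)) hv _)) ?_
    exact Submodule.smul_mem _ _ (P_mono bot_le (by omega) he)
  · rw [symm2_apply]
    exact add_mem (Submodule.smul_mem _ _ (V0_mem_P hv0 _))
      (Submodule.smul_mem _ _ (P_mono bot_le (by omega) he))

omit [FiniteDimensional K V] in
theorem conj_siegel (hB : B.IsAlt) (e v : V) (h : B e v = 0) (g : Sp B) :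
    ∃ h', g * siegel hB e v h * g⁻¹ = siegel hB (Sp.toEnd g e) (Sp.toEnd g v) h' := by
  have h' : B (Sp.toEnd g e) (Sp.toEnd g v) = 0 := by rw [Sp.form_apply, h]
  refine ⟨h', Sp.toEnd_injective ?_⟩
  have := conj_siegel_sub_one hB e v h g
  rw [← siegel_sub_one hB _ _ h'] at this
  exact sub_left_injective this

end Frame

end FrameSection

end
end SpFourier

namespace SpFourier
noncomputable section

/-! ### Nilpotence from chains of subspaces -/

section Reach

variable {K : Type*} [Field K] {V : Type*} [AddCommGroup V] [Module K V]

/-- A power of `T` maps `A` into `A'`. -/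
def Reach (T : Module.End K V) (A A' : Submodule K V) : Prop := ∃ n : ℕ, ∀ v ∈ A, (T ^ n) v ∈ A'

theorem Reach.trans {T : Module.End K V} {A A' A'' : Submodule K V} (h : Reach T A A')
    (h' : Reach T A' A'') : Reach T A A'' := by
  obtain ⟨n, hn⟩ := h
  obtain ⟨m, hm⟩ := h'
  refine ⟨m + n, fun v hv => ?_⟩
  rw [pow_add, Module.End.mul_apply]
  exact hm _ (hn v hv)

theorem Reach.of_le {T : Module.End K V} {A A' : Submodule K V} (h : A ≤ A') : Reach T A A' :=
  ⟨0, fun v hv => by simpa using h hv⟩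

theorem Reach.single {T : Module.End K V} {A A' : Submodule K V} (h : ∀ v ∈ A, T v ∈ A') :
    Reach T A A' := ⟨1, fun v hv => by simpa using h v hv⟩

theorem Reach.chain {T : Module.End K V} (M : ℤ → Submodule K V) (a : ℤ) (n : ℕ)
    (h : ∀ c, a ≤ c → c < a + n → ∀ v ∈ M c, T v ∈ M (c + 1)) : Reach T (M a) (M (a + n)) := by
  induction n with
  | zero => exact Reach.of_le (by simp)
  | succ n ih =>
    refine (ih fun c h1 h2 => h c h1 (by push_cast; omega)).trans (Reach.single fun v hv => ?_)
    have := h _ (by omega) (by push_cast; omega) v hv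
    rwa [add_assoc] at this

theorem Reach.trace_eq_zero {T : Module.End K V} (h : Reach T ⊤ ⊥) :
    LinearMap.trace K V T = 0 := by
  obtain ⟨n, hn⟩ := h
  have : T ^ n = 0 := LinearMap.ext fun v => (Submodule.mem_bot K).1 (hn v Submodule.mem_top)
  exact (LinearMap.isNilpotent_trace_of_isNilpotent ⟨_, this⟩).eq_zero

end Reach

/-! ### The character of `S` and its exchange against `G_{≥ 2}` -/

section FrameExchange

variable {K : Type*} [Field K] {V : Type*} [AddCommGroup V] [Module K V]

namespace Frame

variable {B : LinearMap.BilinForm K V} {Y : Module.End K V} {N : ℕ} {f : Frame B Y N}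

/-- The hypotheses push `V` down a chain to zero: first along the negative string with all of `V0`,
then along `F0` down to step zero with the string from `-1` on, then across from weight `-1` to `1`,
then along the rest of `F0`, then out of the positive string. -/
theorem trace_eq_zero_of_chain {T : Module.End K V}
    (h1 : ∀ c ≤ -3, ∀ v ∈ f.P f.V0 c, T v ∈ f.P f.V0 (c + 1))
    (h2 : ∀ b < 0, ∀ v ∈ f.P (f.F0 b) (-1), T v ∈ f.P (f.F0 (b + 1)) (-1))
    (h3 : ∀ v ∈ f.P (f.F0 0) (-1), T v ∈ f.P (f.F0 0) 1)
    (h4 : ∀ b, 0 ≤ b → ∀ v ∈ f.P (f.F0 b) 1, T v ∈ f.P (f.F0 (b + 1)) 1)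
    (h5 : ∀ c, 1 ≤ c → ∀ v ∈ f.P ⊥ c, T v ∈ f.P ⊥ (c + 1)) :
    LinearMap.trace K V T = 0 := by
  apply Reach.trace_eq_zero
  have r1 := Reach.chain (T := T) (fun c => f.P f.V0 c) (-N - 2) N fun c _ hc =>
    h1 c (by omega)
  have r2 := Reach.chain (T := T) (fun b => f.P (f.F0 b) (-1)) (-N) N fun b _ hb => h2 b (by omega)
  have r4 := Reach.chain (T := T) (fun b => f.P (f.F0 b) 1) 0 (N + 1) fun b hb _ => h4 b hb
  have r5 := Reach.chain (T := T) (fun c => f.P ⊥ c) 1 N fun c hc _ => h5 c hc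
  beta_reduce at r1 r2 r4 r5
  rw [P_V0_eq_top (c := -N - 2) (by omega)] at r1
  rw [P_bot_eq_bot (c := 1 + N) (by omega)] at r5
  rw [f.F0_bot (0 + (N + 1 : ℕ)) (by push_cast; omega)] at r4
  rw [f.F0_top _ le_rfl] at r2
  refine r1.trans ((Reach.of_le ?_).trans (r2.trans ((Reach.of_le ?_).trans
    ((Reach.single h3).trans (r4.trans r5)))))
  · rw [show (-N - 2 + N : ℤ) = -2 by ring]
    exact P_parity (by decide)
  · rw [show (-N + N : ℤ) = 0 by ring]

variable [FiniteDimensional K V]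

/-- The values of `g - 1` on `F0 b` for `b ≥ 1` and on `L0` have no component along the vector of
weight one, for `g ∈ S`. -/
theorem S_apply_aux {g : Sp B} (hg : g ∈ f.S) {b : ℤ} {v : V} (hv : v ∈ f.F0 b)
    (h : ∀ w ∈ f.L0, B v w = 0) : (Sp.toEnd g - 1) v ∈ f.P (f.F0 (b + 2)) 2 := by
  have h1 := (mem_S.1 hg).mid b v (mem_P_of_mem (f.F0_le b) hv 1)
  refine ⟨h1.1, fun k hk hk' => ?_⟩
  by_cases h2 : -1 < 2 * (k : ℤ) - N
  · exact h1.2 k hk h2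
  -- The only new test vector has weight `-1`. Moving `g - 1` to the other side, its image under
  -- `g⁻¹ - 1` has its `V0`-component in `L0`, which is orthogonal to `v`.
  · have h3 := (mem_S.1 (inv_mem hg)).lag (f.x k) (x_mem_P _ (by omega))
    have hv0 := f.F0_le b hv
    rw [Sp.form_sub_left, ← form_pr0 hv0]
    exact h _ h3.1

theorem S_apply_F0 {g : Sp B} (hg : g ∈ f.S) {b : ℤ} (hb : 1 ≤ b) {v : V}
    (hv : v ∈ f.P (f.F0 b) 1) : (Sp.toEnd g - 1) v ∈ f.P (f.F0 (b + 2)) 2 := by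
  have : f.P (f.F0 b) 1 ≤ (f.P (f.F0 (b + 2)) 2).comap (Sp.toEnd g - 1) :=
    P_le (fun v hv => S_apply_aux hg hv fun w hw => f.F0_orth b 0 (by omega) v hv w (f.L0_le hw))
      fun k hk hk' => P_mono bot_le (by omega) ((mem_S.1 hg).bot _ hk' _ (x_mem_P ⊥ le_rfl))
  exact this hv

theorem S_apply_L0 {g : Sp B} (hg : g ∈ f.S) {v : V}
    (hv : v ∈ f.P f.L0 1) : (Sp.toEnd g - 1) v ∈ f.P (f.F0 2) 2 := by
  have : f.P f.L0 1 ≤ (f.P (f.F0 2) 2).comap (Sp.toEnd g - 1) :=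
    P_le (fun v hv => S_apply_aux hg (b := 0) (f.L0_le hv) fun w hw => f.L0_orth v hv w hw)
      fun k hk hk' => P_mono bot_le (by omega) ((mem_S.1 hg).bot _ hk' _ (x_mem_P ⊥ le_rfl))
  exact this hv

/-- Two factors raise by four where `Y` lowers by two, except at the passage between `V0` and the
middle of the string. There the isotropy of `L0` supplies the missing step, and `Y(g - 1)(h - 1)` is
nilpotent. -/
theorem trace_S {g h : Sp B} (hg : g ∈ f.S) (hh : h ∈ f.S) :
    LinearMap.trace K V (Y * ((Sp.toEnd g - 1) * (Sp.toEnd h - 1))) = 0 := by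
  have sg := mem_S.1 hg
  have sh := mem_S.1 hh
  have e : ∀ v, (Y * ((Sp.toEnd g - 1) * (Sp.toEnd h - 1))) v =
      Y ((Sp.toEnd g - 1) ((Sp.toEnd h - 1) v)) := fun v => rfl
  have hbot : ∀ c, 1 ≤ c → ∀ v ∈ f.P ⊥ c,
      (Y * ((Sp.toEnd g - 1) * (Sp.toEnd h - 1))) v ∈ f.P ⊥ (c + 2) := fun c hc v hv => by
    rw [e]
    exact P_mono le_rfl (by omega) (Y_mem_P_bot (sg.bot _ (by omega) _ (sh.bot c hc v hv)))
  have hF : ∀ b, ∀ v ∈ f.F0 b,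
      (Y * ((Sp.toEnd g - 1) * (Sp.toEnd h - 1))) v ∈ f.P (f.F0 (b + 2)) (-1) := fun b v hv => by
    rw [e]
    have := Y_mem_P_F0 (sg.mid _ _ (sh.mid b v (mem_P_of_mem (f.F0_le b) hv 1)))
    exact P_mono (f.F0_anti _ _ (by omega)) (by omega) this
  have hF' : ∀ b, 0 ≤ b → ∀ v ∈ f.F0 b,
      (Y * ((Sp.toEnd g - 1) * (Sp.toEnd h - 1))) v ∈ f.P (f.F0 (b + 2)) 1 := fun b hb v hv => by
    rw [e]
    have := Y_mem_P_F0 (S_apply_F0 hg (b := b + 2) (by omega)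
      (sh.mid b v (mem_P_of_mem (f.F0_le b) hv 1)))
    -- After `Y` the string bound is `2 - 2 = 0`, and parity turns it into `1`.
    exact P_parity (c := 0) (by decide) (P_mono (f.F0_anti _ _ (by omega)) (by omega) this)
  have hL : ∀ v ∈ f.P f.L0 (-1),
      (Y * ((Sp.toEnd g - 1) * (Sp.toEnd h - 1))) v ∈ f.P (f.F0 0) 1 := fun v hv => by
    rw [e]
    have := Y_mem_P_F0 (S_apply_L0 hg (sh.lag v hv))
    exact P_parity (c := 0) (by decide) (P_mono (f.F0_anti _ _ (by omega)) (by omega) this)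
  refine trace_eq_zero_of_chain (f := f) (fun c hc v hv => ?_) (fun b hb => ?_) ?_
    (fun b hb => ?_) fun c hc v hv => P_mono le_rfl (by omega) (hbot c hc v hv)
  · rw [e]
    exact P_mono le_rfl (by omega) (Y_mem_P le_rfl (A := f.V0) (fun a ha => by
      rw [← f.F0_top _ le_rfl] at ha
      exact f.F0_le _ (f.Y_F0 _ a ha)) (sg.top _ (by omega) _ (sh.top c (by omega) v hv)))
  · refine P_le (M := (f.P _ _).comap _) (fun v hv => ?_) fun k hk hk' => ?_
    · exact P_mono (f.F0_anti _ _ (by omega)) le_rfl (hF b v hv)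
    · exact P_mono (f.F0_anti _ _ (by omega)) (by omega) (hL _ (x_mem_P _ hk'))
  · refine P_le (M := (f.P _ _).comap _) (fun v hv => ?_) fun k hk hk' => ?_
    · exact P_mono (f.F0_anti _ _ (by omega)) le_rfl (hF' 0 le_rfl v hv)
    · exact hL _ (x_mem_P _ hk')
  · refine P_le (M := (f.P _ _).comap _) (fun v hv => ?_) fun k hk hk' => ?_
    · exact P_mono (f.F0_anti _ _ (by omega)) le_rfl (hF' b hb v hv)
    · exact P_mono bot_le (by omega) (hbot _ hk' _ (x_mem_P ⊥ le_rfl))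

theorem isCharOn_S (f : Frame B Y N) (ψ : AddChar K ℂ) : IsCharOn f.S (psiLin ψ Y) :=
  isCharOn_psiLin ψ Y _ fun _ hg _ hk => trace_S hg hk

end Frame

/-- The hypotheses of the exchange of `S` against `G_{≥ 2}`. -/
structure Compatible {B : LinearMap.BilinForm K V} {N : ℕ} (γ : Triple B)
    (f : Frame B γ.Y N) : Prop where
  full : γ.Full
  fil_eq : ∀ c, γ.fil c = f.P (f.F0 c) c

namespace Compatible

open _root_.SpFourier.Frame Triple.Full

variable {B : LinearMap.BilinForm K V} {N : ℕ} {γ : Triple B} {f : Frame B γ.Y N}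
  (hf : Compatible γ f) [FiniteDimensional K V]
include hf

omit [FiniteDimensional K V] in
theorem F0_le_fil (c : ℤ) : f.F0 c ≤ γ.fil c := fun v hv => by
  rw [hf.fil_eq]; exact mem_P_of_mem (f.F0_le c) hv c

omit [FiniteDimensional K V] in
theorem x_mem_fil {c : ℤ} {k : ℕ} (hk : c ≤ 2 * (k : ℤ) - N) : f.x k ∈ γ.fil c := by
  rw [hf.fil_eq]; exact x_mem_P _ hk

omit [FiniteDimensional K V] in
theorem two_ne_zero : (2 : K) ≠ 0 := by
  have hc := hf.full.char
  by_cases h0 : finrank K V = 0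
  · exfalso
    have h1 := hf.full.form_fil_fil (i := 1) (j := 1) (by norm_num) (v := f.x N) (w := f.x 0)
    have h2 := f.form_x_ne N 0 (by omega)
    by_cases hfd : FiniteDimensional K V
    · have := finrank_zero_iff.1 h0
      exact h2 (by rw [Subsingleton.elim (f.x N) 0]; simp)
    -- When `finrank` has its default value zero, the weight bounds make `fil 0` both everything and
    -- zero, contradicting `B (x N) (x 0) ≠ 0`.
    · have h3 : γ.fil 0 = ⊤ := by rw [hf.full.fil_eq_top (by omega)]
      have h4 : γ.fil 0 = ⊥ := Triple.fil_eq_bot (by omega)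
      have : f.x N ∈ (⊥ : Submodule K V) := by rw [← h4, h3]; exact Submodule.mem_top
      rw [Submodule.mem_bot] at this
      exact h2 (by rw [this]; simp)
  · exact_mod_cast natCast_ne (K := K) (m := 2) (by norm_num) (by omega)

/-- Inside `G_{≥ 2}` the only condition of `S` that can fail is that positive string vectors stay in
the string. The condition on `V0` is dual to it through `u⁻¹`, and the Lagrangian one follows from
`F0 1 ≤ L0`. -/
theorem mem_S_of_mem_unip_two {u : Sp B} (hu : u ∈ γ.unip 2)
    (h : ∀ k ≤ N, 1 ≤ 2 * (k : ℤ) - N → f.pr0 (Sp.toEnd u (f.x k)) = 0) : u ∈ f.S := by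
  obtain ⟨a, ha⟩ := f.odd
  have hr : ∀ c, ∀ v ∈ f.P (f.F0 c) c, (Sp.toEnd u - 1) v ∈ f.P (f.F0 (c + 2)) (c + 2) := by
    intro c v hv
    rw [← hf.fil_eq] at hv ⊢
    exact hu c v hv
  let T := flagGroup B (fun c : {c : ℤ // 1 ≤ c} => f.P ⊥ c) (fun c => f.P ⊥ (c + 2))
      fun _ => P_mono le_rfl (by omega)
  have hT : u ∈ T := by
    rintro ⟨c, hc⟩
    refine P_le (M := (f.P _ _).comap _) (by simp) fun k hk hk' => ?_
    have h1 := hr _ _ (x_mem_P _ (le_refl (2 * (k : ℤ) - N)))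
    refine ⟨?_, fun j hj hj' => h1.2 j hj (by dsimp only at hk' hj'; omega)⟩
    rw [LinearMap.sub_apply, Module.End.one_apply, map_sub, h k hk (by simp only at hk'; omega),
      f.pr0_x, sub_zero]
    exact zero_mem _
  have hT' := inv_mem hT
  rw [mem_S]
  refine SMap.of_generators (fun k hk hk' => ?_) (fun b v hv => ?_) (fun k hk hk' => ?_)
    fun k hk hk' => ?_
  · exact hT ⟨_, hk'⟩ _ (x_mem_P _ le_rfl)
  · have h1 := hr b v (mem_P_of_mem (f.F0_le b) hv b)
    refine ⟨h1.1, fun j hj hj' => ?_⟩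
    rw [Sp.form_sub_left, form_swap f.alt, mem_bot_P_orth
      (hT' ⟨2 * (j : ℤ) - N, by omega⟩ _ (x_mem_P _ le_rfl)) (f.F0_le b hv), neg_zero]
  · have h1 := hr _ _ (x_mem_P _ (le_refl (2 * (k : ℤ) - N)))
    exact P_mono ((f.F0_anti _ _ (by omega)).trans f.le_L0) (by omega) h1
  · exact P_mono (f.F0_le _) le_rfl (hr _ _ (x_mem_P _ (le_refl (2 * (k : ℤ) - N))))

/-- First half of the exchange. -/
theorem exists_S {ψ : AddChar K ℂ} (hψ : ψ ≠ 1) {u : Sp B} (hu : u ∈ γ.unip 2) (huS : u ∉ f.S) :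
    ∃ s ∈ f.S, u * s * u⁻¹ ∈ f.S ∧ psiLin ψ γ.Y (u * s * u⁻¹) ≠ psiLin ψ γ.Y s := by
  classical
  have hui := inv_mem hu
  have hr : ∀ c, ∀ v ∈ f.P (f.F0 c) c, (Sp.toEnd u⁻¹ - 1) v ∈ f.P (f.F0 (c + 2)) (c + 2) := by
    intro c v hv
    rw [← hf.fil_eq] at hv ⊢
    exact hui c v hv
  -- the last vector of the string moved out of the string
  obtain ⟨k, ⟨hkN, hk1, hk2⟩, hmax⟩ : ∃ k, (k ≤ N ∧ 1 ≤ 2 * (k : ℤ) - N ∧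
      f.pr0 (Sp.toEnd u⁻¹ (f.x k)) ≠ 0) ∧ ∀ j, k < j → j ≤ N →
      f.pr0 (Sp.toEnd u⁻¹ (f.x j)) = 0 := by
    have hne : ∃ k ≤ N, 1 ≤ 2 * (k : ℤ) - N ∧ f.pr0 (Sp.toEnd u⁻¹ (f.x k)) ≠ 0 := by
      by_contra! h
      exact huS (by simpa using inv_mem (hf.mem_S_of_mem_unip_two hui h))
    obtain ⟨k0, h0⟩ := hne
    have := Nat.findGreatest_spec (P := fun k => k ≤ N ∧ 1 ≤ 2 * (k : ℤ) - N ∧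
      f.pr0 (Sp.toEnd u⁻¹ (f.x k)) ≠ 0) h0.1 h0
    refine ⟨_, this, fun j hj hjN => ?_⟩
    by_contra hj0
    exact Nat.findGreatest_is_greatest hj hjN ⟨hjN, by omega, hj0⟩
  have hkN' : k < N := by
    refine lt_of_le_of_ne hkN fun h => hk2 ?_
    have h1 := (hr _ _ (x_mem_P _ (le_refl (2 * (k : ℤ) - N)))).1
    rw [f.F0_bot _ (by omega), Submodule.mem_bot, LinearMap.sub_apply, Module.End.one_apply,
      map_sub, f.pr0_x, sub_zero] at h1
    exact h1
  set m : ℤ := 2 * (k : ℤ) - N + 2 with hm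
  let T := flagGroup B (fun c : {c : ℤ // m ≤ c} => f.P ⊥ c) (fun c => f.P ⊥ (c + 2))
      fun _ => P_mono le_rfl (by omega)
  have hT' : u⁻¹ ∈ T := by
    rintro ⟨c, hc⟩
    refine P_le (M := (f.P _ _).comap _) (by simp) fun j hj hj' => ?_
    have h1 := hr _ _ (x_mem_P _ (le_refl (2 * (j : ℤ) - N)))
    refine ⟨?_, fun i hi hi' => h1.2 i hi (by dsimp only at hj' hi'; omega)⟩
    rw [LinearMap.sub_apply, Module.End.one_apply, map_sub,
      hmax j (by simp only at hj'; omega) hj, f.pr0_x, sub_zero]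
    exact zero_mem _
  have hT : u ∈ T := by simpa using inv_mem hT'
  have hstab : ∀ g ∈ T, ∀ c, m ≤ c → ∀ v ∈ f.P ⊥ c, Sp.toEnd g v ∈ f.P ⊥ c := by
    intro g hg c hc v hv
    have : Sp.toEnd g v = (Sp.toEnd g - 1) v + v := by simp
    rw [this]
    exact add_mem (P_mono le_rfl (by simp) (hg ⟨c, hc⟩ v hv)) hv
  have hx1 : f.x (k + 1) ∈ f.P ⊥ m := x_mem_P _ (by push_cast; omega)
  -- The test element is the transvection along `x (k + 1)` and a multiple of a vector `v` detecting
  -- the escaped component of `x k`. As `x k` has weight at least one, `x (k + 1)` has weight at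
  -- least three, so any `v` in `V0` is allowed.
  obtain ⟨v, hv, hvb⟩ : ∃ v ∈ f.V0, B v (Sp.toEnd u⁻¹ (f.x k)) ≠ 0 := by
    by_contra! h
    exact hk2 (F0_nondeg (f.pr0_mem _) fun w hw => by rw [form_pr0 hw]; exact h w hw)
  obtain ⟨t, ht⟩ := exists_scalar hψ (mul_ne_zero (mul_ne_zero hf.two_ne_zero (f.lam_ne k hkN')) hvb)
  have htv : t • v ∈ f.V0 := Submodule.smul_mem _ _ hv
  have hev : B (f.x (k + 1)) (t • v) = 0 := mem_bot_P_orth hx1 htv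
  refine ⟨siegel f.alt _ _ hev, siegel_mem_S (by omega) hx1 (V0_mem_P htv _) hev, ?_, ?_⟩
  · obtain ⟨h', e⟩ := conj_siegel f.alt _ _ hev u
    rw [e]
    refine siegel_mem_S (by omega) (hstab u hT m le_rfl _ hx1) ⟨f.pr0_mem _, fun j hj hj' => ?_⟩ h'
    rw [Sp.form_apply_left, form_swap f.alt, mem_bot_P_orth
      (hstab u⁻¹ hT' (2 * j - N) (by omega) _ (x_mem_P ⊥ le_rfl)) htv, neg_zero]
  -- The character is trivial on the transvection, since `Y x (k + 1)` is a multiple of `x k`. By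
  -- maximality of `k`, its value after conjugation is `ψ(2 λ_k B(t v, u⁻¹ x k))`, and `t` was
  -- chosen to make this differ from one.
  · have e0 : B (t • v) (γ.Y (f.x (k + 1))) = 0 := by
      rw [f.Y_x_succ k hkN', LinearMap.map_smul (B (t • v)), f.orth _ htv, smul_zero]
    rw [psiLin_conj_siegel f.alt f.skewY, psiLin_siegel f.alt f.skewY, e0, mul_zero,
      AddChar.map_zero_eq_one]
    have e1 : Sp.toEnd u (f.x (k + 1)) = f.x (k + 1) + (Sp.toEnd u - 1) (f.x (k + 1)) := by simp
    have e2 : B (t • v) (Sp.toEnd u⁻¹ (γ.Y ((Sp.toEnd u - 1) (f.x (k + 1))))) = 0 := by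
      have h1 := Y_mem_P_bot (hT ⟨m, le_rfl⟩ _ hx1)
      rw [form_swap f.alt, mem_bot_P_orth (hstab u⁻¹ hT' m le_rfl _ (P_mono le_rfl (by simp) h1))
        htv, neg_zero]
    rw [e1, map_add, map_add, map_add, e2, add_zero, f.Y_x_succ k hkN']
    convert ht using 2
    simp only [map_smul, LinearMap.smul_apply, smul_eq_mul]
    ring

omit hf in
-- `S` does not control the `V0`-components of images of negative string vectors. Prescribing them
-- at weights at most `-3` suffices: at weight `-1` they lie in `L0 ≤ F0 0`. Stating this as
-- membership in a flag group gives the same for `q⁻¹`.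
theorem S_pr0_mem {q : Sp B} (hq : q ∈ f.S) {m : ℤ}
    (h : ∀ k ≤ N, m ≤ 2 * (k : ℤ) - N → 2 * (k : ℤ) - N ≤ -3 →
      f.pr0 (Sp.toEnd q (f.x k)) ∈ f.F0 (2 * k - N + 1)) :
    q ∈ flagGroup B (fun c : {c : ℤ // m ≤ c ∧ c ≤ -1} => f.P (f.F0 (c + 1)) c)
      (fun c => f.P (f.F0 (c + 1)) (c + 2)) fun _ => P_mono le_rfl (by omega) := by
  obtain ⟨a, ha⟩ := f.odd
  rintro ⟨c, hc⟩
  have sq := mem_S.1 hq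
  refine P_le (M := (f.P _ _).comap _) (fun v hv => ?_) fun k hk hk' => ?_
  · exact P_mono (f.F0_anti _ _ (by omega)) (by simp only; omega)
      (sq.mid _ v (mem_P_of_mem (f.F0_le _) hv 1))
  · simp only at hk' ⊢
    by_cases h1 : 1 ≤ 2 * (k : ℤ) - N
    · exact P_mono bot_le (by omega) (sq.bot _ h1 _ (x_mem_P _ le_rfl))
    by_cases h2 : 2 * (k : ℤ) - N = -1
    · exact P_mono (f.L0_le.trans (f.F0_anti _ _ (by omega))) (by omega)
        (sq.lag _ (x_mem_P _ (by omega)))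
    · have h3 := sq.top (2 * k - N) (by omega) _ (x_mem_P _ le_rfl)
      refine ⟨?_, fun j hj hj' => h3.2 j hj (by omega)⟩
      rw [LinearMap.sub_apply, Module.End.one_apply, map_sub, f.pr0_x, sub_zero]
      exact f.F0_anti _ _ (by omega) (h k hk (by omega) (by omega))

/-- The uncontrolled `V0`-components at weights at most `-3` are the only obstruction; the images of
`V0` are handled by pairing with `q⁻¹` applied to the string. -/
theorem mem_unip_one_of_mem_S {q : Sp B} (hq : q ∈ f.S)
    (h : ∀ k ≤ N, 2 * (k : ℤ) - N ≤ -3 →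
      f.pr0 (Sp.toEnd q (f.x k)) ∈ f.F0 (2 * k - N + 1)) : q ∈ γ.unip 1 := by
  obtain ⟨a, ha⟩ := f.odd
  have hT := S_pr0_mem hq (m := -N) fun k hk _ => h k hk
  have hT' := inv_mem hT
  have sq := mem_S.1 hq
  have sq' := mem_S.1 (inv_mem hq)
  intro c
  rw [hf.fil_eq, hf.fil_eq]
  refine P_le (M := (f.P _ _).comap _) (fun v hv => ?_) fun k hk hk' => ?_
  · have h1 := sq.mid c v (mem_P_of_mem (f.F0_le c) hv 1)
    refine ⟨f.F0_anti _ _ (by push_cast; omega) h1.1, fun j hj hj' => ?_⟩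
    rw [Sp.form_sub_left]
    push_cast at hj'
    by_cases h2 : 1 ≤ 2 * (j : ℤ) - N
    · rw [form_swap f.alt, mem_bot_P_orth (sq'.bot _ h2 _ (x_mem_P _ le_rfl)) (f.F0_le c hv),
        neg_zero]
    · have h3 := (hT' ⟨2 * j - N, by omega, by omega⟩ _ (x_mem_P _ le_rfl)).1
      rw [← form_pr0 (f.F0_le c hv)]
      exact f.F0_orth c _ (by simp only; omega) v hv _ h3
  · rw [Submodule.mem_comap]
    by_cases h1 : 1 ≤ 2 * (k : ℤ) - N
    · exact P_mono bot_le (by push_cast; omega) (sq.bot _ h1 _ (x_mem_P _ le_rfl))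
    · have h3 := hT ⟨2 * k - N, by omega, by omega⟩ _ (x_mem_P _ le_rfl)
      exact P_mono (f.F0_anti _ _ (by push_cast; omega)) (by push_cast; omega) h3

/-- Second half of the exchange. -/
theorem exists_unip_two {ψ : AddChar K ℂ} (hψ : ψ ≠ 1) {q : Sp B} (hq : q ∈ f.S)
    (hq1 : q ∉ γ.unip 1) : ∃ z ∈ γ.unip 2, q * z * q⁻¹ ∈ γ.unip 2 ∧
      psiLin ψ γ.Y (q * z * q⁻¹) ≠ psiLin ψ γ.Y z := by
  classical
  obtain ⟨a, ha⟩ := f.odd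
  have hqi := inv_mem hq
  have sq := mem_S.1 hq
  have sq' := mem_S.1 hqi
  -- The last negative string vector whose component is too low. Beyond it, `q` and `q⁻¹` respect
  -- the flags needed to keep the conjugated transvection in `G_{≥ 2}`.
  obtain ⟨k, ⟨hkN, hk1, hk2⟩, hmax⟩ : ∃ k, (k ≤ N ∧ 2 * (k : ℤ) - N ≤ -3 ∧
      f.pr0 (Sp.toEnd q⁻¹ (f.x k)) ∉ f.F0 (2 * k - N + 1)) ∧ ∀ j, k < j → j ≤ N →
      2 * (j : ℤ) - N ≤ -3 → f.pr0 (Sp.toEnd q⁻¹ (f.x j)) ∈ f.F0 (2 * j - N + 1) := by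
    have hne : ∃ k ≤ N, 2 * (k : ℤ) - N ≤ -3 ∧
        f.pr0 (Sp.toEnd q⁻¹ (f.x k)) ∉ f.F0 (2 * k - N + 1) := by
      by_contra! h
      exact hq1 (by simpa using inv_mem (hf.mem_unip_one_of_mem_S hqi h))
    obtain ⟨k0, h0⟩ := hne
    have := Nat.findGreatest_spec (P := fun k => k ≤ N ∧ 2 * (k : ℤ) - N ≤ -3 ∧
      f.pr0 (Sp.toEnd q⁻¹ (f.x k)) ∉ f.F0 (2 * k - N + 1)) h0.1 h0
    refine ⟨_, this, fun j hj hjN hj3 => ?_⟩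
    by_contra hj0
    exact Nat.findGreatest_is_greatest hj hjN ⟨hjN, hj3, hj0⟩
  have hkN' : k < N := by omega
  set m : ℤ := 2 * (k : ℤ) - N + 2 with hm
  have hT' := S_pr0_mem hqi (m := m) fun j hj h1 h2 => hmax j (by omega) hj h2
  have hT := by simpa using inv_mem hT'
  have hx1 : f.x (k + 1) ∈ f.P (f.F0 (m + 1)) m := x_mem_P _ (by push_cast; omega)
  -- `F0 (m - 1)` is the orthogonal of `F0 (2 - m)`, so a component outside it is detected there.
  -- With `x (k + 1)` of weight `m` the transvection has weight two.
  obtain ⟨v, hv, hvb⟩ : ∃ v ∈ f.F0 (2 - m), B v (Sp.toEnd q⁻¹ (f.x k)) ≠ 0 := by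
    by_contra! h
    refine hk2 ?_
    have := f.F0_mem (2 - m) _ (f.pr0_mem _) fun w hw => by
      rw [form_pr0 (f.F0_le _ hw)]; exact h w hw
    rwa [show 1 - (2 - m) = 2 * (k : ℤ) - N + 1 by omega] at this
  obtain ⟨t, ht⟩ := exists_scalar hψ (mul_ne_zero (mul_ne_zero hf.two_ne_zero (f.lam_ne k hkN')) hvb)
  have htv : t • v ∈ f.F0 (2 - m) := Submodule.smul_mem _ _ hv
  have htv0 := f.F0_le _ htv
  have hev : B (f.x (k + 1)) (t • v) = 0 :=
    mem_bot_P_orth (x_mem_P (c := m) ⊥ (by push_cast; omega)) htv0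
  have hqv : Sp.toEnd q (t • v) ∈ f.P (f.F0 (2 - m)) (2 - m) := by
    have e : Sp.toEnd q (t • v) = (Sp.toEnd q - 1) (t • v) + t • v := by
      rw [LinearMap.sub_apply, Module.End.one_apply, sub_add_cancel]
    have h1 := sq.mid _ _ (mem_P_of_mem (f.F0_le _) htv 1)
    rw [e]
    refine add_mem ⟨f.F0_anti _ _ (by omega) h1.1, fun j hj hj' => ?_⟩ (mem_P_of_mem (f.F0_le _) htv _)
    rw [Sp.form_sub_left]
    by_cases h2 : 1 ≤ 2 * (j : ℤ) - N
    · rw [form_swap f.alt, mem_bot_P_orth (sq'.bot _ h2 _ (x_mem_P _ le_rfl)) htv0, neg_zero]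
    · have h3 := (hT' ⟨2 * j - N, by omega, by omega⟩ _ (x_mem_P _ le_rfl)).1
      rw [← form_pr0 htv0]
      exact f.F0_orth _ _ (by simp only; omega) _ htv _ h3
  have hqx : (Sp.toEnd q - 1) (f.x (k + 1)) ∈ f.P (f.F0 (m + 1)) (m + 2) :=
    hT ⟨m, by omega, by omega⟩ _ hx1
  refine ⟨siegel f.alt _ _ hev, ?_, ?_, ?_⟩
  · refine hf.full.siegel_mem_unip (i := m) (j := 2 - m) (by push_cast; omega)
      (hf.x_mem_fil (by push_cast; omega)) (hf.F0_le_fil _ htv) hev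
  · obtain ⟨h', e⟩ := conj_siegel f.alt _ _ hev q
    rw [e]
    refine hf.full.siegel_mem_unip (i := m) (j := 2 - m) (by push_cast; omega) ?_ ?_ h'
    · have e : Sp.toEnd q (f.x (k + 1)) = (Sp.toEnd q - 1) (f.x (k + 1)) + f.x (k + 1) := by simp
      rw [e, hf.fil_eq]
      exact add_mem (P_mono (f.F0_anti _ _ (by omega)) (by omega) hqx)
        (x_mem_P _ (by push_cast; omega))
    · rw [hf.fil_eq]; exact hqv
  · have e0 : B (t • v) (γ.Y (f.x (k + 1))) = 0 := by
      rw [f.Y_x_succ k hkN', LinearMap.map_smul (B (t • v)), f.orth _ htv0, smul_zero]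
    rw [psiLin_conj_siegel f.alt f.skewY, psiLin_siegel f.alt f.skewY, e0, mul_zero,
      AddChar.map_zero_eq_one]
    have e1 : Sp.toEnd q (f.x (k + 1)) = f.x (k + 1) + (Sp.toEnd q - 1) (f.x (k + 1)) := by simp
    -- The two factors lie in complementary steps: `2 - m` against `m - 1` in `F0`, and `2 - m`
    -- against `m` on the string.
    have e2 : B (t • v) (Sp.toEnd q⁻¹ (γ.Y ((Sp.toEnd q - 1) (f.x (k + 1))))) = 0 := by
      rw [← Sp.form_apply_left]
      exact form_P (by omega) (f.F0_le _) (f.F0_le _)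
        (fun a ha a' ha' => f.F0_orth _ _ (by omega) a ha a' ha') hqv (Y_mem_P_F0 hqx)
    rw [e1, map_add, map_add, map_add, e2, add_zero, f.Y_x_succ k hkN']
    convert ht using 2
    simp only [map_smul, LinearMap.smul_apply, smul_eq_mul]
    ring

/-- Exchange of `S` against `(S ∩ G_{≥ 1}) · G_{≥ 2}`. -/
theorem finrank_eig_S [Finite (Sp B)] {ψ : AddChar K ℂ} (hψ : ψ ≠ 1) {W : Type*} [AddCommGroup W]
    [Module ℂ W] [FiniteDimensional ℂ W] (π : Representation ℂ (Sp B) W) :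
    finrank ℂ (eig π f.S (psiLin ψ γ.Y)) =
      finrank ℂ (eig π (f.S ⊓ γ.unip 1) (psiLin ψ γ.Y) ⊓ eig π (γ.unip 2) (psiLin ψ γ.Y) :
        Submodule ℂ W) :=
  finrank_eig_exchange π (f.isCharOn_S ψ) (hf.full.isCharOn_psiLin_unip ψ) inf_le_left
    (fun _ hc _ hz => hf.full.conj_unip_two ψ hc.2 hz) (fun _ _ _ => rfl)
    (fun _ hu huS => hf.exists_S hψ hu huS)
    (fun _ hq hqC => hf.exists_unip_two hψ hq fun h => hqC ⟨hq, h⟩)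

end Compatible

end FrameExchange

end
end SpFourier

namespace SpFourier
noncomputable section

/-! ### Isometries with prescribed first order part -/

section Cayley

variable {K : Type*} [Field K] {V : Type*} [AddCommGroup V] [Module K V] [FiniteDimensional K V]
variable {B : LinearMap.BilinForm K V}

/-- The Cayley transform of a skew endomorphism `ξ`, written as `1 + ξ R`. -/
theorem exists_cayley (hnd : B.Nondegenerate) (h2 : (2 : K) ≠ 0) {ξ : Module.End K V}
    (hs : ∀ v w, B (ξ v) w = -B v (ξ w)) (hi : ∀ v, ξ v = (2 : K) • v → v = 0) :
    ∃ (g : Sp B) (R : Module.End K V), Sp.toEnd g - 1 = ξ * R ∧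
      R = 1 + (2⁻¹ : K) • (ξ * R) ∧
      ∀ F : Submodule K V, (∀ v ∈ F, ξ v ∈ F) → ∀ v ∈ F, R v ∈ F := by
  -- With `R = (1 - η)⁻¹` the isometry is `(1 + η)(1 - η)⁻¹ = 1 + ξ R`; the inverse exists because
  -- `2` is not an eigenvalue of `ξ`.
  let η : Module.End K V := (2⁻¹ : K) • ξ
  have hη : ∀ v, η v = (2⁻¹ : K) • ξ v := fun v => rfl
  have hinj : Function.Injective (1 - η : Module.End K V) := by
    rw [← LinearMap.ker_eq_bot, LinearMap.ker_eq_bot']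
    intro v hv
    refine hi v ?_
    have h1 : v = (2⁻¹ : K) • ξ v := by
      rw [LinearMap.sub_apply, Module.End.one_apply, sub_eq_zero] at hv; exact hv
    conv_rhs => rw [h1]
    rw [smul_smul, mul_inv_cancel₀ h2, one_smul]
  let e := LinearEquiv.ofInjectiveEndo (1 - η) hinj
  let R : Module.End K V := e.symm
  have hR1 : ∀ v, R v - η (R v) = v := fun v => e.apply_symm_apply v
  have hR2 : ∀ v, R (v - η v) = v := fun v => e.symm_apply_apply v
  have hRη : R = 1 + (2⁻¹ : K) • (ξ * R) := by
    refine LinearMap.ext fun v => ?_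
    have := hR1 v
    rw [sub_eq_iff_eq_add] at this
    rw [this]; rfl
  have hiso : ∀ v w, B ((1 + ξ * R : Module.End K V) v) ((1 + ξ * R : Module.End K V) w) = B v w := by
    have e1 : ∀ v, (1 + ξ * R : Module.End K V) v = R v + η (R v) := fun v => by
      change v + ξ (R v) = _
      have : ξ (R v) = η (R v) + η (R v) := by
        rw [hη, ← add_smul, ← two_mul, mul_inv_cancel₀ h2, one_smul]
      rw [this, ← add_assoc, ← sub_eq_iff_eq_add.1 (hR1 v)]
    intro v w
    rw [e1, e1]
    conv_rhs => rw [← hR1 v, ← hR1 w]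
    have h3 : B (η (R v)) (R w) = -B (R v) (η (R w)) := by
      rw [hη, hη, map_smul, LinearMap.smul_apply, hs, map_smul, smul_neg]
    simp only [map_add, map_sub, LinearMap.add_apply, LinearMap.sub_apply, h3]
    ring
  have hginj : Function.Injective (1 + ξ * R : Module.End K V) := by
    rw [← LinearMap.ker_eq_bot, LinearMap.ker_eq_bot']
    intro v hv
    refine hnd.1 v fun w => ?_
    rw [← hiso, hv, map_zero, LinearMap.zero_apply]
  refine ⟨⟨LinearEquiv.ofInjectiveEndo _ hginj, hiso⟩, R, ?_, hRη, fun F hF v hv => ?_⟩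
  · change (1 + ξ * R) - 1 = _
    abel
  · have hle : F.map (1 - η) ≤ F := by
      rintro _ ⟨w, hw, rfl⟩
      exact sub_mem hw (Submodule.smul_mem _ _ (hF w hw))
    have heq : F.map (1 - η) = F :=
      Submodule.eq_of_le_of_finrank_eq hle (LinearEquiv.finrank_map_eq e _)
    rw [← heq] at hv
    obtain ⟨w, hw, rfl⟩ := hv
    have : R ((1 - η) w) = w := hR2 w
    rw [this]; exact hw

/-- A map raising weights has no eigenvector of eigenvalue `2`. As `R` preserves every `ξ`-stable
subspace, `g - 1 = ξ R` inherits all the flag conditions satisfied by `ξ`, so membership in `S` can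
be arranged at the level of Lie algebras. -/
theorem Triple.Full.exists_cayley {γ : Triple B} (hγ : γ.Full) (h2 : (2 : K) ≠ 0)
    {ξ : Module.End K V} (hs : ∀ v w, B (ξ v) w = -B v (ξ w)) (hξ : γ.RaisesZ 1 ξ) :
    ∃ g ∈ γ.unip 1, γ.RaisesZ 2 (Sp.toEnd g - 1 - ξ) ∧
      ∀ F F' : Submodule K V, F' ≤ F → (∀ v ∈ F, ξ v ∈ F') →
        ∀ v ∈ F, (Sp.toEnd g - 1) v ∈ F' := by
  obtain ⟨g, R, h1, hR, h3⟩ := SpFourier.exists_cayley hγ.nondeg h2 hs (fun v hv => by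
    have h1 : ∀ m : ℕ, v ∈ γ.fil (-(finrank K V : ℤ) + m) := by
      intro m
      induction m with
      | zero => rw [hγ.fil_eq_top (by push_cast; omega)]; exact Submodule.mem_top
      | succ m ih =>
        have h4 := hξ _ _ ih
        rw [hv, Submodule.smul_mem_iff _ h2, add_assoc] at h4
        exact_mod_cast h4
    have h4 := h1 (2 * finrank K V)
    rwa [Triple.fil_eq_bot (by push_cast; omega), Submodule.mem_bot] at h4)
  have hF : ∀ F F' : Submodule K V, F' ≤ F → (∀ v ∈ F, ξ v ∈ F') →
        ∀ v ∈ F, (Sp.toEnd g - 1) v ∈ F' := fun F F' hle h v hv => by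
    rw [h1]; exact h _ (h3 F (fun w hw => hle (h w hw)) v hv)
  refine ⟨g, fun i v hv => hF _ _ (γ.fil_anti (by omega)) (fun w hw => hξ i w hw) v hv, ?_, hF⟩
  have e : Sp.toEnd g - 1 - ξ = (2⁻¹ : K) • (ξ * (ξ * R)) := by
    rw [h1]
    conv_lhs => rw [hR]
    rw [mul_add, mul_one, mul_smul_comm, add_sub_cancel_left]
  rw [e]
  refine Triple.RaisesZ.smul ?_ _
  have h4 : γ.RaisesZ 0 R := fun i v hv => by
    rw [add_zero]
    exact h3 _ (fun w hw => γ.fil_anti (by omega) (hξ i w hw)) v hv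
  exact (hξ.mul (hξ.mul h4)).mono (by norm_num)

/-- The degree one part of an element of `G_{≥ 1}` is skew. -/
theorem Triple.Full.gr1_skew {γ : Triple B} (hγ : γ.Full) {x : Sp B} (hx : x ∈ γ.unip 1) (v w : V) :
    B (γ.gr1 (Sp.toEnd x - 1) v) w = -B v (γ.gr1 (Sp.toEnd x - 1) w) := by
  set ξ := γ.gr1 (Sp.toEnd x - 1)
  have h : B ∘ₗ ξ = -B.compl₂ ξ := hγ.ext fun i u hu => hγ.ext fun j u' hu' => by
    simp only [LinearMap.comp_apply, LinearMap.neg_apply, LinearMap.compl₂_apply]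
    have hu1 : ξ u ∈ γ.weightSpace (i + 1) := hγ.gr1_mem hu
    have hu2 : ξ u' ∈ γ.weightSpace (j + 1) := hγ.gr1_mem hu'
    by_cases hij : i + j = -1
    · have h1 := hγ.form_fil_fil (by omega) (Triple.weightSpace_le_fil le_rfl hu)
        (hγ.raisesZ_inv_add_gr1 hx j u' (Triple.weightSpace_le_fil le_rfl hu'))
      have h2 := hγ.form_fil_fil (by omega)
        (hγ.raisesZ_sub_gr1 (raisesZ_of_mem hx) i u (Triple.weightSpace_le_fil le_rfl hu))
        (Triple.weightSpace_le_fil le_rfl hu')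
      rw [LinearMap.sub_apply, map_sub, LinearMap.sub_apply, Sp.form_sub_left] at h2
      rw [LinearMap.add_apply, map_add] at h1
      linear_combination h1 - h2
    · rw [hγ.form_eq_zero (by omega) hu1 hu', hγ.form_eq_zero (by omega) hu hu2, neg_zero]
  exact LinearMap.congr_fun (LinearMap.congr_fun h v) w

omit [FiniteDimensional K V] in
theorem extend_apply (hB : B.IsRefl) {U : Submodule K V} (h : IsCompl U (B.orthogonal U))
    (g : Sp (B.restrict U)) (u : U) {v : V} (hv : v ∈ B.orthogonal U) :
    Sp.toEnd (extend hB U h g) ((u : V) + v) = (Sp.toEnd g u : V) + v := by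
  have : (U.prodEquivOfIsCompl _ h).symm ((u : V) + (⟨v, hv⟩ : B.orthogonal U)) = (u, ⟨v, hv⟩) := by
    rw [LinearEquiv.symm_apply_eq, Submodule.coe_prodEquivOfIsCompl']
  change (U.prodEquivOfIsCompl _ h) (((g : U ≃ₗ[K] U).prodCongr
    (LinearEquiv.refl K (B.orthogonal U))) ((U.prodEquivOfIsCompl _ h).symm ((u : V) + v))) = _
  rw [this, Submodule.coe_prodEquivOfIsCompl']
  rfl

end Cayley

/-! ### The unipotent group of `γ'` inside that of `γ` -/

section Iterated

variable {K : Type*} [Field K] {V : Type*} [AddCommGroup V] [Module K V]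
variable {B : LinearMap.BilinForm K V}

/-- The frame `f` is adapted to the triple `γ` and to a triple `γ'` on the space `U`, and the two
triples agree on `U`. -/
structure Adapted {U : Submodule K V} (γ : Triple B) (γ' : Triple (B.restrict U)) {N : ℕ}
    (f : Frame B γ.Y N) : Prop extends Compatible γ f where
  full' : γ'.Full
  V0_eq : f.V0 = U
  isCompl : IsCompl U (B.orthogonal U)
  F0_eq : ∀ c, f.F0 c = (γ'.fil c).map U.subtype
  Y_eq : ∀ v : U, γ.Y v = γ'.Y v
  x_mem : ∀ k ≤ N, f.x k ∈ γ.weightSpace (2 * (k : ℤ) - N)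
  pr0_weight : ∀ j, ∀ v ∈ γ.weightSpace j, f.pr0 v ∈ γ.weightSpace j

namespace Adapted

open _root_.SpFourier.Frame Triple.Full

variable {U : Submodule K V} {γ : Triple B} {γ' : Triple (B.restrict U)} {N : ℕ}
  {f : Frame B γ.Y N} (hf : Adapted γ γ' f)
include hf

theorem raisesZ_pr0 : γ.RaisesZ 0 f.pr0 := Triple.raisesZ_of_weightSpace fun j v hv =>
  Triple.weightSpace_le_fil (by omega) (hf.pr0_weight j v hv)

theorem pr0_mem_U (v : V) : f.pr0 v ∈ U := hf.V0_eq ▸ f.pr0_mem v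

theorem sub_pr0_mem_orthogonal (v : V) : v - f.pr0 v ∈ B.orthogonal U := by
  intro u hu
  rw [← hf.V0_eq] at hu
  change B u (v - f.pr0 v) = 0
  rw [map_sub, form_pr0 hu, sub_self]

omit hf in
theorem form_pr0_left (v w : V) : B (f.pr0 v) w = B v (f.pr0 w) := by
  rw [← form_pr0 (f.pr0_mem v), form_swap f.alt, form_swap f.alt v, form_pr0 (f.pr0_mem w)]

theorem F0_mem_iff {c : ℤ} (u : U) : (u : V) ∈ f.F0 c ↔ u ∈ γ'.fil c := by
  rw [hf.F0_eq]
  constructor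
  · rintro ⟨w, hw, e⟩
    rwa [← Subtype.ext e]
  · exact fun h => ⟨u, h, rfl⟩

theorem pr0_mem_F0 {c : ℤ} {v : V} (hv : v ∈ γ.fil c) : f.pr0 v ∈ f.F0 c := by
  rw [hf.fil_eq] at hv; exact hv.1

variable [FiniteDimensional K V]

/-- Extension by the identity, as a homomorphism. -/
def ext : Sp (B.restrict U) →* Sp B := extend f.alt.isRefl U hf.isCompl

omit [FiniteDimensional K V] in
theorem ext_sub_one (y : Sp (B.restrict U)) (v : V) :
    (Sp.toEnd (hf.ext y) - 1) v = ((Sp.toEnd y - 1) ⟨f.pr0 v, hf.pr0_mem_U v⟩ : U) := by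
  have h := extend_apply f.alt.isRefl hf.isCompl y ⟨f.pr0 v, hf.pr0_mem_U v⟩
    (hf.sub_pr0_mem_orthogonal v)
  rw [show ((⟨f.pr0 v, hf.pr0_mem_U v⟩ : U) : V) + (v - f.pr0 v) = v by
    change f.pr0 v + _ = v; abel] at h
  rw [LinearMap.sub_apply, Module.End.one_apply]
  change Sp.toEnd (extend f.alt.isRefl U hf.isCompl y) v - v = _
  rw [h]
  simp only [LinearMap.sub_apply, Module.End.one_apply, AddSubgroupClass.coe_sub]
  abel

omit [FiniteDimensional K V] in
theorem raisesZ_ext {k : ℤ} {T : Module.End K V} {T' : Module.End K U} (hT' : γ'.RaisesZ k T')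
    (h : ∀ v, T v = T' ⟨f.pr0 v, hf.pr0_mem_U v⟩) : γ.RaisesZ k T := by
  intro c v hv
  rw [h]
  refine hf.toCompatible.F0_le_fil _ ?_
  rw [hf.F0_mem_iff]
  exact hT' _ _ ((hf.F0_mem_iff _).1 (hf.pr0_mem_F0 hv))

theorem ext_mem_unip {k : ℕ} {y : Sp (B.restrict U)} (hy : y ∈ γ'.unip k) : hf.ext y ∈ γ.unip k :=
  hf.raisesZ_ext (raisesZ_of_mem hy) (hf.ext_sub_one y)

theorem ext_sub_one_mem_F0 {k : ℕ} {y : Sp (B.restrict U)} (hy : y ∈ γ'.unip k) {c : ℤ} {v : V}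
    (hv : f.pr0 v ∈ f.F0 c) : (Sp.toEnd (hf.ext y) - 1) v ∈ f.F0 (c + k) := by
  rw [hf.ext_sub_one, hf.F0_mem_iff]
  exact hy _ _ ((hf.F0_mem_iff _).1 hv)

omit [FiniteDimensional K V] in
theorem ext_sub_one_mem_V0 (y : Sp (B.restrict U)) (v : V) :
    (Sp.toEnd (hf.ext y) - 1) v ∈ f.V0 := by
  rw [hf.ext_sub_one, hf.V0_eq]; exact Subtype.coe_prop _

omit [FiniteDimensional K V] in
/-- `Sp(V0)` acts on the subspaces `P A c`. -/
theorem ext_mem_P {y : Sp (B.restrict U)} {A : Submodule K V} (hA : A ≤ f.V0)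
    (h : ∀ a ∈ A, (Sp.toEnd (hf.ext y) - 1) a ∈ A) {c : ℤ} {v : V} (hv : v ∈ f.P A c) :
    Sp.toEnd (hf.ext y) v ∈ f.P A c := by
  have e : Sp.toEnd (hf.ext y) v = (Sp.toEnd (hf.ext y) - 1) v + v := by simp
  have e2 : (Sp.toEnd (hf.ext y) - 1) v = (Sp.toEnd (hf.ext y) - 1) (f.pr0 v) := by
    rw [hf.ext_sub_one, hf.ext_sub_one]
    simp only [f.pr0_of_mem _ (f.pr0_mem v)]
  rw [e, e2]
  exact add_mem (mem_P_of_mem hA (h _ hv.1) c) hv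

/-- The extended element preserves every subspace in the definition of `S`. For `L0` this holds
since it moves `F0 0` only by elements of `F0 1 ≤ L0`. -/
theorem conj_mem_S {y : Sp (B.restrict U)} (hy : y ∈ γ'.unip 1) {c : Sp B} (hc : c ∈ f.S) :
    hf.ext y * c * (hf.ext y)⁻¹ ∈ f.S := by
  have key : ∀ y ∈ γ'.unip 1, ∀ A : Submodule K V, (A = ⊥ ∨ A = f.V0 ∨ A = f.L0 ∨ ∃ b, A = f.F0 b) →
      ∀ (c : ℤ), ∀ v ∈ f.P A c, Sp.toEnd (hf.ext y) v ∈ f.P A c := by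
    intro y hy A hA c v hv
    rcases hA with rfl | rfl | rfl | ⟨b, rfl⟩
    · exact hf.ext_mem_P bot_le (fun a ha => by rw [(Submodule.mem_bot K).1 ha]; simp) hv
    · exact hf.ext_mem_P le_rfl (fun a _ => hf.ext_sub_one_mem_V0 y a) hv
    · refine hf.ext_mem_P (f.L0_le.trans (f.F0_le 0)) (fun a ha => f.le_L0 ?_) hv
      have h0 := f.L0_le ha
      exact hf.ext_sub_one_mem_F0 hy (c := 0) (by rwa [f.pr0_of_mem a (f.F0_le _ h0)])
    · refine hf.ext_mem_P (f.F0_le b) (fun a ha => f.F0_anti b (b + 1) (by omega) ?_) hv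
      exact hf.ext_sub_one_mem_F0 hy (by rwa [f.pr0_of_mem a (f.F0_le _ ha)])
  have key2 : ∀ A : Submodule K V, (A = ⊥ ∨ A = f.V0 ∨ A = f.L0 ∨ ∃ b, A = f.F0 b) →
      ∀ (c : ℤ), ∀ v ∈ f.P A c, Sp.toEnd (hf.ext y)⁻¹ v ∈ f.P A c := by
    have := key _ (inv_mem hy)
    rwa [map_inv] at this
  have sc := mem_S.1 hc
  rw [mem_S, Sp.conj_sub_one]
  refine ⟨fun i hi v hv => ?_, fun b v hv => ?_, fun v hv => ?_, fun i hi v hv => ?_⟩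
  · exact key y hy ⊥ (by simp) _ _ (sc.bot i hi _ (key2 ⊥ (by simp) _ _ hv))
  · exact key y hy _ (by simp) _ _ (sc.mid b _ (key2 _ (by simp) _ _ hv))
  · exact key y hy _ (by simp) _ _ (sc.lag _ (key2 _ (by simp) _ _ hv))
  · exact key y hy _ (by simp) _ _ (sc.top i hi _ (key2 _ (by simp) _ _ hv))

/-- The difference `D = g⁻¹ Y g - Y` is supported on `V0` and lowers its filtration by only one,
while the compression of `c - 1` to `V0` raises it by two. The trace of the product vanishes. -/
theorem psiLin_conj_S (ψ : AddChar K ℂ) {y : Sp (B.restrict U)} (hy : y ∈ γ'.unip 1) {c : Sp B}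
    (hc : c ∈ f.S) :
    psiLin ψ γ.Y (hf.ext y * c * (hf.ext y)⁻¹) = psiLin ψ γ.Y c := by
  set g := hf.ext y with hg
  have sc := mem_S.1 hc
  set D : Module.End K V := Sp.toEnd g⁻¹ * γ.Y * Sp.toEnd g - γ.Y with hD
  have hgm : ∀ y ∈ γ'.unip 1, ∀ b, ∀ v ∈ f.F0 b, (Sp.toEnd (hf.ext y) - 1) v ∈ f.F0 (b + 1) :=
    fun y hy b v hv => hf.ext_sub_one_mem_F0 hy (by rwa [f.pr0_of_mem v (f.F0_le _ hv)])
  have hgi : ∀ b, ∀ v ∈ f.F0 b, (Sp.toEnd g⁻¹ - 1) v ∈ f.F0 (b + 1) := by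
    have := hgm _ (inv_mem hy)
    rwa [map_inv] at this
  have hx : ∀ v, f.pr0 v = 0 → Sp.toEnd g v = v := fun v hv => by
    have := hf.ext_sub_one y v
    rw [LinearMap.sub_apply, Module.End.one_apply, sub_eq_iff_eq_add] at this
    rw [hg, this]
    have e : (⟨f.pr0 v, hf.pr0_mem_U v⟩ : U) = 0 := Subtype.ext hv
    rw [e]; simp
  have hxi : ∀ v, f.pr0 v = 0 → Sp.toEnd g⁻¹ v = v := fun v hv => by
    conv_lhs => rw [← hx v hv]
    exact Sp.inv_apply_apply g v
  have hYx : ∀ v, f.pr0 v = 0 → f.pr0 (γ.Y v) = 0 := fun v hv => by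
    have h1 : v ∈ f.P ⊥ (-N - 2) := ⟨by rw [hv]; exact zero_mem _, fun k hk h => by omega⟩
    simpa using (Y_mem_P_bot h1).1
  have hDx : ∀ v, f.pr0 v = 0 → D v = 0 := fun v hv => by
    change Sp.toEnd g⁻¹ (γ.Y (Sp.toEnd g v)) - γ.Y v = 0
    rw [hx v hv, hxi _ (hYx v hv), sub_self]
  have hD0 : ∀ b, ∀ v ∈ f.F0 b, D v ∈ f.F0 (b - 1) := fun b v hv => by
    have e : D v = γ.Y ((Sp.toEnd g - 1) v) + (Sp.toEnd g⁻¹ - 1) (γ.Y ((Sp.toEnd g - 1) v))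
        + (Sp.toEnd g⁻¹ - 1) (γ.Y v) := by
      simp only [hD, LinearMap.sub_apply, Module.End.mul_apply, Module.End.one_apply, map_sub]
      abel
    rw [e]
    have h1 := f.Y_F0 _ _ (hgm y hy b v hv)
    have h2 := hgi _ _ h1
    have h3 := hgi _ _ (f.Y_F0 _ _ hv)
    refine add_mem (add_mem ?_ ?_) ?_
    · exact f.F0_anti _ _ (by omega) h1
    · exact f.F0_anti _ _ (by omega) h2
    · exact f.F0_anti _ _ (by omega) h3
  have hsub : ∀ v, f.pr0 (v - f.pr0 v) = 0 := fun v => by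
    rw [map_sub, f.pr0_of_mem _ (f.pr0_mem v), sub_self]
  have hDp : D = f.pr0 * D * f.pr0 := by
    refine LinearMap.ext fun v => ?_
    have h1 := hDx _ (hsub v)
    rw [map_sub, sub_eq_zero] at h1
    rw [Module.End.mul_apply, Module.End.mul_apply, ← h1]
    have h2 := hD0 (-N) (f.pr0 v) (by rw [f.F0_top _ le_rfl]; exact f.pr0_mem v)
    rw [← h1] at h2
    exact (f.pr0_of_mem _ (f.F0_le _ h2)).symm
  have htr : LinearMap.trace K V (D * (Sp.toEnd c - 1)) = 0 := by
    have h1 : LinearMap.trace K V (D * (Sp.toEnd c - 1)) =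
        LinearMap.trace K V (D * (f.pr0 * (Sp.toEnd c - 1) * f.pr0)) := by
      conv_lhs => rw [hDp]
      rw [mul_assoc, mul_assoc, LinearMap.trace_mul_comm, mul_assoc, mul_assoc]
    rw [h1]
    refine hf.full.trace_eq_zero (k := 1) one_pos fun i v hv => ?_
    have h2 := (sc.mid i _ (mem_P_of_mem (f.F0_le _) (hf.pr0_mem_F0 hv) 1)).1
    have h3 := hD0 _ _ h2
    refine hf.toCompatible.F0_le_fil _ (f.F0_anti _ _ ?_ h3)
    omega
  rw [psiLin, psiLin, Sp.conj_sub_one]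
  congr 1
  have e : LinearMap.trace K V (γ.Y * (Sp.toEnd g * (Sp.toEnd c - 1) * Sp.toEnd g⁻¹)) =
      LinearMap.trace K V ((Sp.toEnd g⁻¹ * γ.Y * Sp.toEnd g) * (Sp.toEnd c - 1)) := by
    rw [← mul_assoc, LinearMap.trace_mul_comm]
    simp only [mul_assoc]
  rw [e, ← sub_eq_zero, ← map_sub, ← sub_mul]
  exact htr

theorem trace_ext (y : Sp (B.restrict U)) :
    LinearMap.trace K V (γ.Y * (Sp.toEnd (hf.ext y) - 1)) =
      LinearMap.trace K U (γ'.Y * (Sp.toEnd y - 1)) := by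
  have h : ∀ v, (γ.Y * (Sp.toEnd (hf.ext y) - 1)) v ∈ U := fun v => by
    rw [Module.End.mul_apply, hf.ext_sub_one, hf.Y_eq]; exact Subtype.coe_prop _
  rw [← LinearMap.trace_restrict_eq_of_forall_mem U _ h]
  congr 1
  refine LinearMap.ext fun u => Subtype.ext ?_
  rw [LinearMap.coe_restrict_apply, Module.End.mul_apply, hf.ext_sub_one, hf.Y_eq]
  have e : (⟨f.pr0 u, hf.pr0_mem_U u⟩ : U) = u :=
    Subtype.ext (f.pr0_of_mem u (by rw [hf.V0_eq]; exact u.2))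
  rw [e]; rfl

theorem psiLin_ext (ψ : AddChar K ℂ) (y : Sp (B.restrict U)) :
    psiLin ψ γ.Y (hf.ext y) = psiLin ψ γ'.Y y := by
  rw [psiLin, psiLin, hf.trace_ext]

end Adapted

end Iterated

end
end SpFourier

namespace SpFourier
noncomputable section

/-! ### The `S ∩ G_{≥ 1}`-eigenvectors of the Heisenberg representation -/

section IteratedLeft

variable {K : Type*} [Field K] {V : Type*} [AddCommGroup V] [Module K V]
variable {B : LinearMap.BilinForm K V}

namespace Adapted

open _root_.SpFourier.Frame Triple.Full

variable {U : Submodule K V} {γ : Triple B} {γ' : Triple (B.restrict U)} {N : ℕ}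
  {f : Frame B γ.Y N} (hf : Adapted γ γ' f)
include hf

theorem eq_zero_of_mem_fil {j : ℤ} {v : V} (hv : v ∈ γ.weightSpace j) (h : v ∈ γ.fil (j + 1)) :
    v = 0 := by
  have h1 := hf.full.mem_fil_iff.1 h j (by omega)
  rwa [hf.full.proj_apply_of_mem hv, if_pos rfl] at h1

variable [FiniteDimensional K V]

/-- An element of `G_{≥ 1}` respecting the string to first order is a product of an element of
`G_{≥ 2}`, an element of `S` and an element of `Sp(V0)`. -/
theorem exists_factorization {x : Sp B} (hx : x ∈ γ.unip 1)
    (hA : ∀ k ≤ N, 1 ≤ 2 * (k : ℤ) - N →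
      f.pr0 ((Sp.toEnd x - 1) (f.x k)) ∈ f.F0 (2 * k - N + 2))
    (hL : ∀ k ≤ N, 2 * (k : ℤ) - N = -1 → f.pr0 (γ.gr1 (Sp.toEnd x - 1) (f.x k)) ∈ f.L0) :
    ∃ z ∈ γ.unip 2, ∃ c ∈ f.S ⊓ γ.unip 1, ∃ y ∈ γ'.unip 1, x = z * c * hf.ext y := by
  have h2 := hf.toCompatible.two_ne_zero
  obtain ⟨a, ha⟩ := f.odd
  set ξ := γ.gr1 (Sp.toEnd x - 1) with hξ
  have hξ1 : γ.RaisesZ 1 ξ := hf.full.raisesZ_gr1 _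
  have hξ2 : γ.RaisesZ 2 (Sp.toEnd x - 1 - ξ) := hf.full.raisesZ_sub_gr1 (raisesZ_of_mem hx)
  have hsk : ∀ v w, B (ξ v) w = -B v (ξ w) := hf.full.gr1_skew hx
  have hξx : ∀ k ≤ N, ξ (f.x k) ∈ γ.weightSpace (2 * (k : ℤ) - N + 1) := fun k hk =>
    hf.full.gr1_mem (hf.x_mem k hk)
  -- This component has weight `2k - N + 1`, and by hypothesis it lies one step deeper in the
  -- filtration.
  have hp0 : ∀ k ≤ N, 1 ≤ 2 * (k : ℤ) - N → f.pr0 (ξ (f.x k)) = 0 := by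
    intro k hk hk1
    refine hf.eq_zero_of_mem_fil (hf.pr0_weight _ _ (hξx k hk)) ?_
    have h3 := hξ2 _ _ (Triple.weightSpace_le_fil le_rfl (hf.x_mem k hk))
    have h4 := hf.toCompatible.F0_le_fil _ (hA k hk hk1)
    have h5 := hf.toCompatible.F0_le_fil _ (hf.pr0_mem_F0 h3)
    rw [LinearMap.sub_apply, map_sub] at h5
    have h6 := sub_mem h4 h5
    rwa [sub_sub_cancel, show 2 * (k : ℤ) - N + 2 = 2 * k - N + 1 + 1 by ring] at h6
  -- Split the first order part of `x` into its compression to `V0`, integrated to `y` in `Sp(V0)`,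
  -- and the rest, integrated to `c` in `S`. What remains of `x` has degree two.
  let ξ0 : Module.End K V := f.pr0 * ξ * f.pr0
  have hsk0 : ∀ v w, B (ξ0 v) w = -B v (ξ0 w) := fun v w => by
    change B (f.pr0 (ξ (f.pr0 v))) w = -B v (f.pr0 (ξ (f.pr0 w)))
    rw [form_pr0_left, hsk, ← form_pr0_left]
  have hξ01 : γ.RaisesZ 1 ξ0 := ((hf.raisesZ_pr0.mul hξ1).mul hf.raisesZ_pr0).mono (by norm_num)
  let ξ' : Module.End K U := LinearMap.codRestrict U (f.pr0 ∘ₗ ξ ∘ₗ U.subtype)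
    fun u => hf.pr0_mem_U _
  have hξ'0 : ∀ v, ξ0 v = ξ' ⟨f.pr0 v, hf.pr0_mem_U v⟩ := fun v => rfl
  have hξ'1 : γ'.RaisesZ 1 ξ' := fun i u hu =>
    (hf.F0_mem_iff _).1 (hf.pr0_mem_F0 (hξ1 i _ (hf.toCompatible.F0_le_fil _
      ((hf.F0_mem_iff _).2 hu))))
  have hpu : ∀ u : U, f.pr0 u = u := fun u => f.pr0_of_mem u (by rw [hf.V0_eq]; exact u.2)
  obtain ⟨y, hy, hy2, -⟩ := hf.full'.exists_cayley h2 (ξ := ξ') (fun u w => by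
    have := hsk0 u w
    rw [hξ'0, hξ'0] at this
    simp only [hpu] at this
    exact this) hξ'1
  have hs10 : ∀ v w, B ((ξ - ξ0) v) w = -B v ((ξ - ξ0) w) := fun v w => by
    simp only [LinearMap.sub_apply, map_sub, hsk, hsk0]; ring
  obtain ⟨c, hc, hc2, hcF⟩ := hf.full.exists_cayley h2 hs10 (hξ1.sub hξ01)
  have hS : f.SMap (ξ - ξ0) := by
    have hx0 : ∀ k, (ξ - ξ0) (f.x k) = ξ (f.x k) := fun k => by
      change ξ (f.x k) - f.pr0 (ξ (f.pr0 (f.x k))) = _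
      rw [f.pr0_x, map_zero, map_zero, sub_zero]
    have hfil : ∀ k ≤ N, ξ (f.x k) ∈ f.P f.V0 (2 * (k : ℤ) - N + 2) := by
      intro k hk
      have h3 := Triple.weightSpace_le_fil le_rfl (hξx k hk)
      rw [hf.fil_eq] at h3
      refine P_mono le_rfl ?_ (P_parity ?_ (P_mono (f.F0_le _) le_rfl h3))
      · omega
      · exact ⟨k - a, by omega⟩
    refine SMap.of_generators (fun k hk hk1 => ?_) (fun b v hv => ?_) (fun k hk hk1 => ?_)
      fun k hk hk1 => ?_
    · rw [hx0]
      exact ⟨by rw [hp0 k hk hk1]; exact zero_mem _, (hfil k hk).2⟩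
    · have e : f.pr0 ((ξ - ξ0) v) = 0 := by
        change f.pr0 (ξ v - f.pr0 (ξ (f.pr0 v))) = 0
        rw [f.pr0_of_mem v (f.F0_le _ hv), map_sub, f.pr0_of_mem _ (f.pr0_mem _), sub_self]
      refine ⟨by rw [e]; exact zero_mem _, fun j hj hj1 => ?_⟩
      rw [hs10, hx0, ← form_pr0 (f.F0_le _ hv), hp0 j hj (by omega), map_zero, neg_zero]
    · rw [hx0]
      exact ⟨hL k hk hk1, fun j hj hj1 => (hfil k hk).2 j hj (by omega)⟩
    · rw [hx0]; exact hfil k hk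
  refine ⟨x * (c * hf.ext y)⁻¹, ?_, c, ⟨?_, hc⟩, y, hy, by group⟩
  · have hey := hf.ext_mem_unip hy
    have e : Sp.toEnd (x * (c * hf.ext y)⁻¹) - 1 =
        ((Sp.toEnd x - 1 - ξ) - (Sp.toEnd c - 1 - (ξ - ξ0)) - (Sp.toEnd (hf.ext y) - 1 - ξ0)
          - (Sp.toEnd c - 1) * (Sp.toEnd (hf.ext y) - 1)) * Sp.toEnd (c * hf.ext y)⁻¹ := by
      have h3 := Sp.toEnd_mul_inv (c * hf.ext y)
      have h4 : (Sp.toEnd x - 1 - ξ) - (Sp.toEnd c - 1 - (ξ - ξ0)) - (Sp.toEnd (hf.ext y) - 1 - ξ0)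
          - (Sp.toEnd c - 1) * (Sp.toEnd (hf.ext y) - 1) =
          Sp.toEnd x - Sp.toEnd (c * hf.ext y) := by
        rw [Sp.toEnd_mul]; noncomm_ring
      rw [h4, sub_mul, h3, Sp.toEnd_mul]
    change γ.RaisesZ 2 _
    rw [e]
    have h3 : γ.RaisesZ 2 (Sp.toEnd (hf.ext y) - 1 - ξ0) :=
      hf.raisesZ_ext hy2 fun v => by
        rw [LinearMap.sub_apply, hf.ext_sub_one, hξ'0]; rfl
    have h4 := ((raisesZ_of_mem hc).mul (raisesZ_of_mem hey)).mono (show (2 : ℤ) ≤ _ by norm_num)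
    exact ((((hξ2.sub hc2).sub h3).sub h4).mul
      (raisesZ_toEnd (inv_mem (mul_mem hc hey)))).mono (by norm_num)
  · refine mem_S.2 ?_
    exact ⟨fun i hi => hcF _ _ (P_mono le_rfl (by omega)) (hS.bot i hi),
      fun b => hcF _ _ (P_mono (f.F0_anti _ _ (by omega)) le_rfl) (hS.mid b),
      hcF _ _ (P_mono le_rfl (by omega)) hS.lag,
      fun i hi => hcF _ _ (P_mono le_rfl (by omega)) (hS.top i hi)⟩

/-- An element of `G_{≥ 1}` either pairs nontrivially with `S ∩ G_{≥ 1}` or factors. -/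
theorem commutator_or_factorization {ψ : AddChar K ℂ} (hψ : ψ ≠ 1) {x : Sp B}
    (hx : x ∈ γ.unip 1) :
    (∃ c ∈ f.S ⊓ γ.unip 1, x * c * x⁻¹ * c⁻¹ ∈ γ.unip 2 ∧
      psiLin ψ γ.Y (x * c * x⁻¹ * c⁻¹) ≠ 1) ∨
    ∃ z ∈ γ.unip 2, ∃ c ∈ f.S ⊓ γ.unip 1, ∃ y ∈ γ'.unip 1, x = z * c * hf.ext y := by
  classical
  obtain ⟨a, ha⟩ := f.odd
  set ξ := γ.gr1 (Sp.toEnd x - 1) with hξ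
  have hξ2 : γ.RaisesZ 2 (Sp.toEnd x - 1 - ξ) := hf.full.raisesZ_sub_gr1 (raisesZ_of_mem hx)
  have hpair : ∀ k ≤ N, ∀ i, 0 < i + (2 * (k : ℤ) - N + 2) → ∀ v ∈ γ.fil i,
      B v (ξ (f.x k)) = B v ((Sp.toEnd x - 1) (f.x k)) := by
    intro k hk i hi v hv
    have h3 := hf.full.form_fil_fil hi hv
      (hξ2 _ _ (Triple.weightSpace_le_fil le_rfl (hf.x_mem k hk)))
    rw [LinearMap.sub_apply, map_sub, sub_eq_zero] at h3
    exact h3.symm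
  -- the commutator of `x` and a transvection moving the string
  have key : ∀ k < N, ∀ m : ℤ, m = 2 * (k : ℤ) - N + 2 → ∀ v ∈ f.F0 (1 - m),
      f.pr0 ((Sp.toEnd x - 1) (f.x (k + 1))) ∈ f.F0 (m + 2) → B v (ξ (f.x k)) ≠ 0 →
      (∀ t : K, ∀ h, siegel f.alt (f.x (k + 1)) (t • v) h ∈ f.S) →
      ∃ c ∈ f.S ⊓ γ.unip 1, x * c * x⁻¹ * c⁻¹ ∈ γ.unip 2 ∧
        psiLin ψ γ.Y (x * c * x⁻¹ * c⁻¹) ≠ 1 := by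
    intro k hk m hm v hv h1 h3 h4
    -- The bracket has two terms. The one with `ξ (x (k + 1))` is orthogonal to `v` by the
    -- hypothesis on that vector, and the other is `-λ_k B v (ξ (x k))`.
    have hb : B v (⁅γ.Y, ξ⁆ (f.x (k + 1))) ≠ 0 := by
      have e1 : B v (γ.Y (ξ (f.x (k + 1)))) = 0 := by
        have h5 := skew f.skewY v (ξ (f.x (k + 1)))
        have hYv := f.Y_F0 _ _ hv
        rw [hpair (k + 1) (by omega) (1 - m - 2) (by push_cast; omega) _
          (hf.toCompatible.F0_le_fil _ hYv), ← form_pr0 (f.F0_le _ hYv),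
          f.F0_orth _ _ (by omega) _ hYv _ h1] at h5
        rw [← neg_eq_zero, ← h5]
      rw [Ring.lie_def, LinearMap.sub_apply, map_sub, Module.End.mul_apply, Module.End.mul_apply,
        e1, f.Y_x_succ k hk, map_smul, LinearMap.map_smul (B v), zero_sub, neg_ne_zero]
      exact mul_ne_zero (f.lam_ne k hk) h3
    have hev : B (f.x (k + 1)) v = 0 := by rw [form_swap f.alt, f.orth v (f.F0_le _ hv), neg_zero]
    obtain ⟨t, h, h5, h6, h7⟩ := hf.full.exists_commutator_ne_one hψ hx
      (hf.toCompatible.x_mem_fil (c := m) (by push_cast; omega)) (hf.toCompatible.F0_le_fil _ hv)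
      hev hb
    exact ⟨_, ⟨h4 t h, h5⟩, h6, h7⟩
  by_cases hA : ∀ k ≤ N, 1 ≤ 2 * (k : ℤ) - N →
      f.pr0 ((Sp.toEnd x - 1) (f.x k)) ∈ f.F0 (2 * k - N + 2)
  · by_cases hL : ∀ k ≤ N, 2 * (k : ℤ) - N = -1 → f.pr0 (ξ (f.x k)) ∈ f.L0
    · exact Or.inr (hf.exists_factorization hx hA hL)
    · push Not at hL
      obtain ⟨k, hk, hk1, hk2⟩ := hL
      obtain ⟨v, hv, hvb⟩ : ∃ v ∈ f.L0, B v (ξ (f.x k)) ≠ 0 := by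
        by_contra! h
        exact hk2 (f.L0_mem _ (f.pr0_mem _) fun w hw => by
          rw [form_pr0 (f.F0_le _ (f.L0_le hw))]; exact h w hw)
      have h3 := hA (k + 1) (by omega) (by push_cast; omega)
      rw [show 2 * ((k + 1 : ℕ) : ℤ) - N + 2 = 1 + 2 by push_cast; omega] at h3
      refine Or.inl (key k (by omega) 1 (by omega) v (by simpa using f.L0_le hv) h3 hvb
        fun t h => siegel_mem_S_of_lag (x_mem_P _ (by push_cast; omega))
          (Submodule.smul_mem _ _ hv) h)
  · left
    push Not at hA
    -- Taking the last failing vector makes the condition at `k + 1` available.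
    obtain ⟨k, ⟨hk, hk1, hk2⟩, hmax⟩ : ∃ k, (k ≤ N ∧ 1 ≤ 2 * (k : ℤ) - N ∧
        f.pr0 ((Sp.toEnd x - 1) (f.x k)) ∉ f.F0 (2 * k - N + 2)) ∧ ∀ j, k < j → j ≤ N →
        f.pr0 ((Sp.toEnd x - 1) (f.x j)) ∈ f.F0 (2 * j - N + 2) := by
      obtain ⟨k0, h0⟩ := hA
      have := Nat.findGreatest_spec (P := fun k => k ≤ N ∧ 1 ≤ 2 * (k : ℤ) - N ∧
        f.pr0 ((Sp.toEnd x - 1) (f.x k)) ∉ f.F0 (2 * k - N + 2)) h0.1 h0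
      refine ⟨_, this, fun j hj hjN => ?_⟩
      by_contra hj0
      exact Nat.findGreatest_is_greatest hj hjN ⟨hjN, by omega, hj0⟩
    have hkN : k < N := by
      refine lt_of_le_of_ne hk fun h => hk2 ?_
      have h1 := hf.pr0_mem_F0 (hx _ _ (Triple.weightSpace_le_fil le_rfl (hf.x_mem k hk)))
      rw [f.F0_bot _ (by push_cast; omega), Submodule.mem_bot] at h1
      rw [h1]; exact zero_mem _
    obtain ⟨v, hv, hvb⟩ : ∃ v ∈ f.F0 (1 - (2 * (k : ℤ) - N + 2)),
        B v ((Sp.toEnd x - 1) (f.x k)) ≠ 0 := by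
      by_contra! h
      refine hk2 ?_
      have := f.F0_mem _ _ (f.pr0_mem ((Sp.toEnd x - 1) (f.x k))) fun w hw => by
        rw [form_pr0 (f.F0_le _ hw)]; exact h w hw
      rwa [sub_sub_cancel] at this
    refine key k hkN _ rfl v hv ?_ ?_ fun t h => ?_
    · have := hmax (k + 1) (by omega) (by omega)
      push_cast at this
      convert this using 2
      ring
    · rwa [hpair k hk _ (by omega) v (hf.toCompatible.F0_le_fil _ hv)]
    · exact siegel_mem_S (m := 2 * (k : ℤ) - N + 2) (by omega)
        (x_mem_P _ (by push_cast; omega)) (V0_mem_P (Submodule.smul_mem _ _ (f.F0_le _ hv)) _) h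

variable [Finite (Sp B)] {ψ : AddChar K ℂ} (hψ : ψ ≠ 1)

section

variable {E : Type*} [AddCommGroup E] [Module ℂ E] (ω : Representation ℂ (γ.unip 1) E)

/-- The group `S ∩ G_{≥ 1}` as a subgroup of `G_{≥ 1}`. -/
def C (_ : Adapted γ γ' f) : Subgroup (γ.unip 1) := (f.S ⊓ γ.unip 1).subgroupOf (γ.unip 1)

omit [Finite (Sp B)] in
theorem mem_C {c : γ.unip 1} : c ∈ hf.C ↔ (c : Sp B) ∈ f.S :=
  ⟨fun h => (Subgroup.mem_subgroupOf.1 h).1, fun h => Subgroup.mem_subgroupOf.2 ⟨h, c.2⟩⟩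

omit [Finite (Sp B)] in
theorem isCharOn_C (ψ : AddChar K ℂ) :
    IsCharOn hf.C (fun u : γ.unip 1 => psiLin ψ γ.Y (u : Sp B)) :=
  ⟨(f.isCharOn_S ψ).one, fun g hg h hh =>
    (f.isCharOn_S ψ).mul g (hf.mem_C.1 hg) h (hf.mem_C.1 hh)⟩

/-- The embedding of the unipotent group of `γ'`. -/
def extUnip : γ'.unip 1 →* γ.unip 1 :=
  (hf.ext.comp (γ'.unip 1).subtype).codRestrict _ fun y => hf.ext_mem_unip y.2

/-- The invariants of `S ∩ G_{≥ 1}` as a representation of the unipotent group of `γ'`. -/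
def eigSub (ψ : AddChar K ℂ) : Subrepresentation (ω.comp hf.extUnip) where
  toSubmodule := eig ω hf.C (fun u : γ.unip 1 => psiLin ψ γ.Y (u : Sp B))
  apply_mem_toSubmodule y w hw := by
    intro c hc
    have hc' := hf.mem_C.1 hc
    have h1 := hf.conj_mem_S (inv_mem y.2) hc'
    have h2 := hf.psiLin_conj_S ψ (inv_mem y.2) hc'
    rw [map_inv, inv_inv] at h1 h2
    set Y : γ.unip 1 := hf.extUnip y with hY
    have h3 : Y⁻¹ * c * Y ∈ hf.C := hf.mem_C.2 h1
    have e : ω c (ω Y w) = ω Y (ω (Y⁻¹ * c * Y) w) := by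
      rw [← Module.End.mul_apply, ← Module.End.mul_apply, ← map_mul, ← map_mul]
      congr 2; group
    change ω c (ω Y w) = _ • ω Y w
    rw [e, hw _ h3, map_smul]
    exact congrArg (· • ω Y w) h2

variable {ω} (hi : ω.IsIrreducible)
  (hc : ∀ u : γ.unip 1, (u : Sp B) ∈ γ.unip 2 → ω u = psiLin ψ γ.Y (u : Sp B) • LinearMap.id)
include hi hc hψ

theorem finrank_eig_C_mul : finrank ℂ (eig ω hf.C (fun u : γ.unip 1 => psiLin ψ γ.Y (u : Sp B))) *
    Nat.card hf.C = finrank ℂ E *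
      Nat.card (hf.C ⊓ (γ.unip 2).subgroupOf (γ.unip 1) : Subgroup (γ.unip 1)) := by
  have := finiteDimensional_of_isIrreducible ω hi
  exact (hf.full.isHeis hψ).finrank_eig_mul_card (fun z hz => hc z hz) (hf.isCharOn_C ψ)
    fun _ _ _ => rfl

omit hψ hi [Finite (Sp B)] in
theorem eigSub_central : ∀ z ∈ (γ'.unip 2).subgroupOf (γ'.unip 1),
    (hf.eigSub ω ψ).toRepresentation z =
      psiLin ψ γ'.Y (z : Sp (B.restrict U)) • LinearMap.id := by
  intro z hz
  refine LinearMap.ext fun w => Subtype.ext ?_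
  have h := hc (hf.extUnip z) (hf.ext_mem_unip hz)
  have h1 : ((hf.extUnip z : γ.unip 1) : Sp B) = hf.ext z := rfl
  rw [h1, hf.psiLin_ext] at h
  exact LinearMap.congr_fun h w

/-- The dimension count makes the eigenspace nonzero. An element of `G_{≥ 1}` that does not factor
through `G_{≥ 2}`, `S` and `Sp(V0)` pairs nontrivially with `S`, so a subspace stable under the
group of `γ'` must be everything. -/
theorem isIrreducible_eigSub : (hf.eigSub ω ψ).toRepresentation.IsIrreducible := by
  have hfin := finiteDimensional_of_isIrreducible ω hi
  have hpos := finrank_pos_of_isIrreducible ω hi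
  have hne : 0 < finrank ℂ (hf.eigSub ω ψ).toSubmodule := by
    have h1 := hf.finrank_eig_C_mul hψ hi hc
    by_contra h0
    have h2 : finrank ℂ (eig ω hf.C (fun u : γ.unip 1 => psiLin ψ γ.Y (u : Sp B))) = 0 :=
      Nat.eq_zero_of_not_pos h0
    rw [h2, zero_mul] at h1
    exact (Nat.mul_pos hpos Nat.card_pos).ne h1
  have : Nontrivial (hf.eigSub ω ψ).toSubmodule :=
    Module.nontrivial_of_finrank_pos (R := ℂ) hne
  have hnt : Nontrivial (Subrepresentation (hf.eigSub ω ψ).toRepresentation) :=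
    ⟨⊥, ⊤, fun h => bot_ne_top (congrArg Subrepresentation.toSubmodule h)⟩
  refine @IsSimpleOrder.mk _ _ _ hnt fun D => ?_
  by_cases hD : D.toSubmodule = ⊥
  · exact Or.inl (by
      refine SetLike.ext fun w => ?_
      change w ∈ D.toSubmodule ↔ w ∈ (⊥ : Submodule ℂ _)
      rw [hD])
  · right
    have h1 := IsHeis.eig_eq_of_stable (ω := ω) (Z := (γ.unip 2).subgroupOf (γ.unip 1))
      (θ := fun u : γ.unip 1 => psiLin ψ γ.Y (u : Sp B)) (fun z hz => hc z hz) hi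
      (hf.isCharOn_C ψ) (Set.range hf.extUnip) (fun x => by
          rcases hf.commutator_or_factorization hψ x.2 with ⟨c, hc1, hc2, hc3⟩ |
            ⟨z, hz, c, hc1, y, hy, e⟩
          · exact Or.inl ⟨⟨c, hc1.2⟩, hf.mem_C.2 hc1.1, hc2, hc3⟩
          · exact Or.inr ⟨⟨z, Triple.Full.unip_anti (by norm_num) hz⟩, hz, ⟨c, hc1.2⟩,
              hf.mem_C.2 hc1.1, _, ⟨⟨y, hy⟩, rfl⟩, Subtype.ext e⟩)
      (D.toSubmodule.map (Submodule.subtype _)) (Submodule.map_subtype_le _ _)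
      (by
        rintro _ ⟨y, rfl⟩ _ ⟨w, hw, rfl⟩
        exact ⟨_, D.apply_mem_toSubmodule y hw, rfl⟩)
      (by
        intro h
        exact hD (Submodule.map_injective_of_injective (Submodule.subtype_injective _)
          (by rw [h, Submodule.map_bot])))
    refine SetLike.ext fun w => ⟨fun _ => Submodule.mem_top, fun _ => ?_⟩
    have h2 : (w : E) ∈ D.toSubmodule.map (Submodule.subtype _) := by rw [h1]; exact w.2
    obtain ⟨w', hw', e⟩ := h2
    have e' : w' = w := Subtype.ext e
    rw [← e']; exact hw'

variable {E' : Type*} [AddCommGroup E'] [Module ℂ E'] {ω' : Representation ℂ (γ'.unip 1) E'}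
  (hi' : ω'.IsIrreducible) (hc' : ∀ u : γ'.unip 1, (u : Sp (B.restrict U)) ∈ γ'.unip 2 →
    ω' u = psiLin ψ γ'.Y (u : Sp (B.restrict U)) • LinearMap.id) [Finite (Sp (B.restrict U))]
include hi' hc'

/-- Both spaces are irreducible for the Heisenberg group of `γ'` with the same central character,
and the square of the dimension is then the index of the center. -/
theorem finrank_eig_C :
    finrank ℂ (eig ω hf.C (fun u : γ.unip 1 => psiLin ψ γ.Y (u : Sp B))) = finrank ℂ E' := by
  have := finiteDimensional_of_isIrreducible ω hi
  have := finiteDimensional_of_isIrreducible ω' hi'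
  have h1 := (hf.full'.isHeis hψ).finrank_sq_mul_card (fun z hz => hc' z hz) hi'
  have hfin : FiniteDimensional ℂ (hf.eigSub ω ψ).toSubmodule :=
    FiniteDimensional.finiteDimensional_submodule _
  have h2 := (hf.full'.isHeis hψ).finrank_sq_mul_card (ω := (hf.eigSub ω ψ).toRepresentation)
    (hf.eigSub_central hc) (hf.isIrreducible_eigSub hψ hi hc)
  have h3 : finrank ℂ (hf.eigSub ω ψ).toSubmodule = finrank ℂ E' :=
    Nat.mul_self_inj.1 (Nat.eq_of_mul_eq_mul_right Nat.card_pos (h2.trans h1.symm))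
  exact h3

/-- The first coefficient in terms of the group `S`. -/
theorem finrank_intertwining_mul {W : Type*} [AddCommGroup W] [Module ℂ W] [FiniteDimensional ℂ W]
    (π : Representation ℂ (Sp B) W) :
    finrank ℂ (Representation.IntertwiningMap ω (π.comp (γ.unip 1).subtype)) * finrank ℂ E' =
      finrank ℂ (eig π f.S (psiLin ψ γ.Y)) := by
  have h1 := (hf.full.isHeis hψ).finrank_intertwining_mul_finrank (fun z hz => hc z hz) hi
    (π.comp (γ.unip 1).subtype)
  have h2 := (hf.full.isHeis hψ).finrank_eig_inf_mul_card (π.comp (γ.unip 1).subtype)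
    (fun g z hz => hf.full.conj_unip_two ψ g.2 hz) (hf.isCharOn_C ψ) (fun _ _ _ => rfl)
  have h3 := hf.finrank_eig_C_mul hψ hi hc
  -- The three counts combine so that the order of `C` cancels: the multiplicity of `ω` in `π` times
  -- the dimension of its `C`-eigenspace.
  rw [← h1, mul_assoc, ← h3, ← mul_assoc, hf.finrank_eig_C hψ hi hc hi' hc'] at h2
  rw [hf.toCompatible.finrank_eig_S hψ π, ← Nat.eq_of_mul_eq_mul_right Nat.card_pos h2]
  have h4 : eig (π.comp (γ.unip 1).subtype) hf.C (fun u : γ.unip 1 => psiLin ψ γ.Y (u : Sp B)) =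
      eig π (f.S ⊓ γ.unip 1) (psiLin ψ γ.Y) := by
    ext w
    exact ⟨fun hw c hc => hw ⟨c, hc.2⟩ (hf.mem_C.2 hc.1), fun hw c hc => hw c ⟨hf.mem_C.1 hc, c.2⟩⟩
  have h5 : eig (π.comp (γ.unip 1).subtype) ((γ.unip 2).subgroupOf (γ.unip 1))
      (fun u : γ.unip 1 => psiLin ψ γ.Y (u : Sp B)) = eig π (γ.unip 2) (psiLin ψ γ.Y) := by
    ext w
    exact ⟨fun hw c hc => hw ⟨c, Triple.Full.unip_anti (by norm_num) hc⟩ hc,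
      fun hw c hc => hw c hc⟩
  rw [h4, h5]

end

end Adapted

end IteratedLeft

end
end SpFourier

namespace SpFourier
noncomputable section

/-! ### The cocharacter of a triple -/

section Torus

variable {K : Type*} [Field K] {V : Type*} [AddCommGroup V] [Module K V]
variable {B : LinearMap.BilinForm K V} {γ : Triple B}

namespace Triple.Full

variable (hγ : γ.Full)
include hγ

variable (γ) in
/-- The endomorphism acting on the weight space of weight `j` by `c ^ j`. -/
def _root_.SpFourier.Triple.torusEnd (c : Kˣ) : Module.End K V :=
  ∑ j ∈ Finset.Ioo (-(finrank K V : ℤ)) (finrank K V), ((c ^ j : Kˣ) : K) • γ.proj j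

theorem torusEnd_apply (c : Kˣ) {j : ℤ} {v : V} (hv : v ∈ γ.weightSpace j) :
    γ.torusEnd c v = ((c ^ j : Kˣ) : K) • v := by
  by_cases hj : |j| < (finrank K V : ℤ)
  · rw [Triple.torusEnd, LinearMap.sum_apply, Finset.sum_eq_single j]
    · simp [hγ.proj_apply_of_mem hv]
    · intro i _ hi
      simp [hγ.proj_apply_of_mem hv, Ne.symm hi]
    · intro h
      exact absurd (Finset.mem_Ioo.2 (abs_lt.1 hj)) h
  · rw [weightSpace_eq_bot (not_lt.1 hj)] at hv
    rw [(Submodule.mem_bot K).1 hv]; simp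

theorem torusEnd_mul (c d : Kˣ) (h : c * d = 1) : γ.torusEnd c * γ.torusEnd d = 1 :=
  hγ.ext fun j v hv => by
    rw [Module.End.mul_apply, hγ.torusEnd_apply d hv, map_smul, hγ.torusEnd_apply c hv, smul_smul,
      ← Units.val_mul, ← mul_zpow, mul_comm d, h, one_zpow]
    simp

/-- The cocharacter of a triple. -/
def torus (c : Kˣ) : Sp B :=
  ⟨LinearEquiv.ofLinearMap (γ.torusEnd c) (γ.torusEnd c⁻¹)
    (hγ.torusEnd_mul _ _ (by simp)) (hγ.torusEnd_mul _ _ (by simp)), by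
    intro v w
    change B (γ.torusEnd c v) (γ.torusEnd c w) = B v w
    have h : (B ∘ₗ γ.torusEnd c).compl₂ (γ.torusEnd c) = B :=
      hγ.ext fun i u hu => hγ.ext fun j u' hu' => by
        simp only [LinearMap.compl₂_apply, LinearMap.comp_apply, hγ.torusEnd_apply c hu,
          hγ.torusEnd_apply c hu', map_smul, LinearMap.smul_apply, smul_eq_mul]
        by_cases hij : i + j = 0
        · rw [← mul_assoc, ← Units.val_mul, ← zpow_add, add_comm, hij]; simp
        · rw [hγ.form_eq_zero hij hu hu']; simp
    exact LinearMap.congr_fun (LinearMap.congr_fun h v) w⟩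

theorem torus_apply (c : Kˣ) {j : ℤ} {v : V} (hv : v ∈ γ.weightSpace j) :
    Sp.toEnd (hγ.torus c) v = ((c ^ j : Kˣ) : K) • v := hγ.torusEnd_apply c hv

theorem raisesZ_torus (c : Kˣ) : γ.RaisesZ 0 (Sp.toEnd (hγ.torus c)) :=
  raisesZ_of_weightSpace fun j v hv => by
    rw [hγ.torus_apply c hv]
    exact Submodule.smul_mem _ _ (weightSpace_le_fil (by omega) hv)

theorem torus_inv (c : Kˣ) : (hγ.torus c)⁻¹ = hγ.torus c⁻¹ := by
  rw [inv_eq_iff_mul_eq_one]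
  exact Sp.toEnd_injective (hγ.torusEnd_mul _ _ (by simp))

/-- The torus acts trivially in weight zero. Hence it stabilizes every subspace between `fil 1` and
`fil 0`, in particular `L0`. -/
theorem torus_sub_mem (c : Kˣ) {v : V} (hv : v ∈ γ.fil 0) :
    Sp.toEnd (hγ.torus c) v - v ∈ γ.fil 1 := by
  have h1 := hγ.sub_proj_mem hv
  have h2 := hγ.raisesZ_torus c _ _ h1
  have h3 := hγ.torus_apply c (hγ.proj_mem 0 v)
  rw [map_sub, h3, zpow_zero, Units.val_one, one_smul] at h2
  have := sub_mem h2 h1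
  simpa using this

variable [FiniteDimensional K V]

theorem torus_conj_mem (c : Kˣ) {k : ℕ} {u : Sp B} (hu : u ∈ γ.unip k) :
    hγ.torus c * u * (hγ.torus c)⁻¹ ∈ γ.unip k := by
  change γ.RaisesZ k _
  rw [Sp.conj_sub_one, torus_inv]
  exact (((hγ.raisesZ_torus c).mul (raisesZ_of_mem hu)).mul (hγ.raisesZ_torus _)).mono (by simp)

/-- An element of `G_{≥ 2}` commuting with a generic element of the torus is trivial. -/
theorem eq_one_of_commute_torus {c : Kˣ} (hc : 2 * finrank K V ≤ orderOf c)
    {u : Sp B} (hu : u ∈ γ.unip 2) (h : hγ.torus c * u = u * hγ.torus c) : u = 1 := by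
  refine Sp.toEnd_injective ?_
  rw [Sp.toEnd_one, ← sub_eq_zero]
  refine hγ.ext fun j v hv => ?_
  set w := (Sp.toEnd u - 1) v with hw
  have hwf : w ∈ γ.fil (j + 2) := hu _ _ (weightSpace_le_fil le_rfl hv)
  by_cases hj : |j| < (finrank K V : ℤ)
  swap
  · rw [weightSpace_eq_bot (not_lt.1 hj)] at hv
    rw [hw, (Submodule.mem_bot K).1 hv, map_zero, map_zero]
  have h1 : Sp.toEnd (hγ.torus c) w = ((c ^ j : Kˣ) : K) • w := by
    have h2 : Sp.toEnd (hγ.torus c) (Sp.toEnd u v) = Sp.toEnd u (Sp.toEnd (hγ.torus c) v) :=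
      LinearMap.congr_fun (congrArg Sp.toEnd h) v
    rw [hγ.torus_apply c hv, map_smul] at h2
    rw [hw, LinearMap.sub_apply, Module.End.one_apply, map_sub, h2, hγ.torus_apply c hv, smul_sub]
  have h3 : ∀ i, γ.proj i w = 0 := by
    intro i
    by_cases hij : i < j + 2
    · exact hγ.mem_fil_iff.1 hwf i hij
    by_cases hi : |i| < (finrank K V : ℤ)
    swap
    · rw [Triple.proj, if_neg hi]; rfl
    have h4 : ∀ x, γ.proj i (Sp.toEnd (hγ.torus c) x) = ((c ^ i : Kˣ) : K) • γ.proj i x := by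
      intro x
      have : γ.proj i ∘ₗ Sp.toEnd (hγ.torus c) = ((c ^ i : Kˣ) : K) • γ.proj i :=
        hγ.ext fun l y hy => by
          rw [LinearMap.comp_apply, hγ.torus_apply c hy, map_smul, LinearMap.smul_apply,
            hγ.proj_apply_of_mem hy]
          split_ifs with hl
          · rw [hl]
          · simp
      exact LinearMap.congr_fun this x
    have h5 := h4 w
    rw [h1, map_smul, ← sub_eq_zero, ← sub_smul, smul_eq_zero, sub_eq_zero, Units.val_inj] at h5
    refine h5.resolve_left fun h6 => ?_
    rw [abs_lt] at hi hj
    -- A component of `(u - 1) v` in weight `i` would need `c ^ i = c ^ j`, but `0 < i - j < 2 dim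
    -- V`, which does not exceed the order of `c`.
    have h7 : c ^ (i - j) = 1 := by rw [zpow_sub, h6, mul_inv_cancel]
    have h8 := orderOf_dvd_iff_zpow_eq_one.2 h7
    have h9 := Int.le_of_dvd (by omega) h8
    omega
  rw [← hγ.sum_proj w, Finset.sum_eq_zero fun i _ => h3 i]
  rfl

end Triple.Full

/-- A generator of the cyclic group `Kˣ` has order at least `p - 1`. -/
theorem exists_orderOf_ge [Finite K] {n : ℕ} (h : n < ringChar K) : ∃ c : Kˣ, n ≤ orderOf c := by
  obtain ⟨c, hc⟩ := IsCyclic.exists_generator (α := Kˣ)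
  refine ⟨c, ?_⟩
  rw [orderOf_eq_card_of_forall_mem_zpowers hc, Nat.card_units]
  have h1 : ringChar K ≤ Nat.card K := by
    have := Fintype.ofFinite K
    rw [Nat.card_eq_fintype_card]
    obtain ⟨m, hm, hm2⟩ := FiniteField.card K (ringChar K)
    rw [hm2]
    exact Nat.le_self_pow m.ne_zero _
  omega

end Torus

/-! ### The polarization `S ∩ G_{≥ 1}` for the triple `γ₁` -/

section Stage

variable {K : Type*} [Field K] {V : Type*} [AddCommGroup V] [Module K V]
variable {B : LinearMap.BilinForm K V}

/-- The data of an iterated Fourier coefficient: `γ` agrees with `γ₁` on the string and with `γ'`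
on the space fixed by `γ₁`. -/
structure Stage (γ₁ γ : Triple B) (γ' : Triple (B.restrict γ₁.fixed)) {N : ℕ}
    (f : Frame B γ.Y N) : Prop extends Adapted γ γ' f where
  full₁ : γ₁.Full
  fil₁_pos : ∀ c, 1 ≤ c → γ₁.fil c = f.P ⊥ c
  fil₁_nonpos : ∀ c ≤ 0, γ₁.fil c = f.P f.V0 c
  x_mem₁ : ∀ k ≤ N, f.x k ∈ γ₁.weightSpace (2 * (k : ℤ) - N)
  Y₁_x : ∀ k ≤ N, γ₁.Y (f.x k) = γ.Y (f.x k)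

namespace Stage

open _root_.SpFourier.Frame Triple.Full

variable {γ₁ γ : Triple B} {γ' : Triple (B.restrict γ₁.fixed)} {N : ℕ}
  {f : Frame B γ.Y N} (hf : Stage γ₁ γ γ' f)
include hf

theorem Y₁_apply {v : V} (hv : v ∈ f.V0) : γ₁.Y v = 0 := by
  rw [hf.V0_eq] at hv; exact hv.2

theorem V0_le_fil₁ : f.V0 ≤ γ₁.fil 0 := fun v hv => by
  rw [hf.fil₁_nonpos 0 le_rfl]; exact V0_mem_P hv 0

variable [FiniteDimensional K V]

/-- On the string, degree one for `γ₁` means degree two modulo `V0`, by parity. So the only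
remaining condition of `S` is the Lagrangian one at weight `-1`. -/
theorem mem_S_iff {x : Sp B} (hx : x ∈ γ₁.unip 1) :
    x ∈ f.S ↔ ∀ k ≤ N, 2 * (k : ℤ) - N = -1 → f.pr0 ((Sp.toEnd x - 1) (f.x k)) ∈ f.L0 := by
  obtain ⟨a, ha⟩ := f.odd
  constructor
  · exact fun h k hk hk1 => ((mem_S.1 h).lag _ (x_mem_P _ (by omega))).1
  · intro h
    have hr := fun k hk => hx _ _ (Triple.weightSpace_le_fil le_rfl (hf.x_mem₁ k hk))
    refine mem_S.2 (SMap.of_generators (fun k hk hk1 => ?_) (fun b v hv => ?_) (fun k hk hk1 => ?_)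
      fun k hk hk1 => ?_)
    · have h1 := hr k hk
      rw [hf.fil₁_pos _ (by push_cast; omega)] at h1
      exact P_mono le_rfl (by push_cast; omega) (P_parity (⟨k - a, by push_cast; omega⟩) h1)
    · have h1 := hx _ _ (hf.V0_le_fil₁ (f.F0_le _ hv))
      rw [hf.fil₁_pos _ (by simp)] at h1
      exact P_mono bot_le (by simp) h1
    · have h1 := hr k hk
      rw [hf.fil₁_nonpos _ (by push_cast; omega)] at h1
      exact ⟨h k hk hk1, (P_mono le_rfl (by push_cast; omega)
        (P_parity (⟨k - a, by push_cast; omega⟩) h1)).2⟩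
    · have h1 := hr k hk
      rw [hf.fil₁_nonpos _ (by push_cast; omega)] at h1
      exact P_mono le_rfl (by push_cast; omega) (P_parity (⟨k - a, by push_cast; omega⟩) h1)

theorem unip₁_two_le : γ₁.unip 2 ≤ f.S := fun x hx => by
  refine (hf.mem_S_iff (unip_anti (by norm_num) hx)).2 fun k hk hk1 => ?_
  have h1 := hx _ _ (Triple.weightSpace_le_fil le_rfl (hf.x_mem₁ k hk))
  rw [hf.fil₁_pos _ (by push_cast; omega)] at h1
  rw [(Submodule.mem_bot K).1 h1.1]; exact zero_mem _

theorem pr0_sub_one {x : Sp B} (hx : x ∈ γ₁.unip 1) {v : V} (hv : v ∈ f.V0) :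
    f.pr0 ((Sp.toEnd x - 1) v) = 0 := by
  have h1 := hx _ _ (hf.V0_le_fil₁ hv)
  rw [hf.fil₁_pos _ (by simp)] at h1
  exact (Submodule.mem_bot K).1 h1.1

/-- The two characters agree on `G_{≥ 1}`. -/
theorem psiLin_eq (ψ : AddChar K ℂ) {x : Sp B} (hx : x ∈ γ₁.unip 1) :
    psiLin ψ γ.Y x = psiLin ψ γ₁.Y x := by
  -- The difference is supported on `V0`, and the compression of `x - 1` to `V0` is zero.
  set D := γ.Y - γ₁.Y with hD
  have hDx : ∀ v, f.pr0 v = 0 → D v = 0 := by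
    have h1 : f.P ⊥ (-N - 2) ≤ LinearMap.ker D := P_le (by simp) fun k hk _ => by
      rw [LinearMap.mem_ker, hD, LinearMap.sub_apply, hf.Y₁_x k hk, sub_self]
    exact fun v hv => h1 ⟨by rw [hv]; exact zero_mem _, fun k hk h => by omega⟩
  have hDp : D = f.pr0 * D * f.pr0 := by
    refine LinearMap.ext fun v => ?_
    have h1 : D (v - f.pr0 v) = 0 := hDx _ (by rw [map_sub, f.pr0_of_mem _ (f.pr0_mem v), sub_self])
    rw [map_sub, sub_eq_zero] at h1
    have h2 : D (f.pr0 v) ∈ f.V0 := by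
      rw [hD, LinearMap.sub_apply, hf.Y₁_apply (f.pr0_mem v), sub_zero]
      have := f.pr0_mem v
      rw [← f.F0_top (-N) le_rfl] at this
      exact f.F0_le _ (f.Y_F0 _ _ this)
    rw [Module.End.mul_apply, Module.End.mul_apply, h1, f.pr0_of_mem _ h2]
  have h0 : f.pr0 * (Sp.toEnd x - 1) * f.pr0 = 0 :=
    LinearMap.ext fun v => hf.pr0_sub_one hx (f.pr0_mem v)
  have h1 : LinearMap.trace K V (D * (Sp.toEnd x - 1)) = 0 := by
    rw [hDp, mul_assoc, mul_assoc, LinearMap.trace_mul_comm, mul_assoc, h0, mul_zero, map_zero]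
  rw [psiLin, psiLin]
  rw [hD, sub_mul, map_sub, sub_eq_zero] at h1
  rw [h1]

theorem ext_mem_S {m : Sp (B.restrict γ₁.fixed)} (hm : m ∈ γ'.unip 2) : hf.ext m ∈ f.S := by
  have h0 : ∀ v, f.pr0 v = 0 → (Sp.toEnd (hf.ext m) - 1) v = 0 := fun v hv => by
    have e : (⟨f.pr0 v, hf.pr0_mem_U v⟩ : γ₁.fixed) = 0 := Subtype.ext hv
    rw [hf.ext_sub_one, e]; simp
  refine mem_S.2 (SMap.of_generators (fun k hk hk1 => ?_) (fun b v hv => ?_) (fun k hk hk1 => ?_)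
      fun k hk hk1 => ?_)
  · rw [h0 _ (f.pr0_x k)]; exact zero_mem _
  · have h1 := hf.ext_sub_one_mem_F0 hm (c := b) (v := v) (by rwa [f.pr0_of_mem v (f.F0_le _ hv)])
    exact mem_P_of_mem (f.F0_le _) h1 _
  · rw [h0 _ (f.pr0_x k)]; exact zero_mem _
  · rw [h0 _ (f.pr0_x k)]; exact zero_mem _

/-- `S` is generated by its intersection with `γ₁.unip 1` and by `γ'.unip 2`. -/
theorem exists_factor {g : Sp B} (hg : g ∈ f.S) :
    ∃ a ∈ f.S ⊓ γ₁.unip 1, ∃ m ∈ γ'.unip 2, g = a * hf.ext m := by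
  have sg := mem_S.1 hg
  -- Modulo the positive string, which is isotropic and orthogonal to `V0`, the element `g`
  -- preserves `V0`. Its compression `T` is therefore an isometry `m` of `V0`, and `g m⁻¹` lies in
  -- the group of `γ₁`.
  have hV : ∀ v ∈ f.V0, Sp.toEnd g v - f.pr0 (Sp.toEnd g v) ∈ f.P ⊥ 1 := by
    intro v hv
    rw [← f.F0_top (-N) le_rfl] at hv
    have h1 := sg.mid _ _ (mem_P_of_mem (f.F0_le _) hv 1)
    refine ⟨by rw [map_sub, f.pr0_of_mem _ (f.pr0_mem _), sub_self]; exact zero_mem _,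
      fun k hk hk1 => ?_⟩
    have h2 := h1.2 k hk hk1
    rw [LinearMap.sub_apply, Module.End.one_apply, map_sub, LinearMap.sub_apply,
      f.orth v (f.F0_le _ hv), sub_zero] at h2
    rw [map_sub, LinearMap.sub_apply, h2, f.orth _ (f.pr0_mem _), sub_zero]
  let T : Module.End K γ₁.fixed := LinearMap.codRestrict _ (f.pr0 ∘ₗ Sp.toEnd g ∘ₗ
    γ₁.fixed.subtype) fun u => hf.pr0_mem_U _
  have hu : ∀ u : γ₁.fixed, (u : V) ∈ f.V0 := fun u => by rw [hf.V0_eq]; exact u.2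
  have hTu : ∀ u, (T u : V) = f.pr0 (Sp.toEnd g u) := fun u => rfl
  have hiso : ∀ u w, B.restrict γ₁.fixed (T u) (T w) = B.restrict γ₁.fixed u w := by
    intro u w
    change B (T u : V) (T w : V) = B (u : V) w
    rw [hTu, hTu, ← Sp.form_apply g u w]
    have h1 := hV _ (hu u)
    have h2 := hV _ (hu w)
    have e1 : B (f.pr0 (Sp.toEnd g u)) (Sp.toEnd g w - f.pr0 (Sp.toEnd g w)) = 0 := by
      rw [form_swap f.alt, mem_bot_P_orth h2 (f.pr0_mem _), neg_zero]
    have e2 : B (Sp.toEnd g u - f.pr0 (Sp.toEnd g u)) (f.pr0 (Sp.toEnd g w)) = 0 :=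
      mem_bot_P_orth h1 (f.pr0_mem _)
    have e3 : B (Sp.toEnd g u - f.pr0 (Sp.toEnd g u)) (Sp.toEnd g w - f.pr0 (Sp.toEnd g w)) = 0 :=
      form_bot_P bot_le (by norm_num) h1 h2
    simp only [map_sub, LinearMap.sub_apply] at e1 e2 e3
    linear_combination -e3 - e1 - e2
  have hinj : Function.Injective T := by
    rw [← LinearMap.ker_eq_bot, LinearMap.ker_eq_bot']
    intro u h
    refine Subtype.ext (F0_nondeg (f := f) (hu u) fun w hw => ?_)
    have := hiso ⟨w, by rw [← hf.V0_eq]; exact hw⟩ u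
    rw [h, map_zero] at this
    exact this.symm
  let m : Sp (B.restrict γ₁.fixed) := ⟨LinearEquiv.ofInjectiveEndo T hinj, hiso⟩
  have hmT : ∀ u, Sp.toEnd m u = T u := fun u => rfl
  have hm : m ∈ γ'.unip 2 := by
    intro i u hiu
    rw [← hf.F0_mem_iff] at hiu ⊢
    have h1 := (sg.mid i _ (mem_P_of_mem (f.F0_le _) hiu 1)).1
    rw [LinearMap.sub_apply, Module.End.one_apply, map_sub, f.pr0_of_mem _ (hu u)] at h1
    exact h1
  have haS : g * (hf.ext m)⁻¹ ∈ f.S := mul_mem hg (inv_mem (hf.ext_mem_S hm))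
  set a := g * (hf.ext m)⁻¹ with ha
  refine ⟨a, ⟨haS, ?_⟩, m, hm, by rw [ha]; group⟩
  have sa := mem_S.1 haS
  have haV : ∀ v ∈ f.V0, (Sp.toEnd a - 1) v ∈ f.P ⊥ 1 := by
    intro v hv
    let w : γ₁.fixed := Sp.toEnd m⁻¹ ⟨v, by rw [← hf.V0_eq]; exact hv⟩
    have e1 : Sp.toEnd m w = ⟨v, by rw [← hf.V0_eq]; exact hv⟩ := Sp.apply_inv_apply _ _
    have e2 : Sp.toEnd (hf.ext m) w = v := by
      have h1 := hf.ext_sub_one m (w : V)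
      have h2 : (⟨f.pr0 w, hf.pr0_mem_U w⟩ : γ₁.fixed) = w := Subtype.ext (f.pr0_of_mem _ (hu w))
      rw [h2, LinearMap.sub_apply, LinearMap.sub_apply, e1] at h1
      simpa using h1
    have e3 : Sp.toEnd a v = Sp.toEnd g w := by
      rw [ha, Sp.toEnd_mul, Module.End.mul_apply, ← e2, Sp.inv_apply_apply]
    have e4 : f.pr0 (Sp.toEnd g w) = v := by rw [← hTu, ← hmT, e1]
    have := hV _ (hu w)
    rw [e4] at this
    rw [LinearMap.sub_apply, e3]
    exact this
  intro c v hv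
  push_cast
  rcases lt_trichotomy c 0 with hc | rfl | hc
  · rw [hf.fil₁_nonpos c hc.le] at hv
    rw [hf.fil₁_nonpos _ (by omega)]
    exact P_mono le_rfl (by omega) (sa.top c (by omega) v hv)
  · rw [hf.fil₁_nonpos 0 le_rfl] at hv
    rw [hf.fil₁_pos _ (by norm_num)]
    obtain ⟨b, hb⟩ := f.odd
    refine P_le (M := (f.P ⊥ (0 + 1)).comap (Sp.toEnd a - 1)) haV (fun k hk hk1 => ?_) hv
    exact P_mono le_rfl (by omega) (sa.bot (2 * k - N) (by omega) _ (x_mem_P _ le_rfl))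
  · rw [hf.fil₁_pos c (by omega)] at hv
    rw [hf.fil₁_pos _ (by omega)]
    exact P_mono le_rfl (by omega) (sa.bot c (by omega) v hv)

/-- An element of `γ₁.unip 1` outside of `S` pairs nontrivially with `S`. -/
theorem exists_commutator {ψ : AddChar K ℂ} (hψ : ψ ≠ 1) {x : Sp B}
    (hx : x ∈ γ₁.unip 1) (hxS : x ∉ f.S) :
    ∃ c ∈ f.S ⊓ γ₁.unip 1, x * c * x⁻¹ * c⁻¹ ∈ γ₁.unip 2 ∧
      psiLin ψ γ₁.Y (x * c * x⁻¹ * c⁻¹) ≠ 1 := by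
  obtain ⟨a, ha⟩ := f.odd
  rw [hf.mem_S_iff hx] at hxS
  push Not at hxS
  obtain ⟨k, hk, hk1, hk2⟩ := hxS
  obtain ⟨v, hv, hvb⟩ : ∃ v ∈ f.L0, B v ((Sp.toEnd x - 1) (f.x k)) ≠ 0 := by
    by_contra! h
    exact hk2 (f.L0_mem _ (f.pr0_mem _) fun w hw => by
      rw [form_pr0 (f.F0_le _ (f.L0_le hw))]; exact h w hw)
  have hv0 := f.F0_le _ (f.L0_le hv)
  set ξ := γ₁.gr1 (Sp.toEnd x - 1) with hξ
  -- Here `Y₁` kills `v`, so only the term `λ_k B v (ξ (x k))` remains. It is nonzero because `v` in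
  -- `L0` detects the component outside of `L0`.
  have hb : B v (⁅γ₁.Y, ξ⁆ (f.x (k + 1))) ≠ 0 := by
    have e1 : B v (γ₁.Y (ξ (f.x (k + 1)))) = 0 := by
      have h5 := skew γ₁.Y_mem v (ξ (f.x (k + 1)))
      rw [hf.Y₁_apply hv0, map_zero, LinearMap.zero_apply] at h5
      rw [← neg_eq_zero, ← h5]
    have e2 : B v (ξ (f.x k)) = B v ((Sp.toEnd x - 1) (f.x k)) := by
      have h3 := hf.full₁.raisesZ_sub_gr1 (raisesZ_of_mem hx) _ _
        (Triple.weightSpace_le_fil le_rfl (hf.x_mem₁ k hk))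
      have h4 := hf.full₁.form_fil_fil (by omega) (hf.V0_le_fil₁ hv0) h3
      rw [LinearMap.sub_apply, map_sub, sub_eq_zero] at h4
      exact h4.symm
    rw [Ring.lie_def, LinearMap.sub_apply, map_sub, Module.End.mul_apply, Module.End.mul_apply,
      e1, hf.Y₁_x (k + 1) (by omega), f.Y_x_succ k (by omega), map_smul, LinearMap.map_smul (B v),
      zero_sub, neg_ne_zero, e2]
    exact mul_ne_zero (f.lam_ne k (by omega)) hvb
  have hev : B (f.x (k + 1)) v = 0 := by rw [form_swap f.alt, f.orth v hv0, neg_zero]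
  obtain ⟨t, h, h5, h6, h7⟩ := hf.full₁.exists_commutator_ne_one hψ hx (i := 1)
    (Triple.weightSpace_le_fil (by push_cast; omega) (hf.x_mem₁ (k + 1) (by omega)))
    (by simpa using hf.V0_le_fil₁ hv0) hev hb
  exact ⟨_, ⟨siegel_mem_S_of_lag (x_mem_P _ (by push_cast; omega)) (Submodule.smul_mem _ _ hv) h,
    h5⟩, h6, h7⟩

end Stage

end Stage

end
end SpFourier

namespace SpFourier
noncomputable section

/-! ### Coefficients as intertwining spaces -/

section Coeff

variable {K : Type*} [Field K] {V : Type*} [AddCommGroup V] [Module K V] [FiniteDimensional K V]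
variable {B : LinearMap.BilinForm K V}
variable {W : Type*} [AddCommGroup W] [Module ℂ W] {E : Type*} [AddCommGroup E] [Module ℂ E]

/-- An element of `G_{≥ 1}` as an element of `M_X · G_{≥ 1}`. -/
abbrev Triple.inr (γ : Triple B) : γ.unip 1 →* γ.jacobi :=
  Subgroup.inclusion (le_sup_right : γ.unip 1 ≤ γ.jacobi)

/-- The restriction of a representation of `M_X · G_{≥ 1}` to `G_{≥ 1}`. -/
abbrev Triple.resUnip (γ : Triple B) (ω : Representation ℂ γ.jacobi E) :
    Representation ℂ (γ.unip 1) E := ω.comp γ.inr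

/-- The coefficient space is a space of intertwining maps. -/
def coeffEquiv (γ : Triple B) (ω : Representation ℂ γ.jacobi E) (π : Representation ℂ (Sp B) W) :
    coeff γ ω π ≃ₗ[ℂ]
      Representation.IntertwiningMap (γ.resUnip ω) (π.comp (γ.unip 1).subtype) where
  toFun φ := ⟨φ.1, fun u => (φ.2 (γ.inr u) u.2).symm⟩
  map_add' _ _ := rfl
  map_smul' _ _ := rfl
  invFun φ := ⟨φ.toLinearMap, fun u hu => (φ.isIntertwining' ⟨u, hu⟩).symm⟩
  left_inv _ := rfl
  right_inv _ := rfl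

variable {γ : Triple B}

theorem IsWeil.resUnip_two (hγ : γ.Full) {ψ : AddChar K ℂ} {ω : Representation ℂ γ.jacobi E}
    (hω : IsWeil γ ψ ω) (u : γ.unip 1) (hu : (u : Sp B) ∈ γ.unip 2) :
    γ.resUnip ω u = psiLin ψ γ.Y (u : Sp B) • LinearMap.id := by
  rw [← hγ.psi_eq_psiLin ψ hu]
  exact hω.central _ hu

/-- The dimension of a coefficient. -/
theorem finrank_coeff_mul [Finite (Sp B)] (hγ : γ.Full) {ψ : AddChar K ℂ} (hψ : ψ ≠ 1)
    {ω : Representation ℂ γ.jacobi E} (hω : IsWeil γ ψ ω) [FiniteDimensional ℂ W]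
    (π : Representation ℂ (Sp B) W) :
    finrank ℂ (coeff γ ω π) * finrank ℂ E = finrank ℂ (eig π (γ.unip 2) (psiLin ψ γ.Y)) := by
  have h : eig (π.comp (γ.unip 1).subtype) ((γ.unip 2).subgroupOf (γ.unip 1))
      (fun u : γ.unip 1 => psiLin ψ γ.Y (u : Sp B)) = eig π (γ.unip 2) (psiLin ψ γ.Y) := by
    ext w
    exact ⟨fun hw c hc => hw ⟨c, Triple.Full.unip_anti (by norm_num) hc⟩ hc,
      fun hw c hc => hw c hc⟩
  rw [(coeffEquiv γ ω π).finrank_eq, (hγ.isHeis hψ).finrank_intertwining_mul_finrank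
    (fun z hz => hω.resUnip_two hγ z hz) hω.irreducible, h]

end Coeff

/-! ### The iterated coefficient as an eigenspace of `S` -/

section StageRep

variable {K : Type*} [Field K] {V : Type*} [AddCommGroup V] [Module K V] [FiniteDimensional K V]
variable {B : LinearMap.BilinForm K V}

namespace Stage

open _root_.SpFourier.Frame Triple.Full

variable {γ₁ γ : Triple B} {γ' : Triple (B.restrict γ₁.fixed)} {N : ℕ}
  {f : Frame B γ.Y N} (hf : Stage γ₁ γ γ' f)

/-- The group `S ∩ G_{≥ 1}` for the triple `γ₁`. -/
def A (_ : Stage γ₁ γ γ' f) : Subgroup (γ₁.unip 1) := f.S.subgroupOf (γ₁.unip 1)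

include hf

theorem isCharOn_A (ψ : AddChar K ℂ) :
    IsCharOn hf.A (fun u : γ₁.unip 1 => psiLin ψ γ₁.Y (u : Sp B)) := by
  have h := f.isCharOn_S ψ
  refine ⟨?_, fun g hg h' hh => ?_⟩
  · have := h.one
    rwa [hf.psiLin_eq ψ (one_mem _)] at this
  · have := h.mul g hg h' hh
    rwa [hf.psiLin_eq ψ (mul_mem g.2 h'.2), hf.psiLin_eq ψ g.2, hf.psiLin_eq ψ h'.2] at this

variable {ψ : AddChar K ℂ} (hψ : ψ ≠ 1)
  {E : Type*} [AddCommGroup E] [Module ℂ E] {ω : Representation ℂ γ₁.jacobi E}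

/-- The vectors on which `S ∩ G_{≥ 1}` acts by the character. -/
abbrev line (hf : Stage γ₁ γ γ' f) (ψ : AddChar K ℂ) (ω : Representation ℂ γ₁.jacobi E) :
    Submodule ℂ E :=
  eig (γ₁.resUnip ω) hf.A (fun u : γ₁.unip 1 => psiLin ψ γ₁.Y (u : Sp B))

variable [Finite (Sp B)] (hω : IsWeil γ₁ ψ ω)
include hψ hω

theorem finrank_line_mul : finrank ℂ (hf.line ψ ω) * Nat.card hf.A =
    finrank ℂ E *
      Nat.card (hf.A ⊓ (γ₁.unip 2).subgroupOf (γ₁.unip 1) : Subgroup (γ₁.unip 1)) := by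
  have := finiteDimensional_of_isIrreducible _ hω.irreducible
  exact (hf.full₁.isHeis hψ).finrank_eig_mul_card
    (fun z hz => hω.resUnip_two hf.full₁ z hz) (hf.isCharOn_A ψ) fun _ _ _ => rfl

theorem exists_mem_line : ∃ e ∈ hf.line ψ ω, e ≠ 0 := by
  apply Submodule.exists_mem_ne_zero_of_ne_bot
  intro h
  have h1 := hf.finrank_line_mul hψ hω
  rw [h, finrank_bot, zero_mul] at h1
  exact (Nat.mul_pos (finrank_pos_of_isIrreducible _ hω.irreducible) Nat.card_pos).ne h1

/-- Every element outside of `S` pairs nontrivially with `S`, so the irreducibility criterion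
applies with no further operators (`N = {1}`): any nonzero subspace of the eigenspace is all of it.
-/
theorem span_eq_line {e : E} (he : e ∈ hf.line ψ ω) (h0 : e ≠ 0) :
    Submodule.span ℂ {e} = hf.line ψ ω := by
  refine IsHeis.eig_eq_of_stable (ω := γ₁.resUnip ω) (Z := (γ₁.unip 2).subgroupOf (γ₁.unip 1))
    (fun z hz => hω.resUnip_two hf.full₁ z hz) hω.irreducible (hf.isCharOn_A ψ) {1}
    (fun x => ?_) _ ?_ ?_ ?_
  · by_cases hx : (x : Sp B) ∈ f.S
    · exact Or.inr ⟨1, one_mem _, x, hx, 1, rfl, by simp⟩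
    · obtain ⟨c, hc1, hc2, hc3⟩ := hf.exists_commutator hψ x.2 hx
      exact Or.inl ⟨⟨c, hc1.2⟩, hc1.1, hc2, hc3⟩
  · rw [Submodule.span_le, Set.singleton_subset_iff]; exact he
  · rintro _ rfl w hw
    simpa using hw
  · rwa [Ne, Submodule.span_singleton_eq_bot]

variable {W : Type*} [AddCommGroup W] [Module ℂ W] [FiniteDimensional ℂ W]
  (π : Representation ℂ (Sp B) W)

/-- Since the polarization has a one-dimensional eigenspace in `ω`, its eigenspace in `π` counts the
copies of `ω`. The condition for `G_{≥ 2}` of `γ₁` is included, because that group lies in `S`. -/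
theorem finrank_coeff₁ : finrank ℂ (coeff γ₁ ω π) =
    finrank ℂ (eig π (f.S ⊓ γ₁.unip 1) (psiLin ψ γ.Y)) := by
  obtain ⟨e, he, h0⟩ := hf.exists_mem_line hψ hω
  have h1 := (hf.full₁.isHeis hψ).finrank_intertwining_mul_finrank
    (fun z hz => hω.resUnip_two hf.full₁ z hz) hω.irreducible (π.comp (γ₁.unip 1).subtype)
  have h2 := (hf.full₁.isHeis hψ).finrank_eig_inf_mul_card (π.comp (γ₁.unip 1).subtype)
    (fun g z hz => hf.full₁.conj_unip_two ψ g.2 hz) (hf.isCharOn_A ψ) (fun _ _ _ => rfl)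
  have h3 := hf.finrank_line_mul hψ hω
  rw [← hf.span_eq_line hψ hω he h0, finrank_span_singleton h0, one_mul] at h3
  rw [← h1, mul_assoc, ← h3] at h2
  rw [(coeffEquiv γ₁ ω π).finrank_eq, ← Nat.eq_of_mul_eq_mul_right Nat.card_pos h2]
  have h4 : eig (π.comp (γ₁.unip 1).subtype) hf.A (fun u : γ₁.unip 1 => psiLin ψ γ₁.Y (u : Sp B)) ⊓
      eig (π.comp (γ₁.unip 1).subtype) ((γ₁.unip 2).subgroupOf (γ₁.unip 1))
        (fun u : γ₁.unip 1 => psiLin ψ γ₁.Y (u : Sp B)) =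
      eig π (f.S ⊓ γ₁.unip 1) (psiLin ψ γ.Y) := by
    ext w
    constructor
    · intro hw c hc
      rw [hf.psiLin_eq ψ hc.2]
      exact hw.1 ⟨c, hc.2⟩ hc.1
    · refine fun hw => ⟨fun c hc => ?_, fun c hc => ?_⟩
      · have := hw c ⟨hc, c.2⟩
        rwa [hf.psiLin_eq ψ c.2] at this
      · have := hw c ⟨hf.unip₁_two_le hc, c.2⟩
        rwa [hf.psiLin_eq ψ c.2] at this
  rw [h4]

omit [Finite (Sp B)] hψ hω [FiniteDimensional ℂ W] in
theorem eval_mem {e : E} (he : e ∈ hf.line ψ ω) (φ : coeff γ₁ ω π) :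
    φ.1 e ∈ eig π (f.S ⊓ γ₁.unip 1) (psiLin ψ γ.Y) := by
  intro a ha
  have h1 := φ.2 (γ₁.inr ⟨a, ha.2⟩) ha.2
  have h2 := LinearMap.congr_fun h1 e
  have h3 := he ⟨a, ha.2⟩ ha.1
  change ω (γ₁.inr ⟨a, ha.2⟩) e = _ at h3
  rw [LinearMap.comp_apply, LinearMap.comp_apply, h3, map_smul] at h2
  rw [hf.psiLin_eq ψ ha.2]
  exact h2

omit hf [Finite (Sp B)] hψ [FiniteDimensional ℂ W] in
theorem eval_injective {e : E} (h0 : e ≠ 0) {φ : E →ₗ[ℂ] W} (hφ : φ ∈ coeff γ₁ ω π)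
    (h : φ e = 0) : φ = 0 := by
  have h1 := eq_top_of_isIrreducible _ hω.irreducible (LinearMap.ker φ) (fun g w hw => by
    have h2 := LinearMap.congr_fun (hφ (γ₁.inr g) g.2) w
    rw [LinearMap.comp_apply, LinearMap.comp_apply, LinearMap.mem_ker.1 hw, map_zero] at h2
    exact h2.symm) fun hb => h0 (by
      have : e ∈ LinearMap.ker φ := h
      rwa [hb, Submodule.mem_bot] at this)
  exact LinearMap.ker_eq_top.1 h1

/-- The embedding of `Sp(V0)` into `M_X · G_{≥ 1}`. -/
def emb (hf : Stage γ₁ γ γ' f) : Sp (B.restrict γ₁.fixed) →* γ₁.jacobi :=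
  γ₁.inl.comp (γ₁.embed f.alt.isRefl hf.isCompl)

omit hψ hω [FiniteDimensional ℂ W] [Finite (Sp B)] in
theorem ext_mem_centralizer (y : Sp (B.restrict γ₁.fixed)) : hf.ext y ∈ γ₁.centralizer :=
  (γ₁.embed f.alt.isRefl hf.isCompl y).2

omit hψ hω [FiniteDimensional ℂ W] [Finite (Sp B)] in
theorem psiLin_conj₁ (y : Sp (B.restrict γ₁.fixed)) (x : Sp B) :
    psiLin ψ γ₁.Y (hf.ext y * x * (hf.ext y)⁻¹) = psiLin ψ γ₁.Y x := by
  have h := (hf.ext_mem_centralizer y).2.2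
  set T := Sp.toEnd x - 1
  set g := hf.ext y
  have e : Sp.toEnd g⁻¹ * (γ₁.Y * (Sp.toEnd g * T)) = γ₁.Y * T := by
    rw [← mul_assoc γ₁.Y, ← h.eq, mul_assoc (Sp.toEnd g), ← mul_assoc, Sp.toEnd_inv_mul, one_mul]
  have e2 : γ₁.Y * (Sp.toEnd g * T * Sp.toEnd g⁻¹) = γ₁.Y * (Sp.toEnd g * T) * Sp.toEnd g⁻¹ := by
    simp only [mul_assoc]
  rw [psiLin, psiLin, Sp.conj_sub_one, e2, LinearMap.trace_mul_comm, e]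

omit hψ hω [FiniteDimensional K V] [FiniteDimensional ℂ W] [Finite (Sp B)] in
theorem ext_x (y : Sp (B.restrict γ₁.fixed)) (k : ℕ) : Sp.toEnd (hf.ext y) (f.x k) = f.x k := by
  have e : (⟨f.pr0 (f.x k), hf.pr0_mem_U _⟩ : γ₁.fixed) = 0 := Subtype.ext (f.pr0_x k)
  have h1 := hf.ext_sub_one y (f.x k)
  rw [e] at h1
  simpa [sub_eq_zero] using h1

omit hψ hω [FiniteDimensional K V] [FiniteDimensional ℂ W] [Finite (Sp B)] in
theorem pr0_ext (y : Sp (B.restrict γ₁.fixed)) (v : V) :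
    f.pr0 (Sp.toEnd (hf.ext y) v) = Sp.toEnd (hf.ext y) (f.pr0 v) := by
  have h1 : Sp.toEnd (hf.ext y) v = (Sp.toEnd (hf.ext y) - 1) v + v := by simp
  have h2 : Sp.toEnd (hf.ext y) (f.pr0 v) = (Sp.toEnd (hf.ext y) - 1) (f.pr0 v) + f.pr0 v := by simp
  have h3 : (Sp.toEnd (hf.ext y) - 1) (f.pr0 v) = (Sp.toEnd (hf.ext y) - 1) v := by
    rw [hf.ext_sub_one, hf.ext_sub_one]
    simp only [f.pr0_of_mem _ (f.pr0_mem v)]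
  rw [h1, h2, h3, map_add, f.pr0_of_mem _ (hf.ext_sub_one_mem_V0 y v)]

omit hψ hω [FiniteDimensional ℂ W] [Finite (Sp B)] in
/-- The stabilizer of `L0` normalizes `S ∩ G_{≥ 1}`. -/
theorem conj_mem_A {y : Sp (B.restrict γ₁.fixed)}
    (hy : ∀ v ∈ f.L0, Sp.toEnd (hf.ext y) v ∈ f.L0) {x : Sp B} (hx : x ∈ γ₁.unip 1)
    (hxS : x ∈ f.S) : hf.ext y * x * (hf.ext y)⁻¹ ∈ f.S := by
  have h1 := γ₁.conj_mem_unip (hf.ext_mem_centralizer y) hx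
  rw [hf.mem_S_iff h1]
  intro k hk hk1
  have h2 : Sp.toEnd (hf.ext y)⁻¹ (f.x k) = f.x k := by rw [← map_inv, hf.ext_x]
  rw [Sp.conj_sub_one, Module.End.mul_apply, Module.End.mul_apply, h2, hf.pr0_ext]
  exact hy _ ((hf.mem_S_iff hx).1 hxS k hk hk1)

omit hψ hω [FiniteDimensional ℂ W] [Finite (Sp B)] in
theorem emb_mem_line {y : Sp (B.restrict γ₁.fixed)}
    (hy : ∀ v ∈ f.L0, Sp.toEnd (hf.ext y⁻¹) v ∈ f.L0) {e : E} (he : e ∈ hf.line ψ ω) :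
    ω (hf.emb y) e ∈ hf.line ψ ω := by
  intro a ha
  have h1 := hf.conj_mem_A hy a.2 ha
  have h2 := γ₁.conj_mem_unip (hf.ext_mem_centralizer y⁻¹) a.2
  have h3 := he ⟨_, h2⟩ h1
  have h4 : γ₁.inr a * hf.emb y =
      hf.emb y * γ₁.inr ⟨_, h2⟩ := by
    refine Subtype.ext ?_
    change (a : Sp B) * hf.ext y = hf.ext y * (hf.ext y⁻¹ * a * (hf.ext y⁻¹)⁻¹)
    rw [map_inv]; group
  change ω (γ₁.inr a) (ω (hf.emb y) e) = _
  rw [← Module.End.mul_apply, ← map_mul, h4, map_mul, Module.End.mul_apply]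
  change ω (γ₁.inr ⟨_, h2⟩) e = _ at h3
  rw [h3, map_smul]
  simp only [hf.psiLin_conj₁]

omit hψ hω [FiniteDimensional K V] [FiniteDimensional ℂ W] [Finite (Sp B)] in
theorem ext_torus_mem_L0 (c : Kˣ) : ∀ v ∈ f.L0, Sp.toEnd (hf.ext (hf.full'.torus c)) v ∈ f.L0 := by
  intro v hv
  have h0 := f.L0_le hv
  have hp := f.pr0_of_mem v (f.F0_le _ h0)
  have e : Sp.toEnd (hf.ext (hf.full'.torus c)) v =
    (Sp.toEnd (hf.ext (hf.full'.torus c)) - 1) v + v := by simp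
  rw [e]
  refine add_mem (f.le_L0 ?_) hv
  rw [hf.ext_sub_one, hf.F0_mem_iff]
  refine hf.full'.torus_sub_mem c ?_
  rw [← hf.F0_mem_iff]
  simpa only [hp] using h0

omit hψ hω [FiniteDimensional ℂ W] [Finite (Sp B)] in
theorem ext_unip_mem_L0 {m : Sp (B.restrict γ₁.fixed)} (hm : m ∈ γ'.unip 2) :
    ∀ v ∈ f.L0, Sp.toEnd (hf.ext m) v ∈ f.L0 := by
  intro v hv
  have h0 := f.L0_le hv
  have e : Sp.toEnd (hf.ext m) v = (Sp.toEnd (hf.ext m) - 1) v + v := by simp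
  rw [e]
  refine add_mem (f.le_L0 (f.F0_anti 1 _ ?_
    (hf.ext_sub_one_mem_F0 hm (by rwa [f.pr0_of_mem v (f.F0_le _ h0)])))) hv
  norm_num

omit [FiniteDimensional ℂ W] in
/-- The group `γ'.unip 2` acts trivially on the line. -/
theorem emb_apply_line [Finite K] [Finite (Sp (B.restrict γ₁.fixed))] {e : E}
    (he : e ∈ hf.line ψ ω) {m : Sp (B.restrict γ₁.fixed)} (hm : m ∈ γ'.unip 2) :
    ω (hf.emb m) e = e := by
  by_cases h0 : e = 0
  · rw [h0, map_zero]
  -- An element whose inverse preserves `L0` normalizes the polarization and its character, so it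
  -- acts on the line by a scalar. The extension `ω` is arbitrary and the scalars are unknown; only
  -- commutators are known to act trivially.
  have hs : ∀ y : Sp (B.restrict γ₁.fixed), (∀ v ∈ f.L0, Sp.toEnd (hf.ext y⁻¹) v ∈ f.L0) →
      ∃ κ : ℂ, ω (hf.emb y) e = κ • e := by
    intro y hy
    have h1 := hf.emb_mem_line hy he
    rw [← hf.span_eq_line hψ hω he h0, Submodule.mem_span_singleton] at h1
    obtain ⟨κ, hκ⟩ := h1
    exact ⟨κ, hκ.symm⟩
  obtain ⟨c, hc⟩ := exists_orderOf_ge hf.full'.char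
  set s := hf.full'.torus c with hsdef
  have hcomm : ∀ u ∈ γ'.unip 2, s * u * s⁻¹ * u⁻¹ ∈ γ'.unip 2 := fun u hu =>
    mul_mem (hf.full'.torus_conj_mem c hu) (inv_mem hu)
  -- For a generic torus element `s` the map `u ↦ [s, u]` is injective on this finite group, hence
  -- surjective: every `m` is a commutator of two elements acting by scalars.
  let Φ : γ'.unip 2 → γ'.unip 2 := fun u => ⟨s * u * s⁻¹ * (u : Sp (B.restrict γ₁.fixed))⁻¹, hcomm u u.2⟩
  have hΦ : Function.Injective Φ := by
    intro u u' h
    have h1 : s * (u : Sp (B.restrict γ₁.fixed)) * s⁻¹ * (u : Sp (B.restrict γ₁.fixed))⁻¹ = s * (u' : Sp (B.restrict γ₁.fixed)) * s⁻¹ * (u' : Sp (B.restrict γ₁.fixed))⁻¹ :=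
      congrArg Subtype.val h
    have h2 : ((u' : Sp (B.restrict γ₁.fixed))⁻¹ * u : Sp (B.restrict γ₁.fixed)) = 1 := by
      refine hf.full'.eq_one_of_commute_torus hc (mul_mem (inv_mem u'.2) u.2) ?_
      change s * ((u' : Sp (B.restrict γ₁.fixed))⁻¹ * u) = (u' : Sp (B.restrict γ₁.fixed))⁻¹ * u * s
      have h3 : (u : Sp (B.restrict γ₁.fixed)) =
          s⁻¹ * (s * (u : Sp (B.restrict γ₁.fixed)) * s⁻¹ * (u : Sp (B.restrict γ₁.fixed))⁻¹) * u * s := by group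
      rw [h1] at h3
      have h4 : s * ((u' : Sp (B.restrict γ₁.fixed))⁻¹ * u) = s * ((u' : Sp (B.restrict γ₁.fixed))⁻¹ *
        (s⁻¹ * (s * (u' : Sp (B.restrict γ₁.fixed)) * s⁻¹ * (u' : Sp (B.restrict γ₁.fixed))⁻¹) * u * s)) := by rw [← h3]
      rw [h4]; group
    exact Subtype.ext (inv_mul_eq_one.1 h2).symm
  obtain ⟨u, hu⟩ := Finite.surjective_of_injective hΦ ⟨m, hm⟩
  have hu' : s * (u : Sp (B.restrict γ₁.fixed)) * s⁻¹ * (u : Sp (B.restrict γ₁.fixed))⁻¹ = m := congrArg Subtype.val hu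
  obtain ⟨a, ha⟩ := hs s (by rw [hsdef, torus_inv]; exact hf.ext_torus_mem_L0 _)
  obtain ⟨b, hb⟩ := hs u (hf.ext_unip_mem_L0 (inv_mem u.2))
  have hinv : ∀ y : Sp (B.restrict γ₁.fixed), ∀ a : ℂ, ω (hf.emb y) e = a • e →
      a • ω (hf.emb y⁻¹) e = e := fun y a h => by
    rw [← map_smul, ← h, ← Module.End.mul_apply, ← map_mul, ← map_mul, inv_mul_cancel, map_one,
      map_one]; rfl
  have ha' := hinv _ _ ha
  have hb' := hinv _ _ hb
  -- The scalars `a` and `b` of `s` and `u` cancel against those of the inverses.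
  have e1 : ω (hf.emb m) e = ω (hf.emb s) (ω (hf.emb u) (ω (hf.emb s⁻¹) (ω (hf.emb u⁻¹) e))) := by
    rw [← hu', map_mul, map_mul, map_mul, map_mul, map_mul, map_mul]; rfl
  rw [e1]
  have h3 : b • ω (hf.emb s⁻¹) (ω (hf.emb u⁻¹) e) = ω (hf.emb s⁻¹) e := by
    rw [← map_smul, hb']
  have h4 : ω (hf.emb u) (ω (hf.emb s⁻¹) e) = b • ω (hf.emb s⁻¹) e := by
    by_cases ha0 : a = 0
    · rw [ha0, zero_smul] at ha'; exact absurd ha'.symm h0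
    · have : ω (hf.emb s⁻¹) e = a⁻¹ • e := by rw [← ha', smul_smul, inv_mul_cancel₀ ha0, one_smul, ha']
      rw [this, map_smul, hb, smul_comm]
  have hb0 : b ≠ 0 := fun h => by rw [h, zero_smul] at hb'; exact h0 hb'.symm
  have h5 : ω (hf.emb u) (ω (hf.emb s⁻¹) (ω (hf.emb u⁻¹) e)) = ω (hf.emb s⁻¹) e := by
    have : ω (hf.emb s⁻¹) (ω (hf.emb u⁻¹) e) = b⁻¹ • ω (hf.emb s⁻¹) e := by
      rw [← h3, smul_smul, inv_mul_cancel₀ hb0, one_smul]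
    rw [this, map_smul, h4, smul_smul, inv_mul_cancel₀ hb0, one_smul]
  rw [h5, ← Module.End.mul_apply, ← map_mul, ← map_mul, mul_inv_cancel, map_one, map_one]; rfl

variable {E' : Type*} [AddCommGroup E'] [Module ℂ E'] {ω' : Representation ℂ γ'.jacobi E'}
  (hω' : IsWeil γ' ψ ω')
include hω'

/-- The iterated coefficient in terms of the group `S`. -/
theorem finrank_iterated_mul [Finite K] [Finite (Sp (B.restrict γ₁.fixed))] :
    finrank ℂ (coeff γ' ω' (coeffSp γ₁ ω π f.alt.isRefl hf.isCompl)) * finrank ℂ E' =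
      finrank ℂ (eig π f.S (psiLin ψ γ.Y)) := by
  have hfE := finiteDimensional_of_isIrreducible _ hω.irreducible
  have hfc : FiniteDimensional ℂ (coeff γ₁ ω π) := FiniteDimensional.finiteDimensional_submodule _
  rw [finrank_coeff_mul hf.full' hψ hω']
  obtain ⟨e, he, h0⟩ := hf.exists_mem_line hψ hω
  -- Evaluation at a vector of the line is injective because `ω` is irreducible, and fills the
  -- eigenspace of the polarization by dimension. It commutes with `G_{≥ 2}` of `γ'`, which fixes
  -- `e`.
  let ev : coeff γ₁ ω π →ₗ[ℂ] W := LinearMap.applyₗ e ∘ₗ (coeff γ₁ ω π).subtype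
  have hev : Function.Injective ev := by
    rw [← LinearMap.ker_eq_bot, LinearMap.ker_eq_bot']
    exact fun φ h => Subtype.ext (eval_injective hω π h0 φ.2 h)
  have hrange : LinearMap.range ev = eig π (f.S ⊓ γ₁.unip 1) (psiLin ψ γ.Y) := by
    refine Submodule.eq_of_le_of_finrank_eq ?_ ?_
    · rintro _ ⟨φ, rfl⟩
      exact hf.eval_mem π he φ
    · rw [LinearMap.finrank_range_of_inj hev, hf.finrank_coeff₁ hψ hω π]
  have hact : ∀ m ∈ γ'.unip 2, ∀ φ : coeff γ₁ ω π,
      ev (coeffSp γ₁ ω π f.alt.isRefl hf.isCompl m φ) = π (hf.ext m) (ev φ) := by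
    intro m hm φ
    change π (hf.ext m) (φ.1 (ω (hf.emb m)⁻¹ e)) = π (hf.ext m) (φ.1 e)
    rw [← map_inv, hf.emb_apply_line hψ hω he (inv_mem hm)]
  -- As `S` is the product of the polarization and of `G_{≥ 2}` of `γ'`, an `S`-eigenvector is one
  -- for both factors.
  have hmap : (eig (coeffSp γ₁ ω π f.alt.isRefl hf.isCompl) (γ'.unip 2) (psiLin ψ γ'.Y)).map ev =
      eig π f.S (psiLin ψ γ.Y) := by
    ext w
    constructor
    · rintro ⟨φ, hφ, rfl⟩ g hg
      obtain ⟨a, ha, m, hm, rfl⟩ := hf.exists_factor hg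
      have h1 : ev φ ∈ eig π (f.S ⊓ γ₁.unip 1) (psiLin ψ γ.Y) := hrange ▸ ⟨φ, rfl⟩
      rw [map_mul, Module.End.mul_apply, ← hact m hm φ, hφ m hm, map_smul, map_smul, h1 a ha,
        (f.isCharOn_S ψ).mul a ha.1 _ (hf.ext_mem_S hm), hf.psiLin_ext, smul_smul, mul_comm]
    · intro hw
      have h1 : w ∈ LinearMap.range ev := by
        rw [hrange]; exact fun a ha => hw a ha.1
      obtain ⟨φ, rfl⟩ := h1
      refine ⟨φ, fun m hm => hev ?_, rfl⟩
      rw [hact m hm, hw _ (hf.ext_mem_S hm), hf.psiLin_ext, map_smul]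
  rw [← hmap]
  exact (Submodule.equivMapOfInjective ev hev _).finrank_eq

end Stage

end StageRep

end
end SpFourier

namespace SpFourier
noncomputable section

/-! ### Decomposition into strings and conjugacy of triples -/

section Strings

variable {K : Type*} [Field K] {V : Type*} [AddCommGroup V] [Module K V] [FiniteDimensional K V]
variable {B : LinearMap.BilinForm K V}

/-- In a vanishing sum of eigenvectors the eigenvectors to a fixed eigenvalue sum to zero. -/
theorem sum_eigenvectors_eq_zero {K V ι : Type*} [Field K] [AddCommGroup V] [Module K V]
    [DecidableEq K] (T : Module.End K V) (s : Finset ι) (μ : ι → K) (f : ι → V)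
    (hf : ∀ i ∈ s, T (f i) = μ i • f i) (h : ∑ i ∈ s, f i = 0) (c : K) :
    ∑ i ∈ s with μ i = c, f i = 0 := by
  classical
  by_cases hc : c ∈ s.image μ
  · refine (iSupIndep_iff_finsetSum_eq_zero_imp_eq_zero _).1 (End.eigenspaces_iSupIndep T)
      (s.image μ) (fun c => ∑ i ∈ s with μ i = c, f i) (fun c _ => ?_) ?_ c hc
    · refine sum_mem fun i hi => ?_
      rw [Finset.mem_filter] at hi
      rw [End.mem_eigenspace_iff, hf i hi.1, hi.2]
    · rw [← h]
      exact Finset.sum_fiberwise_of_maps_to (fun i hi => Finset.mem_image_of_mem _ hi) f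
  · rw [Finset.filter_eq_empty_iff.2 fun i hi h => hc (Finset.mem_image.2 ⟨i, hi, h⟩),
      Finset.sum_empty]

namespace Triple

variable (γ : Triple B)

theorem lowest_Y {γ : Triple B} {a : ℕ} {u : V} (hu : u ∈ γ.lowest a) : γ.Y u = 0 := hu.1

theorem lowest_H {γ : Triple B} {a : ℕ} {u : V} (hu : u ∈ γ.lowest a) :
    γ.H u = (1 - (a : K)) • u := by
  rw [γ.H_apply_of_mem hu.2]
  congr 1
  push_cast
  ring

theorem lowest_eq_bot {γ : Triple B} {a : ℕ} (ha : finrank K V < a) : γ.lowest a = ⊥ := by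
  rw [lowest, γ.weightSpace_eq_bot, inf_bot_eq]
  rw [abs_neg, abs_of_nonneg] <;> omega

theorem mem_lowest {γ : Triple B} {a : ℕ} (h0 : 0 < a) (ha : a ≤ finrank K V) {u : V}
    (hY : γ.Y u = 0) (hH : γ.H u = (1 - (a : K)) • u) : u ∈ γ.lowest a := by
  refine ⟨hY, ?_⟩
  rw [SetLike.mem_coe, weightSpace, if_pos (by rw [abs_lt]; omega), End.mem_eigenspace_iff, hH]
  congr 1
  push_cast
  ring

theorem H_X_pow {γ : Triple B} {a : ℕ} {u : V} (hu : u ∈ γ.lowest a) (k : ℕ) :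
    γ.H ((γ.X ^ k) u) = (1 - (a : K) + 2 * k) • (γ.X ^ k) u := γ.H_pow (lowest_H hu) k

theorem X_pow_mem {γ : Triple B} {a : ℕ} {u : V} (hu : u ∈ γ.lowest a)
    {k : ℕ} (hk : k < a) : (γ.X ^ k) u ∈ γ.weightSpace (2 * (k : ℤ) - ((a : ℤ) - 1)) := by
  by_cases ha : finrank K V < a
  · rw [lowest_eq_bot ha, Submodule.mem_bot] at hu
    rw [hu, map_zero]
    exact zero_mem _
  · rw [weightSpace, if_pos (by rw [abs_lt]; omega), End.mem_eigenspace_iff, H_X_pow hu]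
    congr 1
    push_cast
    ring

/-- The Casimir operator. -/
def casimir : Module.End K V := γ.H * γ.H - (2 : K) • γ.H + (4 : K) • (γ.X * γ.Y)

theorem casimir_apply (v : V) :
    γ.casimir v = γ.H (γ.H v) - (2 : K) • γ.H v + (4 : K) • γ.X (γ.Y v) := rfl

theorem casimir_X_pow {γ : Triple B} {a : ℕ} {u : V} (hu : u ∈ γ.lowest a) (k : ℕ) :
    γ.casimir ((γ.X ^ k) u) = ((a : K) ^ 2 - 1) • (γ.X ^ k) u := by
  rw [casimir_apply, H_X_pow hu, map_smul, H_X_pow hu]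
  cases k with
  | zero =>
    simp only [pow_zero, Module.End.one_apply, lowest_Y hu, map_zero, smul_zero, add_zero]
    rw [smul_smul, smul_smul, ← sub_smul]
    congr 1
    push_cast
    ring
  | succ k =>
    rw [γ.Y_pow (lowest_H hu) (lowest_Y hu), map_smul, ← Module.End.mul_apply γ.X, ← pow_succ',
      smul_smul, smul_smul, smul_smul, ← sub_smul, ← add_smul]
    congr 1
    push_cast
    ring

theorem casimir_form (v w : V) : B (γ.casimir v) w = B v (γ.casimir w) := by
  have h2 := γ.YX w
  simp only [casimir_apply, map_add, map_sub, map_smul, LinearMap.add_apply, LinearMap.sub_apply,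
    LinearMap.smul_apply, smul_eq_mul, skew γ.H_mem, skew γ.X_mem, skew γ.Y_mem, h2]
  ring

theorem form_X_pow (j : ℕ) (v w : V) : B ((γ.X ^ j) v) w = (-1) ^ j * B v ((γ.X ^ j) w) := by
  induction j generalizing w with
  | zero => simp
  | succ j ih =>
    rw [pow_succ', Module.End.mul_apply, skew γ.X_mem, ih, ← Module.End.mul_apply, ← pow_succ,
      pow_succ', pow_succ']
    ring

/-- The form on the strings generated by lowest weight vectors. -/
theorem form_strings (hp : 2 * finrank K V < ringChar K) {a b : ℕ} {u w : V}
    (hu : u ∈ γ.lowest a) (hw : w ∈ γ.lowest b) {j k : ℕ} (hj : j < a) (hk : k < b) :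
    B ((γ.X ^ j) u) ((γ.X ^ k) w) =
      if a = b ∧ j + k + 1 = a then (-1) ^ j * B u ((γ.X ^ (a - 1)) w) else 0 := by
  by_cases ha : finrank K V < a
  · rw [lowest_eq_bot ha, Submodule.mem_bot] at hu
    simp [hu]
  by_cases hb : finrank K V < b
  · rw [lowest_eq_bot hb, Submodule.mem_bot] at hw
    simp [hw]
  rcases eq_or_ne a b with rfl | hab
  · have e : B ((γ.X ^ j) u) ((γ.X ^ k) w) = (-1) ^ j * B u ((γ.X ^ (j + k)) w) := by
      rw [form_X_pow, ← Module.End.mul_apply, ← pow_add]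
    split_ifs with h
    · rw [e, show j + k = a - 1 by omega]
    -- `H` is skew, so vectors whose weights do not add up to zero are orthogonal.
    · have h1 := skew γ.H_mem ((γ.X ^ j) u) ((γ.X ^ k) w)
      rw [H_X_pow hu, H_X_pow hw, map_smul, map_smul, LinearMap.smul_apply, smul_eq_mul,
        smul_eq_mul] at h1
      have h2 : (((2 * ((j : ℤ) + k + 1 - a) : ℤ)) : K) * B ((γ.X ^ j) u) ((γ.X ^ k) w) = 0 := by
        push_cast
        linear_combination h1
      refine (mul_eq_zero.1 h2).resolve_left ?_
      rw [Int.cast_mul]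
      refine mul_ne_zero (intCast_ne (by norm_num) ?_) (intCast_ne ?_ ?_)
      · simp; omega
      · intro h3
        exact h ⟨rfl, by omega⟩
      · rw [abs_lt]; omega
  · rw [if_neg (fun h => hab h.1)]
    -- The Casimir operator is self-adjoint. Its eigenvalues on strings of lengths `a` and `b`
    -- differ by `(a - b)(a + b)`, a unit since `a + b ≤ 2 dim V < p`.
    have h1 := γ.casimir_form ((γ.X ^ j) u) ((γ.X ^ k) w)
    rw [casimir_X_pow hu, casimir_X_pow hw, map_smul, map_smul, LinearMap.smul_apply, smul_eq_mul,
        smul_eq_mul] at h1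
    have h2 : ((((a : ℤ) - b) * (a + b) : ℤ) : K) * B ((γ.X ^ j) u) ((γ.X ^ k) w) = 0 := by
      push_cast
      linear_combination h1
    refine (mul_eq_zero.1 h2).resolve_left ?_
    rw [Int.cast_mul]
    refine mul_ne_zero (intCast_ne (by omega) (by rw [abs_lt]; omega))
      (intCast_ne (by omega) (by rw [abs_lt]; omega))

/-- The index set of the vectors `X^k u`, with `k < a`, in the strings of length `a ≤ D`. -/
abbrev StringIndex (D : ℕ) : Type := Σ a : Fin (D + 1), Fin (a : ℕ)

/-- The linear map sending `X^k u`, for `u` a lowest weight vector of an `a`-dimensional module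
and `k < a`, to `X₂^k (l u)`. -/
def stringMap (γ γ₂ : Triple B) (l : ∀ a : ℕ, γ.lowest a →ₗ[K] V) :
    ((i : StringIndex (finrank K V)) → γ.lowest (i.1 : ℕ)) →ₗ[K] V where
  toFun x := ∑ i : StringIndex (finrank K V), (γ₂.X ^ (i.2 : ℕ)) (l i.1 (x i))
  map_add' x y := by simp only [Pi.add_apply, map_add, Finset.sum_add_distrib]
  map_smul' c x := by simp only [Pi.smul_apply, map_smul, Finset.smul_sum, RingHom.id_apply]

theorem stringMap_apply (γ₂ : Triple B) (l : ∀ a : ℕ, γ.lowest a →ₗ[K] V)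
    (x : (i : StringIndex (finrank K V)) → γ.lowest (i.1 : ℕ)) :
    stringMap γ γ₂ l x = ∑ i : StringIndex (finrank K V), (γ₂.X ^ (i.2 : ℕ)) (l i.1 (x i)) := rfl

theorem stringMap_single (γ₂ : Triple B) (l : ∀ a : ℕ, γ.lowest a →ₗ[K] V)
    (i : StringIndex (finrank K V)) (u : γ.lowest (i.1 : ℕ)) :
    stringMap γ γ₂ l (Pi.single i u) = (γ₂.X ^ (i.2 : ℕ)) (l i.1 u) := by
  classical
  rw [stringMap_apply, Finset.sum_eq_single i]
  · simp
  · intro j _ hj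
    rw [Pi.single_eq_of_ne hj, map_zero, map_zero]
  · simp

/-- The eigenvalue of the Casimir operator determines the length of the string, and that of `H` the
position in it. So distinct components are independent, and `X^k` is injective on lowest weight
vectors while `k` is less than the length. -/
theorem stringMap_injective (hp : 2 * finrank K V < ringChar K) :
    Function.Injective (stringMap γ γ fun a => (γ.lowest a).subtype) := by
  classical
  rw [← LinearMap.ker_eq_bot, LinearMap.ker_eq_bot']
  intro x hx
  rw [stringMap_apply] at hx
  have h1 := sum_eigenvectors_eq_zero γ.H _
    (fun i : StringIndex (finrank K V) => 1 - ((i.1 : ℕ) : K) + 2 * ((i.2 : ℕ) : K)) _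
    (fun i _ => H_X_pow (x i).2 i.2) hx
  funext i
  have h2 := sum_eigenvectors_eq_zero γ.casimir _
    (fun i : StringIndex (finrank K V) => ((i.1 : ℕ) : K) ^ 2 - 1) _
    (fun i _ => casimir_X_pow (x i).2 i.2) (h1 (1 - ((i.1 : ℕ) : K) + 2 * ((i.2 : ℕ) : K)))
    (((i.1 : ℕ) : K) ^ 2 - 1)
  rw [Finset.sum_eq_single i] at h2
  · by_contra hne
    have ha := i.1.2
    have hk := i.2.2
    refine γ.X_pow_ne (lowest_H (x i).2) (lowest_Y (x i).2) (fun h => hne (Subtype.ext h)) i.2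
      (fun k hk' => mul_ne_zero ?_ ?_) h2
    · exact_mod_cast natCast_ne (K := K) (m := k + 1) (by omega) (by omega)
    · have := intCast_ne (K := K) (m := 1 - ((i.1 : ℕ) : ℤ) + k) (by omega)
        (by rw [abs_lt]; omega)
      exact_mod_cast this
  · rintro ⟨b, l⟩ hj hne
    exfalso
    obtain ⟨a, k⟩ := i
    simp only [Finset.mem_filter, Finset.mem_univ, true_and] at hj
    obtain ⟨e1, e2⟩ := hj
    have hb := b.2
    have hl := l.2
    have ha := a.2
    have hk := k.2
    have hab : (b : ℕ) = a := by
      by_contra hab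
      have h2 : ((((b : ℕ) : ℤ) - (a : ℕ)) * ((b : ℕ) + (a : ℕ) : ℤ) : ℤ) = (0 : K) := by
        push_cast
        linear_combination e2
      rw [Int.cast_mul] at h2
      exact mul_ne_zero (intCast_ne (by omega) (by rw [abs_lt]; omega))
        (intCast_ne (by omega) (by rw [abs_lt]; omega)) h2
    obtain rfl : b = a := Fin.ext hab
    have hkl : (l : ℕ) = k := by
      by_contra hkl
      have h2 : ((2 * (((l : ℕ) : ℤ) - (k : ℕ)) : ℤ) : K) = 0 := by
        push_cast
        linear_combination e1
      rw [Int.cast_mul] at h2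
      exact mul_ne_zero (intCast_ne (by norm_num) (by simp; omega))
        (intCast_ne (by omega) (by rw [abs_lt]; omega)) h2
    exact hne (by rw [Fin.ext hkl])
  · intro h
    simp at h

/-- The lowest weight vectors generate `V` if the multiplicities are those of a partition of
`dim V`. -/
theorem stringMap_bijective (hp : 2 * finrank K V < ringChar K) {m : Multiset ℕ}
    (hm : m.sum = finrank K V) (h : ∀ a, 0 < a → finrank K (γ.lowest a) = m.count a) :
    Function.Bijective (stringMap γ γ fun a => (γ.lowest a).subtype) := by
  classical
  -- A string of length `a` contributes `a` vectors, so the source has dimension the sum of the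
  -- parts, and injectivity gives bijectivity. Complete reducibility thus comes from the
  -- multiplicities alone.
  have hdim : finrank K ((i : StringIndex (finrank K V)) → γ.lowest (i.1 : ℕ)) = finrank K V := by
    have h1 : m.sum = ∑ a ∈ Finset.range (finrank K V + 1), m.count a • a := by
      refine Finset.sum_multiset_count_of_subset m _ fun a ha => ?_
      rw [Multiset.mem_toFinset] at ha
      have := Multiset.le_sum_of_mem ha
      rw [Finset.mem_range]
      omega
    rw [Finset.sum_range, hm] at h1
    refine Eq.trans ?_ h1.symm
    rw [Module.finrank_pi_fintype, Fintype.sum_sigma]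
    refine Finset.sum_congr rfl fun a _ => ?_
    refine (Finset.sum_congr rfl fun k _ => h a (Nat.zero_lt_of_lt k.2)).trans ?_
    rw [Finset.sum_const, Finset.card_univ, Fintype.card_fin, smul_eq_mul, smul_eq_mul, mul_comm]
  exact ⟨γ.stringMap_injective hp, (LinearMap.injective_iff_surjective_of_finrank_eq_finrank
    hdim).1 (γ.stringMap_injective hp)⟩

theorem iSup_weightSpace_eq_top {M : ℕ} (hM : ∀ a, M < a → γ.lowest a = ⊥)
    (hs : Function.Surjective (stringMap γ γ fun a => (γ.lowest a).subtype)) :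
    ⨆ j : Set.Ioo (-(M : ℤ)) M, γ.weightSpace j = ⊤ := by
  rw [eq_top_iff]
  rintro v -
  obtain ⟨x, rfl⟩ := hs v
  rw [stringMap_apply]
  refine sum_mem fun i _ => ?_
  by_cases ha : M < i.1
  · have := (x i).2
    have h0 : (x i : V) = 0 := (Submodule.eq_bot_iff _).1 (hM _ ha) _ this
    rw [Submodule.subtype_apply, h0, map_zero]
    exact zero_mem _
  · have hk := i.2.2
    exact Submodule.mem_iSup_of_mem (p := fun j : Set.Ioo (-(M : ℤ)) M => γ.weightSpace j)
      ⟨2 * ((i.2 : ℕ) : ℤ) - (((i.1 : ℕ) : ℤ) - 1), by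
        constructor <;> omega⟩ (X_pow_mem (x i).2 hk)

theorem full_of_surjective (hB : B.IsAlt) (hnd : B.Nondegenerate)
    (hp : 2 * finrank K V < ringChar K)
    (hs : Function.Surjective (stringMap γ γ fun a => (γ.lowest a).subtype)) : γ.Full where
  alt := hB
  nondeg := hnd
  char := hp
  top := by
    rw [eq_top_iff, ← γ.iSup_weightSpace_eq_top (fun a ha => lowest_eq_bot ha) hs]
    exact iSup_le fun j => le_iSup (fun j => γ.weightSpace j) (j : ℤ)

theorem Full.weightSpace_eq_bot_of_lowest {γ : Triple B} (hγ : γ.Full) {M : ℕ}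
    (hM : ∀ a, M < a → γ.lowest a = ⊥)
    (hs : Function.Surjective (stringMap γ γ fun a => (γ.lowest a).subtype)) {j : ℤ}
    (hj : (M : ℤ) ≤ |j|) : γ.weightSpace j = ⊥ := by
  rw [Submodule.eq_bot_iff]
  intro v hv
  have h0 : ∀ w : V, γ.proj j w = 0 := by
    intro w
    have hw : w ∈ ⨆ j : Set.Ioo (-(M : ℤ)) M, γ.weightSpace j := by
      rw [γ.iSup_weightSpace_eq_top hM hs]
      trivial
    induction hw using Submodule.iSup_induction' with
    | mem i w hw =>
      rw [hγ.proj_apply_of_mem hw, if_neg]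
      rintro rfl
      have := i.2
      rw [Set.mem_Ioo] at this
      rw [le_abs] at hj
      omega
    | zero => exact map_zero _
    | add v w _ _ hv hw => rw [map_add, hv, hw, add_zero]
  have := h0 v
  rwa [hγ.proj_apply_of_mem hv, if_pos rfl] at this

/-- The form on the space of lowest weight vectors. -/
def lowestForm (a : ℕ) : LinearMap.BilinForm K (γ.lowest a) :=
  LinearMap.BilinForm.restrict (LinearMap.BilinForm.compRight B (γ.X ^ (a - 1))) (γ.lowest a)

theorem lowestForm_apply (a : ℕ) (u w : γ.lowest a) :
    γ.lowestForm a u w = B u ((γ.X ^ (a - 1)) w) := rfl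

theorem lowestForm_swap (hB : B.IsAlt) {a : ℕ} (ha : 0 < a) (u w : γ.lowest a) :
    γ.lowestForm a u w = (-1) ^ a * γ.lowestForm a w u := by
  rw [lowestForm_apply, lowestForm_apply, form_swap hB, form_X_pow]
  have h : (-1 : K) ^ a = -(-1) ^ (a - 1) := by
    conv_lhs => rw [← Nat.sub_add_cancel ha]
    rw [pow_succ]
    ring
  rw [h]
  ring

/-- A lowest weight vector pairs only with top vectors of strings of its own length, so a vector in
the radical of this form is in the radical of `B`. -/
theorem eq_zero_of_lowestForm (hnd : B.Nondegenerate) (hp : 2 * finrank K V < ringChar K)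
    (hs : Function.Surjective (stringMap γ γ fun a => (γ.lowest a).subtype)) {a : ℕ} (ha : 0 < a)
    (u : γ.lowest a) (h : ∀ w, γ.lowestForm a u w = 0) : u = 0 := by
  refine Subtype.ext (hnd.1 _ fun v => ?_)
  obtain ⟨x, rfl⟩ := hs v
  rw [stringMap_apply, map_sum]
  refine Finset.sum_eq_zero fun i _ => ?_
  have := γ.form_strings hp u.2 (x i).2 (j := 0) ha i.2.2
  rw [pow_zero, Module.End.one_apply] at this
  rw [Submodule.subtype_apply, this]
  split_ifs with h1
  · have h2 := h ⟨x i, by rw [h1.1]; exact (x i).2⟩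
    rw [pow_zero, one_mul]
    exact h2
  · rfl

/-- Two triples with isometric spaces of lowest weight vectors are conjugate, as far as `H` and `Y`
are concerned. -/
theorem exists_conj (hnd : B.Nondegenerate) (hp : 2 * finrank K V < ringChar K)
    (hs : Function.Bijective (stringMap γ γ fun a => (γ.lowest a).subtype)) (γ₂ : Triple B)
    (l : ∀ a : ℕ, γ.lowest a →ₗ[K] V) (hl : ∀ a u, l a u ∈ γ₂.lowest a)
    (hf : ∀ a, 0 < a → ∀ u w, B (l a u) ((γ₂.X ^ (a - 1)) (l a w)) = γ.lowestForm a u w) :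
    ∃ g : Sp B, (∀ v, Sp.toEnd g (γ.H v) = γ₂.H (Sp.toEnd g v)) ∧
      ∀ v, Sp.toEnd g (γ.Y v) = γ₂.Y (Sp.toEnd g v) := by
  classical
  set Φ := LinearEquiv.ofBijective _ hs with hΦ
  set Φ₂ := stringMap γ γ₂ l with hΦ₂
  have hΦa : ∀ x, Φ x = ∑ i : StringIndex (finrank K V), (γ.X ^ (i.2 : ℕ)) (x i : V) := fun x => rfl
  -- The form on strings is expressed through the forms on lowest weight vectors by a formula common
  -- to both triples, so sending `X^k u` to `X₂^k (l u)` is isometric.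
  have hiso : ∀ x y, B (Φ₂ x) (Φ₂ y) = B (Φ x) (Φ y) := by
    intro x y
    rw [hΦa, hΦa, stringMap_apply, stringMap_apply]
    simp only [map_sum, LinearMap.sum_apply]
    refine Finset.sum_congr rfl fun i _ => Finset.sum_congr rfl fun j _ => ?_
    rw [γ₂.form_strings hp (hl _ _) (hl _ _) j.2.2 i.2.2,
      γ.form_strings hp (x j).2 (y i).2 j.2.2 i.2.2]
    split_ifs with h
    · have h3 := i.2.2
      obtain ⟨⟨i1, hi1⟩, i2⟩ := i
      obtain ⟨⟨j1, hj1⟩, j2⟩ := j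
      obtain ⟨h1, -⟩ := h
      simp only at h1
      subst h1
      have := hf j1 (by simp only at h3; omega) (x ⟨⟨j1, hj1⟩, j2⟩) (y ⟨⟨j1, hj1⟩, i2⟩)
      rw [lowestForm_apply] at this
      exact congrArg _ this
    · rfl
  have hisoV : ∀ v w, B (Φ₂ (Φ.symm v)) (Φ₂ (Φ.symm w)) = B v w := fun v w => by
    rw [hiso, LinearEquiv.apply_symm_apply, LinearEquiv.apply_symm_apply]
  have hinj : Function.Injective (Φ₂ ∘ₗ (Φ.symm : V →ₗ[K] _)) := by
    rw [← LinearMap.ker_eq_bot, LinearMap.ker_eq_bot']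
    intro v hv
    refine hnd.1 v fun w => ?_
    rw [← hisoV v w]
    have hv' : Φ₂ (Φ.symm v) = 0 := hv
    rw [hv', map_zero, LinearMap.zero_apply]
  let g : Sp B := ⟨LinearEquiv.ofInjectiveEndo _ hinj, hisoV⟩
  have hg : ∀ v, Sp.toEnd g v = Φ₂ (Φ.symm v) := fun v => rfl
  have hgx : ∀ a, ∀ u : γ.lowest a, ∀ k < a, Sp.toEnd g ((γ.X ^ k) u) = (γ₂.X ^ k) (l a u) := by
    intro a u k hk
    by_cases ha : finrank K V < a
    · have hu : u = 0 := by
        have := u.2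
        exact Subtype.ext ((Submodule.eq_bot_iff _).1 (lowest_eq_bot ha) _ this)
      simp [hu]
    · set i : StringIndex (finrank K V) := ⟨⟨a, by omega⟩, ⟨k, hk⟩⟩ with hi
      have h1 : Φ (Pi.single i u) = (γ.X ^ k) u :=
        γ.stringMap_single γ (fun a => (γ.lowest a).subtype) i u
      rw [hg, ← h1, LinearEquiv.symm_apply_apply]
      exact γ.stringMap_single γ₂ l i u
  have hind : ∀ S T : Module.End K V, (∀ a, ∀ u : γ.lowest a, ∀ k < a,
      S ((γ.X ^ k) u) = T ((γ.X ^ k) u)) → S = T := by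
    intro S T h
    refine LinearMap.ext fun v => ?_
    obtain ⟨x, rfl⟩ := hs.2 v
    rw [stringMap_apply, map_sum, map_sum]
    exact Finset.sum_congr rfl fun i _ => h _ _ _ i.2.2
  refine ⟨g, LinearMap.congr_fun (hind (Sp.toEnd g * γ.H) (γ₂.H * Sp.toEnd g) ?_),
    LinearMap.congr_fun (hind (Sp.toEnd g * γ.Y) (γ₂.Y * Sp.toEnd g) ?_)⟩
  · intro a u k hk
    rw [Module.End.mul_apply, Module.End.mul_apply, hgx a u k hk, H_X_pow u.2, map_smul,
      hgx a u k hk, H_X_pow (hl a u)]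
  · intro a u k hk
    rw [Module.End.mul_apply, Module.End.mul_apply, hgx a u k hk]
    cases k with
    | zero => simp [lowest_Y u.2, lowest_Y (hl a u)]
    | succ k =>
      rw [γ.Y_pow (lowest_H u.2) (lowest_Y u.2), γ₂.Y_pow (lowest_H (hl a u)) (lowest_Y (hl a u)),
        map_smul, hgx a u k (by omega)]

end Triple

end Strings

end
end SpFourier

namespace SpFourier
noncomputable section

/-! ### Sum of a triple and of a triple on its fixed space -/

section DirectSum

variable {K : Type*} [Field K] {V : Type*} [AddCommGroup V] [Module K V]
variable {B : LinearMap.BilinForm K V}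

/-- The extension of an endomorphism of `U` by zero on the orthogonal complement of `U`. -/
def liftEnd {U : Submodule K V} (h : IsCompl U (B.orthogonal U)) (T : Module.End K U) :
    Module.End K V := U.subtype ∘ₗ T ∘ₗ U.projectionOnto _ h

section Lift

variable {U : Submodule K V} (h : IsCompl U (B.orthogonal U))

theorem liftEnd_apply (T : Module.End K U) (v : V) :
    liftEnd h T v = T (U.projectionOnto _ h v) := rfl

theorem projectionOnto_coe (u : U) : U.projectionOnto _ h (u : V) = u :=
  Submodule.projectionOnto_apply_left h u

theorem projectionOnto_of_mem_orthogonal {v : V} (hv : v ∈ B.orthogonal U) :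
    U.projectionOnto _ h v = 0 := (Submodule.projectionOnto_apply_eq_zero_iff h).2 hv

theorem sub_projectionOnto_mem (v : V) : v - U.projectionOnto _ h v ∈ B.orthogonal U := by
  rw [← Submodule.projectionOnto_apply_eq_zero_iff h, map_sub, projectionOnto_coe, sub_self]

theorem form_projectionOnto_left (hB : B.IsAlt) (v : V) (u : U) :
    B (U.projectionOnto _ h v) u = B v u := by
  have h1 : B (u : V) (v - U.projectionOnto _ h v) = 0 := sub_projectionOnto_mem h v u u.2
  rw [map_sub, sub_eq_zero] at h1
  rw [form_swap hB, ← h1, ← form_swap hB]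

theorem form_projectionOnto_right (u : U) (v : V) :
    B u (U.projectionOnto _ h v) = B u v := by
  have h1 : B (u : V) (v - U.projectionOnto _ h v) = 0 := sub_projectionOnto_mem h v u u.2
  rw [map_sub, sub_eq_zero] at h1
  exact h1.symm

theorem liftEnd_coe (T : Module.End K U) (u : U) : liftEnd h T u = T u := by
  rw [liftEnd_apply, projectionOnto_coe]

theorem liftEnd_of_mem_orthogonal (T : Module.End K U) {v : V} (hv : v ∈ B.orthogonal U) :
    liftEnd h T v = 0 := by
  rw [liftEnd_apply, projectionOnto_of_mem_orthogonal h hv, map_zero, ZeroMemClass.coe_zero]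

theorem liftEnd_skew (hB : B.IsAlt) {T : Module.End K U}
    (hT : T ∈ skewAdjointLieSubalgebra (B.restrict U)) :
    liftEnd h T ∈ skewAdjointLieSubalgebra B := by
  refine (LinearMap.mem_skewAdjointSubmodule (B := B) _).2 fun v w => ?_
  have h1 : B (T (U.projectionOnto _ h v)) (U.projectionOnto _ h w)
      = -B (U.projectionOnto _ h v) (T (U.projectionOnto _ h w)) := skew hT _ _
  rw [form_projectionOnto_left, form_projectionOnto_right] at h1
  · rw [liftEnd_apply, h1, Pi.neg_apply, map_neg, liftEnd_apply]
  · exact hB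

theorem liftEnd_lie (S T : Module.End K U) :
    ⁅liftEnd h S, liftEnd h T⁆ = liftEnd h ⁅S, T⁆ := by
  ext v
  simp [Ring.lie_def, liftEnd_apply]

/-- An operator killing `U` has its image in the orthogonal complement, by skewness, and there the
lifted operators vanish; hence the mixed brackets are zero. -/
theorem lie_add_liftEnd {S T : Module.End K V} (hS : S ∈ skewAdjointLieSubalgebra B)
    (hT : T ∈ skewAdjointLieSubalgebra B) (hS0 : ∀ u ∈ U, S u = 0) (hT0 : ∀ u ∈ U, T u = 0)
    (S' T' : Module.End K U) :
    ⁅S + liftEnd h S', T + liftEnd h T'⁆ = ⁅S, T⁆ + liftEnd h ⁅S', T'⁆ := by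
  have hp : ∀ {S : Module.End K V}, S ∈ skewAdjointLieSubalgebra B → (∀ u ∈ U, S u = 0) →
      ∀ v, U.projectionOnto _ h (S v) = 0 := by
    intro S hS hS0 v
    refine projectionOnto_of_mem_orthogonal h fun u hu => ?_
    have := skew hS u v
    rw [hS0 u hu, map_zero, LinearMap.zero_apply, eq_comm, neg_eq_zero] at this
    exact this
  have h1 : ⁅S, liftEnd h T'⁆ = 0 := by
    ext v
    simp [Ring.lie_def, liftEnd_apply, hp hS hS0, hS0 _ (SetLike.coe_mem _)]
  have h2 : ⁅liftEnd h S', T⁆ = 0 := by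
    ext v
    simp [Ring.lie_def, liftEnd_apply, hp hT hT0, hT0 _ (SetLike.coe_mem _)]
  have h3 : ⁅S + liftEnd h S', T + liftEnd h T'⁆
      = ⁅S, T⁆ + ⁅S, liftEnd h T'⁆ + ⁅liftEnd h S', T⁆ + ⁅liftEnd h S', liftEnd h T'⁆ := by
    simp only [Ring.lie_def]
    noncomm_ring
  rw [h3, h1, h2, liftEnd_lie, add_zero, add_zero]

end Lift

namespace Triple

/-- The sum of a triple and of a triple on its fixed space. -/
def directSum (hB : B.IsAlt) (γ₁ : Triple B) (γ' : Triple (B.restrict γ₁.fixed))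
    (h : IsCompl γ₁.fixed (B.orthogonal γ₁.fixed)) : Triple B where
  X := γ₁.X + liftEnd h γ'.X
  H := γ₁.H + liftEnd h γ'.H
  Y := γ₁.Y + liftEnd h γ'.Y
  X_mem := add_mem γ₁.X_mem (liftEnd_skew h hB γ'.X_mem)
  H_mem := add_mem γ₁.H_mem (liftEnd_skew h hB γ'.H_mem)
  Y_mem := add_mem γ₁.Y_mem (liftEnd_skew h hB γ'.Y_mem)
  lie_H_X := by
    rw [lie_add_liftEnd h γ₁.H_mem γ₁.X_mem (fun u hu => hu.1.2) (fun u hu => hu.1.1),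
      γ₁.lie_H_X, γ'.lie_H_X, smul_add]
    rfl
  lie_H_Y := by
    rw [lie_add_liftEnd h γ₁.H_mem γ₁.Y_mem (fun u hu => hu.1.2) (fun u hu => hu.2),
      γ₁.lie_H_Y, γ'.lie_H_Y, smul_add, neg_add]
    congr 1
  lie_X_Y := by
    rw [lie_add_liftEnd h γ₁.X_mem γ₁.Y_mem (fun u hu => hu.1.1) (fun u hu => hu.2),
      γ₁.lie_X_Y, γ'.lie_X_Y]

section DirectSumApply

variable (hB : B.IsAlt) (γ₁ : Triple B) (γ' : Triple (B.restrict γ₁.fixed))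
  (h : IsCompl γ₁.fixed (B.orthogonal γ₁.fixed))

theorem directSum_X_coe (u : γ₁.fixed) : (directSum hB γ₁ γ' h).X u = γ'.X u := by
  change γ₁.X u + liftEnd h γ'.X u = _
  rw [show γ₁.X (u : V) = 0 from u.2.1.1, zero_add, liftEnd_coe]

theorem directSum_H_coe (u : γ₁.fixed) : (directSum hB γ₁ γ' h).H u = γ'.H u := by
  change γ₁.H u + liftEnd h γ'.H u = _
  rw [show γ₁.H (u : V) = 0 from u.2.1.2, zero_add, liftEnd_coe]

theorem directSum_Y_coe (u : γ₁.fixed) : (directSum hB γ₁ γ' h).Y u = γ'.Y u := by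
  change γ₁.Y u + liftEnd h γ'.Y u = _
  rw [show γ₁.Y (u : V) = 0 from u.2.2, zero_add, liftEnd_coe]

theorem directSum_X_pow_coe (u : γ₁.fixed) (k : ℕ) :
    ((directSum hB γ₁ γ' h).X ^ k) u = (γ'.X ^ k) u := by
  induction k with
  | zero => rfl
  | succ k ih =>
    rw [pow_succ', pow_succ', Module.End.mul_apply, Module.End.mul_apply, ih, directSum_X_coe]

variable {v : V} (hv : v ∈ B.orthogonal γ₁.fixed)
include hv

theorem directSum_H_of_mem : (directSum hB γ₁ γ' h).H v = γ₁.H v := by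
  change γ₁.H v + liftEnd h γ'.H v = _
  rw [liftEnd_of_mem_orthogonal h _ hv, add_zero]

theorem directSum_Y_of_mem : (directSum hB γ₁ γ' h).Y v = γ₁.Y v := by
  change γ₁.Y v + liftEnd h γ'.Y v = _
  rw [liftEnd_of_mem_orthogonal h _ hv, add_zero]

theorem directSum_X_pow_of_mem (k : ℕ) : ((directSum hB γ₁ γ' h).X ^ k) v = (γ₁.X ^ k) v := by
  induction k with
  | zero => rfl
  | succ k ih =>
    rw [pow_succ', pow_succ', Module.End.mul_apply, Module.End.mul_apply, ih]
    change γ₁.X _ + liftEnd h γ'.X _ = _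
    rw [liftEnd_of_mem_orthogonal h, add_zero]
    cases k with
    | zero => exact hv
    | succ k =>
      intro u hu
      have := skew γ₁.X_mem u ((γ₁.X ^ k) v)
      rw [show γ₁.X u = 0 from hu.1.1, map_zero, LinearMap.zero_apply, eq_comm, neg_eq_zero] at this
      rw [pow_succ']
      exact this

end DirectSumApply

end Triple

/-- A Lagrangian subspace between the steps of degree one and zero of the filtration. -/
theorem Triple.Full.exists_lagrangian [FiniteDimensional K V] {γ : Triple B} (hγ : γ.Full) :
    ∃ L : Submodule K V, γ.fil 1 ≤ L ∧ L ≤ γ.fil 0 ∧ (∀ v ∈ L, ∀ w ∈ L, B v w = 0) ∧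
      ∀ v, (∀ w ∈ L, B w v = 0) → v ∈ L := by
  -- Take a maximal isotropic subspace between the two steps. A vector orthogonal to it is
  -- orthogonal to `fil 1`, hence lies in `fil 0`, and could be adjoined.
  obtain ⟨L, ⟨h1, h0, hiso⟩, hmax⟩ := wellFounded_gt.has_min
    {L : Submodule K V | γ.fil 1 ≤ L ∧ L ≤ γ.fil 0 ∧ ∀ v ∈ L, ∀ w ∈ L, B v w = 0}
    ⟨γ.fil 1, le_rfl, γ.fil_anti (by norm_num),
      fun v hv w hw => hγ.form_fil_fil (by norm_num) hv hw⟩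
  refine ⟨L, h1, h0, hiso, fun v hv => ?_⟩
  have hv0 : v ∈ γ.fil 0 := hγ.mem_fil_of_form fun w hw => by
    rw [form_swap hγ.alt, hv w (h1 (by simpa using hw)), neg_zero]
  by_contra hvL
  refine hmax (L ⊔ Submodule.span K {v}) ⟨h1.trans le_sup_left, sup_le h0 ?_, ?_⟩
    (lt_of_le_of_ne le_sup_left fun h => hvL ?_)
  rotate_right
  · rw [h]
    exact Submodule.mem_sup_right (Submodule.mem_span_singleton_self v)
  · rwa [Submodule.span_singleton_le_iff_mem]
  · intro a' ha' b' hb'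
    obtain ⟨a, ha, x, hx, rfl⟩ := Submodule.mem_sup.1 ha'
    obtain ⟨b, hb, y, hy, rfl⟩ := Submodule.mem_sup.1 hb'
    obtain ⟨c, rfl⟩ := Submodule.mem_span_singleton.1 hx
    obtain ⟨d, rfl⟩ := Submodule.mem_span_singleton.1 hy
    have h3 : B v b = 0 := by rw [form_swap hγ.alt, hv b hb, neg_zero]
    have h4 : B v v = 0 := hγ.alt v
    simp [hiso a ha b hb, hv a ha, h3, h4]

end DirectSum

end
end SpFourier

namespace SpFourier
noncomputable section

/-! ### The sum of the two triples gives a stage -/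

section Stack

variable {K : Type*} [Field K] {V : Type*} [AddCommGroup V] [Module K V] [FiniteDimensional K V]
variable {B : LinearMap.BilinForm K V}

/-- The triple `γ₁` has a single nontrivial string, of even length `m` and generated by `v₀`, and
`γ'` is a triple on its fixed space in which all strings have length at most `m`. -/
structure Stackable (γ₁ : Triple B) (γ' : Triple (B.restrict γ₁.fixed)) (m : ℕ) (v₀ : V) :
    Prop where
  full₁ : γ₁.Full
  full' : γ'.Full
  isCompl : IsCompl γ₁.fixed (B.orthogonal γ₁.fixed)
  even : Even m
  pos : 0 < m
  le : m ≤ finrank K V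
  mem : v₀ ∈ γ₁.lowest m
  ne : v₀ ≠ 0
  span : ∀ v,
    v ∈ γ₁.fixed ⊔ Submodule.span K ((fun k => (γ₁.X ^ k) v₀) '' {k | k ≤ m - 1})
  weight : ∀ j : ℤ, (m : ℤ) ≤ |j| → γ'.weightSpace j = ⊥

namespace Stackable

open Triple Triple.Full

variable {γ₁ : Triple B} {γ' : Triple (B.restrict γ₁.fixed)} {m : ℕ} {v₀ : V}
  (hs : Stackable γ₁ γ' m v₀)
include hs

theorem X_pow_mem_orthogonal (k : ℕ) (hk : k < m) :
    (γ₁.X ^ k) v₀ ∈ B.orthogonal γ₁.fixed := by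
  have hle := hs.le
  have hp := hs.full₁.char
  have hc : ((1 - (m : ℤ) + 2 * (k : ℤ) : ℤ) : K) ≠ 0 := by
    obtain ⟨r, hr⟩ := hs.even
    -- For `m` even the weight `1 - m + 2k` is odd, hence nonzero, so the string is orthogonal to
    -- the weight zero space.
    exact intCast_ne (by omega) (by rw [abs_lt]; omega)
  intro u hu
  have h1 := skew γ₁.H_mem u ((γ₁.X ^ k) v₀)
  rw [show γ₁.H u = 0 from hu.1.2, map_zero, LinearMap.zero_apply, H_X_pow hs.mem, map_smul,
    eq_comm, neg_eq_zero, smul_eq_mul] at h1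
  push_cast at hc
  exact (mul_eq_zero.1 h1).resolve_left hc

theorem form_X_pow_zero {j k : ℕ} (hj : j < m) (hk : k < m) (h : j + k + 1 ≠ m) :
    B ((γ₁.X ^ j) v₀) ((γ₁.X ^ k) v₀) = 0 := by
  rw [γ₁.form_strings hs.full₁.char hs.mem hs.mem hj hk, if_neg fun h' => h h'.2]

theorem sum_mem_span (v : V) : v - γ₁.fixed.projectionOnto _ hs.isCompl v ∈
    Submodule.span K ((fun k => (γ₁.X ^ k) v₀) '' {k | k ≤ m - 1}) := by
  obtain ⟨u, hu, s, hs', rfl⟩ := Submodule.mem_sup.1 (hs.span v)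
  have hpos := hs.pos
  have hle : Submodule.span K ((fun k => (γ₁.X ^ k) v₀) '' {k | k ≤ m - 1})
      ≤ B.orthogonal γ₁.fixed := by
    rw [Submodule.span_le]
    rintro _ ⟨k, hk, rfl⟩
    rw [Set.mem_ofPred_eq] at hk
    exact hs.X_pow_mem_orthogonal k (by omega)
  rw [map_add, projectionOnto_of_mem_orthogonal _ (hle hs'), add_zero,
    projectionOnto_coe hs.isCompl ⟨u, hu⟩, add_sub_cancel_left]
  exact hs'

/-- `v₀` is orthogonal to the fixed space and to all other string vectors, so a zero here would put
it in the radical. -/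
theorem form_top_ne : B v₀ ((γ₁.X ^ (m - 1)) v₀) ≠ 0 := by
  intro h
  have hpos := hs.pos
  refine hs.ne (hs.full₁.nondeg.1 _ fun v => ?_)
  have h1 : B v₀ (γ₁.fixed.projectionOnto _ hs.isCompl v) = 0 := by
    rw [form_swap hs.full₁.alt, show B _ v₀ = 0 from hs.X_pow_mem_orthogonal 0 hpos _ (SetLike.coe_mem _), neg_zero]
  have h2 : Submodule.span K ((fun k => (γ₁.X ^ k) v₀) '' {k | k ≤ m - 1})
      ≤ LinearMap.ker (B v₀) := by
    rw [Submodule.span_le]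
    rintro _ ⟨k, hk, rfl⟩
    rw [Set.mem_ofPred_eq] at hk
    rcases eq_or_ne k (m - 1) with rfl | hne
    · exact h
    · exact hs.form_X_pow_zero (j := 0) hpos (by omega) (by omega)
  have h3 : B v₀ (v - γ₁.fixed.projectionOnto _ hs.isCompl v) = 0 := h2 (hs.sum_mem_span v)
  rwa [map_sub, h1, sub_zero] at h3

theorem form_X_pow_ne {j k : ℕ} (h : j + k + 1 = m) :
    B ((γ₁.X ^ j) v₀) ((γ₁.X ^ k) v₀) ≠ 0 := by
  rw [γ₁.form_strings hs.full₁.char hs.mem hs.mem (by omega) (by omega), if_pos ⟨rfl, h⟩]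
  exact mul_ne_zero (pow_ne_zero _ (by simp)) hs.form_top_ne

/-- The sum of the two triples. -/
abbrev sum : Triple B := directSum hs.full₁.alt γ₁ γ' hs.isCompl

theorem map_weightSpace_le (j : ℤ) :
    (γ'.weightSpace j).map γ₁.fixed.subtype ≤ hs.sum.weightSpace j := by
  rintro _ ⟨u, hu, rfl⟩
  have hle := Submodule.finrank_le γ₁.fixed
  by_cases hj : |j| < (finrank K γ₁.fixed : ℤ)
  · rw [weightSpace, if_pos (by omega), End.mem_eigenspace_iff, Submodule.subtype_apply,
      directSum_H_coe, H_apply_of_mem hu]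
    rfl
  · rw [SetLike.mem_coe, weightSpace_eq_bot (not_lt.1 hj), Submodule.mem_bot] at hu
    rw [hu, map_zero]
    exact zero_mem _

theorem map_fil_le (j : ℤ) : (γ'.fil j).map γ₁.fixed.subtype ≤ hs.sum.fil j := by
  rw [fil, Submodule.map_iSup]
  refine iSup_le fun i => ?_
  rw [Submodule.map_iSup]
  exact iSup_le fun hi => (hs.map_weightSpace_le i).trans (weightSpace_le_fil hi)

theorem X_pow_mem_weightSpace (γ₂ : Triple B) (hγ : γ₂.H ((γ₁.X ^ k) v₀) = γ₁.H ((γ₁.X ^ k) v₀))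
    (hk : k < m) : (γ₁.X ^ k) v₀ ∈ γ₂.weightSpace (2 * (k : ℤ) - (m - 1 : ℕ)) := by
  have hle := hs.le
  rw [weightSpace, if_pos (by rw [abs_lt]; omega), End.mem_eigenspace_iff, hγ, H_X_pow hs.mem]
  congr 1
  rw [Nat.cast_sub hs.pos]
  push_cast
  ring

theorem X_pow_mem_sum {k : ℕ} (hk : k < m) :
    (γ₁.X ^ k) v₀ ∈ hs.sum.weightSpace (2 * (k : ℤ) - (m - 1 : ℕ)) :=
  hs.X_pow_mem_weightSpace hs.sum (directSum_H_of_mem _ _ _ _ (hs.X_pow_mem_orthogonal k hk)) hk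

theorem X_pow_mem_left {k : ℕ} (hk : k < m) :
    (γ₁.X ^ k) v₀ ∈ γ₁.weightSpace (2 * (k : ℤ) - (m - 1 : ℕ)) :=
  hs.X_pow_mem_weightSpace γ₁ rfl hk

theorem full_sum : hs.sum.Full where
  alt := hs.full₁.alt
  nondeg := hs.full₁.nondeg
  char := hs.full₁.char
  top := by
    have hpos := hs.pos
    rw [eq_top_iff]
    intro v _
    rw [← sub_add_cancel v (γ₁.fixed.projectionOnto _ hs.isCompl v : V)]
    refine add_mem ?_ ?_
    · refine (Submodule.span_le.2 ?_) (hs.sum_mem_span v)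
      rintro _ ⟨k, hk, rfl⟩
      rw [Set.mem_ofPred_eq] at hk
      exact Submodule.mem_iSup_of_mem _ (hs.X_pow_mem_sum (by omega))
    · have h1 : (⊤ : Submodule K γ₁.fixed).map γ₁.fixed.subtype ≤ ⨆ j, hs.sum.weightSpace j := by
        rw [← hs.full'.top, Submodule.map_iSup]
        exact iSup_mono hs.map_weightSpace_le
      exact h1 ⟨_, trivial, rfl⟩

theorem exists_frame : ∃ f : Frame B hs.sum.Y (m - 1), f.V0 = γ₁.fixed ∧
    (∀ v, f.pr0 v = γ₁.fixed.projectionOnto _ hs.isCompl v) ∧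
    (∀ k ≤ m - 1, f.x k = (γ₁.X ^ k) v₀) ∧
    ∀ c, f.F0 c = (γ'.fil c).map γ₁.fixed.subtype := by
  classical
  obtain ⟨L, hL1, hL0, hiso, hmax⟩ := hs.full'.exists_lagrangian
  have hpos := hs.pos
  have hle := hs.le
  have hp := hs.full₁.char
  have hbot : ∀ j : ℤ, (m : ℤ) ≤ |j| → ∀ u, γ'.proj j u = 0 := fun j hj u => by
    have := hs.full'.proj_mem j u
    rwa [hs.weight j hj, Submodule.mem_bot] at this
  refine ⟨{
    V0 := γ₁.fixed
    pr0 := γ₁.fixed.subtype ∘ₗ γ₁.fixed.projectionOnto _ hs.isCompl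
    x := fun k => if k ≤ m - 1 then (γ₁.X ^ k) v₀ else 0
    -- The coefficient in `Y X^(k+1) v₀`, for the lowest weight `1 - m`.
    lam := fun k => -(((k : K) + 1) * (1 - (m : K) + k))
    F0 := fun c => (γ'.fil c).map γ₁.fixed.subtype
    L0 := L.map γ₁.fixed.subtype
    alt := hs.full₁.alt
    skewY := hs.sum.Y_mem
    odd := ?_
    pr0_mem := fun v => SetLike.coe_mem _
    pr0_of_mem := fun v hv => congrArg Subtype.val (projectionOnto_coe hs.isCompl ⟨v, hv⟩)
    pr0_x := ?_
    sub_pr0_mem := ?_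
    orth := ?_
    form_x_zero := ?_
    form_x_ne := ?_
    Y_x_zero := ?_
    Y_x_succ := ?_
    lam_ne := ?_
    F0_le := fun c => Submodule.map_subtype_le _ _
    F0_anti := fun b b' hb => Submodule.map_mono (γ'.fil_anti hb)
    F0_top := ?_
    F0_bot := ?_
    F0_orth := ?_
    F0_mem := ?_
    Y_F0 := ?_
    L0_le := Submodule.map_mono hL0
    le_L0 := Submodule.map_mono hL1
    L0_orth := ?_
    L0_mem := ?_ }, rfl, fun v => rfl, fun k hk => if_pos hk, fun c => rfl⟩
  · obtain ⟨r, hr⟩ := hs.even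
    exact ⟨r - 1, by omega⟩
  · intro k
    change ((γ₁.fixed.projectionOnto _ hs.isCompl _ : γ₁.fixed) : V) = 0
    split_ifs with hk
    · rw [projectionOnto_of_mem_orthogonal _ (hs.X_pow_mem_orthogonal k (by omega)),
        ZeroMemClass.coe_zero]
    · rw [map_zero, ZeroMemClass.coe_zero]
  · intro v
    have h1 : (fun k => if k ≤ m - 1 then (γ₁.X ^ k) v₀ else 0) '' {k | k ≤ m - 1}
        = (fun k => (γ₁.X ^ k) v₀) '' {k | k ≤ m - 1} :=
      Set.image_congr fun k hk => if_pos hk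
    rw [h1]
    exact hs.sum_mem_span v
  · intro v hv k
    split_ifs with hk
    · exact hs.X_pow_mem_orthogonal k (by omega) v hv
    · rw [map_zero]
  · intro j k hjk
    split_ifs with hj hk hk
    · exact hs.form_X_pow_zero (by omega) (by omega) (by omega)
    all_goals simp
  · intro j k hjk
    rw [if_pos (by omega), if_pos (by omega)]
    exact hs.form_X_pow_ne (by omega)
  · rw [if_pos (Nat.zero_le _), directSum_Y_of_mem _ _ _ _ (hs.X_pow_mem_orthogonal 0 hpos)]
    exact lowest_Y hs.mem
  · intro k hk
    rw [if_pos (by omega), if_pos (by omega),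
      directSum_Y_of_mem _ _ _ _ (hs.X_pow_mem_orthogonal (k + 1) (by omega)),
      γ₁.Y_pow (lowest_H hs.mem) (lowest_Y hs.mem)]
  · intro k hk
    refine neg_ne_zero.2 (mul_ne_zero ?_ ?_)
    · exact_mod_cast natCast_ne (K := K) (m := k + 1) (by omega) (by omega)
    · have := intCast_ne (K := K) (m := 1 - (m : ℤ) + k) (by omega) (by rw [abs_lt]; omega)
      exact_mod_cast this
  -- All strings of `γ'` have length at most `m`, so its weights do not exceed those of the long
  -- string, and the filtration is already everything at `-(m - 1)` and zero beyond `m - 1`. This is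
  -- where the maximality of the part `2n₁` enters.
  · intro b hb
    have h1 : γ'.fil b = ⊤ := by
      rw [eq_top_iff]
      intro u _
      rw [hs.full'.mem_fil_iff]
      intro j hj
      exact hbot j (by rw [le_abs]; omega) u
    change (γ'.fil b).map _ = _
    rw [h1, Submodule.map_subtype_top]
  · intro b hb
    have h1 : γ'.fil b = ⊥ := by
      rw [fil, eq_bot_iff]
      refine iSup_le fun i => iSup_le fun hi => ?_
      rw [hs.weight i (by rw [le_abs]; omega)]
    change (γ'.fil b).map _ = _
    rw [h1, Submodule.map_bot]
  · rintro b b' hb _ ⟨v, hv, rfl⟩ _ ⟨w, hw, rfl⟩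
    exact hs.full'.form_fil_fil (by omega) hv hw
  · intro b v hv h
    refine ⟨⟨v, hv⟩, hs.full'.mem_fil_of_form fun w hw => ?_, rfl⟩
    rw [form_swap hs.full'.alt]
    refine neg_eq_zero.2 (h w ⟨w, ?_, rfl⟩)
    simpa using hw
  · rintro b _ ⟨v, hv, rfl⟩
    exact ⟨γ'.Y v, hs.full'.raisesZ_Y b v hv, (directSum_Y_coe _ _ _ _ v).symm⟩
  · rintro _ ⟨v, hv, rfl⟩ _ ⟨w, hw, rfl⟩
    exact hiso v hv w hw
  · intro v hv h
    exact ⟨⟨v, hv⟩, hmax _ fun w hw => h w ⟨w, hw, rfl⟩, rfl⟩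

/-- The filtrations of the sum and of `γ₁` must be those of the frame. Generators give one
inclusion; for the other, components are tested by pairing with the dual step of the filtration and
with string vectors. -/
theorem exists_stage : ∃ f : Frame B hs.sum.Y (m - 1), Stage γ₁ hs.sum γ' f := by
  obtain ⟨f, hV0, hpr, hx, hF0⟩ := hs.exists_frame
  have hpos := hs.pos
  have hγ := hs.full_sum
  have hγ₁ := hs.full₁
  have h0 : γ₁.fixed ≤ γ₁.weightSpace 0 := fun u hu =>
    hγ₁.mem_weightSpace_of_eq (by simp; omega) (by rw [show γ₁.H u = 0 from hu.1.2]; simp)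
  have hxs : ∀ k ≤ m - 1, f.x k ∈ hs.sum.weightSpace (2 * (k : ℤ) - (m - 1 : ℕ)) :=
    fun k hk => by rw [hx k hk]; exact hs.X_pow_mem_sum (by omega)
  have hx1 : ∀ k ≤ m - 1, f.x k ∈ γ₁.weightSpace (2 * (k : ℤ) - (m - 1 : ℕ)) :=
    fun k hk => by rw [hx k hk]; exact hs.X_pow_mem_left (by omega)
  refine ⟨f, ?_⟩
  constructor
  · constructor
    · constructor
      · exact hγ
      · intro c
        refine le_antisymm (fun v hv => Frame.mem_P.2 (And.intro ?_ fun k hk hc => ?_)) ?_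
        rotate_right
        · refine Frame.P_le ?_ fun k hk hc => weightSpace_le_fil hc (hxs k hk)
          rw [hF0]
          exact hs.map_fil_le c
        · rw [hpr, hF0]
          refine ⟨_, hs.full'.mem_fil_of_form fun w hw => ?_, rfl⟩
          refine (form_projectionOnto_left hs.isCompl hγ.alt v w).trans ?_
          exact hγ.form_fil_fil (i := c) (j := 1 - c) (by omega) hv (hs.map_fil_le _ ⟨w, hw, rfl⟩)
        · exact hγ.form_fil_weightSpace (by omega) hv (hxs k hk)
    · exact hs.full'
    · exact hV0
    · exact hs.isCompl
    · exact hF0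
    · exact directSum_Y_coe _ _ _ _
    · exact hxs
    · intro j v hv
      unfold weightSpace at hv ⊢
      split_ifs at hv ⊢ with hj
      · rw [End.mem_eigenspace_iff] at hv ⊢
        rw [hpr, directSum_H_coe, ← liftEnd_apply]
        have h1 : hs.sum.H v = γ₁.H v + liftEnd hs.isCompl γ'.H v := rfl
        have h2 : γ₁.fixed.projectionOnto _ hs.isCompl (γ₁.H v) = 0 := by
          refine projectionOnto_of_mem_orthogonal _ fun u hu => ?_
          have := skew γ₁.H_mem u v
          rw [show γ₁.H u = 0 from hu.1.2, map_zero, LinearMap.zero_apply, eq_comm,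
            neg_eq_zero] at this
          exact this
        have h3 := congrArg (γ₁.fixed.projectionOnto _ hs.isCompl) h1
        rw [map_add, h2, zero_add, liftEnd_apply, projectionOnto_coe, hv, map_smul] at h3
        rw [liftEnd_apply, ← h3]
        rfl
      · rw [Submodule.mem_bot] at hv ⊢
        rw [hv, map_zero]
  · exact hγ₁
  · intro c hc
    refine le_antisymm (fun v hv => Frame.mem_P.2 (And.intro ?_ fun k hk hc => ?_))
      (Frame.P_le bot_le fun k hk hc => weightSpace_le_fil hc (hx1 k hk))
    · rw [hpr, Submodule.mem_bot, ZeroMemClass.coe_eq_zero]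
      refine hs.full'.nondeg.1 _ fun w => ?_
      refine (form_projectionOnto_left hs.isCompl hγ.alt v w).trans ?_
      exact hγ₁.form_fil_weightSpace (i := c) (j := 0) (by omega) hv (h0 w.2)
    · exact hγ₁.form_fil_weightSpace (by omega) hv (hx1 k hk)
  · intro c hc
    refine le_antisymm (fun v hv => Frame.mem_P.2 (And.intro (f.pr0_mem v) fun k hk hc =>
      hγ₁.form_fil_weightSpace (by omega) hv (hx1 k hk))) ?_
    refine Frame.P_le ?_ fun k hk hc => weightSpace_le_fil hc (hx1 k hk)
    rw [hV0]
    exact h0.trans (weightSpace_le_fil hc)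
  · exact hx1
  · intro k hk
    rw [hx k hk, directSum_Y_of_mem _ _ _ _ (hs.X_pow_mem_orthogonal k (by omega))]

theorem coe_mem_lowest {a : ℕ} {u : γ₁.fixed} (hu : u ∈ γ'.lowest a) :
    (u : V) ∈ hs.sum.lowest a := by
  refine ⟨?_, hs.map_weightSpace_le _ ⟨u, hu.2, rfl⟩⟩
  rw [SetLike.mem_coe, LinearMap.mem_ker, directSum_Y_coe, lowest_Y hu, ZeroMemClass.coe_zero]

theorem mem_lowest_sum : v₀ ∈ hs.sum.lowest m := by
  have h : v₀ ∈ B.orthogonal γ₁.fixed := hs.X_pow_mem_orthogonal 0 hs.pos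
  refine mem_lowest hs.pos hs.le ?_ ?_
  · rw [directSum_Y_of_mem _ _ _ _ h]
    exact lowest_Y hs.mem
  · rw [directSum_H_of_mem _ _ _ _ h]
    exact lowest_H hs.mem

theorem form_lowest_sum (c d : K) (k : ℕ) (hk : k < m) (u w : γ₁.fixed) :
    B (c • v₀ + u) ((hs.sum.X ^ k) (d • v₀ + w))
      = c * d * B v₀ ((γ₁.X ^ k) v₀) + B.restrict _ u ((γ'.X ^ k) w) := by
  have h : v₀ ∈ B.orthogonal γ₁.fixed := hs.X_pow_mem_orthogonal 0 hs.pos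
  rw [map_add (hs.sum.X ^ k), map_smul (hs.sum.X ^ k), directSum_X_pow_coe,
    directSum_X_pow_of_mem _ _ _ _ h]
  have h1 : B u ((γ₁.X ^ k) v₀) = 0 := hs.X_pow_mem_orthogonal k hk u u.2
  have h2 : B v₀ ((γ'.X ^ k) w : γ₁.fixed) = 0 := by
    rw [form_swap hs.full₁.alt, h _ (SetLike.coe_mem _), neg_zero]
  simp only [map_add, map_smul, LinearMap.add_apply, LinearMap.smul_apply, smul_eq_mul, h1, h2]
  rw [LinearMap.BilinForm.restrict_apply]
  simp only [LinearMap.domRestrict_apply]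
  ring

end Stackable

end Stack

end
end SpFourier

namespace SpFourier
noncomputable section

/-! ### Alternating forms, and quadratic forms over a finite field -/

section Forms

variable {K : Type*} [Field K]

section Alternating

variable {E : Type*} [AddCommGroup E] [Module K E] (h : LinearMap.BilinForm K E)

/-- The vectors orthogonal to `e` and to `f`. -/
abbrev pairOrthogonal (e f : E) : Submodule K E := LinearMap.ker ((h.flip e).prod (h.flip f))

variable {h}

theorem mem_pairOrthogonal {e f u : E} : u ∈ pairOrthogonal h e f ↔ h u e = 0 ∧ h u f = 0 := by
  simp

variable (ha : h.IsAlt)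
include ha

theorem exists_hyperbolic_pair [FiniteDimensional K E] (hn : ∀ u, (∀ w, h u w = 0) → u = 0)
    (h0 : 0 < finrank K E) : ∃ e f : E, h e f = 1 ∧ h f e = -1 := by
  obtain ⟨e, he⟩ := finrank_pos_iff_exists_ne_zero.1 h0
  have : ∃ f, h e f ≠ 0 := by
    by_contra hc
    push Not at hc
    exact he (hn e hc)
  obtain ⟨f, hf⟩ := this
  have h1 : h e ((h e f)⁻¹ • f) = 1 := by rw [map_smul, smul_eq_mul, inv_mul_cancel₀ hf]
  exact ⟨e, (h e f)⁻¹ • f, h1, by rw [← ha.neg_eq, h1]⟩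

variable {e f : E} (hef : h e f = 1) (hfe : h f e = -1)
include hef hfe

theorem finrank_pairOrthogonal [FiniteDimensional K E] :
    finrank K (pairOrthogonal h e f) + 2 = finrank K E := by
  have h1 := LinearMap.finrank_range_add_finrank_ker ((h.flip e).prod (h.flip f))
  have h2 : LinearMap.range ((h.flip e).prod (h.flip f)) = ⊤ := by
    rw [LinearMap.range_eq_top]
    rintro ⟨a, b⟩
    refine ⟨b • e - a • f, ?_⟩
    simp [hef, hfe, ha e, ha f]
  rw [h2, finrank_top, Module.finrank_prod, finrank_self] at h1
  change _ + finrank K (pairOrthogonal h e f) = _ at h1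
  omega

theorem exists_pairProjection (hn : ∀ u, (∀ w, h u w = 0) → u = 0) :
    ∃ π : E →ₗ[K] pairOrthogonal h e f, (∀ v, v = h v f • e - h v e • f + π v) ∧
      ∀ u, (∀ w, h.restrict (pairOrthogonal h e f) u w = 0) → u = 0 := by
  let π : E →ₗ[K] pairOrthogonal h e f :=
    LinearMap.codRestrict _ (LinearMap.id - (h.flip f).smulRight e + (h.flip e).smulRight f)
      fun v => by simp [hef, hfe, ha e, ha f]
  have hπ : ∀ v, (π v : E) = v - h v f • e + h v e • f := fun v => rfl
  refine ⟨π, fun v => by rw [hπ]; abel, fun u hu => Subtype.ext (hn _ fun w => ?_)⟩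
  have h4 : h u (π w) = 0 := hu (π w)
  obtain ⟨h5, h6⟩ := mem_pairOrthogonal.1 u.2
  rw [hπ] at h4
  simpa [h5, h6] using h4

theorem form_pair (a b c d : K) (x y : pairOrthogonal h e f) :
    h (a • e - b • f + x) (c • e - d • f + y) = b * c - a * d
      + h.restrict (pairOrthogonal h e f) x y := by
  obtain ⟨h1, h2⟩ := mem_pairOrthogonal.1 x.2
  obtain ⟨h3, h4⟩ := mem_pairOrthogonal.1 y.2
  have h5 : h e y = 0 := by rw [← ha.neg_eq, h3, neg_zero]
  have h6 : h f y = 0 := by rw [← ha.neg_eq, h4, neg_zero]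
  have h7 : h.restrict (pairOrthogonal h e f) x y = h x y := rfl
  rw [h7]
  simp only [map_add, map_sub, map_smul, LinearMap.add_apply, LinearMap.sub_apply,
    LinearMap.smul_apply, smul_eq_mul, hef, hfe, ha e, ha f, h5, h6, h1, h2]
  ring

end Alternating

/-- Alternating nondegenerate forms of the same dimension are isometric. -/
theorem exists_isometry_of_isAlt {E E₂ : Type*} [AddCommGroup E] [Module K E] [AddCommGroup E₂]
    [Module K E₂] [FiniteDimensional K E] [FiniteDimensional K E₂]
    {h : LinearMap.BilinForm K E} {h₂ : LinearMap.BilinForm K E₂} (ha : h.IsAlt) (ha₂ : h₂.IsAlt)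
    (hn : ∀ u, (∀ w, h u w = 0) → u = 0) (hn₂ : ∀ u, (∀ w, h₂ u w = 0) → u = 0)
    (hd : finrank K E = finrank K E₂) :
    ∃ l : E →ₗ[K] E₂, ∀ u w, h₂ (l u) (l w) = h u w := by
  induction hN : finrank K E using Nat.strong_induction_on generalizing E E₂ with
  | _ N ih =>
  rcases Nat.eq_zero_or_pos N with h0 | h0
  · have hE : Subsingleton E := finrank_zero_iff.1 (hN.trans h0)
    exact ⟨0, fun u w => by rw [Subsingleton.elim u 0]; simp⟩
  · obtain ⟨e, f, hef, hfe⟩ := exists_hyperbolic_pair ha hn (by omega)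
    obtain ⟨e₂, f₂, hef₂, hfe₂⟩ := exists_hyperbolic_pair ha₂ hn₂ (by omega)
    have hr := finrank_pairOrthogonal ha hef hfe
    have hr₂ := finrank_pairOrthogonal ha₂ hef₂ hfe₂
    obtain ⟨π, hπ, hn'⟩ := exists_pairProjection ha hef hfe hn
    obtain ⟨-, -, hn₂'⟩ := exists_pairProjection ha₂ hef₂ hfe₂ hn₂
    obtain ⟨l, hl⟩ := ih _ (by omega) (h := h.restrict (pairOrthogonal h e f))
      (h₂ := h₂.restrict (pairOrthogonal h₂ e₂ f₂)) (fun u => ha u) (fun u => ha₂ u) hn' hn₂'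
      (by omega) rfl
    -- Hyperbolic pair to hyperbolic pair, and the isometry given by induction on the orthogonal
    -- complements.
    refine ⟨(h.flip f).smulRight e₂ - (h.flip e).smulRight f₂ + Submodule.subtype _ ∘ₗ l ∘ₗ π,
      fun u w => ?_⟩
    have e1 := form_pair ha₂ hef₂ hfe₂ (h u f) (h u e) (h w f) (h w e) (l (π u)) (l (π w))
    have e2 := form_pair ha hef hfe (h u f) (h u e) (h w f) (h w e) (π u) (π w)
    rw [← hπ, ← hπ] at e2
    rw [e2, ← hl, ← e1]
    rfl

/-- The one-dimensional quadratic form `a x²`. -/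
abbrev unary (a : K) : QuadraticForm K K := a • QuadraticMap.sq

open QuadraticMap

/-- Splitting off the first diagonal coefficient. -/
theorem weightedSumSquares_equivalent_prod {k : ℕ} (w : Fin (k + 1) → K) :
    (weightedSumSquares K w).Equivalent
      ((unary (w 0)).prod (weightedSumSquares K fun i : Fin k => w i.succ)) :=
  Equivalent.symm ⟨{ Fin.consLinearEquiv K (fun _ : Fin (k + 1) => K) with
    map_app' := fun x => by
      simp [weightedSumSquares_apply, Fin.sum_univ_succ] }⟩

theorem unary_equivalent {a b c : K} (hc : c ≠ 0) (h : a = c ^ 2 * b) :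
    (unary a).Equivalent (unary b) :=
  ⟨{ LinearEquiv.smulOfNeZero K K c hc with
    map_app' := fun x => by
      simp [h]
      ring }⟩

/-- Over a finite field of odd characteristic `a x² + b y²` represents `1`. The vector `(-b y, a x)`
is orthogonal to `(x, y)` and has value `a b`. -/
theorem unary_prod_equivalent [Finite K] (h2 : (2 : K) ≠ 0) {a b : K} (ha : a ≠ 0) (hb : b ≠ 0) :
    ((unary a).prod (unary b)).Equivalent ((unary (a * b)).prod (unary 1)) := by
  have : Fintype K := Fintype.ofFinite K
  obtain ⟨x, y, hxy⟩ : ∃ x y : K, a * x ^ 2 + b * y ^ 2 = 1 := by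
    have hcard : Fintype.card K % 2 = 1 := by
      refine FiniteField.odd_card_of_char_ne_two fun h => h2 ?_
      exact_mod_cast (ringChar.spec K 2).2 (by rw [h])
    obtain ⟨x, y, h⟩ := FiniteField.exists_root_sum_quadratic
      (f := Polynomial.C a * Polynomial.X ^ 2 + Polynomial.C 0 * Polynomial.X + Polynomial.C (-1))
      (g := Polynomial.C b * Polynomial.X ^ 2 + Polynomial.C 0 * Polynomial.X + Polynomial.C 0)
      (Polynomial.degree_quadratic ha) (Polynomial.degree_quadratic hb) hcard
    refine ⟨x, y, ?_⟩
    simp at h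
    linear_combination h
  refine Equivalent.symm ⟨{
    toFun := fun z => (z.2 * x - z.1 * (b * y), z.2 * y + z.1 * (a * x))
    invFun := fun z => (-(y * z.1) + x * z.2, a * x * z.1 + b * y * z.2)
    map_add' := fun z z' => Prod.ext (by simp; ring) (by simp; ring)
    map_smul' := fun c z => Prod.ext (by simp; ring) (by simp; ring)
    left_inv := fun z => Prod.ext (by simp; linear_combination z.1 * hxy)
      (by simp; linear_combination z.2 * hxy)
    right_inv := fun z => Prod.ext (by simp; linear_combination z.1 * hxy)
      (by simp; linear_combination z.2 * hxy)
    map_app' := fun z => ?_ }⟩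
  simp
  linear_combination (z.2 ^ 2 + a * b * z.1 ^ 2) * hxy

theorem prod_assoc_equivalent {M₁ M₂ M₃ : Type*} [AddCommGroup M₁] [AddCommGroup M₂]
    [AddCommGroup M₃] [Module K M₁] [Module K M₂] [Module K M₃] (Q₁ : QuadraticForm K M₁)
    (Q₂ : QuadraticForm K M₂) (Q₃ : QuadraticForm K M₃) :
    ((Q₁.prod Q₂).prod Q₃).Equivalent (Q₁.prod (Q₂.prod Q₃)) :=
  ⟨{ LinearEquiv.prodAssoc K M₁ M₂ M₃ with
    map_app' := fun x => by simp [add_assoc] }⟩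

/-- A diagonal form over a finite field is determined by its dimension and its determinant. -/
theorem weightedSumSquares_equivalent_det [Finite K] (h2 : (2 : K) ≠ 0) {k : ℕ}
    (w : Fin (k + 1) → K) (hw : ∀ i, w i ≠ 0) : (weightedSumSquares K w).Equivalent
      ((unary (∏ i, w i)).prod (weightedSumSquares K fun _ : Fin k => (1 : K))) := by
  induction k with
  | zero =>
    refine (weightedSumSquares_equivalent_prod w).trans (Equivalent.prod ?_ ?_)
    · rw [Fin.prod_univ_succ, Fin.prod_univ_zero, mul_one]
    · rw [show (fun i : Fin 0 => w i.succ) = fun _ => 1 from Subsingleton.elim _ _]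
  | succ k ih =>
    refine (weightedSumSquares_equivalent_prod w).trans ?_
    refine (Equivalent.prod (Equivalent.refl _)
      (ih (fun i => w i.succ) fun i => hw _)).trans ?_
    refine (prod_assoc_equivalent _ _ _).symm.trans ?_
    refine (Equivalent.prod (unary_prod_equivalent h2 (hw 0)
      (Finset.prod_ne_zero_iff.2 fun i _ => hw _)) (Equivalent.refl _)).trans ?_
    refine (prod_assoc_equivalent _ _ _).trans ?_
    rw [← Fin.prod_univ_succ]
    exact Equivalent.prod (Equivalent.refl _)
      (weightedSumSquares_equivalent_prod fun _ : Fin (k + 1) => (1 : K)).symm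

/-- Diagonalization, with control of the determinant. -/
theorem exists_diagonal (h2 : (2 : K) ≠ 0) {k : ℕ} (Q : QuadraticForm K (Fin k → K))
    (hQ : Q.polarBilin.Nondegenerate) : ∃ w : Fin k → K, (∀ i, w i ≠ 0) ∧
      Q.Equivalent (weightedSumSquares K w) ∧
      ∃ c : K, c ≠ 0 ∧ (gram Q).det = c ^ 2 * ∏ i, w i := by
  let _ : Invertible (2 : K) := invertibleOfNonzero h2
  have hass : ∀ (Q : QuadraticForm K (Fin k → K)) x y,
      associated (R := K) Q x y = 2⁻¹ * polar Q x y := by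
    intro Q x y
    rw [associated_apply, polar]
    simp
  have hsep : (associated (R := K) Q).SeparatingLeft := by
    intro x hx
    refine hQ.1 x fun y => ?_
    have := hx y
    rw [hass] at this
    exact (mul_eq_zero.1 this).resolve_left (inv_ne_zero h2)
  obtain ⟨w, hw⟩ : ∃ w : Fin k → Kˣ, Q.Equivalent (weightedSumSquares K w) := by
    have h := QuadraticForm.equivalent_weightedSumSquares_units_of_nondegenerate' Q hsep
    rwa [finrank_fin_fun] at h
  have hw' : weightedSumSquares K w = weightedSumSquares K fun i => (w i : K) := by
    ext x
    simp [weightedSumSquares_apply, Units.smul_def]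
  rw [hw'] at hw
  refine ⟨fun i => w i, fun i => (w i).ne_zero, hw, ?_⟩
  obtain ⟨e⟩ := hw
  have hgram : ∀ Q : QuadraticForm K (Fin k → K), gram Q = Q.toMatrix' := by
    intro Q
    ext i j
    rw [gram, QuadraticForm.toMatrix', LinearMap.toMatrix₂'_apply, hass]
  have hQe : Q = (weightedSumSquares K fun i => (w i : K)).comp (e.toLinearEquiv : _ →ₗ[K] _) := by
    ext x
    exact (e.map_app x).symm
  have hdiag : gram (weightedSumSquares K fun i => (w i : K))
      = Matrix.diagonal fun i => (w i : K) := by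
    have hpolar : ∀ x y, polar (weightedSumSquares K fun i => (w i : K)) x y
        = 2 * ∑ i, w i * (x i * y i) := by
      intro x y
      simp only [polar, weightedSumSquares_apply, Pi.add_apply, smul_eq_mul, Finset.mul_sum,
        ← Finset.sum_sub_distrib]
      exact Finset.sum_congr rfl fun i _ => by ring
    ext i j
    rw [gram, Matrix.diagonal_apply, hpolar, inv_mul_cancel_left₀ h2, Finset.sum_eq_single i]
    · rcases eq_or_ne i j with rfl | hij
      · simp
      · simp [hij]
    · intro b _ hb
      rw [Pi.single_eq_of_ne hb, zero_mul, mul_zero]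
    · simp
  have hdet := QuadraticForm.discr'_comp (Q := weightedSumSquares K fun i => (w i : K))
    (e.toLinearEquiv : _ →ₗ[K] _)
  rw [← hQe, QuadraticForm.discr', QuadraticForm.discr', ← hgram, ← hgram, hdiag,
    Matrix.det_diagonal] at hdet
  refine ⟨_, ?_, hdet.trans (by rw [← pow_two])⟩
  rw [LinearMap.det_toMatrix']
  exact (LinearEquiv.isUnit_det' e.toLinearEquiv).ne_zero

/-- The quadratic form of `Γ` on the strings of maximal length splits off a one-dimensional form,
by the discriminant conditions. -/
theorem equivalent_prod_of_disc [Finite K] (h2 : (2 : K) ≠ 0) {j j₁ k : ℕ} (hj : j = k + 1)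
    (hj₁ : j₁ = 1) (Q : QuadraticForm K (Fin j → K)) (Q₁ : QuadraticForm K (Fin j₁ → K))
    (Q' : QuadraticForm K (Fin k → K)) (hQ : Q.polarBilin.Nondegenerate)
    (hQ₁ : Q₁.polarBilin.Nondegenerate) (hQ' : Q'.polarBilin.Nondegenerate)
    (hd₁ : SameSquareClass (disc Q₁) (disc Q)) (hd' : SameSquareClass (disc Q') ((-1) ^ k)) :
    Q.Equivalent (Q₁.prod Q') := by
  subst hj hj₁
  obtain ⟨w, hw, hwQ, c, hc, hcw⟩ := exists_diagonal h2 Q hQ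
  obtain ⟨w₁, hw₁, hwQ₁, c₁, hc₁, hcw₁⟩ := exists_diagonal h2 Q₁ hQ₁
  -- After diagonalization it remains to see that `det Q` and `det Q₁ · det Q'` agree up to squares.
  obtain ⟨w', hw', hwQ', c', hc', hcw'⟩ := exists_diagonal h2 Q' hQ'
  obtain ⟨a, ha, hd₁⟩ := hd₁
  obtain ⟨b, hb, hd'⟩ := hd'
  rw [disc, disc, hcw, hcw₁, Fin.prod_univ_one] at hd₁
  rw [disc, hcw'] at hd'
  simp only [Nat.sub_self, mul_zero, Nat.zero_div, pow_zero, one_mul, Nat.add_sub_cancel] at hd₁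
  -- Passing from dimension `k` to `k + 1` changes the sign in the discriminant by `(-1)^k`, and
  -- this is the sign prescribed for `disc Q'`.
  have hexp : (k + 1) * k / 2 = k * (k - 1) / 2 + k := by
    cases k with
    | zero => rfl
    | succ k =>
      rw [Nat.add_sub_cancel, show (k + 1 + 1) * (k + 1) = (k + 1) * k + (k + 1) * 2 by ring,
        Nat.add_mul_div_right _ _ two_pos]
  rw [hexp, pow_add] at hd₁
  set s : K := (-1) ^ (k * (k - 1) / 2) with hs
  have hs2 : s * s = 1 := by rw [hs, ← mul_pow]; simp
  have hwk : ((-1 : K) ^ k) * (-1) ^ k = 1 := by rw [← mul_pow]; simp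
  have hprod : ∏ i, w i = (a * c₁ * b * c' * c⁻¹) ^ 2 * (w₁ 0 * ∏ i, w' i) := by
    have h3 : c ^ 2 * ∏ i, w i = (a * c₁ * b * c') ^ 2 * (w₁ 0 * ∏ i, w' i) := by
      have h4 : s * (-1) ^ k = b ^ 2 * (c' ^ 2 * ∏ i, w' i) := by
        rw [hd']
        linear_combination (b ^ 2 * (c' ^ 2 * ∏ i, w' i)) * hs2
      have h5 : (s * (-1) ^ k) * (s * (-1) ^ k) = 1 := by
        linear_combination ((-1 : K) ^ k * (-1) ^ k) * hs2 + hwk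
      calc c ^ 2 * ∏ i, w i
          = (s * (-1) ^ k) * (s * (-1) ^ k * (c ^ 2 * ∏ i, w i)) := by
            rw [← mul_assoc, h5, one_mul]
        _ = _ := by
            rw [hd₁, h4]
            ring
    rw [mul_pow _ c⁻¹, mul_right_comm, ← h3]
    field_simp
  refine hwQ.trans ?_
  refine Equivalent.trans ?_ (Equivalent.prod hwQ₁ hwQ').symm
  have e1 : (weightedSumSquares K w₁).Equivalent (unary (w₁ 0)) :=
    ⟨{ LinearEquiv.funUnique (Fin 1) K K with
      map_app' := fun x => by simp [weightedSumSquares_apply] }⟩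
  refine Equivalent.trans ?_ (Equivalent.prod e1.symm (Equivalent.refl _))
  have e2 := weightedSumSquares_equivalent_prod (Fin.cons (w₁ 0) w' : Fin (k + 1) → K)
  simp only [Fin.cons_zero, Fin.cons_succ] at e2
  refine Equivalent.trans ?_ e2
  refine (weightedSumSquares_equivalent_det h2 w hw).trans ?_
  refine Equivalent.trans ?_ (weightedSumSquares_equivalent_det h2 _ ?_).symm
  · refine Equivalent.prod (unary_equivalent
      (c := a * c₁ * b * c' * c⁻¹) (by simp [ha, hc₁, hb, hc', hc]) ?_) (Equivalent.refl _)
    rw [hprod, Fin.prod_univ_succ]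
    simp
  · intro i
    refine Fin.cases (hw₁ 0) (fun i => ?_) i
    rw [Fin.cons_succ]
    exact hw' i

theorem equivalent_of_subsingleton {M₁ M₂ : Type*} [AddCommGroup M₁] [AddCommGroup M₂]
    [Module K M₁] [Module K M₂] [Subsingleton M₁] [Subsingleton M₂] (Q₁ : QuadraticForm K M₁)
    (Q₂ : QuadraticForm K M₂) : Q₁.Equivalent Q₂ :=
  ⟨{ (0 : M₁ ≃ₗ[K] M₂) with
    map_app' := fun x => by
      rw [Subsingleton.elim x 0]
      simp }⟩

/-- A linear map preserving the squares of symmetric bilinear forms is an isometry. -/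
theorem form_eq_of_self (h2 : (2 : K) ≠ 0) {E E₂ : Type*} [AddCommGroup E] [Module K E]
    [AddCommGroup E₂] [Module K E₂] {h : LinearMap.BilinForm K E} {h₂ : LinearMap.BilinForm K E₂}
    (hs : ∀ u w, h u w = h w u) (hs₂ : ∀ u w, h₂ u w = h₂ w u) (l : E →ₗ[K] E₂)
    (hl : ∀ u, h₂ (l u) (l u) = h u u) (u w : E) : h₂ (l u) (l w) = h u w := by
  have h1 := hl (u + w)
  simp only [map_add, LinearMap.add_apply, hl] at h1
  rw [hs₂ (l w) (l u), hs w u] at h1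
  exact mul_left_cancel₀ h2 (by linear_combination h1)

end Forms

end
end SpFourier

namespace SpFourier
noncomputable section

/-! ### Coefficients of conjugate triples -/

section Transport

variable {K : Type*} [Field K] {V : Type*} [AddCommGroup V] [Module K V]
variable {B : LinearMap.BilinForm K V}

theorem isIrreducible_comp {G G' E : Type*} [Group G] [Group G'] [AddCommGroup E] [Module ℂ E]
    {ω : Representation ℂ G E} (h : ω.IsIrreducible) (c : G' →* G) (hc : Function.Surjective c) :
    Representation.IsIrreducible (ω.comp c) := by
  let e : Subrepresentation (ω.comp c) ≃o Subrepresentation ω :=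
    { toFun := fun D => ⟨D.toSubmodule, fun g v hv => by
        obtain ⟨g', rfl⟩ := hc g
        exact D.apply_mem_toSubmodule g' hv⟩
      invFun := fun D => ⟨D.toSubmodule, fun g v hv => D.apply_mem_toSubmodule (c g) hv⟩
      left_inv := fun _ => rfl
      right_inv := fun _ => rfl
      map_rel_iff' := Iff.rfl }
  exact e.isSimpleOrder_iff.2 h

namespace Triple

variable {γ γ₂ : Triple B} {g : Sp B}

theorem apply_mem_fil_of_commute (hH : ∀ v, Sp.toEnd g (γ.H v) = γ₂.H (Sp.toEnd g v)) {i : ℤ}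
    {v : V} (hv : v ∈ γ.fil i) : Sp.toEnd g v ∈ γ₂.fil i := by
  have h : γ.fil i ≤ (γ₂.fil i).comap (Sp.toEnd g) := by
    refine iSup_le fun j => iSup_le fun hj w hw => weightSpace_le_fil hj ?_
    unfold weightSpace at hw ⊢
    split_ifs at hw ⊢ with hb
    · rw [End.mem_eigenspace_iff] at hw ⊢
      rw [← hH, hw, map_smul]
    · rw [Submodule.mem_bot] at hw ⊢
      rw [hw, map_zero]
  exact h hv

theorem inv_commute {S T : Module.End K V} (hH : ∀ v, Sp.toEnd g (S v) = T (Sp.toEnd g v)) (v : V) :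
    Sp.toEnd g⁻¹ (T v) = S (Sp.toEnd g⁻¹ v) := by
  have h := hH (Sp.toEnd g⁻¹ v)
  rw [Sp.apply_inv_apply] at h
  rw [← h, Sp.inv_apply_apply]

variable [FiniteDimensional K V]

theorem conj_mem_unip_of_commute (hH : ∀ v, Sp.toEnd g (γ.H v) = γ₂.H (Sp.toEnd g v)) {k : ℕ}
    {u : Sp B} (hu : u ∈ γ.unip k) : g * u * g⁻¹ ∈ γ₂.unip k := by
  intro i v hv
  rw [Sp.conj_sub_one]
  exact apply_mem_fil_of_commute hH (hu i _ (apply_mem_fil_of_commute (inv_commute hH) hv))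

theorem psiLin_conj_of_commute (hY : ∀ v, Sp.toEnd g (γ.Y v) = γ₂.Y (Sp.toEnd g v))
    (ψ : AddChar K ℂ) (u : Sp B) : psiLin ψ γ₂.Y (g * u * g⁻¹) = psiLin ψ γ.Y u := by
  have h : γ₂.Y * Sp.toEnd g = Sp.toEnd g * γ.Y := LinearMap.ext fun v => (hY v).symm
  rw [psiLin, psiLin, Sp.conj_sub_one, ← mul_assoc, ← mul_assoc, h, LinearMap.trace_mul_comm,
    ← mul_assoc, ← mul_assoc, Sp.toEnd_inv_mul, one_mul]

/-- Conjugation between the unipotent groups of conjugate triples. -/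
def conjUnip (hH : ∀ v, Sp.toEnd g (γ.H v) = γ₂.H (Sp.toEnd g v)) : γ₂.unip 1 ≃* γ.unip 1 where
  toFun u := ⟨g⁻¹ * u * g, by
    have h := conj_mem_unip_of_commute (inv_commute hH) u.2
    rwa [inv_inv] at h⟩
  invFun u := ⟨g * u * g⁻¹, conj_mem_unip_of_commute hH u.2⟩
  left_inv u := Subtype.ext (by simp [mul_assoc])
  right_inv u := Subtype.ext (by simp [mul_assoc])
  map_mul' u v := Subtype.ext (by simp [mul_assoc])

theorem conjUnip_coe (hH : ∀ v, Sp.toEnd g (γ.H v) = γ₂.H (Sp.toEnd g v)) (u : γ₂.unip 1) :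
    (conjUnip hH u : Sp B) = g⁻¹ * u * g := rfl

variable {W : Type*} [AddCommGroup W] [Module ℂ W] {E : Type*} [AddCommGroup E] [Module ℂ E]

/-- Coefficients of conjugate triples are isomorphic. -/
def coeffConj (hH : ∀ v, Sp.toEnd g (γ.H v) = γ₂.H (Sp.toEnd g v)) (ω : Representation ℂ γ.jacobi E)
    (π : Representation ℂ (Sp B) W) :
    coeff γ ω π ≃ₗ[ℂ] Representation.IntertwiningMap
      ((γ.resUnip ω).comp (conjUnip hH).toMonoidHom) (π.comp (γ₂.unip 1).subtype) where
  toFun φ := ⟨π g ∘ₗ φ.1, fun u => by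
    have h := φ.2 (γ.inr (conjUnip hH u)) (conjUnip hH u).2
    refine LinearMap.ext fun x => ?_
    have h1 := LinearMap.congr_fun h x
    change π g (φ.1 (ω (γ.inr (conjUnip hH u)) x)) = π u (π g (φ.1 x))
    change π (conjUnip hH u : Sp B) (φ.1 x) = φ.1 (ω (γ.inr (conjUnip hH u)) x) at h1
    rw [← h1, conjUnip_coe, ← Module.End.mul_apply, ← Module.End.mul_apply, ← map_mul, ← map_mul]
    simp [mul_assoc]⟩
  map_add' φ φ' := by
    ext x
    exact map_add (π g) _ _
  map_smul' c φ := by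
    ext x
    exact map_smul (π g) _ _
  invFun φ := ⟨π g⁻¹ ∘ₗ φ.toLinearMap, fun u hu => by
    obtain ⟨u', hu'⟩ := (conjUnip hH).surjective ⟨u, hu⟩
    have h2 : u = γ.inr (conjUnip hH u') := by rw [hu']; rfl
    have h := φ.isIntertwining' u'
    refine LinearMap.ext fun x => ?_
    have h1 := LinearMap.congr_fun h x
    change φ.toLinearMap (ω (γ.inr (conjUnip hH u')) x) = π u' (φ.toLinearMap x) at h1
    change π u (π g⁻¹ (φ.toLinearMap x)) = π g⁻¹ (φ.toLinearMap (ω u x))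
    rw [h2, h1, ← Module.End.mul_apply, ← Module.End.mul_apply, ← map_mul, ← map_mul]
    have h3 : ((γ.inr (conjUnip hH u') : γ.jacobi) : Sp B) = g⁻¹ * u' * g := rfl
    rw [h3]
    simp [mul_assoc]⟩
  left_inv φ := by
    ext x
    change π g⁻¹ (π g (φ.1 x)) = φ.1 x
    rw [← Module.End.mul_apply, ← map_mul, inv_mul_cancel, map_one, Module.End.one_apply]
  right_inv φ := by
    ext x
    change π g (π g⁻¹ (φ.toLinearMap x)) = φ.toLinearMap x
    rw [← Module.End.mul_apply, ← map_mul, mul_inv_cancel, map_one, Module.End.one_apply]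

end Triple

/-- The coefficient of a triple conjugate to the triple of a stage is the iterated coefficient. -/
theorem Stage.finrank_coeff_eq_iterated [FiniteDimensional K V] [Finite K] [Finite (Sp B)]
    {W : Type*} [AddCommGroup W] [Module ℂ W] [FiniteDimensional ℂ W]
    {E E₁ E' : Type*} [AddCommGroup E] [Module ℂ E] [AddCommGroup E₁] [Module ℂ E₁]
    [AddCommGroup E'] [Module ℂ E']
    {γ γ₁ γ₂ : Triple B} {γ' : Triple (B.restrict γ₁.fixed)} [Finite (Sp (B.restrict γ₁.fixed))]
    {N : ℕ} {f : Frame B γ₂.Y N} (hf : Stage γ₁ γ₂ γ' f) (hγ : γ.Full) {g : Sp B}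
    (hH : ∀ v, Sp.toEnd g (γ.H v) = γ₂.H (Sp.toEnd g v))
    (hY : ∀ v, Sp.toEnd g (γ.Y v) = γ₂.Y (Sp.toEnd g v)) {ψ : AddChar K ℂ} (hψ : ψ ≠ 1)
    (π : Representation ℂ (Sp B) W) {ω : Representation ℂ γ.jacobi E} (hω : IsWeil γ ψ ω)
    {ω₁ : Representation ℂ γ₁.jacobi E₁} (hω₁ : IsWeil γ₁ ψ ω₁)
    {ω' : Representation ℂ γ'.jacobi E'} (hω' : IsWeil γ' ψ ω') :
    finrank ℂ (coeff γ ω π)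
      = finrank ℂ (coeff γ' ω' (coeffSp γ₁ ω₁ π f.alt.isRefl hf.isCompl)) := by
  have h1 := hf.finrank_iterated_mul hψ hω₁ π hω'
  -- Only the restriction of `ω` to `G_{≥ 1}` matters for the dimension. Transported by `g` it is a
  -- Heisenberg representation for `γ₂`, so no Weil representation of `γ₂` itself is needed.
  have h2 := hf.toAdapted.finrank_intertwining_mul hψ
    (ω := (γ.resUnip ω).comp (Triple.conjUnip hH).toMonoidHom)
    (isIrreducible_comp hω.irreducible _ (Triple.conjUnip hH).surjective) (fun u hu => by
      have h3 : (Triple.conjUnip hH u : Sp B) ∈ γ.unip 2 := by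
        have := Triple.conj_mem_unip_of_commute (Triple.inv_commute hH) hu
        rwa [inv_inv] at this
      have h4 := hω.resUnip_two hγ _ h3
      have h5 := Triple.psiLin_conj_of_commute hY ψ (Triple.conjUnip hH u : Sp B)
      rw [Triple.conjUnip_coe] at h5 h4
      rw [← h5] at h4
      refine h4.trans ?_
      congr 2
      simp [mul_assoc]) hω'.irreducible (fun u hu => hω'.resUnip_two hf.full' u hu) π
  rw [← (Triple.coeffConj hH ω π).finrank_eq, ← h1] at h2
  exact Nat.eq_of_mul_eq_mul_right (finrank_pos_of_isIrreducible _ hω'.irreducible) h2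

end Transport

end
end SpFourier

namespace SpFourier
noncomputable section

/-! ### Matching the strings of `γ` with those of `γ₁` and `γ'` -/

section Matching

variable {K : Type*} [Field K] {V : Type*} [AddCommGroup V] [Module K V] [FiniteDimensional K V]
variable {B : LinearMap.BilinForm K V}

open QuadraticMap

namespace Triple

theorem multForm_apply (γ : Triple B) (a : ℕ) (u : γ.lowest a) :
    γ.multForm a u = γ.lowestForm a u u := rfl

theorem lowestForm_isSymm (γ : Triple B) (hB : B.IsAlt) {a : ℕ} (h0 : 0 < a) (ha : Even a)
    (u w : γ.lowest a) : γ.lowestForm a u w = γ.lowestForm a w u := by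
  rw [γ.lowestForm_swap hB h0, ha.neg_one_pow, one_mul]

theorem lowestForm_isAlt (γ : Triple B) (hB : B.IsAlt) (h2 : (2 : K) ≠ 0) {a : ℕ} (ha : Odd a) :
    (γ.lowestForm a).IsAlt := by
  intro u
  have h := γ.lowestForm_swap hB ha.pos u u
  rw [ha.neg_one_pow] at h
  refine (mul_eq_zero.1 (?_ : (2 : K) * _ = 0)).resolve_left h2
  linear_combination h

/-- The fixed space consists of the lowest weight vectors of weight zero. -/
theorem lowest_one_eq_fixed (γ : Triple B) (hp : finrank K V + 2 < ringChar K) :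
    γ.lowest 1 = γ.fixed := by
  apply le_antisymm
  · intro u hu
    refine γ.mem_fixed hp ?_ (lowest_Y hu)
    rw [lowest_H hu]
    simp
  · intro u hu
    rcases Nat.eq_zero_or_pos (finrank K V) with h0 | h0
    · have := finrank_zero_iff.1 h0
      rw [Subsingleton.elim u 0]
      exact zero_mem _
    · refine mem_lowest one_pos h0 hu.2 ?_
      rw [show γ.H u = 0 from hu.1.2]
      simp

end Triple

open Triple

/-- A triple with strings of lengths `m` and one, the former of multiplicity one, is stackable with
a triple on its fixed space all whose strings have length at most `m`. -/
theorem stackable_of_lowest (hB : B.IsAlt) (hnd : B.Nondegenerate)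
    (hp : 2 * finrank K V < ringChar K) {γ₁ : Triple B} {m : ℕ} (hm : Even m) (hm0 : 0 < m)
    (hle : m ≤ finrank K V)
    (hs₁ : Function.Surjective (stringMap γ₁ γ₁ fun a => (γ₁.lowest a).subtype))
    (h1 : ∀ a, 0 < a → a ≠ 1 → a ≠ m → γ₁.lowest a = ⊥) {v₀ : V} (hv₀ : v₀ ∈ γ₁.lowest m) (hne : v₀ ≠ 0)
    (hline : ∀ u ∈ γ₁.lowest m, ∃ c : K, c • v₀ = u)
    (hc : IsCompl γ₁.fixed (B.orthogonal γ₁.fixed)) {γ' : Triple (B.restrict γ₁.fixed)}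
    (hγ' : γ'.Full)
    (hs' : Function.Surjective (stringMap γ' γ' fun a => (γ'.lowest a).subtype))
    (h' : ∀ a, m < a → γ'.lowest a = ⊥) : Stackable γ₁ γ' m v₀ where
  full₁ := γ₁.full_of_surjective hB hnd hp hs₁
  full' := hγ'
  isCompl := hc
  even := hm
  pos := hm0
  le := hle
  mem := hv₀
  ne := hne
  span v := by
    obtain ⟨x, rfl⟩ := hs₁ v
    rw [stringMap_apply]
    refine sum_mem fun i _ => ?_
    obtain ⟨⟨a, ha⟩, k, hk⟩ := i
    generalize x ⟨⟨a, ha⟩, k, hk⟩ = u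
    change γ₁.lowest a at u
    change k < a at hk
    change (γ₁.X ^ k) (u : V) ∈ _
    rcases eq_or_ne a 1 with rfl | ha1
    · obtain rfl : k = 0 := by omega
      refine Submodule.mem_sup_left ?_
      rw [← γ₁.lowest_one_eq_fixed (by obtain ⟨r, hr⟩ := hm; omega)]
      exact u.2
    · rcases eq_or_ne a m with rfl | ham
      · obtain ⟨c, hc⟩ := hline u u.2
        rw [← hc, map_smul]
        exact Submodule.smul_mem _ _ (Submodule.mem_sup_right
          (Submodule.subset_span ⟨k, by rw [Set.mem_ofPred_eq]; omega, rfl⟩))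
      · rw [(Submodule.eq_bot_iff _).1 (h1 a (by omega) ha1 ham) _ u.2, map_zero]
        exact zero_mem _
  weight j hj := hγ'.weightSpace_eq_bot_of_lowest h' hs' hj

namespace Stackable

variable {γ γ₁ : Triple B} {γ' : Triple (B.restrict γ₁.fixed)} {m : ℕ} {v₀ : V}
  (hs : Stackable γ₁ γ' m v₀)
include hs

/-- An isometry to the lowest weight vectors of `γ'` is one to those of the sum. -/
theorem exists_map_of_right {a : ℕ} (l : γ.lowest a →ₗ[K] γ'.lowest a)
    (hl : ∀ u w, γ'.lowestForm a (l u) (l w) = γ.lowestForm a u w) :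
    ∃ l : γ.lowest a →ₗ[K] V, (∀ u, l u ∈ hs.sum.lowest a) ∧
      ∀ u w, B (l u) ((hs.sum.X ^ (a - 1)) (l w)) = γ.lowestForm a u w := by
  refine ⟨γ₁.fixed.subtype ∘ₗ (γ'.lowest a).subtype ∘ₗ l,
    fun u => hs.coe_mem_lowest (l u).2, fun u w => ?_⟩
  rw [← hl]
  simp only [LinearMap.comp_apply, Submodule.subtype_apply]
  rw [directSum_X_pow_coe]
  rfl

/-- Likewise for the strings of maximal length. -/
theorem exists_map_of_prod (h2 : (2 : K) ≠ 0) (hline : ∀ u ∈ γ₁.lowest m, ∃ c : K, c • v₀ = u)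
    (h : (γ.multForm m).Equivalent ((γ₁.multForm m).prod (γ'.multForm m))) :
    ∃ l : γ.lowest m →ₗ[K] V, (∀ u, l u ∈ hs.sum.lowest m) ∧
      ∀ u w, B (l u) ((hs.sum.X ^ (m - 1)) (l w)) = γ.lowestForm m u w := by
  obtain ⟨e⟩ := h
  have hpos := hs.pos
  let l : γ.lowest m →ₗ[K] V :=
    (γ₁.lowest m).subtype ∘ₗ LinearMap.fst K (γ₁.lowest m) (γ'.lowest m) ∘ₗ (e.toLinearEquiv : _ →ₗ[K] _)
    + γ₁.fixed.subtype ∘ₗ (γ'.lowest m).subtype ∘ₗ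
      LinearMap.snd K (γ₁.lowest m) (γ'.lowest m) ∘ₗ
      (e.toLinearEquiv : _ →ₗ[K] _)
  have hlu : ∀ u, l u = ((e u).1 : V) + ((e u).2 : γ₁.fixed) := fun u => rfl
  have hmem : ∀ u, l u ∈ hs.sum.lowest m := fun u => by
    obtain ⟨c, hc⟩ := hline _ (e u).1.2
    rw [hlu, ← hc]
    exact add_mem (Submodule.smul_mem _ _ hs.mem_lowest_sum) (hs.coe_mem_lowest (e u).2.2)
  -- For `m` even these forms are symmetric, so by polarization it suffices to compare the quadratic
  -- forms.
  refine ⟨l, hmem, form_eq_of_self h2 (h := γ.lowestForm m) (h₂ := hs.sum.lowestForm m)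
    (γ.lowestForm_isSymm hs.full₁.alt hpos hs.even)
    (hs.sum.lowestForm_isSymm hs.full₁.alt hpos hs.even) (l.codRestrict _ hmem) fun u => ?_⟩
  rw [← multForm_apply γ, ← e.map_app u, prod_apply, multForm_apply, multForm_apply]
  change B (l u) ((hs.sum.X ^ (m - 1)) (l u)) = _
  obtain ⟨c, hc⟩ := hline _ (e u).1.2
  rw [hlu, ← hc, hs.form_lowest_sum c c _ (by omega), lowestForm_apply, ← hc]
  simp only [map_smul, LinearMap.smul_apply, smul_eq_mul, mul_assoc]
  rfl

end Stackable

end Matching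

end
end SpFourier

/-! ### The theorem: `γ` is conjugate to the sum of `γ₁` and `γ'` -/

theorem mainTheorem3 {K : Type*} [Field K] [Finite K]
    {V : Type*} [AddCommGroup V] [Module K V] [FiniteDimensional K V]
    (B : LinearMap.BilinForm K V) (hB : B.IsAlt) (hnd : B.Nondegenerate)
    (n n₁ : ℕ) (hn₁ : 0 < n₁)
    (hdim : Module.finrank K V = 2 * n) (hp : 4 * n < ringChar K)
    (ψ : AddChar K ℂ) (hψ : ψ ≠ 1)
    {W : Type*} [AddCommGroup W] [Module ℂ W]
    (π : Representation ℂ (Sp B) W) (hπ : π.IsIrreducible)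
    -- the three orbit data `((2n₁, d₂, …, d_s), (q_i))`, `((2n₁, 1, …, 1), (q₁))` and
    -- `((d₂, …, d_s), (q_i'))`
    (d : Multiset ℕ) (hd : ∀ a ∈ d, a ≤ 2 * n₁) (hsum : 2 * n₁ + d.sum = 2 * n)
    (Γ Γ₁ Γ' : OrbitDatum K)
    (hΓ : Γ.parts = (2 * n₁) ::ₘ d)
    (hΓ₁ : Γ₁.parts = (2 * n₁) ::ₘ Multiset.replicate (2 * (n - n₁)) 1)
    (hΓ' : Γ'.parts = d)
    (hq₁ : SameSquareClass (disc (Γ₁.form (2 * n₁))) (disc (Γ.form (2 * n₁))))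
    (hq' : ∀ a ∈ d, Even a → a < 2 * n₁ → (Γ'.form a).Equivalent (Γ.form a))
    (hq'₁ : 2 * n₁ ∈ d →
      SameSquareClass (disc (Γ'.form (2 * n₁))) ((-1) ^ d.count (2 * n₁)))
    -- representatives of the three orbits, and Weil representations attached to them
    (γ : Triple B) (hγ : γ.HasType Γ)
    {E : Type*} [AddCommGroup E] [Module ℂ E]
    (ω : Representation ℂ γ.jacobi E) (hω : IsWeil γ ψ ω)
    (γ₁ : Triple B) (hγ₁ : γ₁.HasType Γ₁)
    {E₁ : Type*} [AddCommGroup E₁] [Module ℂ E₁]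
    (ω₁ : Representation ℂ γ₁.jacobi E₁) (hω₁ : IsWeil γ₁ ψ ω₁)
    (γ' : Triple (B.restrict γ₁.fixed)) (hγ' : γ'.HasType Γ')
    {E' : Type*} [AddCommGroup E'] [Module ℂ E']
    (ω' : Representation ℂ γ'.jacobi E') (hω' : IsWeil γ' ψ ω') :
    Module.finrank ℂ (coeff γ ω π) =
      Module.finrank ℂ (coeff γ' ω' (coeffSp γ₁ ω₁ π hB.isRefl
        (γ₁.isCompl_fixed hB hnd hn₁ hsum hdim hp hΓ₁ hγ₁))) := by
  classical
  have hfV : Finite V := Module.finite_of_finite K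
  have hfSp : Finite (Sp B) := Finite.of_injective (fun g : Sp B => ((g : V ≃ₗ[K] V) : V → V))
    fun g h e => Subtype.ext (LinearEquiv.ext fun v => congrFun e v)
  have hfSp' : Finite (Sp (B.restrict γ₁.fixed)) :=
    Finite.of_injective (fun g : Sp (B.restrict γ₁.fixed) =>
      ((g : γ₁.fixed ≃ₗ[K] γ₁.fixed) : γ₁.fixed → γ₁.fixed))
    fun g h e => Subtype.ext (LinearEquiv.ext fun v => congrFun e v)
  have hfW := finiteDimensional_of_isIrreducible π hπ
  have hp2 : 2 * finrank K V < ringChar K := by omega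
  have h2 : (2 : K) ≠ 0 := by exact_mod_cast natCast_ne (K := K) (m := 2) (by omega) (by omega)
  have hc := γ₁.isCompl_fixed hB hnd hn₁ hsum hdim hp hΓ₁ hγ₁
  -- the triple `γ`
  have hγs := γ.stringMap_bijective hp2 (m := Γ.parts)
    (by rw [hΓ, Multiset.sum_cons, hdim, hsum]) hγ.1
  have hγf := γ.full_of_surjective hB hnd hp2 hγs.2
  -- the triple `γ₁`
  have hγ₁s := γ₁.stringMap_bijective hp2 (m := Γ₁.parts)
    (by rw [hΓ₁, Multiset.sum_cons, Multiset.sum_replicate, hdim, smul_eq_mul]; omega) hγ₁.1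
  have hcount₁ : Γ₁.parts.count (2 * n₁) = 1 := by
    rw [hΓ₁, Multiset.count_cons_self, Multiset.count_replicate, if_neg (by omega)]
  have hline₁ := hγ₁.1 (2 * n₁) (by omega)
  rw [hcount₁] at hline₁
  obtain ⟨⟨v₀, hv₀⟩, hne, hline⟩ := finrank_eq_one_iff'.1 hline₁
  have hfix : finrank K γ₁.fixed = d.sum := by
    rw [← γ₁.lowest_one_eq_fixed (by omega), hγ₁.1 1 one_pos, hΓ₁,
      Multiset.count_cons_of_ne (by omega), Multiset.count_replicate_self]
    omega
  -- the triple `γ'`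
  have hnd' : (B.restrict γ₁.fixed).Nondegenerate :=
    B.nondegenerate_restrict_of_disjoint_orthogonal hB.isRefl hc.disjoint
  have hp' : 2 * finrank K γ₁.fixed < ringChar K := by omega
  have hγ's := γ'.stringMap_bijective hp' (m := Γ'.parts) (by rw [hΓ', hfix]) hγ'.1
  have hγ'f := γ'.full_of_surjective (fun u => hB u) hnd' hp' hγ's.2
  have hs : Stackable γ₁ γ' (2 * n₁) v₀ := by
    refine stackable_of_lowest hB hnd hp2 ⟨n₁, by ring⟩ (by omega) (by omega) hγ₁s.2
      (fun a ha0 ha1 ha => ?_) hv₀ (fun h => hne (Subtype.ext h))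
      (fun u hu => ?_) hc hγ'f hγ's.2 fun a ha => ?_
    · rw [← Submodule.finrank_eq_zero (R := K), hγ₁.1 a ha0, hΓ₁, Multiset.count_cons_of_ne ha,
        Multiset.count_replicate, if_neg (Ne.symm ha1)]
    · obtain ⟨c, hc⟩ := hline ⟨u, hu⟩
      exact ⟨c, congrArg Subtype.val hc⟩
    · rw [← Submodule.finrank_eq_zero (R := K), hγ'.1 a (by omega), hΓ', Multiset.count_eq_zero]
      exact fun h => absurd (hd a h) (by omega)
  -- the strings of `γ` are those of `γ₁` and `γ'`
  have hmatch : ∀ a, ∃ l : γ.lowest a →ₗ[K] V, (∀ u, l u ∈ hs.sum.lowest a) ∧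
      (0 < a → ∀ u w, B (l u) ((hs.sum.X ^ (a - 1)) (l w)) = γ.lowestForm a u w) := by
    intro a
    rcases Nat.eq_zero_or_pos a with ha0 | ha0
    · exact ⟨0, fun u => zero_mem _, fun h => absurd ha0 h.ne'⟩
    suffices h : ∃ l : γ.lowest a →ₗ[K] V, (∀ u, l u ∈ hs.sum.lowest a) ∧
        ∀ u w, B (l u) ((hs.sum.X ^ (a - 1)) (l w)) = γ.lowestForm a u w by
      obtain ⟨l, hl, hl'⟩ := h
      exact ⟨l, hl, fun _ => hl'⟩
    rcases Nat.even_or_odd a with hev | hodd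
    -- If `a` is not a part of `d`, the multiplicity space in `γ'` is zero and the value of `Γ'.form
    -- a` is immaterial.
    · have hequiv : ∀ a ∉ d, 0 < a → ∀ Q : QuadraticForm K (Fin (Γ'.parts.count a) → K),
          (γ'.multForm a).Equivalent Q := by
        intro a had ha0 Q
        have h1 : Γ'.parts.count a = 0 := by rw [hΓ', Multiset.count_eq_zero]; exact had
        have h3 : Subsingleton (γ'.lowest a) := finrank_zero_iff.1 (by rw [hγ'.1 a ha0, h1])
        have h4 : IsEmpty (Fin (Γ'.parts.count a)) := by rw [h1]; infer_instance
        exact equivalent_of_subsingleton _ _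
      rcases eq_or_ne a (2 * n₁) with rfl | hne'
      · refine hs.exists_map_of_prod h2 (fun u hu => ?_) ?_
        · obtain ⟨c, hc⟩ := hline ⟨u, hu⟩
          exact ⟨c, congrArg Subtype.val hc⟩
        · have hm : 2 * n₁ ∈ Γ.parts := by rw [hΓ]; exact Multiset.mem_cons_self _ _
          have hm₁ : 2 * n₁ ∈ Γ₁.parts := by rw [hΓ₁]; exact Multiset.mem_cons_self _ _
          have hcount : Γ.parts.count (2 * n₁) = Γ'.parts.count (2 * n₁) + 1 := by
            rw [hΓ, hΓ', Multiset.count_cons_self]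
          have hprod : (Γ.form (2 * n₁)).Equivalent
              ((Γ₁.form (2 * n₁)).prod (Γ'.form (2 * n₁))) := by
            refine equivalent_prod_of_disc h2 hcount hcount₁ _ _ _
              (Γ.form_nondegenerate _ hm hev) (Γ₁.form_nondegenerate _ hm₁ hev) ?_ hq₁ ?_
            · by_cases hmd : 2 * n₁ ∈ d
              · exact Γ'.form_nondegenerate _ (hΓ' ▸ hmd) hev
              · have h1 : Γ'.parts.count (2 * n₁) = 0 := by
                  rw [hΓ', Multiset.count_eq_zero]; exact hmd
                have h4 : IsEmpty (Fin (Γ'.parts.count (2 * n₁))) := by rw [h1]; infer_instance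
                exact ⟨fun x _ => Subsingleton.elim _ _, fun x _ => Subsingleton.elim _ _⟩
            · by_cases hmd : 2 * n₁ ∈ d
              · have := hq'₁ hmd
                rwa [← hΓ'] at this
              · have h1 : Γ'.parts.count (2 * n₁) = 0 := by
                  rw [hΓ', Multiset.count_eq_zero]; exact hmd
                have h4 : IsEmpty (Fin (Γ'.parts.count (2 * n₁))) := by rw [h1]; infer_instance
                -- If `2n₁` occurs only once in `Γ`, the form split off is empty and has
                -- discriminant `1 = (-1)^0`, so the condition assumed for `2n₁ ∈ d` holds by
                -- default.
                refine ⟨1, one_ne_zero, ?_⟩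
                rw [disc, Matrix.det_isEmpty, h1]
                simp
          refine (hγ.2 _ hm hev).trans (hprod.trans (QuadraticMap.Equivalent.prod
            (hγ₁.2 _ hm₁ hev).symm ?_))
          by_cases hmd : 2 * n₁ ∈ d
          · exact (hγ'.2 _ (hΓ' ▸ hmd) hev).symm
          · exact (hequiv _ hmd ha0 _).symm
      · have he : (γ.multForm a).Equivalent (γ'.multForm a) := by
          by_cases had : a ∈ d
          · have hlt : a < 2 * n₁ := lt_of_le_of_ne (hd a had) hne'
            exact (hγ.2 a (hΓ ▸ Multiset.mem_cons_of_mem had) hev).trans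
              ((hq' a had hev hlt).symm.trans (hγ'.2 a (hΓ' ▸ had) hev).symm)
          · have h1 : Γ.parts.count a = 0 := by
              rw [hΓ, Multiset.count_cons_of_ne hne', Multiset.count_eq_zero]; exact had
            have h3 : Subsingleton (γ.lowest a) := finrank_zero_iff.1 (by rw [hγ.1 a ha0, h1])
            have h1' : Γ'.parts.count a = 0 := by rw [hΓ', Multiset.count_eq_zero]; exact had
            have h3' : Subsingleton (γ'.lowest a) := finrank_zero_iff.1 (by rw [hγ'.1 a ha0, h1'])
            exact equivalent_of_subsingleton _ _
        obtain ⟨e⟩ := he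
        exact hs.exists_map_of_right (e.toLinearEquiv : _ →ₗ[K] _)
          (form_eq_of_self h2 (γ.lowestForm_isSymm hB ha0 hev)
            (γ'.lowestForm_isSymm hγ'f.alt ha0 hev) _ e.map_app)
    -- For odd parts the forms on lowest weight vectors are alternating and nondegenerate, so equal
    -- multiplicities suffice; the added part `2n₁` is even and does not change them.
    · obtain ⟨l, hl⟩ := exists_isometry_of_isAlt (γ.lowestForm_isAlt hB h2 hodd)
        (γ'.lowestForm_isAlt hγ'f.alt h2 hodd) (γ.eq_zero_of_lowestForm hnd hp2 hγs.2 ha0)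
        (γ'.eq_zero_of_lowestForm hnd' hp' hγ's.2 ha0) (by
          rw [hγ.1 a ha0, hγ'.1 a ha0, hΓ, hΓ', Multiset.count_cons_of_ne]
          rintro rfl
          exact absurd hodd (by simp))
      exact hs.exists_map_of_right l hl
  choose l hl hl' using hmatch
  obtain ⟨g, hH, hY⟩ := γ.exists_conj hnd hp2 hγs hs.sum l hl hl'
  obtain ⟨f, hf⟩ := hs.exists_stage
  exact hf.finrank_coeff_eq_iterated hγf hH hY hψ π hω hω₁ hω'
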